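/- **Setting.** Let $\mathbb M$ be a smooth Hausdorff 4-manifold, possibly with boundary and corners, with a smooth function $f$ whose only critical point $p$ is interior and non-degenerate of index $1$ (the cobordism of a 0-surgery), with Morse coordinates $x=(x_1,\dots,x_4)$ around $p$, $x(p)=0$, $f=f(p)+\frac12(-x_1^2+x_2^2+x_3^2+x_4^2)$, whose range contains the ball $|x|<\xi_2$. Let $g^R$ be a smooth Riemannian metric on $\mathbb M$ which equals $\delta+df\otimes df$ in the Morse coordinates. For a Riemannian metric $G$ and a vector field $Z$ put $G_Z=G-2\,\frac{Z^\flat\otimes Z^\flat}{G(Z,Z)}$; it is singular exactly where $Z=0$. The Morse metric on $\mathbb M\setminus p$ is $g_{\mathbb M}=(g^R)_{\operatorname{grad} f}$. On $\mathbb{CP}^2$ use the affine coordinates $(\frac{Z_1}{Z_3},\frac{Z_2}{Z_3})$, $(\frac{Z_2}{Z_1},\frac{Z_3}{Z_1})$, $(\frac{Z_1}{Z_2},\frac{Z_3}{Z_2})$. Let $w$ be the real part of $(z_1^2+z_2)\partial_{z_1}+z_1z_2\partial_{z_2}$, respectively $-\zeta_1^2\partial_{\zeta_1}-(1+\zeta_1\zeta_2)\partial_{\zeta_2}$,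 respectively $\partial_{\xi_1}-\xi_1\partial_{\xi_2}$, as a real vector field (for instance $w=(x^2-y^2+z,\,2xy+t,\,xz-ty,\,tx+yz)$ in the first chart, $z_1=x+iy$, $z_2=z+it$). For $\Lambda>0$ let $g^{FS}=\frac{6/\Lambda}{1+r^2}\bigl[\delta_{\mu\nu}-\frac{x^\mu x^\nu+\tilde x^\mu\tilde x^\nu}{1+r^2}\bigr]$, $\tilde x=(y,-x,t,-z)$, $r=|x|$, be the Fubini–Study metric, and $g_{\mathbb{CP}^2}=(g^{FS})_w$. Put $\kappa=\sqrt{\Lambda/6}$ and define $\chi$ in the first chart by $r=\tan(\kappa\chi)$. Fix numbers $0<\tau_0<\chi_1<\frac{\pi}{2\kappa}$, $0<\sigma_0<\xi_1<\xi_2$, $R>0$, $n_0<n_1$. Write $d\Omega^2$ for the round metric of the unit sphere $S^3$ and $\sigma_1,\sigma_2,\sigma_3$ for its left-invariant forms, with $\sigma_1^2+\sigma_2^2+\sigma_3^2=4\,d\Omega^2$. Let $v(x)=(-x_1,x_2,x_3,x_4)$ be the Morse field and $w_r=w-2\frac{\langle w,x\rangle}{|x|^2}x$ the radially reflected field on $\mathbb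 R^4\setminus 0$. **Claims.** 1. The three expressions for $w$ define one vector field on $\mathbb{CP}^2$, those for $g^{FS}$ one metric, and $w$ vanishes only at $[0:0:1]$. The field $w_r$ has no zero on $\mathbb R^4\setminus0$, and the maps $S^3\to S^3$, $u\mapsto w_r(Ru)/|w_r(Ru)|$ and $u\mapsto v(Ru)/|v(Ru)|$, both have degree $-1$. 2. (Annuli.) There are smooth $a,b$ with $a>0$ and $b$ non-decreasing on $[\tau_0,\chi_1]$ and $2a(\tau_0)=R$, $\dot a(\tau_0)=0$, $b(\tau_0)=\dot b(\tau_0)=0$, $a(\chi_1)=\frac{\sin\kappa\chi_1}{2\kappa}$, $\dot a(\chi_1)=\frac12\cos\kappa\chi_1$, $b(\chi_1)=\sin\kappa\chi_1$, $\dot b(\chi_1)=\kappa\cos\kappa\chi_1$. There are smooth $\alpha,\beta$ with $\alpha>0$ and $\beta$ non-decreasing on $[\sigma_0,\xi_1]$ and $\alpha(\sigma_0)=R$, $\dot\alpha(\sigma_0)=0$, $\beta(\sigma_0)=\dot\beta(\sigma_0)=0$, $\alpha(\xi_1)=\beta(\xi_1)=\xi_1$, $\dot\alpha(\xi_1)=\dot\beta(\xi_1)=1$.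 3. (Homotopy.) Let $e_0<e_1<e_2<e_3<e_4$; let $b',d'$ be smooth and non-decreasing from $0$ to $1$ on $[e_0,e_1]$ and $[e_2,e_3]$; let $c'$ be smooth with values in $[0,1]$ on $[e_1,e_2]$, $c'(e_1)=1$, $c'(e_2)=0$; let $P$ be a smooth path in $SO(4)$ on $[e_3,e_4]$ from the identity to the map $(x,y,z,t)\mapsto(z,t,x,y)$; all with vanishing derivatives at the ends of their intervals. (Such data exist, with $n_0<e_0$ and $e_4<n_1$.) With $w_{1,r}=(-(x^2+y^2-z),\,t,\,-(ty+xz),\,-(tx-yz))$, $w_{2,r}=-\frac{2(ty+xz)}{x^2+y^2+z^2+t^2}(x,y,z,t)$, $m_c=(z-x^2-y^2,\ t,\ -ty-(c(z-1)+1)x,\ -tx+(c(z-1)+1)y)$ and $s_1=(z,t,-x,y)$, define $h_s$ as $w_{1,r}+(1-b'(s))w_{2,r}$ on $[e_0,e_1]$, $m_{c'(s)}$ on $[e_1,e_2]$, $s_1+(1-d'(s))(m_0-s_1)$ on $[e_2,e_3]$, and $P(s)s_1$ on $[e_3,e_4]$. Then $h_s$ has no zero on $\mathbb R^4\setminus0$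 for any $s\in[e_0,e_4]$, $h_{e_0}=w_r$, $h_{e_4}=v$, and $(s,x)\mapsto h_s(x)/|h_s(x)|$ is $C^1$ on $[e_0,e_4]\times(\mathbb R^4\setminus0)$. 4. (Gluing.) For all data as in 2 and 3 with $n_0<e_0$ and $e_4<n_1$ there is a smooth Hausdorff 4-manifold $W=\mathbb M\#\mathbb{CP}^2$ (compact if $\mathbb M$ is, second countable if $\mathbb M$ is, with $\partial W=\partial\mathbb M$), obtained from $\mathbb M\setminus\{|x|\le\sigma_0\}$ and $\mathbb{CP}^2\setminus\{\chi\le\tau_0\}$ by joining the two boundary spheres by the neck $S^3\times[n_0,n_1]\ni(u,s)$, where the smooth structure at the ends is given by $x=(\sigma_0+s-n_1)u$ for $s>n_1$ and by the point of the first affine chart with $\chi=\tau_0+n_0-s$ in direction $u$ for $s<n_0$ (so that the radius is reversed). On $W$ there are a $C^1$ Riemannian metric $G$ and a $C^1$ vector field $V$ with $G(V,V)=1$ such that $g=G-2V^\flat\otimes V^\flat$ is a $C^1$, everywhere non-degenerate metric of signature $(-,+,+,+)$, time-oriented by the timelike field $V$, and * on $\mathbb M\setminus\{|x|<\xi_1\}$: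 $G=g^R$, $V$ is a positive multiple of $\operatorname{grad}f$, and $g=g_{\mathbb M}$; there the level sets of $f$ are spacelike; * on the annulus $\sigma_0<|x|\le\xi_1$, with $\sigma=|x|$, $x_1=\sigma\cos\psi$: $G=d\sigma^2+\alpha(\sigma)^2d\Omega^2+\beta(\sigma)^2(\cos2\psi\,d\sigma-\sigma\sin2\psi\,d\psi)^2$ and $V$ is a positive multiple of $v$; * on the neck: $G=ds^2+R^2d\Omega^2$; under the isometry $T_{(u,s)}\to\mathbb R^4$ with $\partial_s\mapsto u$, $T_uS^3\ni\theta\mapsto R\theta$, the field $V$ is a positive multiple of $h_s(Ru)$ for $s\in[e_0,e_4]$; of $v(u)$ with its radial component multiplied by a smooth function $\mu(s)>0$ for $s\in[e_4,n_1]$; and of $w_r(\rho(s)u)$ with its radial component multiplied by $\nu(s)$, with smooth $\rho,\nu>0$, for $s\in[n_0,e_0]$; * on the annulus $\tau_0<\chi\le\chi_1$: $G=d\chi^2+a(\chi)^2(\sigma_1^2+\sigma_2^2+(1-b(\chi)^2)\sigma_3^2)$ and $V$ is a positive multiple of $w$; * on $\mathbb{CP}^2\setminus\{\chi<\chi_1\}$: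 $G=g^{FS}$, $V$ is a positive multiple of $w$, and $g=g_{\mathbb{CP}^2}$. There is no thin shell: at the four junctions $|x|=\xi_1$, $s=n_1$, $s=n_0$, $\chi=\chi_1$, with the radial rigging $l=\partial_s$, normal form $N=ds$ (the coordinate $s$ being extended over the annuli) and $\Pi^\alpha{}_\mu=\delta^\alpha_\mu-N_\mu l^\alpha$, the tensor $\mathcal H_{\mu\nu}=\Pi^\alpha{}_\mu\Pi^\beta{}_\nu\nabla_\alpha l_\beta$ has equal limits from both sides. -/

import Mathlib

open Set Filter Topology
open scoped Manifold ContDiff RealInnerProductSpace Bundle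

universe u v

namespace WormholeNucleation

/-- The model space `ℝ⁴`. -/
abbrev E4 := EuclideanSpace ℝ (Fin 4)

/-! ### The complex projective plane -/

/-- The complex projective plane, the set of complex lines in `ℂ³`. -/
def CP2 : Type := Projectivization ℂ (Fin 3 → ℂ)

namespace CP2

/-- The point with homogeneous coordinates `v`. -/
noncomputable def mk (v : {v : Fin 3 → ℂ // v ≠ 0}) : CP2 := Projectivization.mk' ℂ v

/-- The quotient topology. -/
noncomputable instance : TopologicalSpace CP2 := TopologicalSpace.coinduced mk inferInstance

theorem mk_surjective : Function.Surjective mk := by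
  intro p
  induction p using Projectivization.ind with
  | h v hv => exact ⟨⟨v, hv⟩, rfl⟩

theorem isQuotientMap_mk : IsQuotientMap mk := ⟨⟨rfl⟩, mk_surjective⟩

theorem mk_eq_mk (v w : {v : Fin 3 → ℂ // v ≠ 0}) :
    mk v = mk w ↔ ∃ a : ℂ, a • (w : Fin 3 → ℂ) = v :=
  Projectivization.mk_eq_mk_iff' ℂ v.1 w.1 v.2 w.2

/-- The homogeneous coordinate that does not vanish on the affine chart number `i`
(charts `0, 1, 2` are `{Z₃ ≠ 0}`, `{Z₁ ≠ 0}`, `{Z₂ ≠ 0}`). -/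
def pivot : Fin 3 → Fin 3 := ![2, 0, 1]

/-- The numerator of the first affine coordinate. -/
def fst : Fin 3 → Fin 3 := ![0, 1, 0]

/-- The numerator of the second affine coordinate. -/
def snd : Fin 3 → Fin 3 := ![1, 2, 2]

/-- Affine coordinates of a homogeneous vector in chart `i`, as a point of `ℝ⁴ = ℂ²`. -/
noncomputable def affine (i : Fin 3) (v : Fin 3 → ℂ) : E4 :=
  !₂[(v (fst i) / v (pivot i)).re, (v (fst i) / v (pivot i)).im,
    (v (snd i) / v (pivot i)).re, (v (snd i) / v (pivot i)).im]

/-- The homogeneous vector with pivot coordinate `1` and affine coordinates `y` in chart `i`. -/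
noncomputable def homog (i : Fin 3) (y : E4) : Fin 3 → ℂ := fun m =>
  if m = pivot i then 1 else if m = fst i then ⟨y 0, y 1⟩ else ⟨y 2, y 3⟩

theorem homog_pivot (i : Fin 3) (y : E4) : homog i y (pivot i) = 1 := by simp [homog]

theorem homog_fst (i : Fin 3) (y : E4) : homog i y (fst i) = ⟨y 0, y 1⟩ := by
  have : fst i ≠ pivot i := by fin_cases i <;> decide
  simp [homog, this]

theorem homog_snd (i : Fin 3) (y : E4) : homog i y (snd i) = ⟨y 2, y 3⟩ := by
  have h1 : snd i ≠ pivot i := by fin_cases i <;> decide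
  have h2 : snd i ≠ fst i := by fin_cases i <;> decide
  simp [homog, h1, h2]

theorem index_cases (i m : Fin 3) : m = pivot i ∨ m = fst i ∨ m = snd i := by
  fin_cases i <;> fin_cases m <;> decide

theorem homog_ne_zero (i : Fin 3) (y : E4) : homog i y ≠ 0 := fun h => by
  have := congrFun h (pivot i)
  rw [homog_pivot] at this
  exact one_ne_zero this

theorem affine_homog (i : Fin 3) (y : E4) : affine i (homog i y) = y := by
  ext m
  fin_cases m <;> simp [affine, homog_pivot, homog_fst, homog_snd]

theorem homog_affine (i : Fin 3) (v : Fin 3 → ℂ) (h : v (pivot i) ≠ 0) :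
    v (pivot i) • homog i (affine i v) = v := by
  funext m
  rcases index_cases i m with rfl | rfl | rfl
  · simp [homog_pivot]
  · simp only [Pi.smul_apply, homog_fst, affine, smul_eq_mul]
    simp [mul_div_cancel₀, h]
  · simp only [Pi.smul_apply, homog_snd, affine, smul_eq_mul]
    simp [mul_div_cancel₀, h]

theorem affine_smul (i : Fin 3) (a : ℂ) (ha : a ≠ 0) (v : Fin 3 → ℂ) :
    affine i (a • v) = affine i v := by
  simp [affine, mul_div_mul_left _ _ ha]

/-- Affine coordinates on `CP2`. -/
noncomputable def coord (i : Fin 3) : CP2 → E4 :=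
  Projectivization.lift (fun v => affine i v.1) (by
    rintro ⟨a, ha⟩ ⟨b, hb⟩ t (h : a = t • b)
    have ht : t ≠ 0 := by
      rintro rfl
      exact ha (by simpa using h)
    simp only [h]
    exact affine_smul i t ht b)

theorem coord_mk (i : Fin 3) (v : {v : Fin 3 → ℂ // v ≠ 0}) : coord i (mk v) = affine i v.1 := rfl

/-- The domain of the affine chart `i`. -/
def dom (i : Fin 3) : Set CP2 := {p | ∀ v, mk v = p → v.1 (pivot i) ≠ 0}

theorem mk_mem_dom (i : Fin 3) (v : {v : Fin 3 → ℂ // v ≠ 0}) :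
    mk v ∈ dom i ↔ v.1 (pivot i) ≠ 0 := by
  constructor
  · intro h
    exact h v rfl
  · intro h w hw h0
    obtain ⟨a, ha⟩ := (mk_eq_mk w v).1 hw
    have ha0 : a ≠ 0 := by
      rintro rfl
      exact w.2 (by simpa using ha.symm)
    have := congrFun ha (pivot i)
    rw [h0] at this
    simp [ha0, h] at this

theorem isOpen_dom (i : Fin 3) : IsOpen (dom i) := by
  rw [← isQuotientMap_mk.isOpen_preimage]
  have : mk ⁻¹' dom i = {v | v.1 (pivot i) ≠ 0} := by
    ext v
    exact mk_mem_dom i v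
  rw [this]
  exact isOpen_ne_fun ((continuous_apply _).comp continuous_subtype_val) continuous_const

theorem contDiff_homog (i : Fin 3) (m : Fin 3) : ContDiff ℝ ∞ (fun y => homog i y m) := by
  have h1 : ContDiff ℝ ∞ (fun y : E4 => ((y 0 : ℂ) + y 1 * Complex.I)) :=
    (Complex.ofRealCLM.contDiff.comp (by fun_prop)).add
      ((Complex.ofRealCLM.contDiff.comp (by fun_prop)).mul contDiff_const)
  have h2 : ContDiff ℝ ∞ (fun y : E4 => ((y 2 : ℂ) + y 3 * Complex.I)) :=
    (Complex.ofRealCLM.contDiff.comp (by fun_prop)).add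
      ((Complex.ofRealCLM.contDiff.comp (by fun_prop)).mul contDiff_const)
  rcases index_cases i m with rfl | rfl | rfl
  · simp only [homog_pivot]
    exact contDiff_const
  · simp only [homog_fst, Complex.mk_eq_add_mul_I]
    exact h1
  · simp only [homog_snd, Complex.mk_eq_add_mul_I]
    exact h2

/-- The affine chart number `i`, with values in `ℝ⁴ = ℂ²`. -/
noncomputable def chart (i : Fin 3) : OpenPartialHomeomorph CP2 E4 where
  toFun := coord i
  invFun y := mk ⟨homog i y, homog_ne_zero i y⟩
  source := dom i
  target := univ
  map_source' _ _ := mem_univ _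
  map_target' y _ := by
    rw [mk_mem_dom]
    simp [homog_pivot]
  left_inv' p hp := by
    obtain ⟨v, rfl⟩ := mk_surjective p
    rw [mk_mem_dom] at hp
    rw [coord_mk, eq_comm, mk_eq_mk]
    exact ⟨_, homog_affine i v.1 hp⟩
  right_inv' y _ := by
    rw [coord_mk]
    exact affine_homog i y
  open_source := isOpen_dom i
  open_target := isOpen_univ
  continuousOn_toFun := by
    rw [isQuotientMap_mk.continuousOn_isOpen_iff (isOpen_dom i)]
    have h : ∀ m : Fin 3, ContinuousOn (fun v : {v : Fin 3 → ℂ // v ≠ 0} => v.1 m / v.1 (pivot i))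
        (mk ⁻¹' dom i) := fun m =>
      ContinuousOn.div ((continuous_apply _).comp continuous_subtype_val).continuousOn
        ((continuous_apply _).comp continuous_subtype_val).continuousOn (fun v hv => (mk_mem_dom i v).1 hv)
    have hr := fun m => Complex.continuous_re.comp_continuousOn (h m)
    have hi := fun m => Complex.continuous_im.comp_continuousOn (h m)
    refine (PiLp.continuous_toLp 2 _).comp_continuousOn (continuousOn_pi.2 fun m => ?_)
    fin_cases m
    · exact hr (fst i)
    · exact hi (fst i)
    · exact hr (snd i)
    · exact hi (snd i)
  continuousOn_invFun := by
    refine Continuous.continuousOn (isQuotientMap_mk.continuous.comp ?_)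
    exact Continuous.subtype_mk (continuous_pi fun m => (contDiff_homog i m).continuous) _

open Classical in
/-- The number of the preferred affine chart at a point. -/
noncomputable def index (p : CP2) : Fin 3 := if p ∈ dom 0 then 0 else if p ∈ dom 1 then 1 else 2

theorem mem_dom_index (p : CP2) : p ∈ dom (index p) := by
  unfold index
  split_ifs with h0 h1
  · exact h0
  · exact h1
  · obtain ⟨v, rfl⟩ := mk_surjective p
    rw [mk_mem_dom] at *
    intro h2
    apply v.2
    funext m
    fin_cases m
    · simpa [pivot] using h1
    · simpa [pivot] using h2
    · simpa [pivot] using h0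

noncomputable instance : ChartedSpace E4 CP2 where
  atlas := range chart
  chartAt p := chart (index p)
  mem_chart_source p := mem_dom_index p
  chart_mem_atlas _ := mem_range_self _

instance : IsManifold 𝓘(ℝ, E4) ∞ CP2 := by
  refine isManifold_of_contDiffOn _ _ _ ?_
  rintro _ _ ⟨i, rfl⟩ ⟨j, rfl⟩
  have hs : ∀ y : E4, y ∈ ((chart i).symm ≫ₕ chart j).source → homog i y (pivot j) ≠ 0 := by
    intro y hy
    have h : mk ⟨homog i y, homog_ne_zero i y⟩ ∈ dom j := hy.2
    exact (mk_mem_dom j _).1 h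
  have h : ∀ m : Fin 3, ContDiffOn ℝ ∞ (fun y => homog i y m / homog i y (pivot j))
      ((chart i).symm ≫ₕ chart j).source := fun m => by
    simp only [div_eq_mul_inv]
    exact (contDiff_homog i m).contDiffOn.mul
      (ContDiffOn.inv (contDiff_homog i _).contDiffOn (fun y hy => hs y hy))
  have hr := fun m => Complex.reCLM.contDiff.comp_contDiffOn (h m)
  have hi := fun m => Complex.imCLM.contDiff.comp_contDiffOn (h m)
  have key : ContDiffOn ℝ ∞ (fun y => affine j (homog i y)) ((chart i).symm ≫ₕ chart j).source := by
    rw [contDiffOn_euclidean]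
    intro m
    fin_cases m
    · exact hr (fst j)
    · exact hi (fst j)
    · exact hr (snd j)
    · exact hi (snd j)
  refine key.mono ?_
  intro y hy
  simpa using hy.1

end CP2

/-! ### Tensors on `ℝ⁴ ∖ 0` and the two singular Lorentzian metrics

Symmetric bilinear forms are written as functions of the base point and of two tangent vectors. -/

section Forms

/-- The Lorentzian form `g - 2 Z♭ ⊗ Z♭ / g(Z, Z)` of a Riemannian form `g` and a vector `Z`. -/
noncomputable def lorentzForm {T : Type*} (g : T → T → ℝ) (Z v w : T) : ℝ :=
  g v w - 2 * (g Z v * g Z w) / g Z Z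

/-- The unit vector in the direction of `x`. -/
noncomputable def unitVec (x : E4) : E4 := ‖x‖⁻¹ • x

/-- The one-form `dr`, with `r = ‖x‖`. -/
noncomputable def dRadius (x v : E4) : ℝ := ⟪x, v⟫ / ‖x‖

/-- The round metric of the unit sphere `S³`, pulled back by `x ↦ x / ‖x‖`. -/
noncomputable def roundForm (x v w : E4) : ℝ :=
  (⟪v, w⟫ - dRadius x v * dRadius x w) / ‖x‖ ^ 2

/-- Multiplication by `i` on `ℝ⁴ = ℂ²`. -/
noncomputable def mulI (x : E4) : E4 := !₂[-x 1, x 0, -x 3, x 2]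

/-- Half of the left-invariant one-form `σ₃ = dψ + cos θ dφ`, as a form on `ℝ⁴ ∖ 0`. The three
left-invariant forms satisfy `σ₁² + σ₂² + σ₃² = 4 roundForm`. -/
noncomputable def hopfForm (x v : E4) : ℝ := ⟪mulI x, v⟫ / ‖x‖ ^ 2

/-! #### The Morse side -/

/-- The quadratic normal form of a critical point of index one. -/
noncomputable def morseFun (x : E4) : ℝ := (-x 0 ^ 2 + x 1 ^ 2 + x 2 ^ 2 + x 3 ^ 2) / 2

/-- The Euclidean gradient `v` of `morseFun`. -/
noncomputable def morseField (x : E4) : E4 := !₂[-x 0, x 1, x 2, x 3]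

/-- The interpolating metric `dr² + α(r)² dΩ₃² + β(r)² (cos 2ψ dr - r sin 2ψ dψ)²`, where
`x₁ = r cos ψ`. Since `morseFun = - r² cos (2ψ) / 2`, the last one-form is
`- d(morseFun) / r`. -/
noncomputable def morseAnnulusForm (α β : ℝ → ℝ) (x v w : E4) : ℝ :=
  dRadius x v * dRadius x w + α ‖x‖ ^ 2 * roundForm x v w
    + β ‖x‖ ^ 2 * ((fderiv ℝ morseFun x v / ‖x‖) * (fderiv ℝ morseFun x w / ‖x‖))

/-! #### The projective side -/

/-- The inverse length `√(Λ / 6)`. -/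
noncomputable def kappa (Λ : ℝ) : ℝ := √(Λ / 6)

/-- The Fubini-Study metric in each of the affine charts. -/
noncomputable def fubiniStudyForm (Λ : ℝ) (x v w : E4) : ℝ :=
  (6 / Λ) / (1 + ‖x‖ ^ 2) *
    (⟪v, w⟫ - (⟪x, v⟫ * ⟪x, w⟫ + ⟪mulI x, v⟫ * ⟪mulI x, w⟫) / (1 + ‖x‖ ^ 2))

/-- The coordinate expressions of the vector field `w` in the three affine charts: the real parts
of `(z₁² + z₂) ∂₁ + z₁ z₂ ∂₂`, `- ζ₁² ∂₁ - (1 + ζ₁ ζ₂) ∂₂` and `∂₁ - ξ₁ ∂₂`. -/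
noncomputable def affineField : Fin 3 → E4 → E4 := ![
  fun p => !₂[p 0 ^ 2 - p 1 ^ 2 + p 2, 2 * p 0 * p 1 + p 3,
    p 0 * p 2 - p 3 * p 1, p 3 * p 0 + p 1 * p 2],
  fun p => !₂[-(p 0 ^ 2 - p 1 ^ 2), -(2 * p 0 * p 1),
    -(p 0 * p 2 - p 1 * p 3 + 1), -(p 0 * p 3 + p 1 * p 2)],
  fun p => !₂[1, 0, -p 0, -p 1]]

/-- The radial coordinate `χ` with `r = tan (χ √(Λ / 6))`. -/
noncomputable def chi (Λ : ℝ) (x : E4) : ℝ := Real.arctan ‖x‖ / kappa Λ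

/-- The one-form `dχ`. -/
noncomputable def dChi (Λ : ℝ) (x v : E4) : ℝ := dRadius x v / (kappa Λ * (1 + ‖x‖ ^ 2))

/-- The interpolating metric `dχ² + a(χ)² (σ₁² + σ₂² + (1 - b(χ)²) σ₃²)`. -/
noncomputable def projectiveAnnulusForm (Λ : ℝ) (a b : ℝ → ℝ) (x v w : E4) : ℝ :=
  dChi Λ x v * dChi Λ x w
    + a (chi Λ x) ^ 2 *
      (4 * roundForm x v w - b (chi Λ x) ^ 2 * ((2 * hopfForm x v) * (2 * hopfForm x w)))

/-- The vector field `w` on `CP2`. A tangent vector is represented by its coordinates in the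
preferred chart at the base point. -/
noncomputable def CP2.field (p : CP2) : TangentSpace 𝓘(ℝ, E4) p :=
  affineField (CP2.index p) (CP2.coord (CP2.index p) p)

/-- The Fubini-Study metric on `CP2`. -/
noncomputable def CP2.fubiniStudy (Λ : ℝ) (p : CP2) :
    TangentSpace 𝓘(ℝ, E4) p → TangentSpace 𝓘(ℝ, E4) p → ℝ :=
  fubiniStudyForm Λ (CP2.coord (CP2.index p) p)

/-- The centre `[0 : 0 : 1]` of the first affine chart. -/
noncomputable def CP2.center : CP2 := (CP2.chart 0).symm 0

/-! #### The neck

The cylinder `S³ × ℝ` is identified with `ℝ⁴ ∖ 0` by `(u, s) ↦ exp s • u`. -/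

/-- The metric `ds² + R² dΩ₃²` of the cylinder, `s = log ‖y‖`. -/
noncomputable def neckForm (R : ℝ) (y v w : E4) : ℝ :=
  (⟪y, v⟫ / ‖y‖ ^ 2) * (⟪y, w⟫ / ‖y‖ ^ 2) + R ^ 2 * roundForm y v w

/-- The tangent vector of the cylinder of radius `R` that corresponds to `F ∈ ℝ⁴` under the
isometry `T_{(u, s)} (ℝ × S³) = ℝ⁴` sending `∂ₛ` to `u` and a tangent vector `t` of the unit
sphere to `R t`. -/
noncomputable def neckVector (R : ℝ) (y F : E4) : E4 :=
  ‖y‖ • (⟪F, unitVec y⟫ • unitVec y + R⁻¹ • (F - ⟪F, unitVec y⟫ • unitVec y))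

/-- The field `F` with its radial component multiplied by `k`. -/
noncomputable def radialScale (k : ℝ) (F : E4 → E4) (x : E4) : E4 :=
  F x + ((k - 1) * ⟪F x, x⟫ / ‖x‖ ^ 2) • x

/-- The radially reflected field `w_r`. -/
noncomputable def reflectedField : E4 → E4 := radialScale (-1) (affineField 0)

/-- The part `w_{1,r}` of `w_r`. -/
noncomputable def reflectedField₁ (p : E4) : E4 :=
  !₂[-(p 0 ^ 2 + p 1 ^ 2 - p 2), p 3, -(p 3 * p 1 + p 0 * p 2), -(p 3 * p 0 - p 1 * p 2)]

/-- The part `w_{2,r}` of `w_r`. -/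
noncomputable def reflectedField₂ (p : E4) : E4 :=
  (-(2 * (p 3 * p 1 + p 0 * p 2) / ‖p‖ ^ 2)) • p

/-- The field interpolating between `w_{1,r}` (at `c = 1`) and `s` (at `c = 0`). -/
noncomputable def middleField (c : ℝ) (p : E4) : E4 :=
  !₂[p 2 - p 0 ^ 2 - p 1 ^ 2, p 3,
    -(p 3 * p 1) - (c * (p 2 - 1) + 1) * p 0, -(p 3 * p 0) + (c * (p 2 - 1) + 1) * p 1]

/-- The linear part `s₁` of `s`. -/
noncomputable def linearField (p : E4) : E4 := !₂[p 2, p 3, -p 0, p 1]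

/-- The rotation carrying `s₁` to the Morse field. -/
def swapRotation : Matrix (Fin 4) (Fin 4) ℝ := !![0, 0, 1, 0; 0, 0, 0, 1; 1, 0, 0, 0; 0, 1, 0, 0]

/-- Times `e₀ < e₁ < e₂ < e₃ < e₄`, cut-off functions and a path of rotations for the four stages
of the homotopy, all of them stationary at the ends of their stage. -/
structure NeckSchedule (e : Fin 5 → ℝ) (b c d : ℝ → ℝ) (P : ℝ → Matrix (Fin 4) (Fin 4) ℝ) :
    Prop where
  strictMono : StrictMono e
  b_smooth : ContDiff ℝ ∞ b
  b_mono : MonotoneOn b (Icc (e 0) (e 1))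
  b_left : b (e 0) = 0 ∧ deriv b (e 0) = 0
  b_right : b (e 1) = 1 ∧ deriv b (e 1) = 0
  c_smooth : ContDiff ℝ ∞ c
  c_mem : ∀ s ∈ Icc (e 1) (e 2), c s ∈ Icc (0 : ℝ) 1
  c_left : c (e 1) = 1 ∧ deriv c (e 1) = 0
  c_right : c (e 2) = 0 ∧ deriv c (e 2) = 0
  d_smooth : ContDiff ℝ ∞ d
  d_mono : MonotoneOn d (Icc (e 2) (e 3))
  d_left : d (e 2) = 0 ∧ deriv d (e 2) = 0
  d_right : d (e 3) = 1 ∧ deriv d (e 3) = 0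
  P_smooth : ∀ i j, ContDiff ℝ ∞ fun s => P s i j
  P_mem : ∀ s ∈ Icc (e 3) (e 4), P s ∈ Matrix.specialOrthogonalGroup (Fin 4) ℝ
  P_left : P (e 3) = 1 ∧ ∀ i j, deriv (fun s => P s i j) (e 3) = 0
  P_right : P (e 4) = swapRotation ∧ ∀ i j, deriv (fun s => P s i j) (e 4) = 0

/-- The four-stage deformation, before normalization. -/
noncomputable def neckField (e : Fin 5 → ℝ) (b c d : ℝ → ℝ) (P : ℝ → Matrix (Fin 4) (Fin 4) ℝ)
    (s : ℝ) (x : E4) : E4 :=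
  if s ≤ e 1 then reflectedField₁ x + (1 - b s) • reflectedField₂ x
  else if s ≤ e 2 then middleField (c s) x
  else if s ≤ e 3 then linearField x + (1 - d s) • (middleField 0 x - linearField x)
  else Matrix.toEuclideanLin (P s) (linearField x)

end Forms

/-! ### Degree -/

section Degree

/-- The extension of a map of the unit sphere to `ℝ⁴ ∖ 0` that is constant on rays. -/
noncomputable def rayExtension (φ : E4 → E4) (x : E4) : E4 := φ (unitVec x)

/-- The Jacobian determinant at `u` of the self-map `φ` of the unit sphere, oriented by the outward
normal: the derivative of `φ` is completed to a linear map of `ℝ⁴` by sending the normal `u` to the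
normal `φ u`. -/
noncomputable def sphereJacobian (φ : E4 → E4) (u : E4) : ℝ :=
  (fderiv ℝ (rayExtension φ) u + (innerSL ℝ u).smulRight (φ u)).det

/-- The smooth map `φ : S³ → S³` has Brouwer degree `d`: the number of preimages of a regular value,
counted with the sign of the Jacobian, is `d`. (The count is the same for every regular value.) -/
def HasSphereDegree (φ : E4 → E4) (d : ℤ) : Prop :=
  ContDiffOn ℝ ∞ (rayExtension φ) {0}ᶜ ∧ (∀ u, ‖u‖ = 1 → ‖φ u‖ = 1) ∧
    ∃ y : E4, ‖y‖ = 1 ∧ (∀ u, ‖u‖ = 1 → φ u = y → sphereJacobian φ u ≠ 0) ∧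
      {u : E4 | ‖u‖ = 1 ∧ φ u = y}.Finite ∧
      ∑ᶠ u ∈ {u : E4 | ‖u‖ = 1 ∧ φ u = y}, (SignType.sign (sphereJacobian φ u) : ℤ) = d

end Degree

/-! ### The cobordism and its Morse metric -/

section Cobordism

variable {H : Type v} [TopologicalSpace H] (I : ModelWithCorners ℝ E4 H)
variable (M : Type u) [TopologicalSpace M] [ChartedSpace H M]

/-- The data of a cobordism of one `0`-surgery with its singular metric: a smooth function `f` on
the 4-manifold `M` (boundary and corners are allowed) whose only critical point is an interior,
non-degenerate critical point `p` of index one, a chart bringing `f` to normal form near `p`, and a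
Riemannian metric on `M` that is `δ + df ⊗ df` in this chart. -/
structure MorseCobordism [IsManifold I ∞ M] where
  f : M → ℝ
  smooth : ContMDiff I 𝓘(ℝ, ℝ) ∞ f
  p : M
  interior : I.IsInteriorPoint p
  critical_iff : ∀ x, mfderiv I 𝓘(ℝ, ℝ) f x = 0 ↔ x = p
  chart : PartialDiffeomorph I 𝓘(ℝ, E4) M E4 ∞
  mem_chart : p ∈ chart.source
  chart_p : chart p = 0
  normal_form : ∀ x ∈ chart.source, f x = f p + morseFun (chart x)
  metric : Bundle.ContMDiffRiemannianMetric I ∞ E4 (fun x : M => TangentSpace I x)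
  metric_eq : ∀ x ∈ chart.source, ∀ v w : TangentSpace I x,
    metric.inner x v w =
      ⟪(show E4 from mfderiv I 𝓘(ℝ, E4) chart x v), (show E4 from mfderiv I 𝓘(ℝ, E4) chart x w)⟫
      + (show ℝ from mfderiv I 𝓘(ℝ, ℝ) f x v) * (show ℝ from mfderiv I 𝓘(ℝ, ℝ) f x w)

variable {I M}

namespace MorseCobordism

variable [IsManifold I ∞ M] (C : MorseCobordism I M)

/-- The gradient of `f` for the Riemannian metric. -/
noncomputable def gradient (x : M) : TangentSpace I x :=
  Classical.epsilon fun Z => ∀ v, C.metric.inner x Z v = mfderiv I 𝓘(ℝ, ℝ) C.f x v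

/-- The open ball of radius `r` in the Morse chart. -/
def chartBall (r : ℝ) : Set M := {x | x ∈ C.chart.source ∧ ‖C.chart x‖ < r}

/-- The closed ball of radius `r` in the Morse chart. -/
def closedChartBall (r : ℝ) : Set M := {x | x ∈ C.chart.source ∧ ‖C.chart x‖ ≤ r}

end MorseCobordism

/-- A Lorentzian metric of class `C¹`, of signature `(-,+,+,+)`. -/
structure LorentzMetric (I : ModelWithCorners ℝ E4 H) (W : Type u) [TopologicalSpace W]
    [ChartedSpace H W] [IsManifold I ∞ W] where
  inner : ∀ x : W, TangentSpace I x →L[ℝ] TangentSpace I x →L[ℝ] ℝ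
  symm : ∀ x v w, inner x v w = inner x w v
  nondegenerate : ∀ x v, (∀ w, inner x v w = 0) → v = 0
  signature : ∀ x, ∃ v, inner x v v < 0 ∧ ∀ w, w ≠ 0 → inner x v w = 0 → 0 < inner x w w
  contMDiff : ContMDiff I (I.prod 𝓘(ℝ, E4 →L[ℝ] E4 →L[ℝ] ℝ)) 1 fun x : W =>
    Bundle.TotalSpace.mk' (E4 →L[ℝ] E4 →L[ℝ] ℝ)
      (E := fun x : W => TangentSpace I x →L[ℝ] TangentSpace I x →L[ℝ] ℝ) x (inner x)

end Cobordism

/-! ### Junctions -/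

section Junction

/-- The part `v - ds(v) ∂ₛ` of `v` tangent to the spheres, for the cylinder coordinate
`s = log ‖y‖`, the normal one-form `N = ds` and the rigging `l = ∂ₛ` (which is `y` at `y`). -/
noncomputable def rigProjection (y v : E4) : E4 := v - (⟪y, v⟫ / ‖y‖ ^ 2) • y

/-- The lowered covariant derivative `(∇_v l♭)(w)` of the rigging `l = ∂ₛ` at `y`, for the
Levi-Civita connection of `G`; the last bracket is the Christoffel symbol of the first kind. -/
noncomputable def covDerivRigging (G : E4 → E4 → E4 → ℝ) (y v w : E4) : ℝ :=
  fderiv ℝ (fun z => G z z w) y v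
    - (fderiv ℝ (fun z => G z y w) y v + fderiv ℝ (fun z => G z y v) y w
      - fderiv ℝ (fun z => G z v w) y y) / 2

/-- The tensor `𝓗 = Π Π ∇ l`. -/
noncomputable def riggedCurvature (G : E4 → E4 → E4 → ℝ) (y v w : E4) : ℝ :=
  covDerivRigging G y (rigProjection y v) (rigProjection y w)

/-- There is no thin shell at the point `y` of the sphere `s = log ‖y‖`: the tensor `𝓗` has limits
from both sides, and they agree. -/
def NoThinShell (G : E4 → E4 → E4 → ℝ) (y : E4) : Prop :=
  ∀ v w : E4, ∃ L : ℝ,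
    Tendsto (fun z => riggedCurvature G z v w) (𝓝[{z | ‖z‖ < ‖y‖}] y) (𝓝 L) ∧
    Tendsto (fun z => riggedCurvature G z v w) (𝓝[{z | ‖y‖ < ‖z‖}] y) (𝓝 L)

end Junction

/-! ### The glued space-time -/

/-- The parameters: the surgery radius `ξ₁` in the Morse chart (defined on the larger ball of radius
`ξ₂`), the surgery radius `χ₁` in `CP2`, the inner radii `σ₀`, `τ₀` of the two annuli, and the neck,
of radius `R` and with coordinate `s ∈ [n₀, n₁]`. -/
structure GluingParameters {H : Type v} [TopologicalSpace H] {I : ModelWithCorners ℝ E4 H}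
    {M : Type u} [TopologicalSpace M] [ChartedSpace H M] [IsManifold I ∞ M]
    (C : MorseCobordism I M) (Λ τ₀ χ₁ σ₀ ξ₁ ξ₂ R n₀ n₁ : ℝ) : Prop where
  Λ_pos : 0 < Λ
  τ₀_pos : 0 < τ₀
  τ₀_lt : τ₀ < χ₁
  χ₁_lt : χ₁ < Real.pi / (2 * kappa Λ)
  σ₀_pos : 0 < σ₀
  σ₀_lt : σ₀ < ξ₁
  ξ₁_lt : ξ₁ < ξ₂
  ball_subset : Metric.ball 0 ξ₂ ⊆ C.chart.target
  R_pos : 0 < R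
  neck_lt : n₀ < n₁

/-- Profiles of the annulus on the projective side, with the matching conditions at both ends. -/
structure ProjectiveProfile (Λ τ₀ χ₁ R : ℝ) (a b : ℝ → ℝ) : Prop where
  a_smooth : ContDiff ℝ ∞ a
  a_pos : ∀ τ ∈ Icc τ₀ χ₁, 0 < a τ
  a_inner : 2 * a τ₀ = R ∧ deriv a τ₀ = 0
  a_outer : a χ₁ = Real.sin (kappa Λ * χ₁) / (2 * kappa Λ) ∧
    deriv a χ₁ = Real.cos (kappa Λ * χ₁) / 2
  b_smooth : ContDiff ℝ ∞ b
  b_mono : MonotoneOn b (Icc τ₀ χ₁)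
  b_inner : b τ₀ = 0 ∧ deriv b τ₀ = 0
  b_outer : b χ₁ = Real.sin (kappa Λ * χ₁) ∧
    deriv b χ₁ = kappa Λ * Real.cos (kappa Λ * χ₁)

/-- Profiles of the annulus on the Morse side, with the matching conditions at both ends. -/
structure MorseProfile (σ₀ ξ₁ R : ℝ) (α β : ℝ → ℝ) : Prop where
  α_smooth : ContDiff ℝ ∞ α
  α_pos : ∀ σ ∈ Icc σ₀ ξ₁, 0 < α σ
  α_inner : α σ₀ = R ∧ deriv α σ₀ = 0
  α_outer : α ξ₁ = ξ₁ ∧ deriv α ξ₁ = 1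
  β_smooth : ContDiff ℝ ∞ β
  β_mono : MonotoneOn β (Icc σ₀ ξ₁)
  β_inner : β σ₀ = 0 ∧ deriv β σ₀ = 0
  β_outer : β ξ₁ = ξ₁ ∧ deriv β ξ₁ = 1

section Glued

variable {H : Type v} [TopologicalSpace H] {I : ModelWithCorners ℝ E4 H}
variable {M : Type u} [TopologicalSpace M] [ChartedSpace H M] [IsManifold I ∞ M]
variable {W : Type u} [TopologicalSpace W] [ChartedSpace H W]

/-- `W` is the connected sum `M # CP2` with a neck: the balls `ξ ≤ σ₀` around `p` and `χ ≤ τ₀`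
around the centre of `CP2` are removed, and the two boundary spheres are joined by the cylinder
`S³ × [n₀, n₁]`. The smooth structure near the ends of the cylinder is given by `ξ = σ₀ + s - n₁` and
`χ = τ₀ + n₀ - s`, with the identity on the `S³` factor; so the identification of the punctured
neighbourhoods of the two centres reverses the radius. -/
structure IsNeckSum (C : MorseCobordism I M) (Λ τ₀ σ₀ ξ₂ n₀ n₁ : ℝ)
    (jM : PartialDiffeomorph I I M W ∞) (jN : PartialDiffeomorph 𝓘(ℝ, E4) I E4 W ∞)
    (jC : PartialDiffeomorph 𝓘(ℝ, E4) I CP2 W ∞) : Prop where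
  source_M : jM.source = (C.closedChartBall σ₀)ᶜ
  source_C : jC.source = ((CP2.chart 0).symm '' {x | chi Λ x ≤ τ₀})ᶜ
  source_N : jN.source = {y | y ≠ 0 ∧ n₀ + τ₀ - Real.pi / (2 * kappa Λ) < Real.log ‖y‖ ∧
    Real.log ‖y‖ < n₁ + ξ₂ - σ₀}
  cover : jM.target ∪ jN.target ∪ jC.target = univ
  disjoint : Disjoint jM.target jC.target
  mem_M_iff : ∀ y ∈ jN.source, jN y ∈ jM.target ↔ n₁ < Real.log ‖y‖
  mem_C_iff : ∀ y ∈ jN.source, jN y ∈ jC.target ↔ Real.log ‖y‖ < n₀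
  glue_M : ∀ y ∈ jN.source, n₁ < Real.log ‖y‖ →
    jN y = jM (C.chart.symm ((σ₀ + Real.log ‖y‖ - n₁) • unitVec y))
  glue_C : ∀ y ∈ jN.source, Real.log ‖y‖ < n₀ →
    jN y = jC ((CP2.chart 0).symm
      (Real.tan (kappa Λ * (τ₀ + n₀ - Real.log ‖y‖)) • unitVec y))

variable [IsManifold I ∞ W]

/-- At the point `x` of the manifold `A`, the map `j : A → W` pulls the Riemannian metric `gR` back
to `G`, the direction of `V` is the image of `Z`, and `g` pulls back to `G - 2 Z♭ ⊗ Z♭ / G(Z, Z)`. -/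
def ModelledOn {K : Type*} [TopologicalSpace K] (J : ModelWithCorners ℝ E4 K)
    {A : Type*} [TopologicalSpace A] [ChartedSpace K A]
    (g : LorentzMetric I W)
    (gR : Bundle.ContMDiffRiemannianMetric I 1 E4 (fun x : W => TangentSpace I x))
    (V : ∀ x : W, TangentSpace I x) (j : A → W) (x : A)
    (G : TangentSpace J x → TangentSpace J x → ℝ) (Z : TangentSpace J x) : Prop :=
  (∀ v w, gR.inner (j x) (mfderiv J I j x v) (mfderiv J I j x w) = G v w) ∧
  (∃ k : ℝ, 0 < k ∧ V (j x) = k • mfderiv J I j x Z) ∧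
  (∀ v w, g.inner (j x) (mfderiv J I j x v) (mfderiv J I j x w) = lorentzForm G Z v w)

/-- The metric `g`, built from the Riemannian metric `gR` and the unit field `V`, is the prescribed
one on the five pieces of the connected sum. -/
structure IsGluedMetric (C : MorseCobordism I M) (Λ τ₀ χ₁ σ₀ ξ₁ R n₀ n₁ : ℝ)
    (a b α β : ℝ → ℝ) (e : Fin 5 → ℝ) (b' c' d' : ℝ → ℝ) (P : ℝ → Matrix (Fin 4) (Fin 4) ℝ)
    (jM : PartialDiffeomorph I I M W ∞) (jN : PartialDiffeomorph 𝓘(ℝ, E4) I E4 W ∞)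
    (jC : PartialDiffeomorph 𝓘(ℝ, E4) I CP2 W ∞) (g : LorentzMetric I W)
    (gR : Bundle.ContMDiffRiemannianMetric I 1 E4 (fun x : W => TangentSpace I x))
    (V : ∀ x : W, TangentSpace I x) : Prop where
  /-- the Morse metric outside the ball of radius `ξ₁` -/
  morse : ∀ x ∉ C.chartBall ξ₁,
    ModelledOn I g gR V jM x (fun v w => C.metric.inner x v w) (C.gradient x)
  /-- the annulus on the Morse side -/
  morse_annulus : ∀ x : E4, σ₀ < ‖x‖ → ‖x‖ ≤ ξ₁ →
    ModelledOn 𝓘(ℝ, E4) g gR V (fun x => jM (C.chart.symm x)) x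
      (morseAnnulusForm α β x) (morseField x)
  /-- the part of the neck that adapts the radial component of the Morse field -/
  morse_collar : ∃ μ : ℝ → ℝ, ContDiff ℝ ∞ μ ∧ (∀ s, 0 < μ s) ∧
    ∀ y : E4, y ≠ 0 → Real.log ‖y‖ ∈ Icc (e 4) n₁ →
      ModelledOn 𝓘(ℝ, E4) g gR V jN y (neckForm R y)
        (neckVector R y (radialScale (μ (Real.log ‖y‖)) morseField (unitVec y)))
  /-- the part of the neck that carries the explicit deformation -/
  neck : ∀ y : E4, y ≠ 0 → Real.log ‖y‖ ∈ Icc (e 0) (e 4) →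
    ModelledOn 𝓘(ℝ, E4) g gR V jN y (neckForm R y)
      (neckVector R y (unitVec (neckField e b' c' d' P (Real.log ‖y‖) (R • unitVec y))))
  /-- the part of the neck that adapts the radial component and the radius of the reflected field -/
  projective_collar : ∃ ν ρ : ℝ → ℝ, ContDiff ℝ ∞ ν ∧ ContDiff ℝ ∞ ρ ∧
    (∀ s, 0 < ν s) ∧ (∀ s, 0 < ρ s) ∧
    ∀ y : E4, y ≠ 0 → Real.log ‖y‖ ∈ Icc n₀ (e 0) →
      ModelledOn 𝓘(ℝ, E4) g gR V jN y (neckForm R y)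
        (neckVector R y (radialScale (ν (Real.log ‖y‖)) reflectedField
          (ρ (Real.log ‖y‖) • unitVec y)))
  /-- the annulus on the projective side -/
  projective_annulus : ∀ x : E4, τ₀ < chi Λ x → chi Λ x ≤ χ₁ →
    ModelledOn 𝓘(ℝ, E4) g gR V (fun x => jC ((CP2.chart 0).symm x)) x
      (projectiveAnnulusForm Λ a b x) (affineField 0 x)
  /-- the metric of `CP2` outside the ball of radius `χ₁` -/
  projective : ∀ p ∉ (CP2.chart 0).symm '' {x | chi Λ x < χ₁},
    ModelledOn 𝓘(ℝ, E4) g gR V jC p (CP2.fubiniStudy Λ p) (CP2.field p)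
  /-- no thin shell at any of the four junctions -/
  no_thin_shell : ∀ y : E4, y ≠ 0 →
    Real.log ‖y‖ ∈ ({n₀ + τ₀ - χ₁, n₀, n₁, n₁ + ξ₁ - σ₀} : Set ℝ) →
    NoThinShell (fun z v w => g.inner (jN z) (mfderiv 𝓘(ℝ, E4) I jN z v)
      (mfderiv 𝓘(ℝ, E4) I jN z w)) y

end Glued

end WormholeNucleation

open WormholeNucleation

namespace WormholeNucleation

/-! ### Gluing functions of one variable -/

section OneVariable

/-! A tensor G - 2 V♭ ⊗ V♭ with G Riemannian and V of unit length is automatically Lorentzian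
(`reflectForm_nondegenerate`, `reflectForm_signature`), and it is of class C¹ when G and V are.
Nothing has to be solved: it suffices to carry a Riemannian metric and a direction field without
zeros across the neck, with matching values and first derivatives.

The metric. In the cylinder coordinates s = log ‖y‖, u = y / ‖y‖, the neck and both annuli have the
common shape ds² + A dΩ² + B ℓ² - D (σ₃/2)² with A, B, D depending on s alone (`cylForm`). This is
positive definite as soon as B ≥ 0 and 0 ≤ D < A (`cylForm_pos`), which is what a > 0, α > 0 and the
monotonicity of b provide. The coefficients are C¹ because the profiles are stationary at the inner
radii and have the jets of the outer metrics at the outer radii (`contDiff_neckCoef`).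

The field. On the neck, a vector field without zeros is a homotopy of maps from S³ to ℝ⁴ ∖ 0, so the
degree is the only obstruction to joining the two boundary fields. Reversing the radius replaces w
by w_r, and w_r and v both have degree -1: each takes some regular value exactly once, with negative
Jacobian (`hasSphereDegree_neg_one`). The homotopy is explicit and its lack of zeros is algebra.
With z₁ = x₀ + i x₁ and z₂ = x₂ + i x₃, a zero of the first stage satisfies |z̄₁ + q|² |z₂|² = 0 for
a real q; in the second and third stages one component forces x₃ = 0 and makes the rest elementary;
the last stage is a rotation. Positive factors on the radial component and changes of radius
(`exists_neckScales`) create no zeros, and they absorb the distortion of the maps from the cylinder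
to the annuli.

The projective plane. The field w is induced by a nilpotent linear field on ℂ³ (`linearLift`), and
the Fubini-Study metric by a Hermitian expression on ℂ³ that does not change under rescaling or
under adding multiples of the base vector to the tangent vectors. Independence of the chart follows
(`fderiv_affineField`, `fubiniStudyForm_fderiv`).

The gluing. W arises from two gluings along radial diffeomorphisms (`exists_neckSum`). The neck
chart reaches beyond both surgery spheres; it carries one C¹ metric and one C¹ field, and the
original data are used elsewhere (`exists_neckSumModel`). On the overlaps outside the surgery
spheres the two descriptions agree (`NeckSumModel.morse`, `NeckSumModel.projective`), so regularity
is checked at interior points of charts. Since 𝓗 contains only first derivatives of g, the absence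
of thin shells is a consequence of C¹ regularity (`noThinShell_of_contDiffAt`). -/

theorem contDiffAt_one_ite_le {f g : ℝ → ℝ} {c s : ℝ} (hf : s ≤ c → ContDiffAt ℝ 1 f s)
    (hg : c ≤ s → ContDiffAt ℝ 1 g s) (h0 : f c = g c) (h1 : deriv f c = deriv g c) :
    ContDiffAt ℝ 1 (fun t => if t ≤ c then f t else g t) s := by
  rcases lt_trichotomy s c with h | rfl | h
  · refine (hf h.le).congr_of_eventuallyEq ?_
    filter_upwards [Iio_mem_nhds h] with t ht
    exact if_pos (le_of_lt ht)
  · have hf := hf le_rfl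
    have hg := hg le_rfl
    rw [contDiffAt_one_iff] at hf hg ⊢
    obtain ⟨f', u, hu, hfc, hfd⟩ := hf
    obtain ⟨g', w, hw, hgc, hgd⟩ := hg
    obtain ⟨o, ho, hoo, hso⟩ := mem_nhds_iff.1 (inter_mem hu hw)
    -- Equality of the two derivatives at the junction is what makes the piecewise derivative
    -- continuous.
    have e : f' s = g' s := by
      have a := (hfd s (ho hso).1).hasDerivAt.deriv
      have b := (hgd s (ho hso).2).hasDerivAt.deriv
      ext
      rw [← a, ← b, h1]
    refine ⟨fun t => if t ≤ s then f' t else g' t, o, hoo.mem_nhds hso, fun t ht => ?_,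
      fun t ht => ?_⟩
    · have hf' := hfc.continuousAt (mem_of_superset (hoo.mem_nhds ht) fun z hz => (ho hz).1)
      have hg' := hgc.continuousAt (mem_of_superset (hoo.mem_nhds ht) fun z hz => (ho hz).2)
      refine ContinuousAt.continuousWithinAt ?_
      rcases lt_trichotomy t s with h | rfl | h
      · refine hf'.congr ?_
        filter_upwards [Iio_mem_nhds h] with z hz
        exact (if_pos (le_of_lt hz)).symm
      · rw [continuousAt_iff_continuous_left_right]
        refine ⟨hf'.continuousWithinAt.congr (fun z hz => if_pos hz) (if_pos le_rfl),
          hg'.continuousWithinAt.congr (fun z hz => ?_) ?_⟩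
        · rcases eq_or_lt_of_le (show t ≤ z from hz) with rfl | hz
          · simp [e]
          · exact if_neg (not_le.2 hz)
        · simp [e]
      · refine hg'.congr ?_
        filter_upwards [Ioi_mem_nhds h] with z hz
        exact (if_neg (not_le.2 hz)).symm
    · rcases lt_trichotomy t s with h | rfl | h
      · simp only [h.le, if_true]
        refine (hfd t (ho ht).1).congr_of_eventuallyEq ?_
        filter_upwards [Iio_mem_nhds h] with z hz
        exact if_pos (le_of_lt hz)
      · simp only [le_refl, if_true]
        -- The derivatives within the closed left and right half-lines coincide, and the union of
        -- the half-lines is the whole line.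
        have a := ((hfd t (ho ht).1).hasFDerivWithinAt (s := Iic t)).congr
          (f₁ := fun z => if z ≤ t then f z else g z) (fun z hz => if_pos hz) (if_pos le_rfl)
        have b := ((hgd t (ho ht).2).hasFDerivWithinAt (s := Ici t)).congr
          (f₁ := fun z => if z ≤ t then f z else g z) (fun z hz => ?_) (by simp [h0])
        · rw [← e] at b
          have := a.union b
          rwa [Iic_union_Ici, hasFDerivWithinAt_univ] at this
        · rcases eq_or_lt_of_le (show t ≤ z from hz) with rfl | hz
          · simp [h0]
          · exact if_neg (not_le.2 hz)
      · simp only [not_le.2 h, if_false]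
        refine (hgd t (ho ht).2).congr_of_eventuallyEq ?_
        filter_upwards [Ioi_mem_nhds h] with z hz
        exact if_neg (not_le.2 hz)
  · refine (hg h.le).congr_of_eventuallyEq ?_
    filter_upwards [Ioi_mem_nhds h] with t ht
    exact if_neg (not_le.2 ht)

/-- The function `f` on `[p, q]`, extended by constants. -/
noncomputable def clamp (p q : ℝ) (f : ℝ → ℝ) (s : ℝ) : ℝ :=
  if s ≤ p then f p else if s ≤ q then f s else f q

theorem clamp_of_le {p q : ℝ} {f : ℝ → ℝ} {s : ℝ} (h : s ≤ p) : clamp p q f s = f p := if_pos h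

theorem clamp_of_ge {p q : ℝ} (hpq : p ≤ q) {f : ℝ → ℝ} {s : ℝ} (h : q ≤ s) :
    clamp p q f s = f q := by
  unfold clamp
  split_ifs with h1 h2
  · rw [le_antisymm (hpq.trans h) h1, le_antisymm h (h1.trans hpq)]
  · rw [le_antisymm h2 h]
  · rfl

theorem clamp_of_mem {p q : ℝ} {f : ℝ → ℝ} {s : ℝ} (h : s ∈ Icc p q) : clamp p q f s = f s := by
  unfold clamp
  split_ifs with h1 h2
  · rw [le_antisymm h.1 h1]
  · rfl
  · exact absurd h.2 h2

/-- A constant continuation fits to first order because f is stationary at both ends. Second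
derivatives may jump, so C¹ is all that can be expected here. -/
theorem contDiff_clamp {p q : ℝ} (hpq : p < q) {f : ℝ → ℝ} (hf : ContDiff ℝ ∞ f)
    (hp : deriv f p = 0) (hq : deriv f q = 0) : ContDiff ℝ 1 (clamp p q f) := by
  have hf1 : ContDiff ℝ 1 f := hf.of_le (by norm_cast)
  have h2 : ∀ s, ContDiffAt ℝ 1 (fun t => if t ≤ q then f t else f q) s := fun s =>
    contDiffAt_one_ite_le (fun _ => hf1.contDiffAt) (fun _ => contDiffAt_const) rfl (by simp [hq])
  refine contDiff_iff_contDiffAt.2 fun s => ?_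
  refine contDiffAt_one_ite_le (f := fun _ => f p) (fun _ => contDiffAt_const) (fun _ => h2 s)
    (by simp [hpq.le]) ?_
  have : (fun t => if t ≤ q then f t else f q) =ᶠ[𝓝 p] f := by
    filter_upwards [Iio_mem_nhds hpq] with t ht
    exact if_pos (le_of_lt ht)
  rw [this.deriv_eq, hp, deriv_const]

/-- Cubic Hermite interpolation, exponentiated: a positive smooth function with prescribed values
and derivatives at two points. -/
theorem exists_pos_smooth_jets {p q A A' B B' : ℝ} (hpq : p < q) (hA : 0 < A) (hB : 0 < B) :
    ∃ f : ℝ → ℝ, ContDiff ℝ ∞ f ∧ (∀ s, 0 < f s) ∧ f p = A ∧ deriv f p = A' ∧ f q = B ∧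
      deriv f q = B' := by
  have hL : q - p ≠ 0 := (sub_pos.2 hpq).ne'
  -- The interpolation is done for log f, so that positivity is free. The number k gives the value
  -- log B at q; the term with m vanishes at q and m corrects the slope there to B' / B.
  obtain ⟨k, hk⟩ : ∃ k, Real.log A + A' / A * (q - p) + k * (q - p) ^ 2 = Real.log B :=
    ⟨(Real.log B - Real.log A - A' / A * (q - p)) / (q - p) ^ 2, by field_simp; ring⟩
  obtain ⟨m, hm⟩ : ∃ m, A' / A + 2 * k * (q - p) + m * (q - p) ^ 2 = B' / B :=
    ⟨(B' / B - A' / A - 2 * k * (q - p)) / (q - p) ^ 2, by field_simp; ring⟩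
  let P : ℝ → ℝ := fun s =>
    Real.log A + A' / A * (s - p) + k * (s - p) ^ 2 + m * (s - p) ^ 2 * (s - q)
  have hP : ContDiff ℝ ∞ P := by fun_prop
  have hd : ∀ s, HasDerivAt P
      (A' / A + 2 * k * (s - p) + m * (2 * (s - p) * (s - q) + (s - p) ^ 2)) s := by
    intro s
    have h1 := (hasDerivAt_id s).sub_const p
    have h2 := (hasDerivAt_id s).sub_const q
    have := (((h1.const_mul (A' / A)).const_add (Real.log A)).add ((h1.pow 2).const_mul k)).add
      (((h1.pow 2).const_mul m).mul h2)
    refine (this.congr_of_eventuallyEq (Eventually.of_forall fun z => ?_)).congr_deriv ?_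
    · simp [P]
    · simp; ring
  have hde : ∀ s, deriv (fun z => Real.exp (P z)) s = Real.exp (P s) *
      (A' / A + 2 * k * (s - p) + m * (2 * (s - p) * (s - q) + (s - p) ^ 2)) :=
    fun s => (hd s).exp.deriv
  have hPp : P p = Real.log A := by simp [P]
  have hPq : P q = Real.log B := by simp only [P, sub_self, mul_zero, add_zero]; exact hk
  refine ⟨fun s => Real.exp (P s), Real.contDiff_exp.comp hP, fun s => Real.exp_pos _, ?_, ?_, ?_, ?_⟩
  · simp only [hPp, Real.exp_log hA]
  · rw [hde, hPp, Real.exp_log hA]; field_simp; simp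
  · simp only [hPq, Real.exp_log hB]
  · rw [hde, hPq, Real.exp_log hB]
    have : A' / A + 2 * k * (q - p) + m * (2 * (q - p) * (q - q) + (q - p) ^ 2) = B' / B := by
      rw [← hm]; ring
    rw [this]; field_simp

/-- A smooth non-decreasing function that vanishes to second order at `p` and has a prescribed jet
at `q`. -/
theorem exists_monotoneOn_smooth_jets {p q B B' : ℝ} (hpq : p < q) (hB : 0 < B) (hB' : 0 ≤ B') :
    ∃ f : ℝ → ℝ, ContDiff ℝ ∞ f ∧ MonotoneOn f (Icc p q) ∧ f p = 0 ∧ deriv f p = 0 ∧ f q = B ∧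
      deriv f q = B' := by
  have hL : 0 < q - p := sub_pos.2 hpq
  set L := q - p with hLdef
  -- For f = B T² exp (k (T - 1)) the slope at T = 1 is B (2 + k) / L, which has to be B'. The sign
  -- of B' gives k ≥ -2, hence 2 + k T ≥ 0 on [0, 1] and f is non-decreasing.
  set k : ℝ := L * B' / B - 2 with hk
  have hk2 : 0 ≤ k + 2 := by rw [hk]; simp only [sub_add_cancel]; positivity
  let T : ℝ → ℝ := fun s => (s - p) / L
  let f : ℝ → ℝ := fun s => B * (T s ^ 2 * Real.exp (k * (T s - 1)))
  have hf : ContDiff ℝ ∞ f := by fun_prop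
  have hd : ∀ s, HasDerivAt f (B / L * (T s * (2 + k * T s)) * Real.exp (k * (T s - 1))) s := by
    intro s
    have h1 : HasDerivAt T (1 / L) s := ((hasDerivAt_id s).sub_const p).div_const L
    have h2 := ((h1.pow 2).mul ((h1.sub_const 1).const_mul k).exp).const_mul B
    refine h2.congr_deriv ?_
    simp; ring
  have hTp : T p = 0 := by simp [T]
  have hTq : T q = 1 := div_self hL.ne'
  refine ⟨f, hf, ?_, by simp [f, hTp], by rw [(hd p).deriv, hTp]; simp, by simp [f, hTq], ?_⟩
  · refine monotoneOn_of_deriv_nonneg (convex_Icc p q) hf.continuous.continuousOn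
      (fun s _ => (hd s).differentiableAt.differentiableWithinAt) fun s hs => ?_
    rw [interior_Icc] at hs
    have h0 : 0 ≤ T s := div_nonneg (sub_nonneg.2 hs.1.le) hL.le
    have h1 : T s ≤ 1 := (div_le_one hL).2 (by linarith [hs.2])
    rw [(hd s).deriv]
    have : 0 ≤ 2 + k * T s := by nlinarith
    positivity
  · rw [(hd q).deriv, hTq]
    simp [hk]
    field_simp

end OneVariable

/-! ### Existence of the profiles and of the schedule -/

theorem exists_projectiveProfile {Λ τ₀ χ₁ R : ℝ} (hΛ : 0 < Λ) (h0 : 0 < τ₀) (h1 : τ₀ < χ₁)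
    (h2 : χ₁ < Real.pi / (2 * kappa Λ)) (hR : 0 < R) : ∃ a b, ProjectiveProfile Λ τ₀ χ₁ R a b := by
  have hκ : 0 < kappa Λ := Real.sqrt_pos.2 (by positivity)
  have hx : kappa Λ * χ₁ < Real.pi / 2 := by
    rw [lt_div_iff₀ (by positivity)] at h2; linarith
  have hx0 : 0 < kappa Λ * χ₁ := mul_pos hκ (h0.trans h1)
  have hs : 0 < Real.sin (kappa Λ * χ₁) := Real.sin_pos_of_pos_of_lt_pi hx0 (by linarith)
  have hc : 0 < Real.cos (kappa Λ * χ₁) := Real.cos_pos_of_mem_Ioo ⟨by linarith, hx⟩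
  obtain ⟨a, ha, hap, ha1, ha2, ha3, ha4⟩ := exists_pos_smooth_jets (A := R / 2) (A' := 0)
    (B := Real.sin (kappa Λ * χ₁) / (2 * kappa Λ)) (B' := Real.cos (kappa Λ * χ₁) / 2) h1
    (by positivity) (by positivity)
  obtain ⟨b, hb, hbm, hb1, hb2, hb3, hb4⟩ := exists_monotoneOn_smooth_jets
    (B := Real.sin (kappa Λ * χ₁)) (B' := kappa Λ * Real.cos (kappa Λ * χ₁)) h1 hs (by positivity)
  exact ⟨a, b, ha, fun τ _ => hap τ, ⟨by rw [ha1]; ring, ha2⟩, ⟨ha3, ha4⟩, hb, hbm, ⟨hb1, hb2⟩,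
    ⟨hb3, hb4⟩⟩

theorem exists_morseProfile {σ₀ ξ₁ R : ℝ} (h0 : 0 < σ₀) (h1 : σ₀ < ξ₁) (hR : 0 < R) :
    ∃ α β, MorseProfile σ₀ ξ₁ R α β := by
  obtain ⟨a, ha, hap, ha1, ha2, ha3, ha4⟩ := exists_pos_smooth_jets (A := R) (A' := 0)
    (B := ξ₁) (B' := 1) h1 hR (h0.trans h1)
  obtain ⟨b, hb, hbm, hb1, hb2, hb3, hb4⟩ := exists_monotoneOn_smooth_jets
    (B := ξ₁) (B' := 1) h1 (h0.trans h1) zero_le_one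
  exact ⟨a, b, ha, fun τ _ => hap τ, ⟨ha1, ha2⟩, ⟨ha3, ha4⟩, hb, hbm, ⟨hb1, hb2⟩, ⟨hb3, hb4⟩⟩

/-- A smooth step between two values, stationary at the ends. -/
theorem exists_smooth_step {p q : ℝ} (hpq : p < q) : ∃ f : ℝ → ℝ, ContDiff ℝ ∞ f ∧ Monotone f ∧
    (∀ s, f s ∈ Icc (0 : ℝ) 1) ∧ f p = 0 ∧ deriv f p = 0 ∧ f q = 1 ∧ deriv f q = 0 := by
  have hL : 0 < q - p := sub_pos.2 hpq
  let f : ℝ → ℝ := fun s => Real.smoothTransition ((s - p) / (q - p))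
  have hf : ContDiff ℝ ∞ f := Real.smoothTransition.contDiff.comp (by fun_prop)
  have hp : f p = 0 := by simp [f]
  have hq : f q = 1 := by simp [f, div_self hL.ne']
  refine ⟨f, hf, fun x y h => Real.smoothTransition.monotone (by gcongr), fun s =>
    ⟨Real.smoothTransition.nonneg _, Real.smoothTransition.le_one _⟩, hp, ?_, hq, ?_⟩
  -- The values 0 and 1 are extrema of the transition function, so its derivative vanishes where
  -- they are attained.
  · refine IsLocalMin.deriv_eq_zero (Eventually.of_forall fun s => ?_)
    rw [hp]; exact Real.smoothTransition.nonneg _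
  · refine IsLocalMax.deriv_eq_zero (Eventually.of_forall fun s => ?_)
    rw [hq]; exact Real.smoothTransition.le_one _

/-- The rotation by the angle `θ` in the plane spanned by `e₁ - e₃` and `e₂ - e₄`. -/
noncomputable def planeRotation (θ : ℝ) : Matrix (Fin 4) (Fin 4) ℝ :=
  !![(1 + Real.cos θ) / 2, -Real.sin θ / 2, (1 - Real.cos θ) / 2, Real.sin θ / 2;
     Real.sin θ / 2, (1 + Real.cos θ) / 2, -Real.sin θ / 2, (1 - Real.cos θ) / 2;
     (1 - Real.cos θ) / 2, Real.sin θ / 2, (1 + Real.cos θ) / 2, -Real.sin θ / 2;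
     -Real.sin θ / 2, (1 - Real.cos θ) / 2, Real.sin θ / 2, (1 + Real.cos θ) / 2]

theorem planeRotation_mem (θ : ℝ) :
    planeRotation θ ∈ Matrix.specialOrthogonalGroup (Fin 4) ℝ := by
  have h := Real.sin_sq_add_cos_sq θ
  rw [Matrix.mem_specialOrthogonalGroup_iff, Matrix.mem_orthogonalGroup_iff]
  set c := Real.cos θ with hc
  set s := Real.sin θ with hs
  have hs2 : s ^ 2 = 1 - c ^ 2 := by linarith
  constructor
  · ext i j
    fin_cases i <;> fin_cases j <;>
      simp [planeRotation, Matrix.mul_apply, Fin.sum_univ_four, ← hc, ← hs] <;> linarith [hs2]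
  · rw [Matrix.det_succ_row_zero]
    simp [Fin.sum_univ_four, Matrix.det_fin_three, planeRotation, ← hc, ← hs, Fin.succAbove]
    linear_combination h

theorem planeRotation_smooth (i j : Fin 4) : ContDiff ℝ ∞ fun θ => planeRotation θ i j := by
  fin_cases i <;> fin_cases j <;> simp [planeRotation] <;> fun_prop

theorem exists_neckSchedule {n₀ n₁ : ℝ} (h : n₀ < n₁) :
    ∃ e b c d P, n₀ < e 0 ∧ e 4 < n₁ ∧ NeckSchedule e b c d P := by
  -- The five times divide the neck into six intervals of length δ: four stages and a collar at each
  -- end.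
  obtain ⟨δ, hδ⟩ : ∃ δ, δ = (n₁ - n₀) / 6 := ⟨_, rfl⟩
  have hδ0 : 0 < δ := by rw [hδ]; linarith
  let e : Fin 5 → ℝ := fun i => n₀ + ((i : ℕ) + 1) * δ
  have he : StrictMono e := by
    intro i j hij
    have : ((i : ℕ) : ℝ) < (j : ℕ) := by exact_mod_cast hij
    simp only [e]
    nlinarith
  obtain ⟨b, hb, hbm, -, hb1, hb2, hb3, hb4⟩ := exists_smooth_step (he (show (0 : Fin 5) < 1 by decide))
  obtain ⟨c, hc, -, hci, hc1, hc2, hc3, hc4⟩ := exists_smooth_step (he (show (1 : Fin 5) < 2 by decide))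
  obtain ⟨d, hd, hdm, -, hd1, hd2, hd3, hd4⟩ := exists_smooth_step (he (show (2 : Fin 5) < 3 by decide))
  obtain ⟨t, ht, -, -, ht1, ht2, ht3, ht4⟩ := exists_smooth_step (he (show (3 : Fin 5) < 4 by decide))
  have hP : ∀ i j, deriv t j = 0 → ∀ k, deriv (fun s => planeRotation (Real.pi * t s) i k) j = 0 := by
    intro i j hj k
    have h1 : HasDerivAt (fun s => Real.pi * t s) (Real.pi * 0) j := by
      have := (ht.differentiable (by norm_num)).differentiableAt (x := j).hasDerivAt
      rw [hj] at this
      exact this.const_mul _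
    have h2 := ((planeRotation_smooth i k).differentiable (by norm_num)).differentiableAt
      (x := Real.pi * t j) |>.hasDerivAt
    have := (h2.comp j h1).deriv
    simpa [Function.comp_def] using this
  -- The second cut-off has to descend from 1 to 0, hence 1 - c. The rotation angle runs from 0 to
  -- π, where `planeRotation` is the exchange of the two coordinate pairs.
  refine ⟨e, b, fun s => 1 - c s, d, fun s => planeRotation (Real.pi * t s), ?_, ?_, he, hb,
    hbm.monotoneOn _, ⟨hb1, hb2⟩, ⟨hb3, hb4⟩, contDiff_const.sub hc, fun s _ => ?_, ?_, ?_, hd,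
    hdm.monotoneOn _, ⟨hd1, hd2⟩, ⟨hd3, hd4⟩, fun i j =>
    (planeRotation_smooth i j).comp (contDiff_const.mul ht), fun s _ => planeRotation_mem _,
    ⟨?_, fun i j => hP _ _ ht2 _⟩, ?_, fun i j => hP _ _ ht4 _⟩
  · simp [e, hδ0]
  · simp [e]; linarith
  · exact ⟨by linarith [(hci s).2], by linarith [(hci s).1]⟩
  · exact ⟨by simp [hc1], by rw [deriv_const_sub, hc2, neg_zero]⟩
  · exact ⟨by simp [hc3], by rw [deriv_const_sub, hc4, neg_zero]⟩
  · ext i j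
    fin_cases i <;> fin_cases j <;> simp [planeRotation, ht1]
  · ext i j
    fin_cases i <;> fin_cases j <;> simp [planeRotation, ht3, swapRotation]

/-! ### The fields on `ℝ⁴ ∖ 0` -/

section Fields

theorem inner_eq (x y : E4) : ⟪x, y⟫ = x 0 * y 0 + x 1 * y 1 + x 2 * y 2 + x 3 * y 3 := by
  rw [PiLp.inner_apply, Fin.sum_univ_four]
  simp [mul_comm]

theorem norm_sq_eq (x : E4) : ‖x‖ ^ 2 = x 0 ^ 2 + x 1 ^ 2 + x 2 ^ 2 + x 3 ^ 2 := by
  rw [← real_inner_self_eq_norm_sq, inner_eq]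
  ring

theorem E4.eq_zero_iff (x : E4) : x = 0 ↔ x 0 = 0 ∧ x 1 = 0 ∧ x 2 = 0 ∧ x 3 = 0 := by
  constructor
  · rintro rfl
    simp
  · rintro ⟨h0, h1, h2, h3⟩
    ext i
    fin_cases i <;> simp [*]

theorem reflectedField_eq {x : E4} (hx : x ≠ 0) :
    reflectedField x = reflectedField₁ x + reflectedField₂ x := by
  have h : ‖x‖ ^ 2 ≠ 0 := by positivity
  have h' := norm_sq_eq x
  unfold reflectedField radialScale reflectedField₁ reflectedField₂ affineField
  rw [inner_eq]
  ext i
  fin_cases i <;> simp <;> field_simp <;> rw [h'] <;> ring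

/-- The second summand is a multiple of x, so a zero is an equation w_{1,r} = q x. In the notation
z₁ = x₀ + i x₁, z₂ = x₂ + i x₃ its last two components read -z̄₁ z₂ = q z₂. The argument needs no
bound on c. -/
theorem reflectedField_stage_ne_zero (c : ℝ) {x : E4} (hx : x ≠ 0) :
    reflectedField₁ x + c • reflectedField₂ x ≠ 0 := by
  intro h
  have hn : 0 < ‖x‖ ^ 2 := by positivity
  have hn' := norm_sq_eq x
  rw [E4.eq_zero_iff] at h
  obtain ⟨q, hq⟩ : ∃ q, q = c * (2 * (x 3 * x 1 + x 0 * x 2) / ‖x‖ ^ 2) := ⟨_, rfl⟩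
  have e : ∀ i, (c • reflectedField₂ x) i = -q * x i := fun i => by
    simp [reflectedField₂, hq]; ring
  simp only [PiLp.add_apply, e] at h
  simp [reflectedField₁] at h
  obtain ⟨h0, h1, h2, h3⟩ := h
  have hq0 : q * ‖x‖ ^ 2 = 2 * c * (x 3 * x 1 + x 0 * x 2) := by
    rw [hq]; field_simp
  -- This is |z̄₁ + q|² |z₂|² = 0. If the first factor vanishes, z₁ is real and equal to -q, and the
  -- first two components then give z₂ = 0 as well; so q = 0 and finally z₁ = 0.
  have hprod : ((x 0 + q) ^ 2 + x 1 ^ 2) * (x 2 ^ 2 + x 3 ^ 2) = 0 := by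
    linear_combination (-(x 0 + q) * x 2 - x 1 * x 3) * h2 + (-(x 0 + q) * x 3 + x 1 * x 2) * h3
  have hz : x 2 = 0 ∧ x 3 = 0 := by
    rcases mul_eq_zero.1 hprod with h | h
    · have e1 : x 1 = 0 := by nlinarith [sq_nonneg (x 0 + q), sq_nonneg (x 1)]
      have e0 : x 0 + q = 0 := by nlinarith [sq_nonneg (x 0 + q), sq_nonneg (x 1)]
      rw [e1] at h0 h1
      have e3 : x 3 = 0 := by linarith
      exact ⟨by linear_combination h0 + x 0 * e0, e3⟩
    · constructor <;> nlinarith [sq_nonneg (x 2), sq_nonneg (x 3)]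
  rw [hz.1, hz.2] at hq0
  have : q = 0 := by
    rcases mul_eq_zero.1 (show q * ‖x‖ ^ 2 = 0 by rw [hq0]; ring) with h | h
    · exact h
    · exact absurd h hn.ne'
  rw [this, hz.1] at h0
  rw [hz.1, hz.2] at hn'
  nlinarith

/-- At a zero x₃ = 0 and x₂ = x₀² + x₁² ≥ 0. The factor c (x₂ - 1) + 1 = (1 - c) + c x₂ is then a
sum of non-negative terms; if it vanishes, c = 1 and x₂ = 0, and if not, x₀ = x₁ = 0. This is where
c ∈ [0, 1] matters. -/
theorem middleField_ne_zero {c : ℝ} (hc : c ∈ Icc (0 : ℝ) 1) {x : E4} (hx : x ≠ 0) :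
    middleField c x ≠ 0 := by
  intro h
  rw [Ne, E4.eq_zero_iff] at hx
  rw [E4.eq_zero_iff] at h
  simp [middleField] at h
  obtain ⟨h0, h1, h2, h3⟩ := h
  simp only [h1, zero_mul, neg_zero, zero_sub, zero_add, neg_eq_zero] at h2 h3
  apply hx
  rcases mul_eq_zero.1 h2 with hk | hx0
  · have hz : 0 ≤ x 2 := by nlinarith
    have h1c : 1 - c = 0 := by nlinarith [hc.1, hc.2, mul_nonneg hc.1 hz]
    have hc1 : c = 1 := by linarith
    rw [hc1] at hk
    have hz0 : x 2 = 0 := by linarith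
    rw [hz0] at h0
    exact ⟨by nlinarith, by nlinarith, hz0, h1⟩
  · rcases mul_eq_zero.1 h3 with hk | hx1
    · have hz : 0 ≤ x 2 := by nlinarith
      have h1c : 1 - c = 0 := by nlinarith [hc.1, hc.2, mul_nonneg hc.1 hz]
      have hc1 : c = 1 := by linarith
      rw [hc1] at hk
      have hz0 : x 2 = 0 := by linarith
      rw [hz0] at h0
      exact ⟨by nlinarith, by nlinarith, hz0, h1⟩
    · exact ⟨hx0, hx1, by rw [hx0, hx1] at h0; linarith, h1⟩

/-- The segment only scales the quadratic terms. The second component gives x₃ = 0, which removes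
them from the last two components; these give x₀ = x₁ = 0, and the first one x₂ = 0. -/
theorem linearField_stage_ne_zero (c : ℝ) {x : E4} (hx : x ≠ 0) :
    linearField x + c • (middleField 0 x - linearField x) ≠ 0 := by
  intro h
  rw [Ne, E4.eq_zero_iff] at hx
  rw [E4.eq_zero_iff] at h
  simp [middleField, linearField] at h
  obtain ⟨h0, h1, h2, h3⟩ := h
  simp only [h1, zero_mul, neg_zero, mul_zero, add_zero, neg_eq_zero] at h2 h3
  exact hx ⟨by linarith, by linarith, by rw [show x 0 = 0 by linarith, show x 1 = 0 by linarith] at h0; linarith, h1⟩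

theorem linearField_eq_zero_iff (x : E4) : linearField x = 0 ↔ x = 0 := by
  rw [E4.eq_zero_iff, E4.eq_zero_iff]
  simp [linearField]
  tauto

theorem morseField_eq_zero_iff (x : E4) : morseField x = 0 ↔ x = 0 := by
  rw [E4.eq_zero_iff, E4.eq_zero_iff]
  simp [morseField]

theorem middleField_one (x : E4) : middleField 1 x = reflectedField₁ x := by
  ext i
  fin_cases i <;> simp [middleField, reflectedField₁] <;> ring

theorem toEuclideanLin_ne_zero {P : Matrix (Fin 4) (Fin 4) ℝ}
    (hP : P ∈ Matrix.specialOrthogonalGroup (Fin 4) ℝ) {x : E4} (hx : x ≠ 0) :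
    Matrix.toEuclideanLin P x ≠ 0 := by
  rw [Matrix.mem_specialOrthogonalGroup_iff, Matrix.mem_orthogonalGroup_iff'] at hP
  intro h
  apply hx
  have : Matrix.toEuclideanLin (star P) (Matrix.toEuclideanLin P x) = x := by
    rw [Matrix.toLpLin_apply, Matrix.toLpLin_apply]
    rw [Matrix.mulVec_mulVec, show star P * P = 1 from hP.1, Matrix.one_mulVec]
  rw [← this, h, map_zero]

theorem toEuclideanLin_swapRotation (x : E4) :
    Matrix.toEuclideanLin swapRotation (linearField x) = morseField x := by
  ext i
  fin_cases i <;>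
    simp [swapRotation, linearField, morseField]

/-- The four stages of the deformation, added up. -/
noncomputable def deformation (β γ δ : ℝ) (Q : Matrix (Fin 4) (Fin 4) ℝ) (x : E4) : E4 :=
  reflectedField₁ x + (1 - β) • reflectedField₂ x + (middleField γ x - middleField 1 x) +
    (linearField x + (1 - δ) • (middleField 0 x - linearField x) - middleField 0 x) +
    (Matrix.toEuclideanLin Q (linearField x) - linearField x)

/-- The clamped schedule, substituted into `deformation`. -/
noncomputable def clampedDeformation (e : Fin 5 → ℝ) (b c d : ℝ → ℝ)
    (P : ℝ → Matrix (Fin 4) (Fin 4) ℝ) (s : ℝ) (x : E4) : E4 :=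
  deformation (clamp (e 0) (e 1) b s) (clamp (e 1) (e 2) c s) (clamp (e 2) (e 3) d s)
    (Matrix.of fun i j => clamp (e 3) (e 4) (fun s => P s i j) s) x

end Fields

/-! ### The clamped schedule and the four stages -/

section Schedule

variable {e : Fin 5 → ℝ} {b c d : ℝ → ℝ} {P : ℝ → Matrix (Fin 4) (Fin 4) ℝ}

theorem NeckSchedule.lt (h : NeckSchedule e b c d P) :
    e 0 < e 1 ∧ e 1 < e 2 ∧ e 2 < e 3 ∧ e 3 < e 4 :=
  ⟨h.strictMono (by decide), h.strictMono (by decide), h.strictMono (by decide),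
    h.strictMono (by decide)⟩

/-- During one stage the parameters of the other stages sit at their end values, so the sum in
`deformation` telescopes to the active term. The gain is a single formula with C¹ parameters, with
no case distinction at the times e₁, e₂, e₃. -/
theorem NeckSchedule.clampedDeformation_eq (h : NeckSchedule e b c d P) {s : ℝ}
    (hs : s ∈ Icc (e 0) (e 4)) (x : E4) :
    clampedDeformation e b c d P s x = neckField e b c d P s x := by
  obtain ⟨h01, h12, h23, h34⟩ := h.lt
  have hQ1 : s ≤ e 3 → (Matrix.of fun i j => clamp (e 3) (e 4) (fun s => P s i j) s) = 1 := by
    intro hs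
    ext i j
    rw [Matrix.of_apply, clamp_of_le hs, h.P_left.1]
  have hlin : Matrix.toEuclideanLin (1 : Matrix (Fin 4) (Fin 4) ℝ) (linearField x) = linearField x := by
    rw [Matrix.toLpLin_apply]; simp
  unfold clampedDeformation neckField deformation
  split_ifs with h1 h2 h3
  · rw [clamp_of_mem ⟨hs.1, h1⟩, clamp_of_le h1, clamp_of_le (by linarith), hQ1 (by linarith), hlin,
      h.c_left.1, h.d_left.1]
    simp
  · rw [clamp_of_ge h01.le (by linarith), clamp_of_mem ⟨by linarith, h2⟩, clamp_of_le h2,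
      hQ1 (by linarith), hlin, h.b_right.1, h.d_left.1, middleField_one]
    simp
  · rw [clamp_of_ge h01.le (by linarith), clamp_of_ge h12.le (by linarith),
      clamp_of_mem ⟨by linarith, h3⟩, hQ1 h3, hlin, h.b_right.1, h.c_right.1, middleField_one]
    simp
  · have : (Matrix.of fun i j => clamp (e 3) (e 4) (fun s => P s i j) s) = P s := by
      ext i j
      rw [Matrix.of_apply, clamp_of_mem ⟨by linarith, hs.2⟩]
    rw [clamp_of_ge h01.le (by linarith), clamp_of_ge h12.le (by linarith),
      clamp_of_ge h23.le (by linarith), this, h.b_right.1, h.c_right.1, h.d_right.1,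
      middleField_one]
    simp

theorem NeckSchedule.neckField_ne_zero (h : NeckSchedule e b c d P) {s : ℝ}
    (hs : s ∈ Icc (e 0) (e 4)) {x : E4} (hx : x ≠ 0) : neckField e b c d P s x ≠ 0 := by
  unfold neckField
  split_ifs with h1 h2 h3
  · exact reflectedField_stage_ne_zero _ hx
  · exact middleField_ne_zero (h.c_mem s ⟨(not_le.1 h1).le, h2⟩) hx
  · exact linearField_stage_ne_zero _ hx
  · exact toEuclideanLin_ne_zero (h.P_mem s ⟨(not_le.1 h3).le, hs.2⟩)
      (by rwa [Ne, linearField_eq_zero_iff])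

theorem NeckSchedule.neckField_left (h : NeckSchedule e b c d P) {x : E4} (hx : x ≠ 0) :
    neckField e b c d P (e 0) x = reflectedField x := by
  rw [neckField, if_pos h.lt.1.le, h.b_left.1, reflectedField_eq hx]
  simp

theorem NeckSchedule.neckField_right (h : NeckSchedule e b c d P) (x : E4) :
    neckField e b c d P (e 4) x = morseField x := by
  obtain ⟨h01, h12, h23, h34⟩ := h.lt
  rw [neckField, if_neg (by linarith), if_neg (by linarith), if_neg (by linarith), h.P_right.1,
    toEuclideanLin_swapRotation]

/-- Before the first time, and in the companion lemma after the last one, the clamped deformation no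
longer depends on s. The same formula therefore serves on the collars and on both annuli. -/
theorem NeckSchedule.clampedDeformation_left (h : NeckSchedule e b c d P) {s : ℝ} (hs : s ≤ e 0)
    {x : E4} (hx : x ≠ 0) : clampedDeformation e b c d P s x = reflectedField x := by
  obtain ⟨h01, h12, h23, h34⟩ := h.lt
  rw [← h.neckField_left hx, ← h.clampedDeformation_eq ⟨le_rfl, by linarith⟩]
  unfold clampedDeformation
  congr 1
  · rw [clamp_of_le hs, clamp_of_le le_rfl]
  · rw [clamp_of_le (by linarith), clamp_of_le (by linarith)]
  · rw [clamp_of_le (by linarith), clamp_of_le (by linarith)]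
  · ext i j
    rw [Matrix.of_apply, Matrix.of_apply, clamp_of_le (by linarith), clamp_of_le (by linarith)]

theorem NeckSchedule.clampedDeformation_right (h : NeckSchedule e b c d P) {s : ℝ} (hs : e 4 ≤ s)
    (x : E4) : clampedDeformation e b c d P s x = morseField x := by
  obtain ⟨h01, h12, h23, h34⟩ := h.lt
  rw [← h.neckField_right x, ← h.clampedDeformation_eq ⟨by linarith, le_rfl⟩]
  unfold clampedDeformation
  congr 1
  · rw [clamp_of_ge h01.le (by linarith), clamp_of_ge h01.le (by linarith)]
  · rw [clamp_of_ge h12.le (by linarith), clamp_of_ge h12.le (by linarith)]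
  · rw [clamp_of_ge h23.le (by linarith), clamp_of_ge h23.le (by linarith)]
  · ext i j
    rw [Matrix.of_apply, Matrix.of_apply, clamp_of_ge h34.le hs, clamp_of_ge h34.le le_rfl]

end Schedule

/-! ### Regularity of the fields -/

section Regularity

variable {E : Type*} [NormedAddCommGroup E] [NormedSpace ℝ E] {n : WithTop ℕ∞} {X : E → E4} {p : E}

theorem contDiffAt_coord (hX : ContDiffAt ℝ n X p) (i : Fin 4) : ContDiffAt ℝ n (fun q => X q i) p :=
  (contDiffAt_euclidean.1 hX) i

theorem contDiffAt_unitVec (hX : ContDiffAt ℝ n X p) (h : X p ≠ 0) :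
    ContDiffAt ℝ n (fun q => unitVec (X q)) p :=
  ((hX.norm ℝ h).inv (norm_ne_zero_iff.2 h)).smul hX

theorem contDiffAt_morseField (hX : ContDiffAt ℝ n X p) :
    ContDiffAt ℝ n (fun q => morseField (X q)) p := by
  have h := contDiffAt_coord hX
  refine contDiffAt_euclidean.2 fun i => ?_
  fin_cases i <;> simp [morseField] <;> fun_prop (disch := assumption)

theorem contDiffAt_affineField_zero (hX : ContDiffAt ℝ n X p) :
    ContDiffAt ℝ n (fun q => affineField 0 (X q)) p := by
  have h := contDiffAt_coord hX
  refine contDiffAt_euclidean.2 fun i => ?_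
  fin_cases i <;> simp [affineField] <;> fun_prop

theorem contDiffAt_reflectedField₁ (hX : ContDiffAt ℝ n X p) :
    ContDiffAt ℝ n (fun q => reflectedField₁ (X q)) p := by
  have h := contDiffAt_coord hX
  refine contDiffAt_euclidean.2 fun i => ?_
  fin_cases i <;> simp [reflectedField₁] <;> fun_prop

theorem contDiffAt_linearField (hX : ContDiffAt ℝ n X p) :
    ContDiffAt ℝ n (fun q => linearField (X q)) p := by
  have h := contDiffAt_coord hX
  refine contDiffAt_euclidean.2 fun i => ?_
  fin_cases i <;> simp [linearField] <;> fun_prop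

theorem contDiffAt_middleField {γ : E → ℝ} (hγ : ContDiffAt ℝ n γ p) (hX : ContDiffAt ℝ n X p) :
    ContDiffAt ℝ n (fun q => middleField (γ q) (X q)) p := by
  have h := contDiffAt_coord hX
  refine contDiffAt_euclidean.2 fun i => ?_
  fin_cases i <;> simp [middleField] <;> fun_prop

theorem contDiffAt_reflectedField₂ (hX : ContDiffAt ℝ n X p) (h0 : X p ≠ 0) :
    ContDiffAt ℝ n (fun q => reflectedField₂ (X q)) p := by
  have h := contDiffAt_coord hX
  have hn := hX.norm_sq ℝ
  refine ContDiffAt.smul (ContDiffAt.neg (ContDiffAt.div ?_ hn (by positivity))) hX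
  fun_prop

theorem contDiffAt_toEuclideanLin {Q : E → Matrix (Fin 4) (Fin 4) ℝ}
    (hQ : ∀ i j, ContDiffAt ℝ n (fun q => Q q i j) p) (hX : ContDiffAt ℝ n X p) :
    ContDiffAt ℝ n (fun q => Matrix.toEuclideanLin (Q q) (X q)) p := by
  refine contDiffAt_euclidean.2 fun i => ?_
  simp only [Matrix.toLpLin_apply, Matrix.mulVec, dotProduct]
  exact ContDiffAt.sum fun j _ => (hQ i j).mul (contDiffAt_coord hX j)

theorem contDiffAt_radialScale {k : E → ℝ} {F : E4 → E4} (hk : ContDiffAt ℝ n k p)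
    (hF : ContDiffAt ℝ n (fun q => F (X q)) p) (hX : ContDiffAt ℝ n X p) (h0 : X p ≠ 0) :
    ContDiffAt ℝ n (fun q => radialScale (k q) F (X q)) p :=
  hF.add (((((hk.sub contDiffAt_const).mul (hF.inner ℝ hX))).div (hX.norm_sq ℝ)
    (by positivity)).smul hX)

theorem contDiffAt_reflectedField (hX : ContDiffAt ℝ n X p) (h0 : X p ≠ 0) :
    ContDiffAt ℝ n (fun q => reflectedField (X q)) p :=
  contDiffAt_radialScale contDiffAt_const (contDiffAt_affineField_zero hX) hX h0

theorem contDiffAt_deformation {β γ δ : E → ℝ} {Q : E → Matrix (Fin 4) (Fin 4) ℝ}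
    (hβ : ContDiffAt ℝ n β p) (hγ : ContDiffAt ℝ n γ p) (hδ : ContDiffAt ℝ n δ p)
    (hQ : ∀ i j, ContDiffAt ℝ n (fun q => Q q i j) p) (hX : ContDiffAt ℝ n X p) (h0 : X p ≠ 0) :
    ContDiffAt ℝ n (fun q => deformation (β q) (γ q) (δ q) (Q q) (X q)) p := by
  have h1 := contDiffAt_reflectedField₁ hX
  have h2 := contDiffAt_reflectedField₂ hX h0
  have h3 := contDiffAt_middleField hγ hX
  have h4 := contDiffAt_middleField (contDiffAt_const (c := (1 : ℝ))) hX
  have h5 := contDiffAt_middleField (contDiffAt_const (c := (0 : ℝ))) hX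
  have h6 := contDiffAt_linearField hX
  have h7 := contDiffAt_toEuclideanLin hQ h6
  exact (((h1.add ((contDiffAt_const.sub hβ).smul h2)).add (h3.sub h4)).add
    ((h6.add ((contDiffAt_const.sub hδ).smul (h5.sub h6))).sub h5)).add (h7.sub h6)

theorem NeckSchedule.contDiffAt_clampedDeformation {e : Fin 5 → ℝ} {b c d : ℝ → ℝ}
    {P : ℝ → Matrix (Fin 4) (Fin 4) ℝ} (h : NeckSchedule e b c d P) {S : E → ℝ}
    (hS : ContDiffAt ℝ 1 S p) (hX : ContDiffAt ℝ 1 X p) (h0 : X p ≠ 0) :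
    ContDiffAt ℝ 1 (fun q => clampedDeformation e b c d P (S q) (X q)) p := by
  obtain ⟨h01, h12, h23, h34⟩ := h.lt
  refine contDiffAt_deformation ?_ ?_ ?_ (fun i j => ?_) hX h0
  · exact (contDiff_clamp h01 h.b_smooth h.b_left.2 h.b_right.2).contDiffAt.comp p hS
  · exact (contDiff_clamp h12 h.c_smooth h.c_left.2 h.c_right.2).contDiffAt.comp p hS
  · exact (contDiff_clamp h23 h.d_smooth h.d_left.2 h.d_right.2).contDiffAt.comp p hS
  · exact (contDiff_clamp h34 (h.P_smooth i j) (h.P_left.2 i j) (h.P_right.2 i j)).contDiffAt.comp p hS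

theorem NeckSchedule.contDiffOn_unitVec_neckField {e : Fin 5 → ℝ} {b c d : ℝ → ℝ}
    {P : ℝ → Matrix (Fin 4) (Fin 4) ℝ} (h : NeckSchedule e b c d P) :
    ContDiffOn ℝ 1 (fun q : ℝ × E4 => unitVec (neckField e b c d P q.1 q.2))
      (Icc (e 0) (e 4) ×ˢ {0}ᶜ) := by
  have key : ContDiffOn ℝ 1 (fun q : ℝ × E4 =>
      unitVec (clampedDeformation e b c d P q.1 q.2))
      (Icc (e 0) (e 4) ×ˢ {0}ᶜ) := by
    intro q hq
    refine (contDiffAt_unitVec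
      (h.contDiffAt_clampedDeformation contDiffAt_fst contDiffAt_snd hq.2) ?_).contDiffWithinAt
    rw [h.clampedDeformation_eq hq.1]
    exact h.neckField_ne_zero hq.1 hq.2
  refine key.congr fun q hq => ?_
  rw [h.clampedDeformation_eq hq.1]

end Regularity
/-! ### Degrees -/

section DegreeComputation

theorem norm_unitVec {x : E4} (hx : x ≠ 0) : ‖unitVec x‖ = 1 := by
  rw [unitVec, norm_smul, norm_inv, norm_norm, inv_mul_cancel₀ (norm_ne_zero_iff.2 hx)]

theorem unitVec_of_norm_one {x : E4} (hx : ‖x‖ = 1) : unitVec x = x := by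
  rw [unitVec, hx, inv_one, one_smul]

theorem unitVec_ne_zero {x : E4} (hx : x ≠ 0) : unitVec x ≠ 0 := by
  rw [← norm_ne_zero_iff, norm_unitVec hx]
  exact one_ne_zero

theorem norm_smul_unitVec (x : E4) : ‖x‖ • unitVec x = x := by
  rcases eq_or_ne x 0 with rfl | hx
  · simp
  · rw [unitVec, smul_smul, mul_inv_cancel₀ (norm_ne_zero_iff.2 hx), one_smul]

theorem unitVec_smul {c : ℝ} (hc : 0 < c) (x : E4) : unitVec (c • x) = unitVec x := by
  rw [unitVec, unitVec, norm_smul, Real.norm_of_nonneg hc.le, smul_smul, mul_inv]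
  congr 1
  field_simp

/-- The derivative of `unitVec`. -/
noncomputable def unitVecDeriv (x : E4) : E4 →L[ℝ] E4 :=
  ‖x‖⁻¹ • (ContinuousLinearMap.id ℝ E4 - ((‖x‖ ^ 2)⁻¹ • innerSL ℝ x).smulRight x)

theorem unitVecDeriv_apply (x v : E4) :
    unitVecDeriv x v = ‖x‖⁻¹ • (v - (⟪x, v⟫ / ‖x‖ ^ 2) • x) := by
  simp [unitVecDeriv, div_eq_inv_mul]

theorem hasFDerivAt_norm {x : E4} (hx : x ≠ 0) :
    HasFDerivAt (fun z : E4 => ‖z‖) (‖x‖⁻¹ • innerSL ℝ x) x := by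
  have h1 := (hasStrictFDerivAt_norm_sq x).hasFDerivAt
  have hn : ‖x‖ ^ 2 ≠ 0 := by positivity
  have h2 := h1.sqrt hn
  refine (h2.congr_of_eventuallyEq (Eventually.of_forall fun z => ?_)).congr_fderiv ?_
  · simp [Real.sqrt_sq]
  · ext v
    simp [Real.sqrt_sq]
    ring

theorem hasFDerivAt_unitVec {x : E4} (hx : x ≠ 0) : HasFDerivAt unitVec (unitVecDeriv x) x := by
  have hn : ‖x‖ ≠ 0 := norm_ne_zero_iff.2 hx
  have h := ((hasDerivAt_inv hn).comp_hasFDerivAt x (hasFDerivAt_norm hx)).smul (hasFDerivAt_id x)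
  refine h.congr_fderiv ?_
  ext1 v
  rw [unitVecDeriv_apply]
  simp
  module

/-- At a unit vector u the derivative of `unitVec` is the orthogonal projection along u, which
explains the argument v - ⟪u, v⟫ u; the rest is the chain rule. -/
theorem fderiv_rayExtension {F : E4 → E4} {L : E4 →L[ℝ] E4} {R : ℝ} {u : E4} (hu : ‖u‖ = 1)
    (hF : HasFDerivAt F L (R • u)) (h0 : F (R • u) ≠ 0) (v : E4) :
    fderiv ℝ (rayExtension fun u => unitVec (F (R • u))) u v =
      unitVecDeriv (F (R • u)) (R • L (v - ⟪u, v⟫ • u)) := by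
  have hu0 : u ≠ 0 := by
    rintro rfl
    simp at hu
  have e : unitVec u = u := unitVec_of_norm_one hu
  have h1 : HasFDerivAt (fun x => R • unitVec x) (R • unitVecDeriv u) u :=
    (hasFDerivAt_unitVec hu0).const_smul R
  have h2 : HasFDerivAt F L (R • unitVec u) := by rwa [e]
  have h3 : HasFDerivAt unitVec (unitVecDeriv (F (R • u))) (F (R • unitVec u)) := by
    rw [e]; exact hasFDerivAt_unitVec h0
  have h4 : HasFDerivAt (rayExtension fun u => unitVec (F (R • u))) _ u := h3.comp u (h2.comp u h1)
  rw [h4.fderiv]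
  simp [unitVecDeriv_apply, hu]

theorem det_eq_of_apply {L : E4 →L[ℝ] E4} {A : Matrix (Fin 4) (Fin 4) ℝ}
    (h : ∀ v, L v = Matrix.toEuclideanLin A v) : L.det = A.det := by
  have : (L : E4 →ₗ[ℝ] E4) = Matrix.toLin (PiLp.basisFun 2 ℝ (Fin 4)) (PiLp.basisFun 2 ℝ (Fin 4)) A := by
    rw [← Matrix.toLpLin_eq_toLin 2 2]
    exact LinearMap.ext h
  rw [ContinuousLinearMap.det, this, LinearMap.det_toLin]

/-- A self-map of the sphere that takes a regular value exactly once, with negative Jacobian, has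
degree `-1`. -/
theorem hasSphereDegree_neg_one {F : E4 → E4} {L : E4 →L[ℝ] E4} {R : ℝ} (hR : 0 < R) {u y : E4}
    (hu : ‖u‖ = 1) (hsm : ∀ x : E4, x ≠ 0 → ContDiffAt ℝ ∞ F x) (h0 : ∀ x : E4, x ≠ 0 → F x ≠ 0)
    (huy : unitVec (F (R • u)) = y) (hone : ∀ w : E4, ‖w‖ = 1 → unitVec (F (R • w)) = y → w = u)
    (hF : HasFDerivAt F L (R • u)) {A : Matrix (Fin 4) (Fin 4) ℝ} (hA : A.det < 0)
    (hLA : ∀ v, unitVecDeriv (F (R • u)) (R • L (v - ⟪u, v⟫ • u)) + ⟪u, v⟫ • y =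
      Matrix.toEuclideanLin A v) :
    HasSphereDegree (fun u => unitVec (F (R • u))) (-1) := by
  have hne : ∀ w : E4, ‖w‖ = 1 → R • w ≠ 0 := by
    intro w hw
    refine smul_ne_zero hR.ne' ?_
    rintro rfl
    simp at hw
  have hset : {w : E4 | ‖w‖ = 1 ∧ unitVec (F (R • w)) = y} = {u} := by
    ext w
    exact ⟨fun h => hone w h.1 h.2, by rintro rfl; exact ⟨hu, huy⟩⟩
  have hJ : sphereJacobian (fun u => unitVec (F (R • u))) u = A.det := by
    refine det_eq_of_apply fun v => ?_
    rw [← hLA]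
    simp only [add_apply, ContinuousLinearMap.smulRight_apply,
      fderiv_rayExtension hu hF (h0 _ (hne u hu)), innerSL_apply_apply, huy]
  refine ⟨?_, fun w hw => norm_unitVec (h0 _ (hne w hw)), y, ?_, ?_, ?_, ?_⟩
  · intro x hx
    have hx : x ≠ 0 := hx
    have hRx : R • unitVec x ≠ 0 := hne _ (norm_unitVec hx)
    have h1 : ContDiffAt ℝ ∞ (fun z => R • unitVec z) x :=
      (contDiffAt_unitVec contDiffAt_id hx).const_smul R
    exact (contDiffAt_unitVec ((hsm _ hRx).comp x h1) (h0 _ hRx)).contDiffWithinAt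
  · rw [← huy]; exact norm_unitVec (h0 _ (hne u hu))
  · intro w hw hwy
    rw [hone w hw hwy, hJ]
    exact hA.ne
  · rw [hset]; exact finite_singleton u
  · rw [hset, finsum_mem_singleton, hJ, sign_neg hA]
    rfl

theorem hasFDerivAt_coord (x : E4) (i : Fin 4) :
    HasFDerivAt (fun p : E4 => p i) (EuclideanSpace.proj i : E4 →L[ℝ] ℝ) x :=
  (EuclideanSpace.proj i : E4 →L[ℝ] ℝ).hasFDerivAt

/-- The derivative of the Morse field. -/
noncomputable def morseFieldCLM : E4 →L[ℝ] E4 :=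
  LinearMap.toContinuousLinearMap (Matrix.toEuclideanLin (Matrix.diagonal ![-1, 1, 1, 1]))

theorem morseFieldCLM_apply (x : E4) : morseFieldCLM x = morseField x := by
  ext i
  fin_cases i <;> simp [morseFieldCLM, morseField, Matrix.toLpLin_apply, Matrix.mulVec_diagonal]

theorem hasFDerivAt_morseField (x : E4) : HasFDerivAt morseField morseFieldCLM x := by
  have : morseField = morseFieldCLM := funext fun x => (morseFieldCLM_apply x).symm
  rw [this]
  exact morseFieldCLM.hasFDerivAt

theorem morseField_smul (c : ℝ) (x : E4) : morseField (c • x) = c • morseField x := by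
  rw [← morseFieldCLM_apply, map_smul, morseFieldCLM_apply]

theorem norm_morseField (x : E4) : ‖morseField x‖ = ‖x‖ := by
  have : ‖morseField x‖ ^ 2 = ‖x‖ ^ 2 := by
    rw [norm_sq_eq, norm_sq_eq]
    simp [morseField]
  rwa [sq_eq_sq₀ (norm_nonneg _) (norm_nonneg _)] at this

theorem hasSphereDegree_morseField {R : ℝ} (hR : 0 < R) :
    HasSphereDegree (fun u => unitVec (morseField (R • u))) (-1) := by
  have hval : ∀ w : E4, ‖w‖ = 1 → unitVec (morseField (R • w)) = morseField w := by
    intro w hw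
    rw [morseField_smul, unitVec_smul hR, unitVec_of_norm_one (by rw [norm_morseField, hw])]
  have hu : ‖(!₂[0, 1, 0, 0] : E4)‖ = 1 := by
    rw [← sq_eq_sq₀ (norm_nonneg _) zero_le_one, norm_sq_eq]
    simp
  -- On the sphere the Morse field is a reflection. The second basis vector is fixed by it, and the
  -- completed Jacobian there is the reflection itself.
  refine hasSphereDegree_neg_one (L := morseFieldCLM) (u := !₂[0, 1, 0, 0]) (y := !₂[0, 1, 0, 0])
    (A := Matrix.diagonal ![-1, 1, 1, 1]) hR hu (fun x _ => contDiffAt_morseField contDiffAt_id)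
    (fun x hx => by rwa [Ne, morseField_eq_zero_iff]) ?_ ?_ (hasFDerivAt_morseField _) ?_ ?_
  · rw [hval _ hu]
    ext i
    fin_cases i <;> simp [morseField]
  · intro w hw h
    rw [hval w hw] at h
    ext i
    have := congrArg (fun z : E4 => z i) h
    fin_cases i <;> simpa [morseField] using this
  · simp [Matrix.det_diagonal, Fin.prod_univ_four]
  · intro v
    have e : morseField (R • !₂[0, 1, 0, 0]) = !₂[0, R, 0, 0] := by
      ext i
      fin_cases i <;> simp [morseField]
    have hn : ‖(!₂[0, R, 0, 0] : E4)‖ = R := by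
      rw [← sq_eq_sq₀ (norm_nonneg _) hR.le, norm_sq_eq]
      simp
    rw [e, unitVecDeriv_apply, hn, morseFieldCLM_apply]
    ext i
    fin_cases i <;>
      simp [inner_eq, morseField, Matrix.toLpLin_apply, Matrix.mulVec_diagonal] <;> field_simp

/-- The derivative of the reflected field at `(0, 0, R, 0)`. -/
noncomputable def reflectedFieldCLM (R : ℝ) : E4 →L[ℝ] E4 :=
  LinearMap.toContinuousLinearMap (Matrix.toEuclideanLin
    !![0, 0, 1, 0; 0, 0, 0, 1; -(R + 2), 0, 0, 0; 0, R, 0, 0])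

theorem hasFDerivAt_reflectedField {R : ℝ} (hR : 0 < R) :
    HasFDerivAt reflectedField (reflectedFieldCLM R) !₂[0, 0, R, 0] := by
  set x : E4 := !₂[0, 0, R, 0] with hxdef
  have hx2 : ‖x‖ ^ 2 = R ^ 2 := by rw [norm_sq_eq]; simp [hxdef]
  have hx : x ≠ 0 := by
    rintro h
    rw [h] at hx2
    simp at hx2
    exact (pow_pos hR 2).ne hx2
  have e : reflectedField =ᶠ[𝓝 x] fun z => reflectedField₁ z + reflectedField₂ z := by
    filter_upwards [isOpen_ne.mem_nhds hx] with z hz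
    exact reflectedField_eq hz
  refine HasFDerivAt.congr_of_eventuallyEq ?_ e
  have hc := hasFDerivAt_coord x
  -- The numerator vanishes at this point, so the derivative of the denominator does not contribute.
  have hq : HasFDerivAt (fun p : E4 => -(2 * (p 3 * p 1 + p 0 * p 2) / ‖p‖ ^ 2))
      (-(2 / R) • (EuclideanSpace.proj 0 : E4 →L[ℝ] ℝ)) x := by
    have hn := (hasStrictFDerivAt_norm_sq x).hasFDerivAt
    have := ((((hc 3).mul (hc 1)).add ((hc 0).mul (hc 2))).const_mul 2).mul
      ((hasDerivAt_inv (by rw [hx2]; positivity : ‖x‖ ^ 2 ≠ 0)).comp_hasFDerivAt x hn)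
    refine (this.neg).congr_fderiv ?_
    ext v
    simp [hx2]
    simp [hxdef]
    field_simp
  rw [← hasFDerivWithinAt_univ, hasFDerivWithinAt_euclidean]
  intro i
  rw [hasFDerivWithinAt_univ]
  have hi : HasFDerivAt (fun p : E4 => reflectedField₂ p i) _ x := hq.mul (hc i)
  have h1 : HasFDerivAt (fun p : E4 => reflectedField₁ p i)
      ((EuclideanSpace.proj i : E4 →L[ℝ] ℝ).comp (LinearMap.toContinuousLinearMap
        (Matrix.toEuclideanLin !![0, 0, 1, 0; 0, 0, 0, 1; -R, 0, 0, 0; 0, R, 0, 0]))) x := by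
    fin_cases i
    · refine (((((hc 0).pow 2).add ((hc 1).pow 2)).sub (hc 2)).neg).congr_fderiv ?_
      ext v; simp [hxdef, Matrix.toLpLin_apply, dotProduct, Fin.sum_univ_four]
    · refine (hc 3).congr_fderiv ?_
      ext v; simp [Matrix.toLpLin_apply, dotProduct, Fin.sum_univ_four]
    · refine ((((hc 3).mul (hc 1)).add ((hc 0).mul (hc 2))).neg).congr_fderiv ?_
      ext v; simp [hxdef, Matrix.toLpLin_apply, dotProduct, Fin.sum_univ_four]
    · refine ((((hc 3).mul (hc 0)).sub ((hc 1).mul (hc 2))).neg).congr_fderiv ?_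
      ext v; simp [hxdef, Matrix.toLpLin_apply, dotProduct, Fin.sum_univ_four]
  refine (h1.add hi).congr_fderiv ?_
  ext v
  fin_cases i <;> simp [hxdef, reflectedFieldCLM, Matrix.toLpLin_apply, dotProduct, Fin.sum_univ_four]
  field_simp
  ring

theorem sq_add_sq_eq_zero {a b : ℝ} (h : a ^ 2 + b ^ 2 = 0) : a = 0 ∧ b = 0 := by
  rw [add_eq_zero_iff_of_nonneg (sq_nonneg a) (sq_nonneg b)] at h
  exact ⟨pow_eq_zero_iff two_ne_zero |>.1 h.1, pow_eq_zero_iff two_ne_zero |>.1 h.2⟩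

/-- The equations for the points where the reflected field has the direction `(1, 0, 0, 0)`. -/
theorem reflectedField_fiber {a b c d q k N : ℝ} (hN : 0 < N) (hk : 0 < k)
    (hq : q * N = 2 * (d * b + a * c)) (f0 : c - (a ^ 2 + b ^ 2) - q * a = k) (f1 : d = q * b)
    (f2 : d * b + a * c = -(q * c)) (f3 : d * a - b * c = -(q * d)) :
    a = 0 ∧ b = 0 ∧ d = 0 ∧ 0 < c := by
  -- The factorization |z̄₁ + q|² |z₂|² = 0 again. If z₂ = 0, then q = 0 and the first component is
  -- -|z₁|², which cannot equal k > 0. Otherwise z₂ = k is real, q (N + 2k) = 0, and hence z₁ = 0.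
  have hprod : ((a + q) ^ 2 + b ^ 2) * (c ^ 2 + d ^ 2) = 0 := by
    linear_combination ((a + q) * c + b * d) * f2 + ((a + q) * d - b * c) * f3
  rcases mul_eq_zero.1 hprod with h | h
  · obtain ⟨e0, e1⟩ := sq_add_sq_eq_zero h
    rw [e1, mul_zero] at f1
    have e2 : c = k := by
      rw [e1] at f0
      linear_combination f0 + a * e0
    have hq1 : q * (N + 2 * c) = 0 := by
      rw [f1] at hq
      linear_combination hq + 2 * c * e0
    have hq2 : q = 0 := (mul_eq_zero.1 hq1).resolve_right (by linarith)
    exact ⟨by linarith, e1, f1, by linarith⟩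
  · obtain ⟨e2, e3⟩ := sq_add_sq_eq_zero h
    rw [e2, e3] at hq
    have hq2 : q = 0 := (mul_eq_zero.1 (show q * N = 0 by rw [hq]; ring)).resolve_right hN.ne'
    rw [hq2, e2] at f0
    nlinarith [sq_nonneg a, sq_nonneg b]

theorem hasSphereDegree_reflectedField {R : ℝ} (hR : 0 < R) :
    HasSphereDegree (fun u => unitVec (reflectedField (R • u))) (-1) := by
  have hu : ‖(!₂[0, 0, 1, 0] : E4)‖ = 1 := by
    rw [← sq_eq_sq₀ (norm_nonneg _) zero_le_one, norm_sq_eq]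
    simp
  have hRu : R • (!₂[0, 0, 1, 0] : E4) = !₂[0, 0, R, 0] := by
    ext i
    fin_cases i <;> simp
  have h0 : ∀ x : E4, x ≠ 0 → reflectedField x ≠ 0 := by
    intro x hx
    rw [reflectedField_eq hx, ← one_smul ℝ (reflectedField₂ x)]
    exact reflectedField_stage_ne_zero 1 hx
  have hval : reflectedField !₂[0, 0, R, 0] = R • !₂[1, 0, 0, 0] := by
    rw [reflectedField_eq (by intro h; have := congrArg (fun z : E4 => z 2) h; simp at this; exact hR.ne' this)]
    ext i
    fin_cases i <;> simp [reflectedField₁, reflectedField₂]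
  have hy : ‖(!₂[1, 0, 0, 0] : E4)‖ = 1 := by
    rw [← sq_eq_sq₀ (norm_nonneg _) zero_le_one, norm_sq_eq]
    simp
  -- The direction (1, 0, 0, 0) is taken only at (0, 0, 1, 0). The completed Jacobian there
  -- exchanges the two coordinate planes up to the diagonal entries -(R + 2) and R; its determinant
  -- is -R (R + 2).
  refine hasSphereDegree_neg_one (L := reflectedFieldCLM R) (u := !₂[0, 0, 1, 0])
    (y := !₂[1, 0, 0, 0]) (A := !![0, 0, 1, 0; 0, 0, 0, 1; -(R + 2), 0, 0, 0; 0, R, 0, 0]) hR hu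
    (fun x hx => contDiffAt_reflectedField contDiffAt_id hx) h0 ?_ ?_
    (by rw [hRu]; exact hasFDerivAt_reflectedField hR) ?_ ?_
  · rw [hRu, hval, unitVec_smul hR, unitVec_of_norm_one hy]
  · intro w hw h
    have hw0 : w ≠ 0 := by
      rintro rfl
      simp at hw
    set x := R • w with hx
    have hx0 : x ≠ 0 := smul_ne_zero hR.ne' hw0
    have hxn : ‖x‖ = R := by rw [hx, norm_smul, hw, mul_one, Real.norm_of_nonneg hR.le]
    have hx2 : ‖x‖ ^ 2 = x 0 ^ 2 + x 1 ^ 2 + x 2 ^ 2 + x 3 ^ 2 := norm_sq_eq x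
    have hpos : 0 < ‖reflectedField x‖ := norm_pos_iff.2 (h0 x hx0)
    have hf : reflectedField x = ‖reflectedField x‖ • !₂[1, 0, 0, 0] := by
      rw [← h, norm_smul_unitVec]
    set k := ‖reflectedField x‖
    rw [reflectedField_eq hx0] at hf
    obtain ⟨q, hq⟩ : ∃ q, q = 2 * (x 3 * x 1 + x 0 * x 2) / ‖x‖ ^ 2 := ⟨_, rfl⟩
    have e : ∀ i, reflectedField₂ x i = -q * x i := fun i => by simp [reflectedField₂, hq]
    have hq0 : q * ‖x‖ ^ 2 = 2 * (x 3 * x 1 + x 0 * x 2) := by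
      rw [hq, div_mul_cancel₀ _ (by positivity)]
    have hfi := fun i => congrArg (fun z : E4 => z i) hf
    simp only [PiLp.add_apply, e, PiLp.smul_apply] at hfi
    have f0 := hfi 0
    have f1 := hfi 1
    have f2 := hfi 2
    have f3 := hfi 3
    simp [reflectedField₁] at f0 f1 f2 f3
    clear_value k
    have hx2' : ‖x‖ ^ 2 = R ^ 2 := by rw [hxn]
    have hx01 := reflectedField_fiber (by positivity : 0 < ‖x‖ ^ 2) hpos hq0 (by linarith)
      (by linarith) (by linarith) (by linarith)
    obtain ⟨e0, e1, e3, e2⟩ := hx01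
    have hxR : x 2 = R := by
      rw [hx2', e0, e1, e3] at hx2
      nlinarith
    have : R • w = R • !₂[0, 0, 1, 0] := by
      rw [← hx, hRu]
      ext i
      fin_cases i
      · simpa using e0
      · simpa using e1
      · simpa using hxR
      · simpa using e3
    exact smul_right_injective E4 hR.ne' this
  · rw [Matrix.det_succ_row_zero]
    simp [Fin.sum_univ_four, Matrix.det_fin_three, Fin.succAbove]
    nlinarith
  · intro v
    have hn : ‖R • (!₂[1, 0, 0, 0] : E4)‖ = R := by
      rw [norm_smul, hy, mul_one, Real.norm_of_nonneg hR.le]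
    rw [hRu, hval, unitVecDeriv_apply, hn]
    ext i
    fin_cases i <;>
      simp [reflectedFieldCLM, inner_eq, Matrix.toLpLin_apply, Matrix.vecHead, Matrix.vecTail] <;>
      field_simp

end DegreeComputation
/-! ### Gluing manifolds along a partial diffeomorphism -/

section SmoothPartialHomeo

variable {𝕜 : Type*} [NontriviallyNormedField 𝕜]
  {E₁ : Type*} [NormedAddCommGroup E₁] [NormedSpace 𝕜 E₁] {H₁ : Type*} [TopologicalSpace H₁]
  {E₂ : Type*} [NormedAddCommGroup E₂] [NormedSpace 𝕜 E₂] {H₂ : Type*} [TopologicalSpace H₂]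
  {E₃ : Type*} [NormedAddCommGroup E₃] [NormedSpace 𝕜 E₃] {H₃ : Type*} [TopologicalSpace H₃]
  (I₁ : ModelWithCorners 𝕜 E₁ H₁) (I₂ : ModelWithCorners 𝕜 E₂ H₂) (I₃ : ModelWithCorners 𝕜 E₃ H₃)
  {X : Type*} [TopologicalSpace X] [ChartedSpace H₁ X]
  {Y : Type*} [TopologicalSpace Y] [ChartedSpace H₂ Y]
  {Z : Type*} [TopologicalSpace Z] [ChartedSpace H₃ Z]

/-- A partial homeomorphism between manifolds that is smooth in both directions. -/
def IsSmoothPH (f : OpenPartialHomeomorph X Y) : Prop :=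
  ContMDiffOn I₁ I₂ ∞ f f.source ∧ ContMDiffOn I₂ I₁ ∞ f.symm f.target

variable {I₁ I₂ I₃}

theorem IsSmoothPH.symm {f : OpenPartialHomeomorph X Y} (h : IsSmoothPH I₁ I₂ f) :
    IsSmoothPH I₂ I₁ f.symm := ⟨h.2, h.1⟩

theorem IsSmoothPH.trans {f : OpenPartialHomeomorph X Y} {g : OpenPartialHomeomorph Y Z}
    (hf : IsSmoothPH I₁ I₂ f) (hg : IsSmoothPH I₂ I₃ g) : IsSmoothPH I₁ I₃ (f.trans g) :=
  ⟨hg.1.comp (hf.1.mono inter_subset_left) inter_subset_right,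
    hf.2.comp (hg.2.mono inter_subset_left) inter_subset_right⟩

theorem isSmoothPH_ofSet {s : Set X} (hs : IsOpen s) :
    IsSmoothPH I₁ I₁ (OpenPartialHomeomorph.ofSet s hs) :=
  ⟨contMDiffOn_id, contMDiffOn_id⟩

theorem IsSmoothPH.congr {f g : OpenPartialHomeomorph X Y} (hf : IsSmoothPH I₁ I₂ f)
    (h : g ≈ f) : IsSmoothPH I₁ I₂ g := by
  have h' := OpenPartialHomeomorph.EqOnSource.symm' h
  refine ⟨?_, ?_⟩
  · rw [h.1]
    exact hf.1.congr fun x hx => h.2 (h.1.symm ▸ hx)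
  · have := h'.1
    simp only [OpenPartialHomeomorph.symm_source] at this
    rw [this]
    exact hf.2.congr fun x hx => h'.2 (by rw [OpenPartialHomeomorph.symm_source, this]; exact hx)

theorem IsSmoothPH.contMDiffAt {f : OpenPartialHomeomorph X Y} (hf : IsSmoothPH I₁ I₂ f) {x : X}
    (hx : x ∈ f.source) : ContMDiffAt I₁ I₂ ∞ f x :=
  hf.1.contMDiffAt (f.open_source.mem_nhds hx)

/-- The corresponding partial diffeomorphism. -/
def IsSmoothPH.toPartialDiffeomorph {f : OpenPartialHomeomorph X Y} (hf : IsSmoothPH I₁ I₂ f) :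
    PartialDiffeomorph I₁ I₂ X Y ∞ where
  toPartialEquiv := f.toPartialEquiv
  open_source := f.open_source
  open_target := f.open_target
  contMDiffOn_toFun := hf.1
  contMDiffOn_invFun := hf.2

theorem isSmoothPH_toOpenPartialHomeomorph (f : PartialDiffeomorph I₁ I₂ X Y ∞) :
    IsSmoothPH I₁ I₂ f.toOpenPartialHomeomorph :=
  ⟨f.contMDiffOn_toFun, f.contMDiffOn_invFun⟩

theorem isSmoothPH_chart [IsManifold I₁ ∞ X] {e : OpenPartialHomeomorph X H₁}
    (he : e ∈ atlas H₁ X) : IsSmoothPH I₁ I₁ e :=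
  ⟨contMDiffOn_of_mem_maximalAtlas (IsManifold.subset_maximalAtlas he),
    contMDiffOn_symm_of_mem_maximalAtlas (IsManifold.subset_maximalAtlas he)⟩

end SmoothPartialHomeo

/-! ### Smooth structure on a space covered by two manifolds -/

section Atlas

variable {E : Type*} [NormedAddCommGroup E] [NormedSpace ℝ E] {H : Type*} [TopologicalSpace H]
  {I : ModelWithCorners ℝ E H}
  {E₁ : Type*} [NormedAddCommGroup E₁] [NormedSpace ℝ E₁] {H₁ : Type*} [TopologicalSpace H₁]
  {E₂ : Type*} [NormedAddCommGroup E₂] [NormedSpace ℝ E₂] {H₂ : Type*} [TopologicalSpace H₂]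
  {I₁ : ModelWithCorners ℝ E₁ H₁} {I₂ : ModelWithCorners ℝ E₂ H₂}
  {X : Type*} [TopologicalSpace X] [ChartedSpace H₁ X]
  {Y : Type*} [TopologicalSpace Y] [ChartedSpace H₂ Y]
  {W : Type*} [TopologicalSpace W]

/-- Near a point that comes from X, the transition from e to e' factors through X as the inverse of
q followed by e, composed with q followed by e'; both are smooth by assumption. -/
theorem IsSmoothPH.contMDiffAt_symm_trans {q : OpenPartialHomeomorph X W}
    {e e' : OpenPartialHomeomorph W H} (h1 : IsSmoothPH I₁ I (q.trans e))
    (h2 : IsSmoothPH I₁ I (q.trans e')) {h : H} (hh : h ∈ (e.symm.trans e').source)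
    (hq : e.symm h ∈ q.target) : ContMDiffAt I I ∞ (e.symm.trans e') h := by
  have h3 := h1.symm.trans h2
  simp only [OpenPartialHomeomorph.trans_source, OpenPartialHomeomorph.symm_source] at hh
  have hs : h ∈ ((q.trans e).symm.trans (q.trans e')).source := by
    simp [hh.1, hq]
    exact hh.2
  refine (h3.contMDiffAt hs).congr_of_eventuallyEq ?_
  filter_upwards [((q.trans e).symm.trans (q.trans e')).open_source.mem_nhds hs] with z hz
  simp at hz
  simp [hz]

theorem isSmoothPH_of_charts [ChartedSpace H W] [IsManifold I ∞ W] {q : OpenPartialHomeomorph X W}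
    (hq : ∀ w, IsSmoothPH I₁ I (q.trans (chartAt H w))) : IsSmoothPH I₁ I q := by
  have hchart : ∀ w, IsSmoothPH I I (chartAt H w : OpenPartialHomeomorph W H) :=
    fun w => isSmoothPH_chart (chart_mem_atlas H w)
  constructor
  · intro x hx
    have h1 := (hq (q x)).trans (hchart (q x)).symm
    have hs : x ∈ ((q.trans (chartAt H (q x))).trans (chartAt H (q x)).symm).source := by
      simp [hx]
    refine ((h1.contMDiffAt hs).congr_of_eventuallyEq ?_).contMDiffWithinAt
    filter_upwards [OpenPartialHomeomorph.open_source _ |>.mem_nhds hs] with z hz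
    simp at hz
    simp [hz]
  · intro w hw
    have h1 := (hchart w).trans (hq w).symm
    have hs : w ∈ ((chartAt H w).trans (q.trans (chartAt H w)).symm).source := by
      simp [hw]
    refine ((h1.contMDiffAt hs).congr_of_eventuallyEq ?_).contMDiffWithinAt
    filter_upwards [OpenPartialHomeomorph.open_source _ |>.mem_nhds hs] with z hz
    simp at hz
    simp [hz]

/-- A space covered by two manifolds with smooth transition is a manifold, if the two manifolds
have local parametrizations by the model space. -/
theorem exists_chartedSpace_of_cover (f : OpenPartialHomeomorph X W) (g : OpenPartialHomeomorph Y W)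
    (hcov : f.target ∪ g.target = univ) (hfg : IsSmoothPH I₁ I₂ (f.trans g.symm))
    (hX : ∀ x : X, ∃ c : OpenPartialHomeomorph X H, x ∈ c.source ∧ IsSmoothPH I₁ I c)
    (hY : ∀ y : Y, ∃ c : OpenPartialHomeomorph Y H, y ∈ c.source ∧ IsSmoothPH I₂ I c) :
    ∃ (_ : ChartedSpace H W) (_ : IsManifold I ∞ W), IsSmoothPH I₁ I f ∧ IsSmoothPH I₂ I g := by
  have hgf : IsSmoothPH I₂ I₁ (g.trans f.symm) := by
    have := hfg.symm
    rwa [OpenPartialHomeomorph.trans_symm_eq_symm_trans_symm, OpenPartialHomeomorph.symm_symm] at this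
  -- The atlas consists of all local homeomorphisms to H that are smooth as seen from both
  -- manifolds. Compatibility is then automatic: each point lies in the image of one of the two, and
  -- the transition factors through it.
  let good : Set (OpenPartialHomeomorph W H) :=
    {e | IsSmoothPH I₁ I (f.trans e) ∧ IsSmoothPH I₂ I (g.trans e)}
  have hex : ∀ w : W, ∃ e ∈ good, w ∈ e.source := by
    intro w
    rcases (hcov ▸ mem_univ w : w ∈ f.target ∪ g.target) with h | h
    · obtain ⟨c, hc, hs⟩ := hX (f.symm w)
      refine ⟨f.symm.trans c, ⟨?_, ?_⟩, by simp [h, hc]⟩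
      · rw [← OpenPartialHomeomorph.trans_assoc]
        exact ((isSmoothPH_ofSet f.open_source).congr
          (OpenPartialHomeomorph.self_trans_symm f)).trans hs
      · rw [← OpenPartialHomeomorph.trans_assoc]
        exact hgf.trans hs
    · obtain ⟨c, hc, hs⟩ := hY (g.symm w)
      refine ⟨g.symm.trans c, ⟨?_, ?_⟩, by simp [h, hc]⟩
      · rw [← OpenPartialHomeomorph.trans_assoc]
        exact hfg.trans hs
      · rw [← OpenPartialHomeomorph.trans_assoc]
        exact ((isSmoothPH_ofSet g.open_source).congr
          (OpenPartialHomeomorph.self_trans_symm g)).trans hs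
  choose ch hgood hmem using hex
  let cs : ChartedSpace H W :=
    { atlas := good
      chartAt := ch
      mem_chart_source := hmem
      chart_mem_atlas := hgood }
  have htrans : ∀ e ∈ good, ∀ e' ∈ good, ContMDiffOn I I ∞ (e.symm.trans e') (e.symm.trans e').source := by
    intro e he e' he' h hh
    rcases (hcov ▸ mem_univ (e.symm h) : e.symm h ∈ f.target ∪ g.target) with h' | h'
    · exact (he.1.contMDiffAt_symm_trans he'.1 hh h').contMDiffWithinAt
    · exact (he.2.contMDiffAt_symm_trans he'.2 hh h').contMDiffWithinAt
  have hman : IsManifold I ∞ W := by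
    refine isManifold_of_contDiffOn _ _ _ ?_
    intro e e' he he'
    rw [← contMDiffOn_iff_contDiffOn]
    refine (I.contMDiff.comp_contMDiffOn (htrans e he e' he')).comp
      (I.contMDiffOn_symm.mono inter_subset_right) inter_subset_left
  exact ⟨cs, hman, isSmoothPH_of_charts fun w => (hgood w).1, isSmoothPH_of_charts fun w => (hgood w).2⟩

end Atlas

/-- A smooth open embedding of `ℝ⁴` into the model space of a manifold that has an interior point. -/
theorem exists_isSmoothPH_model {H : Type*} [TopologicalSpace H] (I : ModelWithCorners ℝ E4 H)
    {y : E4} (hy : y ∈ interior (range I)) :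
    ∃ φ : OpenPartialHomeomorph E4 H, φ.source = univ ∧ IsSmoothPH 𝓘(ℝ, E4) I φ := by
  obtain ⟨r, hr, hball⟩ := Metric.isOpen_iff.1 isOpen_interior y hy
  have hball : Metric.ball y r ⊆ range I := hball.trans interior_subset
  -- Inside the range of I the inverse of the model embedding is a local homeomorphism into H.
  -- Precomposing with a diffeomorphism from ℝ⁴ to the ball makes it one chart for the whole of ℝ⁴,
  -- so that boundaryless pieces can be modelled on H.
  let ψ : OpenPartialHomeomorph E4 H :=
    { toFun := I.symm
      invFun := I
      source := Metric.ball y r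
      target := I ⁻¹' Metric.ball y r
      map_source' := fun x hx => by
        rw [mem_preimage, I.right_inv (hball hx)]
        exact hx
      map_target' := fun h hh => hh
      left_inv' := fun x hx => I.right_inv (hball hx)
      right_inv' := fun h _ => I.left_inv h
      open_source := Metric.isOpen_ball
      open_target := Metric.isOpen_ball.preimage I.continuous
      continuousOn_toFun := I.continuous_symm.continuousOn
      continuousOn_invFun := I.continuous.continuousOn }
  have hψ : IsSmoothPH 𝓘(ℝ, E4) I ψ :=
    ⟨I.contMDiffOn_symm.mono hball, I.contMDiff.contMDiffOn⟩
  have hb : IsSmoothPH 𝓘(ℝ, E4) 𝓘(ℝ, E4) (OpenPartialHomeomorph.univBall y r) := by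
    constructor
    · exact OpenPartialHomeomorph.contDiff_univBall.contMDiff.contMDiffOn
    · rw [OpenPartialHomeomorph.univBall_target y hr]
      exact OpenPartialHomeomorph.contDiffOn_univBall_symm.contMDiffOn
  refine ⟨(OpenPartialHomeomorph.univBall y r).trans ψ, ?_, hb.trans hψ⟩
  rw [OpenPartialHomeomorph.trans_source, OpenPartialHomeomorph.univBall_source, univ_inter,
    eq_univ_iff_forall]
  intro x
  have := (OpenPartialHomeomorph.univBall y r).map_source (x := x) (by simp)
  rwa [OpenPartialHomeomorph.univBall_target y hr] at this

/-! ### The underlying space of a gluing -/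

section Glue

variable {A : Type u} [TopologicalSpace A] {B : Type v} [TopologicalSpace B]

/-- Two spaces glued along a partial homeomorphism `Φ` between open subsets of `SA` and `SB`. -/
def Glue (SA : Set A) (SB : Set B) (Φ : OpenPartialHomeomorph A B) : Type (max u v) :=
  SA ⊕ ↥(SB \ Φ.target)

namespace Glue

variable (SA : Set A) (SB : Set B) (Φ : OpenPartialHomeomorph A B) (a₀ : SA)

open Classical in
/-- The map of the first space. -/
noncomputable def left (a : A) : Glue SA SB Φ := if h : a ∈ SA then Sum.inl ⟨a, h⟩ else Sum.inl a₀

open Classical in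
/-- The map of the second space. -/
noncomputable def right (b : B) : Glue SA SB Φ :=
  if h : b ∈ SB \ Φ.target then Sum.inr ⟨b, h⟩ else left SA SB Φ a₀ (Φ.symm b)

/-- The inverse of `left`. -/
def leftInv : Glue SA SB Φ → A := Sum.elim (fun a => a.1) fun _ => a₀.1

/-- The inverse of `right`. -/
def rightInv : Glue SA SB Φ → B := Sum.elim (fun a => Φ a.1) fun b => b.1

variable {SA SB Φ}

theorem leftInv_left {a : A} (h : a ∈ SA) : leftInv SA SB Φ a₀ (left SA SB Φ a₀ a) = a := by
  simp [left, h, leftInv]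

theorem right_of_mem {b : B} (h : b ∈ Φ.target) :
    right SA SB Φ a₀ b = left SA SB Φ a₀ (Φ.symm b) := by
  simp [right, h]

theorem right_map {a : A} (h : a ∈ Φ.source) : right SA SB Φ a₀ (Φ a) = left SA SB Φ a₀ a := by
  rw [right_of_mem a₀ (Φ.map_source h), Φ.left_inv h]

theorem rightInv_right (hA : Φ.source ⊆ SA) {b : B} (h : b ∈ SB) :
    rightInv SA SB Φ (right SA SB Φ a₀ b) = b := by
  by_cases hb : b ∈ Φ.target
  · rw [right_of_mem a₀ hb]
    simp [left, rightInv, hA (Φ.map_target hb), Φ.right_inv hb]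
  · simp [right, h, hb, rightInv]

/-- This locates the overlap of the two images: the trace of an open set of A on the side of B is
Φ.target ∩ Φ.symm⁻¹(U), which is open. -/
theorem right_mem_image_left_iff {b : B} (hA : Φ.source ⊆ SA) (h : b ∈ SB) (U : Set A) :
    right SA SB Φ a₀ b ∈ left SA SB Φ a₀ '' (SA ∩ U) ↔ b ∈ Φ.target ∧ Φ.symm b ∈ U := by
  by_cases hb : b ∈ Φ.target
  · rw [right_of_mem a₀ hb]
    have hs := hA (Φ.map_target hb)
    constructor
    · rintro ⟨a, ⟨ha, haU⟩, e⟩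
      have := congrArg (leftInv SA SB Φ a₀) e
      rw [leftInv_left a₀ ha, leftInv_left a₀ hs] at this
      exact ⟨hb, this ▸ haU⟩
    · rintro ⟨-, hU⟩
      exact ⟨_, ⟨hs, hU⟩, rfl⟩
  · refine iff_of_false ?_ fun h => hb h.1
    rintro ⟨a, ⟨ha, haU⟩, e⟩
    simp [left, ha, right, h, hb] at e

theorem left_mem_image_right_iff {a : A} (hA : Φ.source ⊆ SA) (hB : Φ.target ⊆ SB) (h : a ∈ SA)
    (V : Set B) :
    left SA SB Φ a₀ a ∈ right SA SB Φ a₀ '' (SB ∩ V) ↔ a ∈ Φ.source ∧ Φ a ∈ V := by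
  constructor
  · rintro ⟨b, ⟨hb, hbV⟩, e⟩
    have h1 : right SA SB Φ a₀ b ∈ left SA SB Φ a₀ '' (SA ∩ univ) := by
      rw [e]; exact ⟨a, ⟨h, mem_univ _⟩, rfl⟩
    have h2 := ((right_mem_image_left_iff a₀ hA hb univ).1 h1).1
    rw [right_of_mem a₀ h2] at e
    have := congrArg (leftInv SA SB Φ a₀) e
    rw [leftInv_left a₀ (hA (Φ.map_target h2)), leftInv_left a₀ h] at this
    rw [← this]
    exact ⟨Φ.map_target h2, by rwa [Φ.right_inv h2]⟩
  · rintro ⟨ha, hV⟩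
    exact ⟨Φ a, ⟨hB (Φ.map_source ha), hV⟩, right_map a₀ ha⟩

theorem mem_range (w : Glue SA SB Φ) :
    (∃ a ∈ SA, left SA SB Φ a₀ a = w) ∨ ∃ b ∈ SB, right SA SB Φ a₀ b = w := by
  rcases w with ⟨a, ha⟩ | ⟨b, hb⟩
  · exact Or.inl ⟨a, ha, dif_pos ha⟩
  · exact Or.inr ⟨b, hb.1, dif_pos hb⟩

end Glue

/-- Two spaces can be glued along a partial homeomorphism between open subsets. -/
theorem exists_glue (SA : Set A) (SB : Set B) (Φ : OpenPartialHomeomorph A B) (hSA : IsOpen SA)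
    (hSB : IsOpen SB) (hne : SA.Nonempty) (hA : Φ.source ⊆ SA) (hB : Φ.target ⊆ SB) :
    ∃ (W : Type (max u v)) (_ : TopologicalSpace W) (f : OpenPartialHomeomorph A W)
      (g : OpenPartialHomeomorph B W), f.source = SA ∧ g.source = SB ∧
      f.target ∪ g.target = univ ∧ (∀ b ∈ SB, g b ∈ f.target ↔ b ∈ Φ.target) ∧
      (∀ b ∈ Φ.target, g b = f (Φ.symm b)) ∧ f.trans g.symm ≈ Φ := by
  obtain ⟨a, ha⟩ := hne
  -- A default value: the maps from A and B to the glued space are total, and points outside the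
  -- glued sets are sent to the image of a₀.
  let a₀ : SA := ⟨a, ha⟩
  let l := Glue.left SA SB Φ a₀
  let r := Glue.right SA SB Φ a₀
  -- A set is open when its traces on SA and on SB are. With this choice both inclusions are
  -- continuous, and `hl` and `hr` show that they are open.
  let top : TopologicalSpace (Glue SA SB Φ) :=
    { IsOpen := fun U => IsOpen (SA ∩ l ⁻¹' U) ∧ IsOpen (SB ∩ r ⁻¹' U)
      isOpen_univ := by simp [hSA, hSB]
      isOpen_inter := fun U V hU hV => by
        rw [preimage_inter, preimage_inter]
        refine ⟨?_, ?_⟩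
        · convert! hU.1.inter hV.1 using 1
          exact inter_inter_distrib_left ..
        · convert! hU.2.inter hV.2 using 1
          exact inter_inter_distrib_left ..
      isOpen_sUnion := fun S hS => by
        simp only [preimage_sUnion, inter_iUnion]
        exact ⟨isOpen_biUnion fun U hU => (hS U hU).1, isOpen_biUnion fun U hU => (hS U hU).2⟩ }
  have hl : ∀ U, IsOpen U → IsOpen (l '' (SA ∩ U)) := by
    intro U hU
    constructor
    · have : SA ∩ l ⁻¹' (l '' (SA ∩ U)) = SA ∩ U := by
        ext z
        constructor
        · rintro ⟨hz, z', hz', e⟩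
          have := congrArg (Glue.leftInv SA SB Φ a₀) e
          rw [Glue.leftInv_left a₀ hz'.1, Glue.leftInv_left a₀ hz] at this
          exact this ▸ hz'
        · exact fun hz => ⟨hz.1, z, hz, rfl⟩
      rw [this]
      exact hSA.inter hU
    · have : SB ∩ r ⁻¹' (l '' (SA ∩ U)) = Φ.target ∩ Φ.symm ⁻¹' U := by
        ext z
        constructor
        · rintro ⟨hz, h⟩
          exact (Glue.right_mem_image_left_iff a₀ hA hz U).1 h
        · intro h
          exact ⟨hB h.1, (Glue.right_mem_image_left_iff a₀ hA (hB h.1) U).2 h⟩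
      rw [this]
      exact Φ.isOpen_inter_preimage_symm hU
  have hr : ∀ V, IsOpen V → IsOpen (r '' (SB ∩ V)) := by
    intro V hV
    constructor
    · have : SA ∩ l ⁻¹' (r '' (SB ∩ V)) = Φ.source ∩ Φ ⁻¹' V := by
        ext z
        constructor
        · rintro ⟨hz, h⟩
          exact (Glue.left_mem_image_right_iff a₀ hA hB hz V).1 h
        · intro h
          exact ⟨hA h.1, (Glue.left_mem_image_right_iff a₀ hA hB (hA h.1) V).2 h⟩
      rw [this]
      exact Φ.isOpen_inter_preimage hV
    · have : SB ∩ r ⁻¹' (r '' (SB ∩ V)) = SB ∩ V := by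
        ext z
        constructor
        · rintro ⟨hz, z', hz', e⟩
          have := congrArg (Glue.rightInv SA SB Φ) e
          rw [Glue.rightInv_right a₀ hA hz'.1, Glue.rightInv_right a₀ hA hz] at this
          exact this ▸ hz'
        · exact fun hz => ⟨hz.1, z, hz, rfl⟩
      rw [this]
      exact hSB.inter hV
  let f : OpenPartialHomeomorph A (Glue SA SB Φ) :=
    { toFun := l
      invFun := Glue.leftInv SA SB Φ a₀
      source := SA
      target := l '' SA
      map_source' := fun z hz => mem_image_of_mem l hz
      map_target' := by
        rintro _ ⟨z, hz, rfl⟩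
        rw [Glue.leftInv_left a₀ hz]
        exact hz
      left_inv' := fun z hz => Glue.leftInv_left a₀ hz
      right_inv' := by
        rintro _ ⟨z, hz, rfl⟩
        rw [Glue.leftInv_left a₀ hz]
      open_source := hSA
      open_target := by simpa using hl univ isOpen_univ
      continuousOn_toFun := (continuousOn_open_iff hSA).2 fun U hU => hU.1
      continuousOn_invFun := (continuousOn_open_iff (by simpa using hl univ isOpen_univ)).2
        fun U hU => by
          convert hl U hU using 1
          ext w
          constructor
          · rintro ⟨⟨z, hz, rfl⟩, h⟩
            rw [mem_preimage, Glue.leftInv_left a₀ hz] at h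
            exact ⟨z, ⟨hz, h⟩, rfl⟩
          · rintro ⟨z, ⟨hz, h⟩, rfl⟩
            refine ⟨⟨z, hz, rfl⟩, ?_⟩
            rw [mem_preimage, Glue.leftInv_left a₀ hz]
            exact h }
  let g : OpenPartialHomeomorph B (Glue SA SB Φ) :=
    { toFun := r
      invFun := Glue.rightInv SA SB Φ
      source := SB
      target := r '' SB
      map_source' := fun z hz => mem_image_of_mem r hz
      map_target' := by
        rintro _ ⟨z, hz, rfl⟩
        rw [Glue.rightInv_right a₀ hA hz]
        exact hz
      left_inv' := fun z hz => Glue.rightInv_right a₀ hA hz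
      right_inv' := by
        rintro _ ⟨z, hz, rfl⟩
        rw [Glue.rightInv_right a₀ hA hz]
      open_source := hSB
      open_target := by simpa using hr univ isOpen_univ
      continuousOn_toFun := (continuousOn_open_iff hSB).2 fun U hU => hU.2
      continuousOn_invFun := (continuousOn_open_iff (by simpa using hr univ isOpen_univ)).2
        fun U hU => by
          convert hr U hU using 1
          ext w
          constructor
          · rintro ⟨⟨z, hz, rfl⟩, h⟩
            rw [mem_preimage, Glue.rightInv_right a₀ hA hz] at h
            exact ⟨z, ⟨hz, h⟩, rfl⟩
          · rintro ⟨z, ⟨hz, h⟩, rfl⟩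
            refine ⟨⟨z, hz, rfl⟩, ?_⟩
            rw [mem_preimage, Glue.rightInv_right a₀ hA hz]
            exact h }
  refine ⟨Glue SA SB Φ, top, f, g, rfl, rfl, ?_, ?_, fun b hb => Glue.right_of_mem a₀ hb, ?_, ?_⟩
  · rw [eq_univ_iff_forall]
    intro w
    rcases Glue.mem_range a₀ w with ⟨z, hz, rfl⟩ | ⟨z, hz, rfl⟩
    · exact Or.inl ⟨z, hz, rfl⟩
    · exact Or.inr ⟨z, hz, rfl⟩
  · intro b hb
    have := Glue.right_mem_image_left_iff a₀ hA hb univ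
    rw [inter_univ] at this
    exact this.trans (and_iff_left (mem_univ _))
  · rw [OpenPartialHomeomorph.trans_source]
    ext z
    constructor
    · rintro ⟨hz, h⟩
      have := Glue.left_mem_image_right_iff a₀ hA hB (show z ∈ SA from hz) univ
      simp only [inter_univ, mem_univ, and_true] at this
      exact this.1 h
    · intro h
      have := Glue.left_mem_image_right_iff a₀ hA hB (hA h) univ
      simp only [inter_univ, mem_univ, and_true] at this
      exact ⟨hA h, this.2 h⟩
  · rintro z ⟨hz, h⟩
    have := Glue.left_mem_image_right_iff a₀ hA hB (show z ∈ SA from hz) univ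
    simp only [inter_univ, mem_univ, and_true] at this
    have hz' := this.1 h
    show Glue.rightInv SA SB Φ (l z) = Φ z
    rw [← Glue.rightInv_right a₀ hA (hB (Φ.map_source hz')), Glue.right_map a₀ hz']

end Glue

/-- Two manifolds can be glued along a partial diffeomorphism. -/
theorem exists_glue_manifold {E : Type*} [NormedAddCommGroup E] [NormedSpace ℝ E] {H : Type*}
    [TopologicalSpace H] {I : ModelWithCorners ℝ E H}
    {E₁ : Type*} [NormedAddCommGroup E₁] [NormedSpace ℝ E₁] {H₁ : Type*} [TopologicalSpace H₁]
    {E₂ : Type*} [NormedAddCommGroup E₂] [NormedSpace ℝ E₂] {H₂ : Type*} [TopologicalSpace H₂]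
    {I₁ : ModelWithCorners ℝ E₁ H₁} {I₂ : ModelWithCorners ℝ E₂ H₂}
    {A : Type u} [TopologicalSpace A] [ChartedSpace H₁ A]
    {B : Type v} [TopologicalSpace B] [ChartedSpace H₂ B]
    (hcA : ∀ x : A, ∃ c : OpenPartialHomeomorph A H, x ∈ c.source ∧ IsSmoothPH I₁ I c)
    (hcB : ∀ y : B, ∃ c : OpenPartialHomeomorph B H, y ∈ c.source ∧ IsSmoothPH I₂ I c)
    (SA : Set A) (SB : Set B) (Φ : PartialDiffeomorph I₁ I₂ A B ∞) (hSA : IsOpen SA)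
    (hSB : IsOpen SB) (hne : SA.Nonempty) (hA : Φ.source ⊆ SA) (hB : Φ.target ⊆ SB) :
    ∃ (W : Type (max u v)) (_ : TopologicalSpace W) (_ : ChartedSpace H W) (_ : IsManifold I ∞ W)
      (f : PartialDiffeomorph I₁ I A W ∞) (g : PartialDiffeomorph I₂ I B W ∞),
      f.source = SA ∧ g.source = SB ∧
      f.target ∪ g.target = univ ∧ (∀ b ∈ SB, g b ∈ f.target ↔ b ∈ Φ.target) ∧
      (∀ b ∈ Φ.target, g b = f (Φ.symm b)) := by
  obtain ⟨W, top, f, g, hf, hg, hcov, hmem, hglue, heq⟩ :=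
    exists_glue SA SB Φ.toOpenPartialHomeomorph hSA hSB hne hA hB
  obtain ⟨cs, hm, h1, h2⟩ := exists_chartedSpace_of_cover f g hcov
    ((isSmoothPH_toOpenPartialHomeomorph Φ).congr heq) hcA hcB
  exact ⟨W, top, cs, hm, h1.toPartialDiffeomorph, h2.toPartialDiffeomorph, hf, hg, hcov, hmem, hglue⟩
/-! ### Radial diffeomorphisms and the neck sum -/

section Radial

theorem norm_radial {c : ℝ} (hc : 0 < c) {x : E4} (hx : x ≠ 0) : ‖c • unitVec x‖ = c := by
  rw [norm_smul, norm_unitVec hx, mul_one, Real.norm_of_nonneg hc.le]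

theorem unitVec_radial {c : ℝ} (hc : 0 < c) {x : E4} (hx : x ≠ 0) :
    unitVec (c • unitVec x) = unitVec x := by
  rw [unitVec_smul hc, unitVec_of_norm_one (norm_unitVec hx)]

theorem contDiffOn_radial {ρ : ℝ → ℝ} {S : Set ℝ} (hS : IsOpen S) (hpos : ∀ r ∈ S, 0 < r)
    (hρ : ContDiffOn ℝ ∞ ρ S) :
    ContDiffOn ℝ ∞ (fun x : E4 => ρ ‖x‖ • unitVec x) {x | ‖x‖ ∈ S} := by
  intro x hx
  have hx0 : x ≠ 0 := norm_pos_iff.1 (hpos _ hx)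
  have h1 : ContDiffAt ℝ ∞ (fun x : E4 => ‖x‖) x := contDiffAt_norm ℝ hx0
  exact (((hρ.contDiffAt (hS.mem_nhds hx)).comp x h1).smul
    (contDiffAt_unitVec contDiffAt_id hx0)).contDiffWithinAt

/-- The radial diffeomorphism `x ↦ ρ ‖x‖ • x / ‖x‖`. -/
noncomputable def radialDiffeo (ρ σ : ℝ → ℝ) (S T : Set ℝ) (hS : IsOpen S) (hT : IsOpen T)
    (hSpos : ∀ r ∈ S, 0 < r) (hTpos : ∀ r ∈ T, 0 < r) (hρ : ContDiffOn ℝ ∞ ρ S)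
    (hσ : ContDiffOn ℝ ∞ σ T) (hST : ∀ r ∈ S, ρ r ∈ T ∧ σ (ρ r) = r)
    (hTS : ∀ r ∈ T, σ r ∈ S ∧ ρ (σ r) = r) : PartialDiffeomorph 𝓘(ℝ, E4) 𝓘(ℝ, E4) E4 E4 ∞ where
  toFun x := ρ ‖x‖ • unitVec x
  invFun x := σ ‖x‖ • unitVec x
  source := {x | ‖x‖ ∈ S}
  target := {x | ‖x‖ ∈ T}
  map_source' x hx := by
    have := hST _ hx
    rw [mem_ofPred_eq, norm_radial (hTpos _ this.1) (norm_pos_iff.1 (hSpos _ hx))]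
    exact this.1
  map_target' x hx := by
    have := hTS _ hx
    rw [mem_ofPred_eq, norm_radial (hSpos _ this.1) (norm_pos_iff.1 (hTpos _ hx))]
    exact this.1
  left_inv' x hx := by
    have := hST _ hx
    have hx0 : x ≠ 0 := norm_pos_iff.1 (hSpos _ hx)
    rw [norm_radial (hTpos _ this.1) hx0, unitVec_radial (hTpos _ this.1) hx0, this.2,
      norm_smul_unitVec]
  right_inv' x hx := by
    have := hTS _ hx
    have hx0 : x ≠ 0 := norm_pos_iff.1 (hTpos _ hx)
    rw [norm_radial (hSpos _ this.1) hx0, unitVec_radial (hSpos _ this.1) hx0, this.2,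
      norm_smul_unitVec]
  open_source := hS.preimage continuous_norm
  open_target := hT.preimage continuous_norm
  contMDiffOn_toFun := (contDiffOn_radial hS hSpos hρ).contMDiffOn
  contMDiffOn_invFun := (contDiffOn_radial hT hTpos hσ).contMDiffOn

end Radial

theorem kappa_pos {Λ : ℝ} (h : 0 < Λ) : 0 < kappa Λ := Real.sqrt_pos.2 (by positivity)

theorem isSmoothPH_CP2_chart (i : Fin 3) : IsSmoothPH 𝓘(ℝ, E4) 𝓘(ℝ, E4) (CP2.chart i) :=
  isSmoothPH_chart (mem_range_self i)

/-! ### Removed balls and the coordinate changes at the two ends of the neck -/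

section NeckSum

variable {H : Type v} [TopologicalSpace H] {I : ModelWithCorners ℝ E4 H}
variable {M : Type u} [TopologicalSpace M] [ChartedSpace H M] [IsManifold I ∞ M]
variable {C : MorseCobordism I M} {Λ τ₀ χ₁ σ₀ ξ₁ ξ₂ R n₀ n₁ : ℝ}

theorem GluingParameters.closedBall_subset (hP : GluingParameters C Λ τ₀ χ₁ σ₀ ξ₁ ξ₂ R n₀ n₁)
    {r : ℝ} (hr : r < ξ₂) : Metric.closedBall 0 r ⊆ C.chart.target :=
  (Metric.closedBall_subset_ball hr).trans hP.ball_subset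

theorem MorseCobordism.closedChartBall_eq {r : ℝ}
    (h : Metric.closedBall 0 r ⊆ C.chart.target) :
    C.closedChartBall r = C.chart.symm '' Metric.closedBall 0 r := by
  ext x
  constructor
  · rintro ⟨hx, hr⟩
    exact ⟨C.chart x, by simpa using hr, C.chart.left_inv hx⟩
  · rintro ⟨y, hy, rfl⟩
    refine ⟨C.chart.map_target (h hy), ?_⟩
    rw [show C.chart (C.chart.symm y) = y from C.chart.right_inv (h hy)]
    simpa using hy

theorem MorseCobordism.isCompact_closedChartBall {r : ℝ}
    (h : Metric.closedBall 0 r ⊆ C.chart.target) : IsCompact (C.closedChartBall r) := by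
  rw [MorseCobordism.closedChartBall_eq h]
  exact (isCompact_closedBall 0 r).image_of_continuousOn
    (C.chart.contMDiffOn_invFun.continuousOn.mono h)

theorem MorseCobordism.isClosed_closedChartBall [T2Space M] {r : ℝ}
    (h : Metric.closedBall 0 r ⊆ C.chart.target) : IsClosed (C.closedChartBall r) :=
  (MorseCobordism.isCompact_closedChartBall h).isClosed

theorem MorseCobordism.isOpen_chartBall {r : ℝ} : IsOpen (C.chartBall r) := by
  have := C.chart.contMDiffOn_toFun.continuousOn.isOpen_inter_preimage C.chart.open_source
    (Metric.isOpen_ball (x := (0 : E4)) (ε := r))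
  convert this using 1
  ext x
  simp [MorseCobordism.chartBall]

/-- The coordinate change between the Morse chart and the neck. -/
noncomputable def morseNeck (σ₀ ξ₂ n₁ : ℝ) (hσ : 0 < σ₀) :
    PartialDiffeomorph 𝓘(ℝ, E4) 𝓘(ℝ, E4) E4 E4 ∞ :=
  radialDiffeo (fun r => Real.exp (r - σ₀ + n₁)) (fun t => σ₀ + Real.log t - n₁)
    (Ioo σ₀ ξ₂) (Ioo (Real.exp n₁) (Real.exp (n₁ + ξ₂ - σ₀))) isOpen_Ioo isOpen_Ioo
    (fun r hr => hσ.trans hr.1) (fun r hr => (Real.exp_pos _).trans hr.1) (by fun_prop)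
    (by
      intro t ht
      have : ContDiffAt ℝ ∞ Real.log t := Real.contDiffAt_log.2 ((Real.exp_pos _).trans ht.1).ne'
      exact ((contDiffAt_const.add this).sub contDiffAt_const).contDiffWithinAt)
    (fun r hr => ⟨⟨Real.exp_lt_exp.2 (by linarith [hr.1]), Real.exp_lt_exp.2 (by linarith [hr.2])⟩,
      by simp only [Real.log_exp]; ring⟩)
    (fun t ht => by
      have ht0 := (Real.exp_pos _).trans ht.1
      have h1 := (Real.lt_log_iff_exp_lt ht0).2 ht.1
      have h2 := (Real.log_lt_iff_lt_exp ht0).2 ht.2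
      refine ⟨⟨by linarith, by linarith⟩, ?_⟩
      rw [show σ₀ + Real.log t - n₁ - σ₀ + n₁ = Real.log t by ring, Real.exp_log ht0])

/-- The coordinate change between the neck and the first affine chart. -/
noncomputable def neckProjective (κ τ₀ n₀ : ℝ) (hκ : 0 < κ) (hτ : 0 < τ₀)
    (hτ' : τ₀ < Real.pi / (2 * κ)) :
    PartialDiffeomorph 𝓘(ℝ, E4) 𝓘(ℝ, E4) E4 E4 ∞ :=
  have key : ∀ t ∈ Ioo (Real.exp (n₀ + τ₀ - Real.pi / (2 * κ))) (Real.exp n₀),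
      0 < t ∧ κ * τ₀ < κ * (τ₀ + n₀ - Real.log t) ∧ κ * (τ₀ + n₀ - Real.log t) < Real.pi / 2 := by
    intro t ht
    have ht0 := (Real.exp_pos _).trans ht.1
    have h1 := (Real.lt_log_iff_exp_lt ht0).2 ht.1
    have h2 := (Real.log_lt_iff_lt_exp ht0).2 ht.2
    refine ⟨ht0, by gcongr; linarith, ?_⟩
    rw [show Real.pi / 2 = κ * (Real.pi / (2 * κ)) by field_simp]
    gcongr
    linarith
  have hκτ : 0 < κ * τ₀ := mul_pos hκ hτ
  have hκτ' : κ * τ₀ < Real.pi / 2 := by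
    rw [show Real.pi / 2 = κ * (Real.pi / (2 * κ)) by field_simp]
    gcongr
  radialDiffeo (fun t => Real.tan (κ * (τ₀ + n₀ - Real.log t)))
    (fun r => Real.exp (τ₀ + n₀ - Real.arctan r / κ))
    (Ioo (Real.exp (n₀ + τ₀ - Real.pi / (2 * κ))) (Real.exp n₀)) (Ioi (Real.tan (κ * τ₀)))
    isOpen_Ioo isOpen_Ioi (fun t ht => (Real.exp_pos _).trans ht.1)
    (fun r hr => (Real.tan_pos_of_pos_of_lt_pi_div_two hκτ hκτ').trans hr)
    (by
      intro t ht
      obtain ⟨h0, h1, h2⟩ := key t ht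
      have h3 : ContDiffAt ℝ ∞ Real.log t := Real.contDiffAt_log.2 h0.ne'
      have h4 : ContDiffAt ℝ ∞ Real.tan (κ * (τ₀ + n₀ - Real.log t)) :=
        Real.contDiffAt_tan.2 (Real.cos_pos_of_mem_Ioo ⟨by linarith, h2⟩).ne'
      exact (h4.comp t (contDiffAt_const.mul (contDiffAt_const.sub h3))).contDiffWithinAt)
    (ContDiff.contDiffOn (Real.contDiff_exp.comp
      (contDiff_const.sub (Real.contDiff_arctan.div_const κ))))
    (fun t ht => by
      obtain ⟨h0, h1, h2⟩ := key t ht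
      refine ⟨Real.tan_lt_tan_of_lt_of_lt_pi_div_two (by linarith) h2 h1, ?_⟩
      rw [Real.arctan_tan (by linarith) h2]
      rw [show τ₀ + n₀ - κ * (τ₀ + n₀ - Real.log t) / κ = Real.log t by field_simp; ring,
        Real.exp_log h0])
    (fun r hr => by
      have h1 : κ * τ₀ < Real.arctan r := by
        rw [← Real.arctan_tan (by linarith) hκτ']
        exact Real.arctan_strictMono hr
      have h2 := Real.arctan_lt_pi_div_two r
      refine ⟨⟨Real.exp_lt_exp.2 ?_, Real.exp_lt_exp.2 ?_⟩, ?_⟩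
      · have : Real.arctan r / κ < Real.pi / (2 * κ) := by
          rw [div_lt_div_iff₀ hκ (by positivity)]
          nlinarith
        linarith
      · have : τ₀ < Real.arctan r / κ := by
          rw [lt_div_iff₀ hκ]; linarith
        linarith
      · rw [Real.log_exp, show κ * (τ₀ + n₀ - (τ₀ + n₀ - Real.arctan r / κ)) = Real.arctan r by
          field_simp; ring, Real.tan_arctan])

theorem tan_kappa_lt_iff {κ τ r : ℝ} (hκ : 0 < κ) (hτ : 0 < τ)
    (hτ' : τ < Real.pi / (2 * κ)) : Real.tan (κ * τ) < r ↔ τ < Real.arctan r / κ := by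
  have h0 : 0 < κ * τ := mul_pos hκ hτ
  have h1 : κ * τ < Real.pi / 2 := by
    rw [show Real.pi / 2 = κ * (Real.pi / (2 * κ)) by field_simp]
    gcongr
  rw [lt_div_iff₀ hκ, mul_comm τ κ, ← Real.arctan_lt_arctan_iff, Real.arctan_tan (by linarith) h1]

/-- A closed ball around the centre of `CP2`. -/
def CP2.closedBall (Λ τ : ℝ) : Set CP2 := (CP2.chart 0).symm '' {x | chi Λ x ≤ τ}

theorem isCompact_chi_le {Λ τ : ℝ} (hΛ : 0 < Λ) (hτ : 0 < τ) (hτ' : τ < Real.pi / (2 * kappa Λ)) :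
    IsCompact {x : E4 | chi Λ x ≤ τ} := by
  have : {x : E4 | chi Λ x ≤ τ} = Metric.closedBall 0 (Real.tan (kappa Λ * τ)) := by
    ext x
    have := tan_kappa_lt_iff (r := ‖x‖) (kappa_pos hΛ) hτ hτ'
    simp only [mem_ofPred_eq, Metric.mem_closedBall, dist_zero_right, chi]
    rw [← not_lt, ← not_lt, this]
  rw [this]
  exact isCompact_closedBall _ _

theorem CP2.isCompact_closedBall {Λ τ : ℝ} (hΛ : 0 < Λ) (hτ : 0 < τ)
    (hτ' : τ < Real.pi / (2 * kappa Λ)) : IsCompact (CP2.closedBall Λ τ) :=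
  (isCompact_chi_le hΛ hτ hτ').image_of_continuousOn
    ((CP2.chart 0).continuousOn_symm.mono (subset_univ _))

end NeckSum
-- Existence of the connected sum
section Existence

variable {H : Type v} [TopologicalSpace H] {I : ModelWithCorners ℝ E4 H}
variable {M : Type u} [TopologicalSpace M] [ChartedSpace H M] [IsManifold I ∞ M]
variable {C : MorseCobordism I M} {Λ τ₀ χ₁ σ₀ ξ₁ ξ₂ R n₀ n₁ : ℝ}

theorem CP2.mem_closedBall_iff {Λ τ : ℝ} (x : E4) :
    (CP2.chart 0).symm x ∈ CP2.closedBall Λ τ ↔ chi Λ x ≤ τ := by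
  constructor
  · rintro ⟨y, hy, h⟩
    have := congrArg (CP2.chart 0) h
    rw [(CP2.chart 0).right_inv (mem_univ _), (CP2.chart 0).right_inv (mem_univ _)] at this
    rwa [← this]
  · exact fun h => ⟨x, h, rfl⟩

/-- Two successive gluings: the punctured manifold with the open cylinder, and the result with the
punctured projective plane. The Hausdorff property of the summands makes the removed compact balls
closed, so that their complements are open. -/
theorem exists_neckSum [T2Space M] [T2Space CP2]
    (hP : GluingParameters C Λ τ₀ χ₁ σ₀ ξ₁ ξ₂ R n₀ n₁) :
    ∃ (W : Type u) (_ : TopologicalSpace W) (_ : ChartedSpace H W) (_ : IsManifold I ∞ W)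
      (jM : PartialDiffeomorph I I M W ∞) (jN : PartialDiffeomorph 𝓘(ℝ, E4) I E4 W ∞)
      (jC : PartialDiffeomorph 𝓘(ℝ, E4) I CP2 W ∞),
      IsNeckSum C Λ τ₀ σ₀ ξ₂ n₀ n₁ jM jN jC := by
  have hκ := kappa_pos hP.Λ_pos
  have hτ' : τ₀ < Real.pi / (2 * kappa Λ) := hP.τ₀_lt.trans hP.χ₁_lt
  have hσξ : σ₀ < ξ₂ := hP.σ₀_lt.trans hP.ξ₁_lt
  have hclM : IsClosed (C.closedChartBall σ₀) :=
    MorseCobordism.isClosed_closedChartBall (hP.closedBall_subset hσξ)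
  -- The model I may have boundary and corners; that p is an interior point provides a smooth open
  -- embedding of ℝ⁴ into H, which gives charts to the neck and to the projective plane.
  obtain ⟨φ, hφ, hφs⟩ := exists_isSmoothPH_model I C.interior
  set SB : Set E4 := {y | y ≠ 0 ∧ n₀ + τ₀ - Real.pi / (2 * kappa Λ) < Real.log ‖y‖ ∧
    Real.log ‖y‖ < n₁ + ξ₂ - σ₀} with hSB
  have hSBo : IsOpen SB := by
    rw [isOpen_iff_mem_nhds]
    rintro y ⟨h0, h1, h2⟩
    have hc : ContinuousAt (fun y : E4 => Real.log ‖y‖) y :=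
      (Real.continuousAt_log (norm_ne_zero_iff.2 h0)).comp continuous_norm.continuousAt
    filter_upwards [isOpen_ne.mem_nhds h0, hc.eventually (lt_mem_nhds h1),
      hc.eventually (gt_mem_nhds h2)] with z h0 h1 h2
    exact ⟨h0, h1, h2⟩
  let Φ := C.chart.trans (morseNeck σ₀ ξ₂ n₁ hP.σ₀_pos)
  have hΦs : ∀ x, x ∈ Φ.source ↔ x ∈ C.chart.source ∧ ‖C.chart x‖ ∈ Ioo σ₀ ξ₂ := fun x => Iff.rfl
  have hlog : ∀ y : E4, y ≠ 0 → ∀ s, Real.exp s < ‖y‖ ↔ s < Real.log ‖y‖ := fun y hy s =>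
    (Real.lt_log_iff_exp_lt (norm_pos_iff.2 hy)).symm
  have hlog' : ∀ y : E4, y ≠ 0 → ∀ s, ‖y‖ < Real.exp s ↔ Real.log ‖y‖ < s := fun y hy s =>
    (Real.log_lt_iff_lt_exp (norm_pos_iff.2 hy)).symm
  have hΦt : ∀ y, y ∈ SB → (y ∈ Φ.target ↔ n₁ < Real.log ‖y‖) := by
    intro y hy
    have : y ∈ Φ.target ↔ ‖y‖ ∈ Ioo (Real.exp n₁) (Real.exp (n₁ + ξ₂ - σ₀)) ∧
      (σ₀ + Real.log ‖y‖ - n₁) • unitVec y ∈ C.chart.target := Iff.rfl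
    rw [this, mem_Ioo, hlog y hy.1, hlog' y hy.1]
    refine ⟨fun h => h.1.1, fun h => ⟨⟨h, hy.2.2⟩, hP.ball_subset ?_⟩⟩
    rw [mem_ball_zero_iff, norm_radial (by linarith [hP.σ₀_pos]) hy.1]
    linarith [hy.2.2]
  have hΦSB : Φ.target ⊆ SB := by
    intro y hy
    have : ‖y‖ ∈ Ioo (Real.exp n₁) (Real.exp (n₁ + ξ₂ - σ₀)) := hy.1
    have h0 : y ≠ 0 := norm_pos_iff.1 ((Real.exp_pos _).trans this.1)
    rw [mem_Ioo, hlog y h0, hlog' y h0] at this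
    exact ⟨h0, by linarith [hP.neck_lt], this.2⟩
  -- The gluing requires a point outside the removed ball; a point of radius midway between σ₀ and
  -- ξ₂ will do.
  have hne : (C.closedChartBall σ₀)ᶜ.Nonempty := by
    have hr : (0 : ℝ) < (σ₀ + ξ₂) / 2 := by linarith [hP.σ₀_pos]
    have h1 : ‖EuclideanSpace.single (0 : Fin 4) ((σ₀ + ξ₂) / 2)‖ = (σ₀ + ξ₂) / 2 := by
      rw [PiLp.norm_single, Real.norm_of_nonneg hr.le]
    have h2 : EuclideanSpace.single (0 : Fin 4) ((σ₀ + ξ₂) / 2) ∈ C.chart.target :=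
      hP.ball_subset (by rw [mem_ball_zero_iff, h1]; linarith)
    refine ⟨C.chart.symm (EuclideanSpace.single (0 : Fin 4) ((σ₀ + ξ₂) / 2)), fun h => ?_⟩
    have h3 : C.chart (C.chart.symm (EuclideanSpace.single (0 : Fin 4) ((σ₀ + ξ₂) / 2))) = _ :=
      C.chart.right_inv h2
    have := h.2
    rw [h3, h1] at this
    linarith
  obtain ⟨W₁, top₁, cs₁, man₁, jM₁, jN₁, hM₁, hN₁, hcov₁, hmem₁, hglue₁⟩ :=
    exists_glue_manifold (I := I) (I₁ := I) (I₂ := 𝓘(ℝ, E4)) (A := M) (B := E4)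
      (fun x => ⟨chartAt H x, mem_chart_source H x, isSmoothPH_chart (chart_mem_atlas H x)⟩)
      (fun y => ⟨φ, by rw [hφ]; exact mem_univ _, hφs⟩)
      (C.closedChartBall σ₀)ᶜ SB Φ hclM.isOpen_compl hSBo hne
      (fun x hx h => not_lt.2 h.2 ((hΦs x).1 hx).2.1) hΦSB
  have hmem₁' : ∀ y ∈ SB, jN₁ y ∈ jM₁.target ↔ n₁ < Real.log ‖y‖ := fun y hy => by
    rw [hmem₁ y hy, hΦt y hy]
  let Ψ := neckProjective (kappa Λ) τ₀ n₀ hκ hP.τ₀_pos hτ'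
  let Θ : PartialDiffeomorph 𝓘(ℝ, E4) 𝓘(ℝ, E4) E4 CP2 ∞ :=
    Ψ.trans (isSmoothPH_CP2_chart 0).symm.toPartialDiffeomorph
  have hΘs : ∀ y, y ∈ SB → (y ∈ Θ.source ↔ Real.log ‖y‖ < n₀) := by
    intro y hy
    have : y ∈ Θ.source ↔ ‖y‖ ∈ Ioo (Real.exp (n₀ + τ₀ - Real.pi / (2 * kappa Λ))) (Real.exp n₀)
      ∧ Ψ y ∈ (univ : Set E4) := Iff.rfl
    rw [this, mem_Ioo, hlog y hy.1, hlog' y hy.1]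
    exact ⟨fun h => h.1.2, fun h => ⟨⟨hy.2.1, h⟩, mem_univ _⟩⟩
  have hΘSB : Θ.source ⊆ SB := by
    intro y hy
    have : ‖y‖ ∈ Ioo (Real.exp (n₀ + τ₀ - Real.pi / (2 * kappa Λ))) (Real.exp n₀) := hy.1
    have h0 : y ≠ 0 := norm_pos_iff.1 ((Real.exp_pos _).trans this.1)
    rw [mem_Ioo, hlog y h0, hlog' y h0] at this
    exact ⟨h0, this.1, by linarith [hP.neck_lt]⟩
  have hΘt : Θ.target ⊆ (CP2.closedBall Λ τ₀)ᶜ := by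
    rintro p hp ⟨x, hx, rfl⟩
    have h1 : (CP2.chart 0) ((CP2.chart 0).symm x) ∈ Ψ.target := hp.2
    rw [(CP2.chart 0).right_inv (mem_univ _)] at h1
    have h2 : Real.tan (kappa Λ * τ₀) < ‖x‖ := h1
    rw [tan_kappa_lt_iff hκ hP.τ₀_pos hτ'] at h2
    exact not_lt.2 hx h2
  -- The second coordinate change, read in the first gluing through its neck chart.
  let Ξ : PartialDiffeomorph I 𝓘(ℝ, E4) W₁ CP2 ∞ := jN₁.symm.trans Θ
  have hclC : IsClosed (CP2.closedBall Λ τ₀) :=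
    (CP2.isCompact_closedBall hP.Λ_pos hP.τ₀_pos hτ').isClosed
  have hne₁ : (univ : Set W₁).Nonempty := by
    obtain ⟨x, hx⟩ := hne
    exact ⟨jM₁ x, mem_univ _⟩
  have hΞt : Ξ.target ⊆ (CP2.closedBall Λ τ₀)ᶜ := fun p hp => hΘt hp.1
  obtain ⟨W, top, cs, man, jA, jC, hA, hC, hcov, hmem, hglue⟩ :=
    exists_glue_manifold (I := I) (I₁ := I) (I₂ := 𝓘(ℝ, E4)) (A := W₁) (B := CP2)
      (fun x => ⟨chartAt H x, mem_chart_source H x, isSmoothPH_chart (chart_mem_atlas H x)⟩)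
      (fun p => ⟨(CP2.chart (CP2.index p)).trans φ,
        ⟨CP2.mem_dom_index p, by rw [mem_preimage, hφ]; exact mem_univ _⟩,
        (isSmoothPH_CP2_chart _).trans hφs⟩)
      univ (CP2.closedBall Λ τ₀)ᶜ Ξ isOpen_univ hclC.isOpen_compl hne₁ (subset_univ _) hΞt
  have hAinj : ∀ {w w'}, jA w = jA w' → w = w' := fun {w w'} h =>
    jA.injOn (by rw [hA]; exact mem_univ _) (by rw [hA]; exact mem_univ _) h
  have hMs : ∀ x, x ∈ (jM₁.trans jA).source ↔ x ∈ (C.closedChartBall σ₀)ᶜ := fun x => by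
    have : x ∈ (jM₁.trans jA).source ↔ x ∈ jM₁.source ∧ jM₁ x ∈ jA.source := Iff.rfl
    rw [this, hA, hM₁]
    simp
  have hNs : ∀ x, x ∈ (jN₁.trans jA).source ↔ x ∈ SB := fun x => by
    have : x ∈ (jN₁.trans jA).source ↔ x ∈ jN₁.source ∧ jN₁ x ∈ jA.source := Iff.rfl
    rw [this, hA, hN₁]
    simp
  have hAt : ∀ w, jA w ∈ jA.target := fun w => jA.map_source (by rw [hA]; exact mem_univ _)
  have hMt : ∀ w, jA w ∈ (jM₁.trans jA).target ↔ w ∈ jM₁.target := fun w => by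
    have : jA w ∈ (jM₁.trans jA).target ↔ jA w ∈ jA.target ∧ jA.symm (jA w) ∈ jM₁.target := Iff.rfl
    rw [this, show jA.symm (jA w) = w from jA.left_inv (by rw [hA]; exact mem_univ _)]
    exact and_iff_right (hAt w)
  have hNt : ∀ w, jA w ∈ (jN₁.trans jA).target ↔ w ∈ jN₁.target := fun w => by
    have : jA w ∈ (jN₁.trans jA).target ↔ jA w ∈ jA.target ∧ jA.symm (jA w) ∈ jN₁.target := Iff.rfl
    rw [this, show jA.symm (jA w) = w from jA.left_inv (by rw [hA]; exact mem_univ _)]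
    exact and_iff_right (hAt w)
  have hCt : ∀ w, jA w ∈ jC.target ↔ w ∈ Ξ.source := fun w => by
    constructor
    · intro h
      have h1 : jC.symm (jA w) ∈ jC.source := jC.map_target h
      have h2 : jC (jC.symm (jA w)) = jA w := jC.right_inv h
      have h3 : jC.symm (jA w) ∈ Ξ.target := by
        rw [← hmem _ (hC ▸ h1), h2]
        exact hAt w
      have h4 := hglue _ h3
      rw [h2] at h4
      rw [hAinj h4]
      exact Ξ.map_target h3
    · intro h
      have h1 : Ξ w ∈ Ξ.target := Ξ.map_source h
      have h2 := hglue _ h1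
      rw [show Ξ.symm (Ξ w) = w from Ξ.left_inv h] at h2
      rw [← h2]
      exact jC.map_source (by rw [hC]; exact hΞt h1)
  have hΞs : ∀ y ∈ SB, jN₁ y ∈ Ξ.source ↔ Real.log ‖y‖ < n₀ := fun y hy => by
    have : jN₁ y ∈ Ξ.source ↔ jN₁ y ∈ jN₁.target ∧ jN₁.symm (jN₁ y) ∈ Θ.source := Iff.rfl
    rw [this, show jN₁.symm (jN₁ y) = y from jN₁.left_inv (hN₁ ▸ hy), hΘs y hy]
    exact and_iff_right (jN₁.map_source (hN₁ ▸ hy))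
  refine ⟨W, top, cs, man, jM₁.trans jA, jN₁.trans jA, jC, ?_⟩
  refine
    { source_M := Set.ext hMs
      source_C := hC
      source_N := Set.ext hNs
      cover := ?_
      disjoint := ?_
      mem_M_iff := ?_
      mem_C_iff := ?_
      glue_M := ?_
      glue_C := ?_ }
  · refine eq_univ_of_forall fun w => ?_
    rcases (hcov ▸ mem_univ w : w ∈ jA.target ∪ jC.target) with h | h
    · left
      have h2 : jA (jA.symm w) = w := jA.right_inv h
      rw [← h2]
      rcases (hcov₁ ▸ mem_univ _ : jA.symm w ∈ jM₁.target ∪ jN₁.target) with h | h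
      · exact Or.inl ((hMt _).2 h)
      · exact Or.inr ((hNt _).2 h)
    · exact Or.inr h
  -- A common point would be a point of the neck with n₁ < log ‖y‖ < n₀.
  · rw [Set.disjoint_left]
    intro w h1 h2
    have h3 : jA (jA.symm w) = w := jA.right_inv h1.1
    rw [← h3, hCt] at h2
    rw [← h3, hMt] at h1
    have h4 : jN₁ (jN₁.symm (jA.symm w)) = jA.symm w := jN₁.right_inv h2.1
    have h5 : jN₁.symm (jA.symm w) ∈ SB := hΘSB h2.2
    rw [← h4] at h1 h2
    have h6 := (hmem₁' _ h5).1 h1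
    have h7 := (hΞs _ h5).1 h2
    linarith [hP.neck_lt]
  · intro y hy
    rw [hNs] at hy
    rw [← hmem₁' y hy]
    exact hMt _
  · intro y hy
    rw [hNs] at hy
    rw [← hΞs y hy]
    exact hCt _
  · intro y hy hn
    rw [hNs] at hy
    exact congrArg jA (hglue₁ y ((hΦt y hy).2 hn))
  · intro y hy hn
    rw [hNs] at hy
    have h1 := (hΞs y hy).2 hn
    have h2 := hglue _ (Ξ.map_source h1)
    rw [show Ξ.symm (Ξ (jN₁ y)) = jN₁ y from Ξ.left_inv h1] at h2
    refine h2.symm.trans (congrArg jC ?_)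
    change Θ (jN₁.symm (jN₁ y)) = _
    rw [show jN₁.symm (jN₁ y) = y from jN₁.left_inv (hN₁ ▸ hy)]
    rfl

end Existence
/-! ### Topology of `CP2` and of the connected sum -/

namespace CP2

/-- The orthogonal projector onto a complex line, as a matrix. -/
noncomputable def projector : CP2 → Fin 3 → Fin 3 → ℂ :=
  Projectivization.lift
    (fun v i j => v.1 i * star (v.1 j) / (∑ k, v.1 k * star (v.1 k))) (by
    rintro ⟨a, ha⟩ ⟨b, hb⟩ t (h : a = t • b)
    have ht : t ≠ 0 := by
      rintro rfl
      exact ha (by simpa using h)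
    have ht' : star t ≠ 0 := star_ne_zero.2 ht
    subst h
    funext i j
    simp only [Pi.smul_apply, smul_eq_mul, star_mul']
    rw [show ∑ k, t * b k * (star t * star (b k)) = (t * star t) * ∑ k, b k * star (b k) by
      rw [Finset.mul_sum]; exact Finset.sum_congr rfl fun k _ => by ring]
    rw [show t * b i * (star t * star (b j)) = (t * star t) * (b i * star (b j)) by ring,
      mul_div_mul_left _ _ (mul_ne_zero ht ht')])

theorem projector_mk (v : {v : Fin 3 → ℂ // v ≠ 0}) (i j : Fin 3) :
    projector (mk v) i j = v.1 i * star (v.1 j) / (∑ k, v.1 k * star (v.1 k)) := rfl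

theorem sum_mul_star_ne_zero {v : Fin 3 → ℂ} (hv : v ≠ 0) : ∑ k, v k * star (v k) ≠ 0 := by
  have h : ∑ k, v k * star (v k) = ((∑ k, Complex.normSq (v k) : ℝ) : ℂ) := by
    push_cast
    exact Finset.sum_congr rfl fun k _ => Complex.mul_conj (v k)
  rw [h, Complex.ofReal_ne_zero]
  intro h0
  apply hv
  funext k
  exact Complex.normSq_eq_zero.1
    ((Finset.sum_eq_zero_iff_of_nonneg fun k _ => Complex.normSq_nonneg _).1 h0 k (Finset.mem_univ k))

theorem continuous_projector : Continuous projector := by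
  rw [isQuotientMap_mk.continuous_iff]
  refine continuous_pi fun i => continuous_pi fun j => ?_
  have hc : ∀ k, Continuous fun v : {v : Fin 3 → ℂ // v ≠ 0} => v.1 k := fun k =>
    (continuous_apply k).comp continuous_subtype_val
  exact ((hc i).mul (hc j).star).div (continuous_finsetSum _ fun k _ => (hc k).mul (hc k).star)
    fun v => sum_mul_star_ne_zero v.2

/-- Equal projectors mean v_i v̄_j |w|² = w_i w̄_j |v|² for all i, j. For a j with w_j ≠ 0 also v_j
≠ 0, and v is w times a factor that does not involve i. Since the projector is continuous, the
Hausdorff property follows. -/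
theorem projector_injective : Function.Injective projector := by
  intro p q h
  obtain ⟨v, rfl⟩ := mk_surjective p
  obtain ⟨w, rfl⟩ := mk_surjective q
  have hv := sum_mul_star_ne_zero v.2
  have hw := sum_mul_star_ne_zero w.2
  have h' : ∀ i j, v.1 i * star (v.1 j) * (∑ k, w.1 k * star (w.1 k)) =
      w.1 i * star (w.1 j) * (∑ k, v.1 k * star (v.1 k)) := fun i j => by
    have := congrFun (congrFun h i) j
    rwa [projector_mk, projector_mk, div_eq_div_iff hv hw] at this
  obtain ⟨j, hj⟩ : ∃ j, w.1 j ≠ 0 := by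
    by_contra! h0
    exact w.2 (funext h0)
  have hvj : v.1 j ≠ 0 := by
    intro h0
    have := h' j j
    rw [h0] at this
    simp only [zero_mul] at this
    exact mul_ne_zero (mul_ne_zero hj (star_ne_zero.2 hj)) hv this.symm
  have hvj' := star_ne_zero.2 hvj
  rw [mk_eq_mk]
  refine ⟨star (w.1 j) * (∑ k, v.1 k * star (v.1 k)) /
    (star (v.1 j) * ∑ k, w.1 k * star (w.1 k)), ?_⟩
  funext i
  rw [Pi.smul_apply, smul_eq_mul, div_mul_eq_mul_div, div_eq_iff (mul_ne_zero hvj' hw)]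
  linear_combination -h' i j

instance : T2Space CP2 := T2Space.of_injective_continuous projector_injective continuous_projector

instance : CompactSpace CP2 := by
  -- The norm here is the supremum norm; only compactness of the sphere and the fact that it meets
  -- every complex line are used.
  let S := Metric.sphere (0 : Fin 3 → ℂ) 1
  have hS : ∀ v : S, (v : Fin 3 → ℂ) ≠ 0 := fun v h => by
    have := v.2
    rw [h] at this
    simp [S] at this
  let f : S → CP2 := fun v => mk ⟨v, hS v⟩
  have hf : Continuous f := isQuotientMap_mk.continuous.comp
    (Continuous.subtype_mk continuous_subtype_val _)
  have hsurj : Function.Surjective f := by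
    intro p
    obtain ⟨v, rfl⟩ := mk_surjective p
    have hv : ‖v.1‖ ≠ 0 := norm_ne_zero_iff.2 v.2
    refine ⟨⟨((‖v.1‖⁻¹ : ℝ) : ℂ) • v.1, ?_⟩, ?_⟩
    · simp [S, norm_smul, hv]
    · exact (mk_eq_mk _ _).2 ⟨((‖v.1‖⁻¹ : ℝ) : ℂ), rfl⟩
  have : CompactSpace S := isCompact_iff_compactSpace.1 (isCompact_sphere _ _)
  rw [← isCompact_univ_iff, ← hsurj.range_eq]
  exact isCompact_range hf

instance : SecondCountableTopology CP2 := by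
  have : ∀ i : Fin 3, SecondCountableTopology (chart i).source := fun i =>
    (chart i).secondCountableTopology_source
  exact TopologicalSpace.secondCountableTopology_of_countable_cover (fun i => (chart i).open_source)
    (eq_univ_of_forall fun p => mem_iUnion.2 ⟨index p, mem_dom_index p⟩)

end CP2

/-! ### Topological properties transported by partial diffeomorphisms -/

section Topology

variable {𝕜 : Type*} [NontriviallyNormedField 𝕜]
  {E₁ : Type*} [NormedAddCommGroup E₁] [NormedSpace 𝕜 E₁] {H₁ : Type*} [TopologicalSpace H₁]
  {E₂ : Type*} [NormedAddCommGroup E₂] [NormedSpace 𝕜 E₂] {H₂ : Type*} [TopologicalSpace H₂]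
  {I₁ : ModelWithCorners 𝕜 E₁ H₁} {I₂ : ModelWithCorners 𝕜 E₂ H₂}
  {X : Type*} [TopologicalSpace X] [ChartedSpace H₁ X]
  {Y : Type*} [TopologicalSpace Y] [ChartedSpace H₂ Y]

theorem isOpen_image_partialDiffeomorph (f : PartialDiffeomorph I₁ I₂ X Y ∞) {s : Set X}
    (hs : IsOpen s) (h : s ⊆ f.source) : IsOpen (f '' s) :=
  f.toOpenPartialHomeomorph.isOpen_image_of_subset_source hs h

theorem isCompact_image_partialDiffeomorph (f : PartialDiffeomorph I₁ I₂ X Y ∞) {s : Set X}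
    (hs : IsCompact s) (h : s ⊆ f.source) : IsCompact (f '' s) :=
  hs.image_of_continuousOn (f.contMDiffOn_toFun.continuousOn.mono h)

theorem secondCountableTopology_target (f : PartialDiffeomorph I₁ I₂ X Y ∞)
    [SecondCountableTopology X] : SecondCountableTopology f.target :=
  f.toOpenPartialHomeomorph.toHomeomorphSourceTarget.symm.secondCountableTopology

theorem separated_of_mem_target [T2Space X] (f : PartialDiffeomorph I₁ I₂ X Y ∞) {y y' : Y}
    (hy : y ∈ f.target) (hy' : y' ∈ f.target) (h : y ≠ y') :
    ∃ U V : Set Y, IsOpen U ∧ IsOpen V ∧ y ∈ U ∧ y' ∈ V ∧ Disjoint U V := by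
  have hne : f.symm y ≠ f.symm y' := fun h' => h (f.symm.injOn hy hy' h')
  obtain ⟨U, V, hU, hV, hyU, hyV, hd⟩ := t2_separation hne
  refine ⟨_, _, isOpen_image_partialDiffeomorph f (hU.inter f.open_source) inter_subset_right,
    isOpen_image_partialDiffeomorph f (hV.inter f.open_source) inter_subset_right,
    ⟨_, ⟨hyU, f.map_target hy⟩, f.right_inv hy⟩, ⟨_, ⟨hyV, f.map_target hy'⟩, f.right_inv hy'⟩, ?_⟩
  rw [Set.disjoint_left]
  rintro _ ⟨a, ha, rfl⟩ ⟨b, hb, hab⟩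
  have := f.injOn hb.2 ha.2 hab
  exact Set.disjoint_left.1 hd ha.1 (this ▸ hb.1)

end Topology

/-! ### Separation, countability, compactness and boundary of the connected sum -/

section NeckSumTopology

variable {H : Type v} [TopologicalSpace H] {I : ModelWithCorners ℝ E4 H}
variable {M : Type u} [TopologicalSpace M] [ChartedSpace H M] [IsManifold I ∞ M]
variable {C : MorseCobordism I M} {Λ τ₀ χ₁ σ₀ ξ₁ ξ₂ R n₀ n₁ : ℝ}
variable {W : Type u} [TopologicalSpace W] [ChartedSpace H W]
variable {jM : PartialDiffeomorph I I M W ∞} {jN : PartialDiffeomorph 𝓘(ℝ, E4) I E4 W ∞}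
  {jC : PartialDiffeomorph 𝓘(ℝ, E4) I CP2 W ∞}

theorem norm_exp_smul_unitVec (s : ℝ) {x : E4} (hx : x ≠ 0) :
    Real.log ‖Real.exp s • unitVec x‖ = s := by
  rw [norm_radial (Real.exp_pos s) hx, Real.log_exp]

theorem chi_lt {Λ : ℝ} (hΛ : 0 < Λ) (x : E4) : chi Λ x < Real.pi / (2 * kappa Λ) := by
  have hκ := kappa_pos hΛ
  unfold chi
  rw [div_lt_div_iff₀ hκ (by positivity)]
  nlinarith [Real.arctan_lt_pi_div_two ‖x‖]

theorem kappa_mul_chi {Λ : ℝ} (hΛ : 0 < Λ) (x : E4) : kappa Λ * chi Λ x = Real.arctan ‖x‖ := by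
  have hκ := kappa_pos hΛ
  unfold chi
  field_simp

theorem ne_zero_of_chi_pos {Λ : ℝ} {x : E4} (h : 0 < chi Λ x) : x ≠ 0 := by
  rintro rfl
  simp [chi] at h

/-- The point of the neck over a point of the Morse annulus. -/
theorem IsNeckSum.exists_neck_of_chart (hS : IsNeckSum C Λ τ₀ σ₀ ξ₂ n₀ n₁ jM jN jC)
    (hP : GluingParameters C Λ τ₀ χ₁ σ₀ ξ₁ ξ₂ R n₀ n₁) {x : E4} (h₁ : σ₀ < ‖x‖) (h₂ : ‖x‖ < ξ₂) :
    Real.exp (‖x‖ - σ₀ + n₁) • unitVec x ∈ jN.source ∧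
      jN (Real.exp (‖x‖ - σ₀ + n₁) • unitVec x) = jM (C.chart.symm x) := by
  have hx : x ≠ 0 := norm_pos_iff.1 (hP.σ₀_pos.trans h₁)
  have hlog := norm_exp_smul_unitVec (‖x‖ - σ₀ + n₁) hx
  have hκ := kappa_pos hP.Λ_pos
  have hτ' : τ₀ < Real.pi / (2 * kappa Λ) := hP.τ₀_lt.trans hP.χ₁_lt
  have hs : Real.exp (‖x‖ - σ₀ + n₁) • unitVec x ∈ jN.source := by
    rw [hS.source_N]
    refine ⟨smul_ne_zero (Real.exp_pos _).ne' (unitVec_ne_zero hx), ?_⟩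
    rw [hlog]
    exact ⟨by linarith [hP.neck_lt], by linarith⟩
  refine ⟨hs, ?_⟩
  rw [hS.glue_M _ hs (by rw [hlog]; linarith), hlog, unitVec_radial (Real.exp_pos _) hx,
    show σ₀ + (‖x‖ - σ₀ + n₁) - n₁ = ‖x‖ by ring, norm_smul_unitVec]

/-- The point of the neck over a point of the projective annulus. -/
theorem IsNeckSum.exists_neck_of_chi (hS : IsNeckSum C Λ τ₀ σ₀ ξ₂ n₀ n₁ jM jN jC)
    (hP : GluingParameters C Λ τ₀ χ₁ σ₀ ξ₁ ξ₂ R n₀ n₁) {x : E4} (h₁ : τ₀ < chi Λ x) :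
    Real.exp (τ₀ + n₀ - chi Λ x) • unitVec x ∈ jN.source ∧
      jN (Real.exp (τ₀ + n₀ - chi Λ x) • unitVec x) = jC ((CP2.chart 0).symm x) := by
  have hx : x ≠ 0 := ne_zero_of_chi_pos (hP.τ₀_pos.trans h₁)
  have hlog := norm_exp_smul_unitVec (τ₀ + n₀ - chi Λ x) hx
  have hs : Real.exp (τ₀ + n₀ - chi Λ x) • unitVec x ∈ jN.source := by
    rw [hS.source_N]
    refine ⟨smul_ne_zero (Real.exp_pos _).ne' (unitVec_ne_zero hx), ?_⟩
    rw [hlog]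
    exact ⟨by linarith [chi_lt hP.Λ_pos x],
      by linarith [hP.neck_lt, hP.σ₀_lt, hP.ξ₁_lt]⟩
  refine ⟨hs, ?_⟩
  rw [hS.glue_C _ hs (by rw [hlog]; linarith), hlog, unitVec_radial (Real.exp_pos _) hx,
    show τ₀ + n₀ - (τ₀ + n₀ - chi Λ x) = chi Λ x by ring, kappa_mul_chi hP.Λ_pos, Real.tan_arctan,
    norm_smul_unitVec]

/-- The converse of `IsNeckSum.exists_neck_of_chart`: injectivity of `jM` identifies every point
shared by M and the neck, together with its radius. -/
theorem IsNeckSum.chart_of_glue (hS : IsNeckSum C Λ τ₀ σ₀ ξ₂ n₀ n₁ jM jN jC)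
    (hP : GluingParameters C Λ τ₀ χ₁ σ₀ ξ₁ ξ₂ R n₀ n₁) {x : M} {y : E4} (hx : x ∈ jM.source)
    (hy : y ∈ jN.source) (h : jN y = jM x) :
    n₁ < Real.log ‖y‖ ∧ x ∈ C.chart.source ∧
      C.chart x = (σ₀ + Real.log ‖y‖ - n₁) • unitVec y ∧
      ‖C.chart x‖ = σ₀ + Real.log ‖y‖ - n₁ := by
  have h1 : n₁ < Real.log ‖y‖ := by
    rw [← hS.mem_M_iff y hy, h]
    exact jM.map_source hx
  have hy' := hy
  rw [hS.source_N] at hy'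
  have h2 := hS.glue_M y hy h1
  have hn : ‖(σ₀ + Real.log ‖y‖ - n₁) • unitVec y‖ = σ₀ + Real.log ‖y‖ - n₁ :=
    norm_radial (by linarith [hP.σ₀_pos]) hy'.1
  have h3 : (σ₀ + Real.log ‖y‖ - n₁) • unitVec y ∈ C.chart.target := hP.ball_subset (by
    rw [mem_ball_zero_iff, hn]
    linarith [hy'.2.2])
  have h5 : C.chart (C.chart.symm ((σ₀ + Real.log ‖y‖ - n₁) • unitVec y)) =
    (σ₀ + Real.log ‖y‖ - n₁) • unitVec y := C.chart.right_inv h3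
  have h4 : C.chart.symm ((σ₀ + Real.log ‖y‖ - n₁) • unitVec y) ∈ jM.source := by
    rw [hS.source_M]
    intro h
    have := h.2
    rw [h5, hn] at this
    linarith
  have h6 : x = C.chart.symm ((σ₀ + Real.log ‖y‖ - n₁) • unitVec y) :=
    jM.injOn hx h4 (h.symm.trans h2)
  rw [h6, h5]
  exact ⟨h1, C.chart.map_target h3, rfl, hn⟩

theorem norm_tan_smul_unitVec {κ τ : ℝ} (hκ : 0 < κ) (hτ : 0 < τ) (hτ' : τ < Real.pi / (2 * κ))
    {y : E4} (hy : y ≠ 0) : ‖Real.tan (κ * τ) • unitVec y‖ = Real.tan (κ * τ) ∧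
      0 < Real.tan (κ * τ) ∧ Real.arctan (Real.tan (κ * τ)) = κ * τ := by
  have h0 : 0 < κ * τ := mul_pos hκ hτ
  have h1 : κ * τ < Real.pi / 2 := by
    rw [show Real.pi / 2 = κ * (Real.pi / (2 * κ)) by field_simp]
    gcongr
  have := Real.tan_pos_of_pos_of_lt_pi_div_two h0 h1
  exact ⟨norm_radial this hy, this, Real.arctan_tan (by linarith) h1⟩

theorem chi_tan_smul_unitVec {Λ τ : ℝ} (hΛ : 0 < Λ) (hτ : 0 < τ)
    (hτ' : τ < Real.pi / (2 * kappa Λ)) {y : E4} (hy : y ≠ 0) :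
    chi Λ (Real.tan (kappa Λ * τ) • unitVec y) = τ := by
  have hκ := kappa_pos hΛ
  obtain ⟨h1, h2, h3⟩ := norm_tan_smul_unitVec hκ hτ hτ' hy
  unfold chi
  rw [h1, h3]
  field_simp

theorem IsNeckSum.chi_of_glue (hS : IsNeckSum C Λ τ₀ σ₀ ξ₂ n₀ n₁ jM jN jC)
    (hP : GluingParameters C Λ τ₀ χ₁ σ₀ ξ₁ ξ₂ R n₀ n₁) {p : CP2} {y : E4} (hp : p ∈ jC.source)
    (hy : y ∈ jN.source) (h : jN y = jC p) :
    Real.log ‖y‖ < n₀ ∧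
      p = (CP2.chart 0).symm (Real.tan (kappa Λ * (τ₀ + n₀ - Real.log ‖y‖)) • unitVec y) ∧
      chi Λ (Real.tan (kappa Λ * (τ₀ + n₀ - Real.log ‖y‖)) • unitVec y) =
        τ₀ + n₀ - Real.log ‖y‖ := by
  have h1 : Real.log ‖y‖ < n₀ := by
    rw [← hS.mem_C_iff y hy, h]
    exact jC.map_source hp
  have hy' := hy
  rw [hS.source_N] at hy'
  have h2 := hS.glue_C y hy h1
  have hc := chi_tan_smul_unitVec hP.Λ_pos (τ := τ₀ + n₀ - Real.log ‖y‖)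
    (by linarith [hP.τ₀_pos]) (by linarith [hy'.2.1]) hy'.1
  refine ⟨h1, jC.injOn hp ?_ (h.symm.trans h2), hc⟩
  rw [hS.source_C]
  intro h
  have := (CP2.mem_closedBall_iff _).1 h
  rw [hc] at this
  linarith

/-- Radii strictly between the removed sphere and the surgery sphere: cutting there splits W into
pieces that overlap only in spheres. -/
theorem GluingParameters.lt_mid (hP : GluingParameters C Λ τ₀ χ₁ σ₀ ξ₁ ξ₂ R n₀ n₁) :
    (σ₀ < (σ₀ + ξ₁) / 2 ∧ (σ₀ + ξ₁) / 2 < ξ₁) ∧ (τ₀ < (τ₀ + χ₁) / 2 ∧ (τ₀ + χ₁) / 2 < χ₁) :=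
  ⟨⟨by linarith [hP.σ₀_lt], by linarith [hP.σ₀_lt]⟩,
    ⟨by linarith [hP.τ₀_lt], by linarith [hP.τ₀_lt]⟩⟩

theorem isOpen_log_norm_lt (c : ℝ) : IsOpen {y : E4 | y ≠ 0 ∧ Real.log ‖y‖ < c} := by
  rw [isOpen_iff_mem_nhds]
  rintro y ⟨h0, h1⟩
  have hc : ContinuousAt (fun y : E4 => Real.log ‖y‖) y :=
    (Real.continuousAt_log (norm_ne_zero_iff.2 h0)).comp continuous_norm.continuousAt
  filter_upwards [isOpen_ne.mem_nhds h0, hc.eventually (gt_mem_nhds h1)] with z h0 h1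
  exact ⟨h0, h1⟩

theorem isOpen_lt_log_norm (c : ℝ) : IsOpen {y : E4 | y ≠ 0 ∧ c < Real.log ‖y‖} := by
  rw [isOpen_iff_mem_nhds]
  rintro y ⟨h0, h1⟩
  have hc : ContinuousAt (fun y : E4 => Real.log ‖y‖) y :=
    (Real.continuousAt_log (norm_ne_zero_iff.2 h0)).comp continuous_norm.continuousAt
  filter_upwards [isOpen_ne.mem_nhds h0, hc.eventually (lt_mem_nhds h1)] with z h0 h1
  exact ⟨h0, h1⟩

/-- Two points of one patch are separated inside it, and the images of M and of the projective plane
are disjoint. The remaining case is a point of a summand off the neck against a point of the neck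
off that summand; the sphere of the intermediate radius separates them, because a point of the
summand within that radius would lie on the neck. -/
theorem IsNeckSum.t2Space [T2Space M] (hS : IsNeckSum C Λ τ₀ σ₀ ξ₂ n₀ n₁ jM jN jC)
    (hP : GluingParameters C Λ τ₀ χ₁ σ₀ ξ₁ ξ₂ R n₀ n₁) : T2Space W := by
  obtain ⟨⟨hσ1, hσ2⟩, ⟨hτ1, hτ2⟩⟩ := hP.lt_mid
  have hMN : ∀ w ∈ jM.target, ∀ w' ∈ jN.target, w ≠ w' →
      ∃ U V : Set W, IsOpen U ∧ IsOpen V ∧ w ∈ U ∧ w' ∈ V ∧ Disjoint U V := by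
    intro w hw w' hw' hne
    by_cases h1 : w' ∈ jM.target
    · exact separated_of_mem_target jM hw h1 hne
    by_cases h2 : w ∈ jN.target
    · exact separated_of_mem_target jN h2 hw' hne
    have hcl : IsClosed (C.closedChartBall ((σ₀ + ξ₁) / 2)) :=
      MorseCobordism.isClosed_closedChartBall (hP.closedBall_subset (hσ2.trans hP.ξ₁_lt))
    refine ⟨_, _, isOpen_image_partialDiffeomorph jM (hcl.isOpen_compl.inter jM.open_source)
      inter_subset_right, isOpen_image_partialDiffeomorph jN
      ((isOpen_log_norm_lt (n₁ + (σ₀ + ξ₁) / 2 - σ₀)).inter jN.open_source) inter_subset_right,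
      ⟨jM.symm w, ⟨fun h => h2 ?_, jM.map_target hw⟩, jM.right_inv hw⟩,
      ⟨jN.symm w', ⟨?_, jN.map_target hw'⟩, jN.right_inv hw'⟩, ?_⟩
    · have h3 : σ₀ < ‖C.chart (jM.symm w)‖ := by
        by_contra h4
        have h5 : jM.symm w ∈ jM.source := jM.map_target hw
        rw [hS.source_M] at h5
        exact h5 ⟨h.1, not_lt.1 h4⟩
      obtain ⟨h4, h5⟩ := hS.exists_neck_of_chart hP h3 (by linarith [h.2, hP.ξ₁_lt])
      rw [show C.chart.symm (C.chart (jM.symm w)) = jM.symm w from C.chart.left_inv h.1,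
        show jM (jM.symm w) = w from jM.right_inv hw] at h5
      rw [← h5]
      exact jN.map_source h4
    · have h3 : jN.symm w' ∈ jN.source := jN.map_target hw'
      have h4 := h3
      rw [hS.source_N] at h4
      refine ⟨h4.1, ?_⟩
      have h5 : ¬ n₁ < Real.log ‖jN.symm w'‖ := by
        rw [← hS.mem_M_iff _ h3, show jN (jN.symm w') = w' from jN.right_inv hw']
        exact h1
      linarith
    · rw [Set.disjoint_left]
      rintro _ ⟨x, hx, rfl⟩ ⟨y, hy, hxy⟩
      obtain ⟨h3, h4, h5, h6⟩ := hS.chart_of_glue hP hx.2 hy.2 hxy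
      exact hx.1 ⟨h4, by linarith [hy.1.2]⟩
  have hCN : ∀ w ∈ jC.target, ∀ w' ∈ jN.target, w ≠ w' →
      ∃ U V : Set W, IsOpen U ∧ IsOpen V ∧ w ∈ U ∧ w' ∈ V ∧ Disjoint U V := by
    intro w hw w' hw' hne
    by_cases h1 : w' ∈ jC.target
    · exact separated_of_mem_target jC hw h1 hne
    by_cases h2 : w ∈ jN.target
    · exact separated_of_mem_target jN h2 hw' hne
    have hcl : IsClosed (CP2.closedBall Λ ((τ₀ + χ₁) / 2)) :=
      (CP2.isCompact_closedBall hP.Λ_pos (by linarith [hP.τ₀_pos]) (hτ2.trans hP.χ₁_lt)).isClosed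
    refine ⟨_, _, isOpen_image_partialDiffeomorph jC (hcl.isOpen_compl.inter jC.open_source)
      inter_subset_right, isOpen_image_partialDiffeomorph jN
      ((isOpen_lt_log_norm (τ₀ + n₀ - (τ₀ + χ₁) / 2)).inter jN.open_source) inter_subset_right,
      ⟨jC.symm w, ⟨fun h => h2 ?_, jC.map_target hw⟩, jC.right_inv hw⟩,
      ⟨jN.symm w', ⟨?_, jN.map_target hw'⟩, jN.right_inv hw'⟩, ?_⟩
    · obtain ⟨x, hx, hxw⟩ := h
      have h3 : τ₀ < chi Λ x := by
        by_contra h4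
        have h5 : jC.symm w ∈ jC.source := jC.map_target hw
        rw [hS.source_C, ← hxw] at h5
        exact h5 ⟨x, not_lt.1 h4, rfl⟩
      obtain ⟨h4, h5⟩ := hS.exists_neck_of_chi hP h3
      rw [hxw, show jC (jC.symm w) = w from jC.right_inv hw] at h5
      rw [← h5]
      exact jN.map_source h4
    · have h3 : jN.symm w' ∈ jN.source := jN.map_target hw'
      have h4 := h3
      rw [hS.source_N] at h4
      refine ⟨h4.1, ?_⟩
      have h5 : ¬ Real.log ‖jN.symm w'‖ < n₀ := by
        rw [← hS.mem_C_iff _ h3, show jN (jN.symm w') = w' from jN.right_inv hw']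
        exact h1
      linarith
    · rw [Set.disjoint_left]
      rintro _ ⟨x, hx, rfl⟩ ⟨y, hy, hxy⟩
      obtain ⟨h3, h4, h5⟩ := hS.chi_of_glue hP hx.2 hy.2 hxy
      refine hx.1 ?_
      rw [h4, CP2.mem_closedBall_iff, h5]
      linarith [hy.1.2]
  have swap : ∀ {w w' : W}, (∃ U V : Set W, IsOpen U ∧ IsOpen V ∧ w ∈ U ∧ w' ∈ V ∧ Disjoint U V) →
      ∃ U V : Set W, IsOpen U ∧ IsOpen V ∧ w' ∈ U ∧ w ∈ V ∧ Disjoint U V :=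
    fun ⟨U, V, hU, hV, hwU, hwV, hd⟩ => ⟨V, U, hV, hU, hwV, hwU, hd.symm⟩
  refine ⟨fun w w' hne => ?_⟩
  have hw := hS.cover ▸ mem_univ w
  have hw' := hS.cover ▸ mem_univ w'
  rcases hw with (hw | hw) | hw <;> rcases hw' with (hw' | hw') | hw'
  · exact separated_of_mem_target jM hw hw' hne
  · exact hMN w hw w' hw' hne
  · exact ⟨_, _, jM.open_target, jC.open_target, hw, hw', hS.disjoint⟩
  · exact swap (hMN w' hw' w hw hne.symm)
  · exact separated_of_mem_target jN hw hw' hne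
  · exact swap (hCN w' hw' w hw hne.symm)
  · exact ⟨_, _, jC.open_target, jM.open_target, hw, hw', hS.disjoint.symm⟩
  · exact hCN w hw w' hw' hne
  · exact separated_of_mem_target jC hw hw' hne

theorem IsNeckSum.secondCountableTopology [SecondCountableTopology M]
    (hS : IsNeckSum C Λ τ₀ σ₀ ξ₂ n₀ n₁ jM jN jC) : SecondCountableTopology W := by
  let U : Fin 3 → Set W := ![jM.target, jN.target, jC.target]
  have hU : ∀ i, SecondCountableTopology (U i) := by
    intro i
    fin_cases i
    · exact secondCountableTopology_target jM
    · exact secondCountableTopology_target jN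
    · exact secondCountableTopology_target jC
  refine TopologicalSpace.secondCountableTopology_of_countable_cover (U := U) (fun i => ?_) ?_
  · fin_cases i
    · exact jM.open_target
    · exact jN.open_target
    · exact jC.open_target
  · refine eq_univ_of_forall fun w => mem_iUnion.2 ?_
    rcases hS.cover ▸ mem_univ w with (h | h) | h
    · exact ⟨0, h⟩
    · exact ⟨1, h⟩
    · exact ⟨2, h⟩

theorem isCompact_log_norm (a b : ℝ) :
    IsCompact {y : E4 | y ≠ 0 ∧ a ≤ Real.log ‖y‖ ∧ Real.log ‖y‖ ≤ b} := by
  have : {y : E4 | y ≠ 0 ∧ a ≤ Real.log ‖y‖ ∧ Real.log ‖y‖ ≤ b} =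
      Metric.closedBall 0 (Real.exp b) ∩ {y | Real.exp a ≤ ‖y‖} := by
    ext y
    simp only [mem_ofPred_eq, mem_inter_iff, mem_closedBall_zero_iff]
    constructor
    · rintro ⟨h0, h1, h2⟩
      have h0 := norm_pos_iff.2 h0
      exact ⟨(Real.log_le_iff_le_exp h0).1 h2, (Real.le_log_iff_exp_le h0).1 h1⟩
    · rintro ⟨h2, h1⟩
      have h0 : 0 < ‖y‖ := (Real.exp_pos a).trans_le h1
      exact ⟨norm_pos_iff.1 h0, (Real.le_log_iff_exp_le h0).2 h1, (Real.log_le_iff_le_exp h0).2 h2⟩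
  rw [this]
  exact (isCompact_closedBall _ _).inter_right (isClosed_le continuous_const continuous_norm)

theorem CP2.isOpen_ball (Λ τ : ℝ) : IsOpen ((CP2.chart 0).symm '' {x | chi Λ x < τ}) := by
  refine (CP2.chart 0).symm.isOpen_image_of_subset_source ?_ (subset_univ _)
  exact isOpen_lt ((Real.continuous_arctan.comp continuous_norm).div_const _) continuous_const

/-- W is the union of three compact images: the complements of the open balls of intermediate radius
in both summands, and the closed part of the neck between the corresponding spheres. -/
theorem IsNeckSum.compactSpace [CompactSpace M] (hS : IsNeckSum C Λ τ₀ σ₀ ξ₂ n₀ n₁ jM jN jC)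
    (hP : GluingParameters C Λ τ₀ χ₁ σ₀ ξ₁ ξ₂ R n₀ n₁) : CompactSpace W := by
  obtain ⟨⟨hσ1, hσ2⟩, ⟨hτ1, hτ2⟩⟩ := hP.lt_mid
  have hKM : IsCompact (C.chartBall ((σ₀ + ξ₁) / 2))ᶜ :=
    MorseCobordism.isOpen_chartBall.isClosed_compl.isCompact
  have hKC : IsCompact ((CP2.chart 0).symm '' {x | chi Λ x < (τ₀ + χ₁) / 2})ᶜ :=
    (CP2.isOpen_ball _ _).isClosed_compl.isCompact
  have hKN := isCompact_log_norm (n₀ + τ₀ - (τ₀ + χ₁) / 2) (n₁ + (σ₀ + ξ₁) / 2 - σ₀)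
  have hM : (C.chartBall ((σ₀ + ξ₁) / 2))ᶜ ⊆ jM.source := by
    rw [hS.source_M]
    exact compl_subset_compl.2 fun x hx => ⟨hx.1, hx.2.trans_lt hσ1⟩
  have hC : ((CP2.chart 0).symm '' {x | chi Λ x < (τ₀ + χ₁) / 2})ᶜ ⊆ jC.source := by
    rw [hS.source_C]
    exact compl_subset_compl.2 (image_mono fun x hx => lt_of_le_of_lt hx hτ1)
  have hN : {y : E4 | y ≠ 0 ∧ n₀ + τ₀ - (τ₀ + χ₁) / 2 ≤ Real.log ‖y‖ ∧
      Real.log ‖y‖ ≤ n₁ + (σ₀ + ξ₁) / 2 - σ₀} ⊆ jN.source := by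
    rw [hS.source_N]
    rintro y ⟨h0, h1, h2⟩
    exact ⟨h0, by linarith [hP.χ₁_lt], by linarith [hP.ξ₁_lt]⟩
  refine ⟨((isCompact_image_partialDiffeomorph jM hKM hM).union
    ((isCompact_image_partialDiffeomorph jN hKN hN).union
      (isCompact_image_partialDiffeomorph jC hKC hC))).of_isClosed_subset isClosed_univ ?_⟩
  intro w _
  by_cases hw : w ∈ jN.target
  · have h1 : jN (jN.symm w) = w := jN.right_inv hw
    have h2 : jN.symm w ∈ jN.source := jN.map_target hw
    have h3 := h2
    rw [hS.source_N] at h3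
    by_cases h4 : n₁ + (σ₀ + ξ₁) / 2 - σ₀ < Real.log ‖jN.symm w‖
    · have h5 : n₁ < Real.log ‖jN.symm w‖ := by linarith
      have h6 := (hS.mem_M_iff _ h2).2 h5
      rw [h1] at h6
      have h7 : jM (jM.symm w) = w := jM.right_inv h6
      obtain ⟨-, -, -, h8⟩ := hS.chart_of_glue hP (jM.map_target h6) h2 (h1.trans h7.symm)
      refine Or.inl ⟨jM.symm w, fun h9 => ?_, h7⟩
      have h10 : ‖C.chart (jM.symm w)‖ < (σ₀ + ξ₁) / 2 := h9.2
      have h11 : ‖C.chart (jM.symm w)‖ = σ₀ + Real.log ‖jN.symm w‖ - n₁ := h8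
      linarith
    by_cases h5 : Real.log ‖jN.symm w‖ < n₀ + τ₀ - (τ₀ + χ₁) / 2
    · have h6 := (hS.mem_C_iff _ h2).2 (by linarith)
      rw [h1] at h6
      have h7 : jC (jC.symm w) = w := jC.right_inv h6
      obtain ⟨-, h8, h9⟩ := hS.chi_of_glue hP (jC.map_target h6) h2 (h1.trans h7.symm)
      refine Or.inr (Or.inr ⟨jC.symm w, ?_, h7⟩)
      rintro ⟨x, hx, hxw⟩
      have h10 := (CP2.chart 0).symm.injOn (mem_univ _) (mem_univ _) (hxw.trans h8)
      rw [h10] at hx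
      have hx' : chi Λ _ < _ := hx
      rw [h9] at hx'
      linarith
    · exact Or.inr (Or.inl ⟨jN.symm w, ⟨h3.1, not_lt.1 h5, not_lt.1 h4⟩, h1⟩)
  · rcases hS.cover ▸ mem_univ w with (h | h) | h
    · refine Or.inl ⟨jM.symm w, fun h1 => hw ?_, jM.right_inv h⟩
      have h3 : σ₀ < ‖C.chart (jM.symm w)‖ := by
        by_contra h4
        have h5 : jM.symm w ∈ jM.source := jM.map_target h
        rw [hS.source_M] at h5
        exact h5 ⟨h1.1, not_lt.1 h4⟩
      obtain ⟨h4, h5⟩ := hS.exists_neck_of_chart hP h3 (by linarith [h1.2, hP.ξ₁_lt])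
      rw [show C.chart.symm (C.chart (jM.symm w)) = jM.symm w from C.chart.left_inv h1.1,
        show jM (jM.symm w) = w from jM.right_inv h] at h5
      rw [← h5]
      exact jN.map_source h4
    · exact absurd h hw
    · refine Or.inr (Or.inr ⟨jC.symm w, ?_, jC.right_inv h⟩)
      rintro ⟨x, hx, hxw⟩
      have h3 : τ₀ < chi Λ x := by
        by_contra h4
        have h5 : jC.symm w ∈ jC.source := jC.map_target h
        rw [hS.source_C, ← hxw] at h5
        exact h5 ⟨x, not_lt.1 h4, rfl⟩
      obtain ⟨h4, h5⟩ := hS.exists_neck_of_chi hP h3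
      rw [hxw, show jC (jC.symm w) = w from jC.right_inv h] at h5
      exact hw (h5 ▸ jN.map_source h4)

/-- Local diffeomorphisms preserve boundary points, and the neck and the projective plane have none.
For the same reason no boundary point of M lies in the Morse chart, so the removed ball does not
meet the boundary. -/
theorem IsNeckSum.boundary_eq [IsManifold I ∞ W] (hS : IsNeckSum C Λ τ₀ σ₀ ξ₂ n₀ n₁ jM jN jC) :
    I.boundary W = jM '' I.boundary M := by
  have hn : (∞ : WithTop ℕ∞) ≠ 0 := by simp
  have hE : ∀ y : E4, ¬ (𝓘(ℝ, E4)).IsBoundaryPoint y := fun y =>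
    ((𝓘(ℝ, E4)).isInteriorPoint_iff_not_isBoundaryPoint y).1
      BoundarylessManifold.isInteriorPoint
  have hCP : ∀ y : CP2, ¬ (𝓘(ℝ, E4)).IsBoundaryPoint y := fun y =>
    ((𝓘(ℝ, E4)).isInteriorPoint_iff_not_isBoundaryPoint y).1
      BoundarylessManifold.isInteriorPoint
  ext w
  constructor
  · intro hw
    rcases hS.cover ▸ mem_univ w with (h | h) | h
    · refine ⟨jM.symm w, ?_, jM.right_inv h⟩
      have h1 := (jM.isLocalDiffeomorphAt _ _ _ (jM.map_target h)).isBoundaryPoint_iff hn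
      rw [jM.right_inv h] at h1
      exact h1.2 hw
    · have h1 := (jN.isLocalDiffeomorphAt _ _ _ (jN.map_target h)).isBoundaryPoint_iff hn
      rw [jN.right_inv h] at h1
      exact absurd (h1.2 hw) (hE _)
    · have h1 := (jC.isLocalDiffeomorphAt _ _ _ (jC.map_target h)).isBoundaryPoint_iff hn
      rw [jC.right_inv h] at h1
      exact absurd (h1.2 hw) (hCP _)
  · rintro ⟨x, hx, rfl⟩
    have hxs : x ∈ jM.source := by
      rw [hS.source_M]
      intro h
      exact hE _ (((C.chart.isLocalDiffeomorphAt _ _ _ h.1).isBoundaryPoint_iff hn).1 hx)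
    exact ((jM.isLocalDiffeomorphAt _ _ _ hxs).isBoundaryPoint_iff hn).1 hx

end NeckSumTopology
/-! ### The vector field and the metric of `CP2` in homogeneous coordinates -/

namespace CP2

/-- The derivative of `homog i`. -/
noncomputable def tangent (i : Fin 3) (v : E4) : Fin 3 → ℂ := fun m =>
  if m = pivot i then 0 else if m = fst i then ⟨v 0, v 1⟩ else ⟨v 2, v 3⟩

theorem tangent_pivot (i : Fin 3) (y : E4) : tangent i y (pivot i) = 0 := by simp [tangent]

theorem fst_ne_pivot (i : Fin 3) : fst i ≠ pivot i := by fin_cases i <;> decide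

theorem snd_ne_pivot (i : Fin 3) : snd i ≠ pivot i := by fin_cases i <;> decide

theorem snd_ne_fst (i : Fin 3) : snd i ≠ fst i := by fin_cases i <;> decide

theorem tangent_fst (i : Fin 3) (y : E4) : tangent i y (fst i) = ⟨y 0, y 1⟩ := by
  simp [tangent, fst_ne_pivot]

theorem tangent_snd (i : Fin 3) (y : E4) : tangent i y (snd i) = ⟨y 2, y 3⟩ := by
  simp [tangent, snd_ne_pivot, snd_ne_fst]

theorem tangent_injective (i : Fin 3) : Function.Injective (tangent i) := by
  intro v w h
  have h1 := congrFun h (fst i)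
  have h2 := congrFun h (snd i)
  rw [tangent_fst, tangent_fst, Complex.ext_iff] at h1
  rw [tangent_snd, tangent_snd, Complex.ext_iff] at h2
  ext m
  fin_cases m
  · exact h1.1
  · exact h1.2
  · exact h2.1
  · exact h2.2

theorem homog_add_smul (i : Fin 3) (x v : E4) (t : ℝ) (m : Fin 3) :
    homog i (x + t • v) m = homog i x m + t * tangent i v m := by
  rcases index_cases i m with rfl | rfl | rfl
  · simp [homog_pivot, tangent_pivot]
  · simp only [homog_fst, tangent_fst]
    apply Complex.ext <;> simp
  · simp only [homog_snd, tangent_snd]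
    apply Complex.ext <;> simp

theorem contDiffAt_affine_homog {i j : Fin 3} {x : E4} (h : homog i x (pivot j) ≠ 0) :
    ContDiffAt ℝ ∞ (fun y => affine j (homog i y)) x := by
  have hq : ∀ m : Fin 3, ContDiffAt ℝ ∞ (fun y => homog i y m / homog i y (pivot j)) x := fun m => by
    simp only [div_eq_mul_inv]
    exact (contDiff_homog i m).contDiffAt.mul (ContDiffAt.inv (contDiff_homog i _).contDiffAt h)
  have hr := fun m => Complex.reCLM.contDiff.contDiffAt.comp x (hq m)
  have hi := fun m => Complex.imCLM.contDiff.contDiffAt.comp x (hq m)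
  rw [contDiffAt_euclidean]
  intro m
  fin_cases m
  · exact hr (fst j)
  · exact hi (fst j)
  · exact hr (snd j)
  · exact hi (snd j)

/-- The derivative of a coordinate change, in homogeneous coordinates. -/
theorem tangent_fderiv {i j : Fin 3} {x : E4} (h : homog i x (pivot j) ≠ 0) (v : E4) (m : Fin 3) :
    tangent j (fderiv ℝ (fun y => affine j (homog i y)) x v) m =
      (tangent i v m * homog i x (pivot j) - homog i x m * tangent i v (pivot j)) /
        homog i x (pivot j) ^ 2 := by
  set D := fderiv ℝ (fun y => affine j (homog i y)) x v with hD
  have hf : HasFDerivAt (fun y => affine j (homog i y))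
      (fderiv ℝ (fun y => affine j (homog i y)) x) x :=
    ((contDiffAt_affine_homog h).differentiableAt (by simp)).hasFDerivAt
  have hl : HasDerivAt (fun t : ℝ => affine j (homog i (x + t • v))) D 0 := by
    have h1 : HasDerivAt (fun t : ℝ => x + t • v) v 0 := by
      simpa using ((hasDerivAt_id (0 : ℝ)).smul_const v).const_add x
    have h2 : HasFDerivAt (fun y => affine j (homog i y))
      (fderiv ℝ (fun y => affine j (homog i y)) x) (x + (0 : ℝ) • v) := by simpa using hf
    exact h2.comp_hasDerivAt (0 : ℝ) h1
  -- Along a real line both homogeneous coordinates are affine in t, so the derivative of the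
  -- coordinate change is a quotient rule in one variable.
  have hq : ∀ m, HasDerivAt (fun t : ℝ => homog i (x + t • v) m / homog i (x + t • v) (pivot j))
      ((tangent i v m * homog i x (pivot j) - homog i x m * tangent i v (pivot j)) /
        homog i x (pivot j) ^ 2) 0 := by
    intro m
    simp only [homog_add_smul]
    have hk : ∀ m, HasDerivAt (fun t : ℝ => homog i x m + (t : ℂ) * tangent i v m)
        (tangent i v m) 0 := fun m => by
      have := ((Complex.ofRealCLM.hasDerivAt (x := (0 : ℝ))).mul_const
        (tangent i v m)).const_add (homog i x m)
      simpa using this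
    refine ((hk m).div (hk (pivot j)) (by simpa using h)).congr_deriv ?_
    simp
  have hc : ∀ k : Fin 4, HasDerivAt (fun t : ℝ => affine j (homog i (x + t • v)) k) (D k) 0 :=
    fun k => (EuclideanSpace.proj k : E4 →L[ℝ] ℝ).hasFDerivAt.comp_hasDerivAt (0 : ℝ) hl
  rcases index_cases j m with rfl | rfl | rfl
  · rw [tangent_pivot]
    rw [mul_comm, sub_self, zero_div]
  · rw [tangent_fst]
    apply Complex.ext
    · exact (hc 0).unique (Complex.reCLM.hasFDerivAt.comp_hasDerivAt (0 : ℝ) (hq (fst j)))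
    · exact (hc 1).unique (Complex.imCLM.hasFDerivAt.comp_hasDerivAt (0 : ℝ) (hq (fst j)))
  · rw [tangent_snd]
    apply Complex.ext
    · exact (hc 2).unique (Complex.reCLM.hasFDerivAt.comp_hasDerivAt (0 : ℝ) (hq (snd j)))
    · exact (hc 3).unique (Complex.imCLM.hasFDerivAt.comp_hasDerivAt (0 : ℝ) (hq (snd j)))

/-- The nilpotent linear field on `ℂ³` that induces the vector field of `CP2`. -/
noncomputable def linearLift (h : Fin 3 → ℂ) : Fin 3 → ℂ := ![h 1, 0, -h 0]

theorem linearLift_smul (a : ℂ) (h : Fin 3 → ℂ) : linearLift (a • h) = a • linearLift h := by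
  funext m
  fin_cases m <;> simp [linearLift]

/-- The chart expression is the linear field on ℂ³ projected along the line through the base point
to the slice where the pivot coordinate is 1; the subtracted multiple of the base vector cancels the
pivot component. -/
theorem tangent_affineField (i : Fin 3) (x : E4) (m : Fin 3) :
    tangent i (affineField i x) m =
      linearLift (homog i x) m - linearLift (homog i x) (pivot i) * homog i x m := by
  fin_cases i <;> fin_cases m <;> apply Complex.ext <;>
    simp [tangent, affineField, linearLift, homog, pivot, fst] <;> ring

theorem homog_affine_eq {i j : Fin 3} {x : E4} (h : homog i x (pivot j) ≠ 0) :
    homog j (affine j (homog i x)) = (homog i x (pivot j))⁻¹ • homog i x := by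
  rw [eq_inv_smul_iff₀ h]
  exact homog_affine j _ h

/-- The lift is linear, so it commutes with the rescaling that relates the homogeneous vectors of
two charts; both sides are therefore projections of the same field on ℂ³. -/
theorem fderiv_affineField {i j : Fin 3} {x : E4} (h : homog i x (pivot j) ≠ 0) :
    fderiv ℝ (fun y => affine j (homog i y)) x (affineField i x) =
      affineField j (affine j (homog i x)) := by
  apply tangent_injective j
  funext m
  rw [tangent_fderiv h, tangent_affineField, tangent_affineField, tangent_affineField,
    homog_affine_eq h, linearLift_smul]
  simp only [Pi.smul_apply, smul_eq_mul]
  field_simp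
  ring

/-- The standard Hermitian form of `ℂ³`. -/
noncomputable def herm (k l : Fin 3 → ℂ) : ℂ := ∑ m, k m * star (l m)

theorem sum_pivot (i : Fin 3) (f : Fin 3 → ℂ) : ∑ m, f m = f (pivot i) + f (fst i) + f (snd i) := by
  fin_cases i <;> simp [Fin.sum_univ_three, pivot, fst, snd] <;> ring

/-- The Hermitian expression has the same shape in all charts. It is unchanged when base and tangent
vectors are scaled together or a multiple of the base vector is added to a tangent vector, and a
change of chart does just this. -/
theorem fubiniStudyForm_eq (Λ : ℝ) (i : Fin 3) (x v w : E4) :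
    fubiniStudyForm Λ x v w = 6 / Λ *
      ((herm (tangent i v) (tangent i w) * herm (homog i x) (homog i x) -
        herm (tangent i v) (homog i x) * herm (homog i x) (tangent i w)) /
        herm (homog i x) (homog i x) ^ 2).re := by
  have hN : herm (homog i x) (homog i x) = ((1 + ‖x‖ ^ 2 : ℝ) : ℂ) := by
    rw [herm, sum_pivot i, homog_pivot, homog_fst, homog_snd, norm_sq_eq]
    apply Complex.ext <;> simp [pow_two] <;> ring
  have hA : (herm (tangent i v) (tangent i w)).re = ⟪v, w⟫ := by
    rw [herm, sum_pivot i]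
    simp [tangent_pivot, tangent_fst, tangent_snd, inner_eq]
    ring
  have hB : (herm (tangent i v) (homog i x) * herm (homog i x) (tangent i w)).re =
      ⟪x, v⟫ * ⟪x, w⟫ + ⟪mulI x, v⟫ * ⟪mulI x, w⟫ := by
    rw [herm, herm, sum_pivot i, sum_pivot i]
    simp [tangent_pivot, tangent_fst, tangent_snd, homog_fst, homog_snd, inner_eq, mulI]
    ring
  have hp : (1 + ‖x‖ ^ 2 : ℝ) ≠ 0 := by positivity
  rw [hN, ← Complex.ofReal_pow, Complex.div_ofReal_re, Complex.sub_re, Complex.re_mul_ofReal, hA, hB,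
    fubiniStudyForm]
  field_simp

theorem herm_add_smul_left (a b : ℂ) (k h l : Fin 3 → ℂ) :
    herm (a • k + b • h) l = a * herm k l + b * herm h l := by
  simp only [herm, Pi.add_apply, Pi.smul_apply, smul_eq_mul, Finset.mul_sum,
    ← Finset.sum_add_distrib]
  exact Finset.sum_congr rfl fun m _ => by ring

theorem herm_add_smul_right (a b : ℂ) (k h l : Fin 3 → ℂ) :
    herm l (a • k + b • h) = star a * herm l k + star b * herm l h := by
  simp only [herm, Pi.add_apply, Pi.smul_apply, smul_eq_mul, Finset.mul_sum,
    ← Finset.sum_add_distrib, star_add, star_mul']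
  exact Finset.sum_congr rfl fun m _ => by ring

theorem herm_smul_left (a : ℂ) (k l : Fin 3 → ℂ) : herm (a • k) l = a * herm k l := by
  simpa using herm_add_smul_left a 0 k 0 l

theorem herm_smul_right (a : ℂ) (k l : Fin 3 → ℂ) : herm l (a • k) = star a * herm l k := by
  simpa using herm_add_smul_right a 0 k 0 l

theorem fubiniStudyForm_fderiv (Λ : ℝ) {i j : Fin 3} {x : E4} (h : homog i x (pivot j) ≠ 0)
    (v w : E4) :
    fubiniStudyForm Λ (affine j (homog i x)) (fderiv ℝ (fun y => affine j (homog i y)) x v)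
      (fderiv ℝ (fun y => affine j (homog i y)) x w) = fubiniStudyForm Λ x v w := by
  set a := (homog i x (pivot j))⁻¹ with ha
  have ha0 : a ≠ 0 := inv_ne_zero h
  have ha0' : star a ≠ 0 := star_ne_zero.2 ha0
  have ht : ∀ v, ∃ b : ℂ, tangent j (fderiv ℝ (fun y => affine j (homog i y)) x v) =
      a • tangent i v + b • homog i x := by
    intro v
    -- The coefficient is read off from the quotient rule `tangent_fderiv`.
    refine ⟨-tangent i v (pivot j) / homog i x (pivot j) ^ 2, ?_⟩
    funext m
    rw [tangent_fderiv h]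
    simp only [Pi.add_apply, Pi.smul_apply, smul_eq_mul, ha]
    field_simp
    ring
  obtain ⟨b, hb⟩ := ht v
  obtain ⟨c, hc⟩ := ht w
  have hN := sum_mul_star_ne_zero (homog_ne_zero i x)
  change herm (homog i x) (homog i x) ≠ 0 at hN
  rw [fubiniStudyForm_eq Λ j, fubiniStudyForm_eq Λ i x, hb, hc, homog_affine_eq h, ← ha]
  clear_value a
  congr 2
  simp only [herm_add_smul_left, herm_add_smul_right, herm_smul_left, herm_smul_right]
  field_simp
  ring

/-- Tangent vectors are represented in the preferred chart at the base point, so the derivative of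
an inverse chart is that of a coordinate change. This turns global statements into statements about
pairs of charts. -/
theorem mfderiv_chart_symm (i : Fin 3) (x : E4) :
    mfderiv 𝓘(ℝ, E4) 𝓘(ℝ, E4) (chart i).symm x =
      fderiv ℝ (fun y => affine (index ((chart i).symm x)) (homog i y)) x := by
  have h : MDifferentiableAt 𝓘(ℝ, E4) 𝓘(ℝ, E4) (chart i).symm x :=
    ((isSmoothPH_CP2_chart i).symm.contMDiffAt (mem_univ x)).mdifferentiableAt (by simp)
  rw [h.mfderiv, ModelWithCorners.range_eq_univ, fderivWithin_univ]
  rfl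

theorem homog_index_ne_zero (i : Fin 3) (x : E4) :
    homog i x (pivot (index ((chart i).symm x))) ≠ 0 :=
  (mk_mem_dom _ ⟨homog i x, homog_ne_zero i x⟩).1 (mem_dom_index ((chart i).symm x))

theorem mfderiv_chart_symm_affineField (i : Fin 3) (x : E4) :
    mfderiv 𝓘(ℝ, E4) 𝓘(ℝ, E4) (chart i).symm x (affineField i x) = field ((chart i).symm x) := by
  rw [mfderiv_chart_symm]
  exact fderiv_affineField (homog_index_ne_zero i x)

theorem fubiniStudy_mfderiv_chart_symm (Λ : ℝ) (i : Fin 3) (x v w : E4) :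
    fubiniStudy Λ ((chart i).symm x)
      (mfderiv 𝓘(ℝ, E4) 𝓘(ℝ, E4) (chart i).symm x v)
      (mfderiv 𝓘(ℝ, E4) 𝓘(ℝ, E4) (chart i).symm x w) = fubiniStudyForm Λ x v w := by
  rw [mfderiv_chart_symm]
  exact fubiniStudyForm_fderiv Λ (homog_index_ne_zero i x) v w

theorem affineField_zero_eq_zero_iff (y : E4) : affineField 0 y = 0 ↔ y = 0 := by
  constructor
  · intro h
    have h0 := congrArg (fun z : E4 => z 0) h
    have h1 := congrArg (fun z : E4 => z 1) h
    have h2 := congrArg (fun z : E4 => z 2) h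
    have h3 := congrArg (fun z : E4 => z 3) h
    simp [affineField] at h0 h1 h2 h3
    have e2 : y 2 = y 1 ^ 2 - y 0 ^ 2 := by linarith
    have e3 : y 3 = -(2 * y 0 * y 1) := by linarith
    rw [e2, e3] at h2 h3
    -- The first two equations say z₂ = -z₁². The remaining ones, z₁ z₂ = 0, become z₁³ = 0, and
    -- this line is its squared modulus.
    have h4 : (y 0 ^ 2 + y 1 ^ 2) ^ 3 = 0 := by
      linear_combination (y 0 * (y 1 ^ 2 - y 0 ^ 2) + 2 * y 0 * y 1 * y 1) * h2 +
        (-(2 * y 0 * y 1) * y 0 + y 1 * (y 1 ^ 2 - y 0 ^ 2)) * h3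
    have h5 := sq_add_sq_eq_zero (pow_eq_zero_iff (by norm_num) |>.1 h4)
    rw [h5.1, h5.2] at e2 e3
    rw [E4.eq_zero_iff]
    refine ⟨h5.1, h5.2, ?_, ?_⟩ <;> simp [e2, e3]
  · rintro rfl
    ext m
    fin_cases m <;> simp [affineField]

theorem field_eq_zero_iff (p : CP2) : field p = 0 ↔ p = center := by
  -- In the chart numbered 1 the first component forces ζ₁ = 0, and the second is then -1; in the
  -- chart numbered 2 the first component is the constant 1. Only the chart numbered 0 can contain a
  -- zero.
  have hz : ∀ (i : Fin 3) (y : E4), affineField i y = 0 ↔ i = 0 ∧ y = 0 := by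
    intro i y
    fin_cases i
    · simpa using affineField_zero_eq_zero_iff y
    · refine ⟨fun h => ?_, fun h => absurd h.1 (by decide)⟩
      have h0 := congrArg (fun z : E4 => z 0) h
      have h1 := congrArg (fun z : E4 => z 1) h
      have h2 := congrArg (fun z : E4 => z 2) h
      simp [affineField] at h0 h1 h2
      exfalso
      rcases h1 with h1 | h1
      · rw [h1] at h0 h2
        have : y 1 = 0 := pow_eq_zero_iff (two_ne_zero) |>.1 (by linarith)
        rw [this] at h2
        norm_num at h2
      · rw [h1] at h0 h2
        have : y 0 = 0 := pow_eq_zero_iff (two_ne_zero) |>.1 (by linarith)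
        rw [this] at h2
        norm_num at h2
    · refine ⟨fun h => ?_, fun h => absurd h.1 (by decide)⟩
      have h0 := congrArg (fun z : E4 => z 0) h
      simp [affineField] at h0
  have h1 : field p = 0 ↔ index p = 0 ∧ coord (index p) p = 0 := hz _ _
  rw [h1]
  constructor
  · rintro ⟨h2, h3⟩
    have hp : p ∈ dom 0 := h2 ▸ mem_dom_index p
    rw [h2] at h3
    rw [center, ← h3]
    exact ((chart 0).left_inv hp).symm
  · rintro rfl
    have hc : center ∈ dom 0 := (chart 0).map_target (mem_univ _)
    have hi : index center = 0 := by
      unfold index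
      exact if_pos hc
    rw [hi]
    exact ⟨rfl, (chart 0).right_inv (mem_univ _)⟩

end CP2
/-! ### Sections of class `C¹` -/

section Sections

variable {H : Type*} [TopologicalSpace H] {I : ModelWithCorners ℝ E4 H}
  {W : Type*} [TopologicalSpace W] [ChartedSpace H W]
  {K : Type*} [TopologicalSpace K] {J : ModelWithCorners ℝ E4 K}
  {A : Type*} [TopologicalSpace A] [ChartedSpace K A]
  {F : Type*} [NormedAddCommGroup F] [NormedSpace ℝ F]

/-- By finite dimension, a linear map depends linearly and continuously on its values at the
standard basis vectors, so regularity can be tested on fixed vectors. -/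
theorem contMDiffAt_clm_of_apply {n : WithTop ℕ∞} {f : W → E4 →L[ℝ] F} {x₀ : W}
    (h : ∀ v, ContMDiffAt I 𝓘(ℝ, F) n (fun x => f x v) x₀) :
    ContMDiffAt I 𝓘(ℝ, E4 →L[ℝ] F) n f x₀ := by
  let T : (Fin 4 → F) →L[ℝ] (E4 →L[ℝ] F) := ∑ i : Fin 4,
    (ContinuousLinearMap.smulRightL ℝ E4 F (EuclideanSpace.proj i)).comp
      (ContinuousLinearMap.proj i)
  have hT : f = fun x => T (fun i => f x (EuclideanSpace.single i 1)) := by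
    funext x
    ext v
    have hv : v = ∑ i : Fin 4, v i • EuclideanSpace.single i (1 : ℝ) := by
      ext j
      fin_cases j <;> simp [Fin.sum_univ_four]
    conv_lhs => rw [hv]
    simp [T]
  rw [hT]
  exact T.contMDiff.contMDiffAt.comp x₀ (contMDiffAt_pi_space.2 fun i => h _)

/-- A vector field is of class `C¹` at a point. -/
def FieldC1At (I : ModelWithCorners ℝ E4 H) [IsManifold I ∞ W] (X : ∀ x : W, TangentSpace I x)
    (x₀ : W) : Prop :=
  ContMDiffAt I I.tangent 1 (fun x => (⟨x, X x⟩ : TangentBundle I W)) x₀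

/-- A field of bilinear forms is of class `C¹` at a point. -/
def FormC1At (I : ModelWithCorners ℝ E4 H) [IsManifold I ∞ W]
    (Q : ∀ x : W, TangentSpace I x →L[ℝ] TangentSpace I x →L[ℝ] ℝ) (x₀ : W) : Prop :=
  ContMDiffAt I (I.prod 𝓘(ℝ, E4 →L[ℝ] E4 →L[ℝ] ℝ)) 1 (fun x : W =>
    Bundle.TotalSpace.mk' (E4 →L[ℝ] E4 →L[ℝ] ℝ)
      (E := fun x : W => TangentSpace I x →L[ℝ] TangentSpace I x →L[ℝ] ℝ) x (Q x)) x₀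

variable [IsManifold I ∞ W] [IsManifold J ∞ A]

variable (I) in
/-- The local vector field with constant components in the trivialization at `w₀`. -/
noncomputable def frameField (w₀ : W) (v : E4) (x : W) :
    TangentSpace I x :=
  (trivializationAt E4 (TangentSpace I : W → Type _) w₀).symm x v

theorem fieldC1At_frameField (w₀ : W) (v : E4) : FieldC1At I (frameField I w₀ v) w₀ := by
  unfold FieldC1At
  rw [show I.tangent = I.prod 𝓘(ℝ, E4) from rfl]
  refine (Bundle.contMDiffAt_section _).2 ?_
  refine (contMDiffAt_const (c := v)).congr_of_eventuallyEq ?_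
  filter_upwards [(trivializationAt E4 (TangentSpace I : W → Type _) w₀).open_baseSet.mem_nhds
    (FiberBundle.mem_baseSet_trivializationAt' w₀)] with x hx
  exact congrArg Prod.snd ((trivializationAt E4 (TangentSpace I : W → Type _) w₀).apply_mk_symm hx v)

theorem FormC1At.apply {Q : ∀ x : W, TangentSpace I x →L[ℝ] TangentSpace I x →L[ℝ] ℝ} {w₀ : W}
    {X Y : ∀ x : W, TangentSpace I x} (hQ : FormC1At I Q w₀) (hX : FieldC1At I X w₀)
    (hY : FieldC1At I Y w₀) : ContMDiffAt I 𝓘(ℝ, ℝ) 1 (fun x => Q x (X x) (Y x)) w₀ := by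
  have := ContMDiffAt.clm_bundle_apply₂ (F₁ := E4) (F₂ := E4) (F₃ := ℝ)
    (E₁ := fun x : W => TangentSpace I x) (E₂ := fun x : W => TangentSpace I x)
    (E₃ := Bundle.Trivial W ℝ) hQ hX hY
  exact ((Bundle.contMDiffAt_section _).1 this)

theorem eventually_inCoordinates_eq
    (Q : ∀ x : W, TangentSpace I x →L[ℝ] TangentSpace I x →L[ℝ] ℝ) (w₀ : W) :
    ∀ᶠ x in 𝓝 w₀, ∀ v w : E4, ContinuousLinearMap.inCoordinates E4 (TangentSpace I : W → Type _)
      (E4 →L[ℝ] ℝ) (fun x : W => TangentSpace I x →L[ℝ] ℝ) w₀ x w₀ x (Q x) v w =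
      Q x (frameField I w₀ v x) (frameField I w₀ w x) := by
  filter_upwards [(trivializationAt E4 (TangentSpace I : W → Type _) w₀).open_baseSet.mem_nhds
    (FiberBundle.mem_baseSet_trivializationAt' w₀)] with x hx v w
  have := inCoordinates_apply_eq₂ (F₁ := E4) (F₂ := E4) (F₃ := ℝ)
    (E₁ := fun x : W => TangentSpace I x) (E₂ := fun x : W => TangentSpace I x)
    (E₃ := Bundle.Trivial W ℝ) (ϕ := Q x) (v := v) (w := w) hx hx (mem_univ _)
  refine this.trans ?_
  simp only [Bundle.Trivial.fiberBundle_trivializationAt', Bundle.Trivial.linearMapAt_trivialization,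
    LinearMap.id_coe, id_eq]
  rfl

/-- Regularity of a section of the bundle of bilinear forms reduces to scalar functions: the
coordinate expression of Q at fixed vectors is Q evaluated on the corresponding local frame fields.
-/
theorem formC1At_of_apply {Q : ∀ x : W, TangentSpace I x →L[ℝ] TangentSpace I x →L[ℝ] ℝ} {w₀ : W}
    (h : ∀ v w : E4, ContMDiffAt I 𝓘(ℝ, ℝ) 1
      (fun x => Q x (frameField I w₀ v x) (frameField I w₀ w x)) w₀) : FormC1At I Q w₀ := by
  unfold FormC1At
  rw [contMDiffAt_hom_bundle]
  refine ⟨contMDiffAt_id, ?_⟩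
  refine contMDiffAt_clm_of_apply fun v => contMDiffAt_clm_of_apply fun w => ?_
  refine (h v w).congr_of_eventuallyEq ?_
  filter_upwards [eventually_inCoordinates_eq Q w₀] with x hx
  exact hx v w

theorem one_add_one_le_infty : (1 + 1 : WithTop ℕ∞) ≤ ∞ :=
  WithTop.coe_le_coe.2 (show (1 + 1 : ℕ∞) ≤ ⊤ from le_top)

theorem contMDiffAt_mfderiv_apply {H' : Type*} [TopologicalSpace H'] {E' : Type*}
    [NormedAddCommGroup E'] [NormedSpace ℝ E'] {I' : ModelWithCorners ℝ E' H'}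
    {B : Type*} [TopologicalSpace B] [ChartedSpace H' B] [IsManifold I' ∞ B] {ψ : W → B} {w₀ : W}
    (hψ : ContMDiffAt I I' ∞ ψ w₀) {X : ∀ x : W, TangentSpace I x} (hX : FieldC1At I X w₀) :
    ContMDiffAt I I'.tangent 1
      (fun x => (⟨ψ x, mfderiv I I' ψ x (X x)⟩ : TangentBundle I' B)) w₀ := by
  have h1 := hψ.mfderiv_const (m := 1) one_add_one_le_infty
  exact ContMDiffAt.clm_apply_of_inCoordinates (F₁ := E4) (F₂ := E')
    (E₁ := fun x : W => TangentSpace I x) (E₂ := fun x : B => TangentSpace I' x)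
    (b₁ := id) (b₂ := ψ) h1 hX (hψ.of_le (by simp))

theorem contMDiffAt_mfderiv_apply_vectorSpace {E' : Type*}
    [NormedAddCommGroup E'] [NormedSpace ℝ E'] {ψ : W → E'} {w₀ : W}
    (hψ : ContMDiffAt I 𝓘(ℝ, E') ∞ ψ w₀) {X : ∀ x : W, TangentSpace I x} (hX : FieldC1At I X w₀) :
    ContMDiffAt I 𝓘(ℝ, E') 1 (fun x => (show E' from mfderiv I 𝓘(ℝ, E') ψ x (X x))) w₀ := by
  have h := contMDiffAt_mfderiv_apply hψ hX
  rw [show (𝓘(ℝ, E')).tangent = (𝓘(ℝ, E')).prod 𝓘(ℝ, E') from rfl,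
    Bundle.contMDiffAt_totalSpace] at h
  exact h.2.congr_of_eventuallyEq (Eventually.of_forall fun x => by simp; rfl)

theorem FieldC1At.smul {X : ∀ x : W, TangentSpace I x} {k : W → ℝ} {w₀ : W}
    (hk : ContMDiffAt I 𝓘(ℝ, ℝ) 1 k w₀) (hX : FieldC1At I X w₀) :
    FieldC1At I (fun x => k x • X x) w₀ :=
  ContMDiffAt.smul_section hk hX

theorem fieldC1At_iff_contDiffAt {Z : E4 → E4} {y : E4} :
    FieldC1At 𝓘(ℝ, E4) (W := E4) Z y ↔ ContDiffAt ℝ 1 Z y :=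
  contMDiffAt_vectorSpace_iff_contDiffAt

theorem formC1At_of_contDiffAt {G : E4 → E4 →L[ℝ] E4 →L[ℝ] ℝ} {y : E4} (hG : ContDiffAt ℝ 1 G y) :
    FormC1At 𝓘(ℝ, E4) (W := E4) G y := by
  refine formC1At_of_apply fun v w => ?_
  have hv := fieldC1At_iff_contDiffAt.1 (fieldC1At_frameField (I := 𝓘(ℝ, E4)) y v)
  have hw := fieldC1At_iff_contDiffAt.1 (fieldC1At_frameField (I := 𝓘(ℝ, E4)) y w)
  exact ((hG.clm_apply hv).clm_apply hw).contMDiffAt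

theorem FormC1At.apply_comp {G : ∀ x : A, TangentSpace J x →L[ℝ] TangentSpace J x →L[ℝ] ℝ}
    {ψ : W → A} {w₀ : W} (hG : FormC1At J G (ψ w₀)) (hψ : ContMDiffAt I J 1 ψ w₀)
    {X Y : ∀ w : W, TangentSpace J (ψ w)}
    (hX : ContMDiffAt I J.tangent 1 (fun w => (⟨ψ w, X w⟩ : TangentBundle J A)) w₀)
    (hY : ContMDiffAt I J.tangent 1 (fun w => (⟨ψ w, Y w⟩ : TangentBundle J A)) w₀) :
    ContMDiffAt I 𝓘(ℝ, ℝ) 1 (fun w => G (ψ w) (X w) (Y w)) w₀ := by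
  have h1 := ContMDiffAt.comp w₀ hG hψ
  have := ContMDiffAt.clm_bundle_apply₂ (F₁ := E4) (F₂ := E4) (F₃ := ℝ)
    (E₁ := fun x : A => TangentSpace J x) (E₂ := fun x : A => TangentSpace J x)
    (E₃ := Bundle.Trivial A ℝ) (b := ψ) h1 hX hY
  exact (Bundle.contMDiffAt_totalSpace.1 this).2

end Sections

/-! ### Forms and fields transported by a partial diffeomorphism -/

section Patches

variable {H : Type*} [TopologicalSpace H] {I : ModelWithCorners ℝ E4 H}
  {W : Type*} [TopologicalSpace W] [ChartedSpace H W]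
  {K : Type*} [TopologicalSpace K] {J : ModelWithCorners ℝ E4 K}
  {A : Type*} [TopologicalSpace A] [ChartedSpace K A]
  (j : PartialDiffeomorph J I A W ∞)

theorem PartialDiffeomorph.contMDiffAt' {x : A} (hx : x ∈ j.source) : ContMDiffAt J I ∞ j x :=
  j.contMDiffOn_toFun.contMDiffAt (j.open_source.mem_nhds hx)

theorem PartialDiffeomorph.mfderiv_symm_mfderiv {x : A} (hx : x ∈ j.source)
    (v : TangentSpace J x) : mfderiv I J j.symm (j x) (mfderiv J I j x v) = v := by
  have h1 : MDifferentiableAt J I j x := j.mdifferentiableAt (by simp) hx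
  have h2 : MDifferentiableAt I J j.symm (j x) :=
    j.symm.mdifferentiableAt (by simp) (j.map_source hx)
  have h3 := mfderiv_comp x h2 h1
  have h4 : (j.symm ∘ j : A → A) =ᶠ[𝓝 x] id := by
    filter_upwards [j.open_source.mem_nhds hx] with z hz
    exact j.left_inv hz
  rw [h4.mfderiv_eq, mfderiv_id] at h3
  exact (DFunLike.congr_fun h3 v).symm

theorem PartialDiffeomorph.mfderiv_mfderiv_symm {w : W} (hw : w ∈ j.target)
    (v : TangentSpace I w) :
    mfderiv J I j (j.symm w) (mfderiv I J j.symm w v) = v := by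
  have h1 : MDifferentiableAt J I j (j.symm w) := j.mdifferentiableAt (by simp) (j.map_target hw)
  have h2 : MDifferentiableAt I J j.symm w := j.symm.mdifferentiableAt (by simp) hw
  have h3 := mfderiv_comp w h1 h2
  have h4 : (j ∘ j.symm : W → W) =ᶠ[𝓝 w] id := by
    filter_upwards [j.open_target.mem_nhds hw] with z hz
    exact j.right_inv hz
  rw [h4.mfderiv_eq, mfderiv_id] at h3
  exact (DFunLike.congr_fun h3 v).symm

/-- The pull-back of a bilinear form. -/
noncomputable def pullForm (B : E4 →L[ℝ] E4 →L[ℝ] ℝ) (T : E4 →L[ℝ] E4) : E4 →L[ℝ] E4 →L[ℝ] ℝ :=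
  B.bilinearComp T T

/-- The push-forward of a field of bilinear forms. -/
noncomputable def pushForm (G : ∀ x : A, TangentSpace J x →L[ℝ] TangentSpace J x →L[ℝ] ℝ) (w : W) :
    TangentSpace I w →L[ℝ] TangentSpace I w →L[ℝ] ℝ :=
  pullForm (G (j.symm w)) (mfderiv I J j.symm w)

/-- The push-forward of a vector field. -/
noncomputable def pushField (Z : ∀ x : A, TangentSpace J x) (w : W) : TangentSpace I w :=
  (mfderiv J I j (j.symm w) (Z (j.symm w)) : E4)

theorem pushForm_apply (G : ∀ x : A, TangentSpace J x →L[ℝ] TangentSpace J x →L[ℝ] ℝ) {x : A}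
    (hx : x ∈ j.source) (v w : TangentSpace J x) :
    pushForm j G (j x) (mfderiv J I j x v) (mfderiv J I j x w) = G x v w := by
  have h : ∀ v w : TangentSpace I (j x), pushForm j G (j x) v w =
    G (j.symm (j x)) (mfderiv I J j.symm (j x) v) (mfderiv I J j.symm (j x) w) := fun v w => rfl
  rw [h, PartialDiffeomorph.mfderiv_symm_mfderiv j hx, PartialDiffeomorph.mfderiv_symm_mfderiv j hx,
    show j.symm (j x) = x from j.left_inv hx]

theorem pushField_apply (Z : ∀ x : A, TangentSpace J x) {x : A} (hx : x ∈ j.source) :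
    pushField j Z (j x) = mfderiv J I j x (Z x) := by
  unfold pushField
  rw [show j.symm (j x) = x from j.left_inv hx]

variable [IsManifold I ∞ W] [IsManifold J ∞ A]

/-- Near the image point Q is the pull-back of G by the inverse of j. That inverse is smooth, so the
derivative lost in forming its differential costs no regularity of the form. -/
theorem formC1At_of_patch {G : ∀ x : A, TangentSpace J x →L[ℝ] TangentSpace J x →L[ℝ] ℝ}
    {Q : ∀ w : W, TangentSpace I w →L[ℝ] TangentSpace I w →L[ℝ] ℝ} {x₀ : A} (hx₀ : x₀ ∈ j.source)
    (hG : FormC1At J G x₀)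
    (h : ∀ᶠ x in 𝓝 x₀, ∀ v w, Q (j x) (mfderiv J I j x v) (mfderiv J I j x w) = G x v w) :
    FormC1At I Q (j x₀) := by
  have ht : j x₀ ∈ j.target := j.map_source hx₀
  have hs : ContMDiffAt I J ∞ j.symm (j x₀) := PartialDiffeomorph.contMDiffAt' j.symm ht
  have hsx : j.symm (j x₀) = x₀ := j.left_inv hx₀
  refine formC1At_of_apply fun v w => ?_
  have h1 := contMDiffAt_mfderiv_apply hs (fieldC1At_frameField (I := I) (j x₀) v)
  have h2 := contMDiffAt_mfderiv_apply hs (fieldC1At_frameField (I := I) (j x₀) w)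
  have h3 := FormC1At.apply_comp (ψ := j.symm) (w₀ := j x₀) (by rw [hsx]; exact hG)
    (hs.of_le (by simp)) h1 h2
  refine h3.congr_of_eventuallyEq ?_
  have hc : Tendsto j.symm (𝓝 (j x₀)) (𝓝 x₀) := by
    have := hs.continuousAt
    unfold ContinuousAt at this
    rwa [hsx] at this
  filter_upwards [hc.eventually h, j.open_target.mem_nhds ht] with z hz hzt
  have h4 := hz (mfderiv I J j.symm z (frameField I (j x₀) v z))
    (mfderiv I J j.symm z (frameField I (j x₀) w z))
  rw [PartialDiffeomorph.mfderiv_mfderiv_symm j hzt,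
    PartialDiffeomorph.mfderiv_mfderiv_symm j hzt] at h4
  rw [← h4, show j (j.symm z) = z from j.right_inv hzt]

theorem fieldC1At_of_patch {Z : ∀ x : A, TangentSpace J x} {V : ∀ w : W, TangentSpace I w} {x₀ : A}
    (hx₀ : x₀ ∈ j.source) (hZ : FieldC1At J Z x₀)
    (h : ∀ᶠ x in 𝓝 x₀, V (j x) = mfderiv J I j x (Z x)) : FieldC1At I V (j x₀) := by
  have ht : j x₀ ∈ j.target := j.map_source hx₀
  have hs : ContMDiffAt I J ∞ j.symm (j x₀) := PartialDiffeomorph.contMDiffAt' j.symm ht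
  have hsx : j.symm (j x₀) = x₀ := j.left_inv hx₀
  have h1 := contMDiffAt_mfderiv_apply (PartialDiffeomorph.contMDiffAt' j hx₀) hZ
  rw [← hsx] at h1
  have h2 := ContMDiffAt.comp (j x₀) h1 (hs.of_le (by simp))
  refine h2.congr_of_eventuallyEq ?_
  have hc : Tendsto j.symm (𝓝 (j x₀)) (𝓝 x₀) := by
    have := hs.continuousAt
    unfold ContinuousAt at this
    rwa [hsx] at this
  filter_upwards [hc.eventually h, j.open_target.mem_nhds ht] with z hz hzt
  have h3 : j (j.symm z) = z := j.right_inv hzt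
  simp only [Function.comp_apply]
  rw [← hz, h3]

end Patches
/-! ### Positive definite forms, Lorentzian metrics and gradients -/

section PosDef

variable {B : E4 →L[ℝ] E4 →L[ℝ] ℝ}

theorem exists_equiv_of_pos (h : ∀ v, v ≠ 0 → 0 < B v v) :
    ∃ e : E4 ≃L[ℝ] (E4 →L[ℝ] ℝ), (e : E4 →L[ℝ] E4 →L[ℝ] ℝ) = B := by
  have hinj : Function.Injective (B : E4 →ₗ[ℝ] E4 →L[ℝ] ℝ) := by
    rw [← LinearMap.ker_eq_bot, LinearMap.ker_eq_bot']
    intro v hv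
    by_contra hne
    have h1 := h v hne
    have h2 : B v = 0 := hv
    rw [h2] at h1
    exact lt_irrefl _ h1
  have hdim : Module.finrank ℝ E4 = Module.finrank ℝ (E4 →L[ℝ] ℝ) := by
    rw [← (LinearMap.toContinuousLinearMap (𝕜 := ℝ) (E := E4) (F' := ℝ)).finrank_eq]
    exact (Subspace.dual_finrank_eq (K := ℝ) (V := E4)).symm
  refine ⟨(LinearEquiv.ofInjectiveOfFinrankEq (B : E4 →ₗ[ℝ] E4 →L[ℝ] ℝ) hinj
    hdim).toContinuousLinearEquiv, ?_⟩
  ext v w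
  rfl

/-- The minimum of B on the unit sphere is positive and bounds B(v, v) from below by a multiple of
‖v‖². The boundedness of the unit ball of B is part of the data of a Riemannian metric. -/
theorem isVonNBounded_of_pos (h : ∀ v, v ≠ 0 → 0 < B v v) :
    Bornology.IsVonNBounded ℝ {v : E4 | B v v < 1} := by
  rw [NormedSpace.isVonNBounded_iff]
  have hcont : Continuous fun v : E4 => B v v := by fun_prop
  obtain ⟨v₀, hv₀, hmin⟩ := (isCompact_sphere (0 : E4) 1).exists_isMinOn
    (NormedSpace.sphere_nonempty.2 zero_le_one) hcont.continuousOn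
  have hv₀' : ‖v₀‖ = 1 := by simpa using hv₀
  have hc : 0 < B v₀ v₀ := h v₀ (by rintro rfl; simp at hv₀')
  refine (Metric.isBounded_closedBall (x := (0 : E4)) (r := √(1 / B v₀ v₀))).subset ?_
  intro v hv
  rw [mem_closedBall_zero_iff]
  apply Real.le_sqrt_of_sq_le
  rcases eq_or_ne v 0 with rfl | hne
  · simp only [norm_zero]
    exact (by rw [zero_pow two_ne_zero]; exact (one_div_pos.2 hc).le)
  have h1 : B v₀ v₀ ≤ B (unitVec v) (unitVec v) :=
    hmin (by simpa using norm_unitVec hne)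
  have h2 : B v v = ‖v‖ ^ 2 * B (unitVec v) (unitVec v) := by
    conv_lhs => rw [← norm_smul_unitVec v]
    simp only [map_smul, smul_apply, smul_eq_mul]
    ring
  have h3 : B v v < 1 := hv
  rw [le_div_iff₀ hc]
  nlinarith [sq_nonneg ‖v‖]

/-- The Lorentzian form of a Riemannian form and a unit vector. -/
noncomputable def reflectForm (B : E4 →L[ℝ] E4 →L[ℝ] ℝ) (V : E4) : E4 →L[ℝ] E4 →L[ℝ] ℝ :=
  B - (2 : ℝ) • (B V).smulRight (B V)

theorem reflectForm_apply (B : E4 →L[ℝ] E4 →L[ℝ] ℝ) (V v w : E4) :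
    reflectForm B V v w = B v w - 2 * (B V v * B V w) := by
  simp [reflectForm]

theorem form_smul_left (B : E4 →L[ℝ] E4 →L[ℝ] ℝ) (c : ℝ) (a b : E4) :
    B (c • a) b = c * B a b := by simp

theorem form_smul_smul (B : E4 →L[ℝ] E4 →L[ℝ] ℝ) (c : ℝ) (a : E4) :
    B (c • a) (c • a) = c ^ 2 * B a a := by
  simp only [map_smul, smul_apply, smul_eq_mul]
  ring

theorem eq_of_form_eq (h : ∀ v, v ≠ 0 → 0 < B v v) {a b : E4} (hab : ∀ v, B a v = B b v) :
    a = b := by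
  by_contra hne
  have h1 := h (a - b) (sub_ne_zero.2 hne)
  have h2 : B (a - b) (a - b) = B a (a - b) - B b (a - b) := by simp
  rw [h2, hab, sub_self] at h1
  exact lt_irrefl _ h1

theorem reflectForm_symm (hs : ∀ v w, B v w = B w v) (V v w : E4) :
    reflectForm B V v w = reflectForm B V w v := by
  rw [reflectForm_apply, reflectForm_apply, hs v w]
  ring

/-- Pairing v with V gives -B(V, v), so B(V, v) = 0; pairing v with itself then gives B(v, v) = 0.
-/
theorem reflectForm_nondegenerate (hs : ∀ v w, B v w = B w v) (hpos : ∀ v, v ≠ 0 → 0 < B v v)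
    {V : E4} (hV : B V V = 1) {v : E4} (h : ∀ w, reflectForm B V v w = 0) : v = 0 := by
  simp only [reflectForm_apply] at h
  have h1 := h V
  rw [hV, hs v V] at h1
  have h2 := h v
  have h3 : B V v = 0 := by linarith
  rw [h3] at h2
  by_contra hne
  have h4 := hpos v hne
  linarith

/-- The form takes the value -1 on V and coincides with B on the orthogonal complement of V. -/
theorem reflectForm_signature (hpos : ∀ v, v ≠ 0 → 0 < B v v)
    {V : E4} (hV : B V V = 1) : reflectForm B V V V < 0 ∧
      ∀ w, w ≠ 0 → reflectForm B V V w = 0 → 0 < reflectForm B V w w := by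
  simp only [reflectForm_apply, hV]
  refine ⟨by norm_num, fun w hw h => ?_⟩
  have h1 : B V w = 0 := by linarith
  have h4 := hpos w hw
  rw [h1]
  linarith

end PosDef

/-! ### Metrics built from a form and a unit field -/

section Metrics

variable {H : Type*} [TopologicalSpace H] {I : ModelWithCorners ℝ E4 H}
  {W : Type u} [TopologicalSpace W] [ChartedSpace H W] [IsManifold I ∞ W]

/-- The Riemannian metric given by a field of positive definite symmetric forms. -/
noncomputable def riemannianMetricOf
    (Q : ∀ x : W, TangentSpace I x →L[ℝ] TangentSpace I x →L[ℝ] ℝ)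
    (hsymm : ∀ x v w, Q x v w = Q x w v) (hpos : ∀ x v, v ≠ 0 → 0 < Q x v v)
    (hQ : ∀ x, FormC1At I Q x) :
    Bundle.ContMDiffRiemannianMetric I 1 E4 (fun x : W => TangentSpace I x) where
  inner := Q
  symm := hsymm
  pos := hpos
  isVonNBounded x := isVonNBounded_of_pos (B := Q x) (hpos x)
  contMDiff := hQ

/-- The Lorentzian metric given by a Riemannian metric and a unit vector field. -/
noncomputable def lorentzMetricOf
    (Q : ∀ x : W, TangentSpace I x →L[ℝ] TangentSpace I x →L[ℝ] ℝ)
    (V : ∀ x : W, TangentSpace I x)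
    (hsymm : ∀ x v w, Q x v w = Q x w v) (hpos : ∀ x v, v ≠ 0 → 0 < Q x v v)
    (hQ : ∀ x, FormC1At I Q x) (hV : ∀ x, FieldC1At I V x) (hunit : ∀ x, Q x (V x) (V x) = 1) :
    LorentzMetric I W where
  inner x := reflectForm (Q x) (V x)
  symm x := reflectForm_symm (B := Q x) (hsymm x) (V x)
  nondegenerate x _ hv := reflectForm_nondegenerate (B := Q x) (hsymm x) (hpos x) (hunit x) hv
  signature x := ⟨V x, reflectForm_signature (B := Q x) (hpos x) (hunit x)⟩
  contMDiff x₀ := by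
    refine formC1At_of_apply fun v w => ?_
    have hv := fieldC1At_frameField (I := I) x₀ v
    have hw := fieldC1At_frameField (I := I) x₀ w
    have h1 := (hQ x₀).apply hv hw
    have h2 := (hQ x₀).apply (hV x₀) hv
    have h3 := (hQ x₀).apply (hV x₀) hw
    refine (h1.sub ((contMDiffAt_const (c := (2 : ℝ))).mul (h2.mul h3))).congr_of_eventuallyEq
      (Eventually.of_forall fun x => ?_)
    exact reflectForm_apply (Q x) (V x) _ _

theorem ContMDiffAt.real_inv_sqrt {A : Type*} [TopologicalSpace A] [ChartedSpace H A] {f : A → ℝ}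
    {x₀ : A} (hf : ContMDiffAt I 𝓘(ℝ, ℝ) 1 f x₀)
    (h : 0 < f x₀) : ContMDiffAt I 𝓘(ℝ, ℝ) 1 (fun x => (√(f x))⁻¹) x₀ := by
  have h1 : ContDiffAt ℝ 1 (fun t : ℝ => (√t)⁻¹) (f x₀) :=
    (Real.contDiffAt_sqrt h.ne').inv (Real.sqrt_pos.2 h).ne'
  exact h1.contMDiffAt.comp x₀ hf

end Metrics

/-! ### Local models of the form and of the direction field -/

section PatchModel

variable {H : Type*} [TopologicalSpace H] {I : ModelWithCorners ℝ E4 H}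
  {W : Type u} [TopologicalSpace W] [ChartedSpace H W]
  {K : Type*} [TopologicalSpace K] {J : ModelWithCorners ℝ E4 K}
  {A : Type*} [TopologicalSpace A] [ChartedSpace K A]
  {Q : ∀ x : W, TangentSpace I x →L[ℝ] TangentSpace I x →L[ℝ] ℝ} {V : ∀ x : W, TangentSpace I x}

/-- The linear map `T` into the tangent space at `w` pulls the form back to `G`, and the direction
of the vector is the image of `Z`. -/
def PatchModel (Q : ∀ x : W, TangentSpace I x →L[ℝ] TangentSpace I x →L[ℝ] ℝ)
    (V : ∀ x : W, TangentSpace I x) (w : W) (T : E4 →L[ℝ] E4) (G : E4 → E4 → ℝ) (Z : E4) : Prop :=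
  (∀ a b : E4, Q w (T a) (T b) = G a b) ∧ ∃ k : ℝ, 0 < k ∧ V w = (k • T Z : E4)

theorem PatchModel.of_comp {w : W} {T S : E4 →L[ℝ] E4} {G G' : E4 → E4 → ℝ} {Z Z' : E4}
    (h : PatchModel Q V w (T.comp S) G' Z') (hS : Function.Surjective S)
    (hG : ∀ a b, G (S a) (S b) = G' a b) (hZ : ∃ c : ℝ, 0 < c ∧ S Z' = c • Z) :
    PatchModel Q V w T G Z := by
  obtain ⟨h1, k, hk, h2⟩ := h
  obtain ⟨c, hc, h3⟩ := hZ
  refine ⟨fun a b => ?_, k * c, mul_pos hk hc, ?_⟩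
  · obtain ⟨a, rfl⟩ := hS a
    obtain ⟨b, rfl⟩ := hS b
    rw [hG]
    exact h1 a b
  · rw [h2, ContinuousLinearMap.comp_apply, h3, map_smul, smul_smul]

/-- Unit length determines the positive factor: it is 1 / √G(Z, Z). For this reason a model only has
to prescribe the direction of the field. -/
theorem PatchModel.pos {w : W} {T : E4 →L[ℝ] E4} {G : E4 → E4 → ℝ} {Z : E4}
    (h : PatchModel Q V w T G Z) (hunit : Q w (V w) (V w) = 1) :
    0 < G Z Z ∧ V w = ((√(G Z Z))⁻¹ • T Z : E4) := by
  obtain ⟨h1, k, hk, h2⟩ := h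
  have h3 : k ^ 2 * G Z Z = 1 := by
    have h3 := form_smul_smul (Q w) k (T Z)
    rw [← h1, ← hunit, h2]
    exact h3.symm
  have h4 : 0 < G Z Z := by
    by_contra h
    nlinarith [sq_nonneg k]
  refine ⟨h4, ?_⟩
  rw [h2]
  congr 1
  apply eq_inv_of_mul_eq_one_left
  have : (k * √(G Z Z)) ^ 2 = 1 := by rw [mul_pow, Real.sq_sqrt h4.le, h3]
  have h5 : 0 < k * √(G Z Z) := mul_pos hk (Real.sqrt_pos.2 h4)
  nlinarith

variable [IsManifold I ∞ W]

/-- Substituting V = Z / √G(Z, Z) turns 2 V♭ ⊗ V♭ into 2 Z♭ ⊗ Z♭ / G(Z, Z), so the Lorentzian part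
of a model follows from its Riemannian part. -/
theorem PatchModel.modelledOn {g : LorentzMetric I W}
    {gR : Bundle.ContMDiffRiemannianMetric I 1 E4 (fun x : W => TangentSpace I x)}
    (hunit : ∀ x, gR.inner x (V x) (V x) = 1)
    (hg : ∀ x v w, g.inner x v w = gR.inner x v w - 2 * (gR.inner x (V x) v * gR.inner x (V x) w))
    {j : A → W} {x : A} {G : TangentSpace J x → TangentSpace J x → ℝ} {Z : TangentSpace J x}
    (h : PatchModel gR.inner V (j x) (mfderiv J I j x) G Z) : ModelledOn J g gR V j x G Z := by
  refine ⟨h.1, h.2, fun v w => ?_⟩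
  obtain ⟨h1, h2⟩ := h.pos (hunit _)
  have h3 : ∀ v : TangentSpace J x, gR.inner (j x) (V (j x)) (mfderiv J I j x v) =
      (√(G Z Z))⁻¹ * G Z v := by
    intro v
    rw [h2, ← h.1 Z v]
    exact form_smul_left (gR.inner (j x)) _ _ _
  have h4 : √(G Z Z) ^ 2 = G Z Z := Real.sq_sqrt h1.le
  have h5 : √(G Z Z) ≠ 0 := (Real.sqrt_pos.2 h1).ne'
  have h6 : gR.inner (j x) (mfderiv J I j x v) (mfderiv J I j x w) = G v w := h.1 v w
  rw [hg, h3, h3, h6, lorentzForm]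
  have h7 : 2 * (G Z v * G Z w) / G Z Z = 2 * (G Z v * G Z w) / √(G Z Z) ^ 2 := by rw [h4]
  rw [h7]
  field_simp

theorem fieldC1At_of_patchModel [IsManifold J ∞ A] (j : PartialDiffeomorph J I A W ∞)
    {G : ∀ x : A, TangentSpace J x →L[ℝ] TangentSpace J x →L[ℝ] ℝ} {Z : ∀ x : A, TangentSpace J x}
    {x₀ : A} (hx₀ : x₀ ∈ j.source) (hG : FormC1At J G x₀) (hZ : FieldC1At J Z x₀)
    (hunit : ∀ x, Q x (V x) (V x) = 1)
    (h : ∀ᶠ x in 𝓝 x₀, PatchModel Q V (j x) (mfderiv J I j x) (fun v w => G x v w) (Z x)) :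
    FieldC1At I V (j x₀) := by
  have h1 := (hG.apply hZ hZ)
  have h2 : 0 < G x₀ (Z x₀) (Z x₀) := (h.self_of_nhds.pos (hunit _)).1
  refine fieldC1At_of_patch j hx₀ (FieldC1At.smul (ContMDiffAt.real_inv_sqrt h1 h2) hZ) ?_
  filter_upwards [h] with x hx
  rw [(hx.pos (hunit _)).2, map_smul]
  rfl

/-- The multiple of a vector that has length one. -/
noncomputable def normalize (B : E4 →L[ℝ] E4 →L[ℝ] ℝ) (Z : E4) : E4 := (√(B Z Z))⁻¹ • Z

theorem normalize_unit {B : E4 →L[ℝ] E4 →L[ℝ] ℝ} {Z : E4} (h : 0 < B Z Z) :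
    B (normalize B Z) (normalize B Z) = 1 := by
  have h4 : √(B Z Z) ^ 2 = B Z Z := Real.sq_sqrt h.le
  have h5 : √(B Z Z) ≠ 0 := (Real.sqrt_pos.2 h).ne'
  simp only [normalize, map_smul, smul_apply, smul_eq_mul]
  field_simp
  exact h4.symm

end PatchModel

/-! ### The gradient of the Morse function -/

section Gradient

variable {H : Type v} [TopologicalSpace H] {I : ModelWithCorners ℝ E4 H}
variable {M : Type u} [TopologicalSpace M] [ChartedSpace H M] [IsManifold I ∞ M]
variable (C : MorseCobordism I M)

namespace MorseCobordism

theorem formC1At_metric (x : M) : FormC1At I C.metric.inner x :=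
  (C.metric.contMDiff x).of_le (by simp)

theorem inner_gradient (x : M) (v : TangentSpace I x) :
    C.metric.inner x (C.gradient x) v = mfderiv I 𝓘(ℝ, ℝ) C.f x v := by
  have hex : ∃ Z : TangentSpace I x, ∀ v, C.metric.inner x Z v = mfderiv I 𝓘(ℝ, ℝ) C.f x v := by
    obtain ⟨e, he⟩ := exists_equiv_of_pos (B := C.metric.inner x) (C.metric.pos x)
    let ℓ : E4 →L[ℝ] ℝ := mfderiv I 𝓘(ℝ, ℝ) C.f x
    refine ⟨e.symm ℓ, fun v => ?_⟩
    have h1 : (e : E4 →L[ℝ] E4 →L[ℝ] ℝ) (e.symm ℓ) = ℓ := e.apply_symm_apply ℓ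
    rw [he] at h1
    exact DFunLike.congr_fun h1 v
  exact Classical.epsilon_spec hex v

theorem gradient_eq {x : M} {Z : TangentSpace I x}
    (h : ∀ v, C.metric.inner x Z v = mfderiv I 𝓘(ℝ, ℝ) C.f x v) : C.gradient x = Z := by
  refine eq_of_form_eq (B := C.metric.inner x) (C.metric.pos x) fun v => ?_
  exact (C.inner_gradient x v).trans (h v).symm

theorem gradient_ne_zero {x : M} (h : x ≠ C.p) : C.gradient x ≠ 0 := by
  intro h0
  apply h
  rw [← C.critical_iff]
  ext v
  rw [← C.inner_gradient, h0]
  simp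
  rfl

/-- In a local frame the components c of the gradient solve A c = df, with A the matrix of the
metric. A is invertible by positivity, and inversion of linear maps is smooth. -/
theorem fieldC1At_gradient (x₀ : M) : FieldC1At I C.gradient x₀ := by
  set e := trivializationAt E4 (TangentSpace I : M → Type _) x₀ with he
  have hbase : ∀ᶠ x in 𝓝 x₀, x ∈ e.baseSet := e.open_baseSet.mem_nhds
    (FiberBundle.mem_baseSet_trivializationAt' x₀)
  let c : M → E4 := fun x => (e ⟨x, C.gradient x⟩).2
  let A : M → E4 →L[ℝ] E4 →L[ℝ] ℝ := fun x =>
    ContinuousLinearMap.inCoordinates E4 (TangentSpace I : M → Type _)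
      (E4 →L[ℝ] ℝ) (fun x : M => TangentSpace I x →L[ℝ] ℝ) x₀ x x₀ x (C.metric.inner x)
  have hA : ContMDiffAt I 𝓘(ℝ, E4 →L[ℝ] E4 →L[ℝ] ℝ) 1 A x₀ := by
    have := C.formC1At_metric x₀
    unfold FormC1At at this
    rw [contMDiffAt_hom_bundle] at this
    exact this.2
  have hAe : ∀ᶠ x in 𝓝 x₀, ∀ v w : E4, A x v w =
      C.metric.inner x (frameField I x₀ v x) (frameField I x₀ w x) :=
    eventually_inCoordinates_eq C.metric.inner x₀
  have hinj : ∀ x ∈ e.baseSet, ∀ v : E4, v ≠ 0 → frameField I x₀ v x ≠ 0 := by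
    intro x hx v hv h0
    apply hv
    have h1 := e.linearMapAt_symmₗ (R := ℝ) hx v
    have h2 : e.symmₗ ℝ x v = 0 := (e.symmₗ_apply (R := ℝ) hx v).trans h0
    rw [h2, map_zero] at h1
    exact h1.symm
  have hc : ∀ x ∈ e.baseSet, frameField I x₀ (c x) x = C.gradient x := fun x hx =>
    e.symm_apply_apply_mk hx (C.gradient x)
  have hAc : ContMDiffAt I 𝓘(ℝ, E4 →L[ℝ] ℝ) 1 (fun x => A x (c x)) x₀ := by
    refine contMDiffAt_clm_of_apply fun w => ?_
    refine (contMDiffAt_mfderiv_apply_vectorSpace (C.smooth x₀)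
      (fieldC1At_frameField (I := I) x₀ w)).congr_of_eventuallyEq ?_
    filter_upwards [hAe, hbase] with x h1 h2
    rw [h1, hc x h2, C.inner_gradient]
  have hex : ∀ᶠ x in 𝓝 x₀, ∃ e : E4 ≃L[ℝ] (E4 →L[ℝ] ℝ), (e : E4 →L[ℝ] E4 →L[ℝ] ℝ) = A x := by
    filter_upwards [hAe, hbase] with x h1 h2
    exact exists_equiv_of_pos fun v hv => by
      rw [h1]
      exact C.metric.pos x _ (hinj x h2 v hv)
  obtain ⟨e₀, he₀⟩ := hex.self_of_nhds
  have hinv : ContMDiffAt I 𝓘(ℝ, (E4 →L[ℝ] ℝ) →L[ℝ] E4) 1 (fun x => (A x).inverse) x₀ := by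
    have h1 : ContDiffAt ℝ 1 (ContinuousLinearMap.inverse : (E4 →L[ℝ] E4 →L[ℝ] ℝ) → _) (A x₀) := by
      rw [← he₀]
      exact contDiffAt_map_inverse e₀
    exact h1.contMDiffAt.comp x₀ hA
  unfold FieldC1At
  refine (Bundle.contMDiffAt_section _).2 ?_
  refine (hinv.clm_apply hAc).congr_of_eventuallyEq ?_
  filter_upwards [hex] with x hx
  obtain ⟨e₁, he₁⟩ := hx
  rw [← he₁, ContinuousLinearMap.inverse_equiv]
  exact (e₁.symm_apply_apply (c x)).symm

end MorseCobordism

end Gradient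
/-! ### Forms and vectors on the cylinder -/

section Cylinder

/-- The one-form `ds`, with `s = log ‖y‖`. -/
noncomputable def cylDs (y : E4) : E4 →L[ℝ] ℝ := (‖y‖ ^ 2)⁻¹ • innerSL ℝ y

theorem cylDs_apply (y v : E4) : cylDs y v = ⟪y, v⟫ / ‖y‖ ^ 2 := by
  simp [cylDs, div_eq_inv_mul]

theorem hasFDerivAt_log_norm {y : E4} (hy : y ≠ 0) :
    HasFDerivAt (fun z : E4 => Real.log ‖z‖) (cylDs y) y := by
  have hn : ‖y‖ ≠ 0 := norm_ne_zero_iff.2 hy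
  refine ((hasFDerivAt_norm hy).log hn).congr_fderiv ?_
  ext v
  simp [cylDs]
  field_simp

theorem inner_unitVec_self {y : E4} (hy : y ≠ 0) : ⟪unitVec y, unitVec y⟫ = 1 := by
  rw [real_inner_self_eq_norm_sq, norm_unitVec hy, one_pow]

theorem inner_unitVec_eq {y : E4} (hy : y ≠ 0) (v : E4) :
    ⟪unitVec y, v⟫ = ‖y‖ * cylDs y v := by
  have hn : ‖y‖ ≠ 0 := norm_ne_zero_iff.2 hy
  rw [cylDs_apply, unitVec, real_inner_smul_left]
  field_simp

theorem inner_unitVec_unitVecDeriv {y : E4} (hy : y ≠ 0) (v : E4) :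
    ⟪unitVec y, unitVecDeriv y v⟫ = 0 := by
  have hn : ‖y‖ ≠ 0 := norm_ne_zero_iff.2 hy
  rw [unitVecDeriv_apply, unitVec, real_inner_smul_left, real_inner_smul_right, inner_sub_right,
    real_inner_smul_right, real_inner_self_eq_norm_sq]
  field_simp
  ring

/-- The decomposition of a tangent vector into its radial and its spherical part. -/
theorem cyl_decomposition {y : E4} (hy : y ≠ 0) (v : E4) :
    v = ‖y‖ • (cylDs y v • unitVec y + unitVecDeriv y v) := by
  have hn : ‖y‖ ≠ 0 := norm_ne_zero_iff.2 hy
  rw [unitVecDeriv_apply, unitVec, cylDs_apply, smul_add, smul_smul, smul_smul, smul_smul,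
    mul_inv_cancel₀ hn, one_smul]
  have : ‖y‖ * (⟪y, v⟫ / ‖y‖ ^ 2) * ‖y‖⁻¹ = ⟪y, v⟫ / ‖y‖ ^ 2 := by field_simp
  rw [this]
  module

theorem cylDs_mk {y : E4} (hy : y ≠ 0) (c : ℝ) {q : E4} (hq : ⟪unitVec y, q⟫ = 0) :
    cylDs y (‖y‖ • (c • unitVec y + q)) = c := by
  have hn : ‖y‖ ≠ 0 := norm_ne_zero_iff.2 hy
  have h := inner_unitVec_eq hy (‖y‖ • (c • unitVec y + q))
  rw [real_inner_smul_right, inner_add_right, real_inner_smul_right, inner_unitVec_self hy, hq] at h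
  have := mul_left_cancel₀ hn h
  rw [← this]
  ring

theorem unitVecDeriv_mk {y : E4} (hy : y ≠ 0) (c : ℝ) {q : E4} (hq : ⟪unitVec y, q⟫ = 0) :
    unitVecDeriv y (‖y‖ • (c • unitVec y + q)) = q := by
  have hn : ‖y‖ ≠ 0 := norm_ne_zero_iff.2 hy
  have h := cyl_decomposition hy (‖y‖ • (c • unitVec y + q))
  rw [cylDs_mk hy c hq] at h
  have := smul_right_injective E4 hn h
  exact (add_left_cancel this).symm

/-- The derivative at `y` of `y ↦ h (log ‖y‖) • unitVec y`, for a function with value `h` and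
derivative `h'`. -/
noncomputable def radialCLM (h' h : ℝ) (y : E4) : E4 →L[ℝ] E4 :=
  h' • (cylDs y).smulRight (unitVec y) + h • unitVecDeriv y

theorem radialCLM_apply (h' h : ℝ) (y v : E4) :
    radialCLM h' h y v = (h' * cylDs y v) • unitVec y + h • unitVecDeriv y v := by
  simp [radialCLM, smul_smul]

theorem hasFDerivAt_radial {h : ℝ → ℝ} {h' : ℝ} {y : E4} (hy : y ≠ 0)
    (hh : HasDerivAt h h' (Real.log ‖y‖)) :
    HasFDerivAt (fun z => h (Real.log ‖z‖) • unitVec z) (radialCLM h' (h (Real.log ‖y‖)) y) y := by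
  refine ((hh.comp_hasFDerivAt y (hasFDerivAt_log_norm hy)).smul
    (hasFDerivAt_unitVec hy)).congr_fderiv ?_
  ext1 v
  rw [radialCLM_apply]
  simp [add_comm]

theorem sub_inner_smul_orthogonal {y : E4} (hy : y ≠ 0) (F : E4) :
    ⟪unitVec y, F - ⟪F, unitVec y⟫ • unitVec y⟫ = 0 := by
  rw [inner_sub_right, real_inner_smul_right, inner_unitVec_self hy, real_inner_comm]
  ring

theorem surjective_radialCLM {h' h : ℝ} (hh' : h' ≠ 0) (hh : h ≠ 0) {y : E4} (hy : y ≠ 0) :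
    Function.Surjective (radialCLM h' h y) := by
  intro F
  have hq : ⟪unitVec y, h⁻¹ • (F - ⟪F, unitVec y⟫ • unitVec y)⟫ = 0 := by
    rw [real_inner_smul_right, sub_inner_smul_orthogonal hy, mul_zero]
  refine ⟨‖y‖ • ((h'⁻¹ * ⟪F, unitVec y⟫) • unitVec y +
    h⁻¹ • (F - ⟪F, unitVec y⟫ • unitVec y)), ?_⟩
  rw [radialCLM_apply, cylDs_mk hy _ hq, unitVecDeriv_mk hy _ hq, smul_smul,
    mul_inv_cancel₀ hh, mul_inv_cancel_left₀ hh']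
  module

theorem cylDs_neckVector {R : ℝ} {y : E4} (hy : y ≠ 0) (F : E4) :
    cylDs y (neckVector R y F) = ⟪F, unitVec y⟫ :=
  cylDs_mk hy _ (by rw [real_inner_smul_right, sub_inner_smul_orthogonal hy, mul_zero])

theorem unitVecDeriv_neckVector {R : ℝ} {y : E4} (hy : y ≠ 0) (F : E4) :
    unitVecDeriv y (neckVector R y F) = R⁻¹ • (F - ⟪F, unitVec y⟫ • unitVec y) :=
  unitVecDeriv_mk hy _ (by rw [real_inner_smul_right, sub_inner_smul_orthogonal hy, mul_zero])

theorem radialCLM_neckVector {h' h R : ℝ} {y : E4} (hy : y ≠ 0) (F : E4) :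
    radialCLM h' h y (neckVector R y F) = (h' * ⟪F, unitVec y⟫) • unitVec y +
      (h * R⁻¹) • (F - ⟪F, unitVec y⟫ • unitVec y) := by
  rw [radialCLM_apply, cylDs_neckVector hy, unitVecDeriv_neckVector hy, smul_smul]

theorem neckVector_smul (R c : ℝ) (y F : E4) : neckVector R y (c • F) = c • neckVector R y F := by
  simp only [neckVector, real_inner_smul_left]
  module

theorem neckVector_ne_zero {R : ℝ} (hR : R ≠ 0) {y F : E4} (hy : y ≠ 0) (hF : F ≠ 0) :
    neckVector R y F ≠ 0 := by
  intro h
  have h1 := cylDs_neckVector (R := R) hy F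
  have h2 := unitVecDeriv_neckVector (R := R) hy F
  rw [h, map_zero] at h1 h2
  rw [← h1, zero_smul, sub_zero] at h2
  exact hF ((smul_eq_zero.1 h2.symm).resolve_left (inv_ne_zero hR))

theorem inner_radialScale {k : ℝ} {F : E4 → E4} {x : E4} (hx : x ≠ 0) :
    ⟪radialScale k F x, x⟫ = k * ⟪F x, x⟫ := by
  have hn : ‖x‖ ^ 2 ≠ 0 := by positivity
  rw [radialScale, inner_add_left, real_inner_smul_left, real_inner_self_eq_norm_sq]
  field_simp
  ring

theorem radialScale_one (F : E4 → E4) (x : E4) : radialScale 1 F x = F x := by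
  simp [radialScale]

/-- A non-zero factor loses nothing: a zero would have vanishing radial component, so the original
radial component vanishes and the field was not changed at all. -/
theorem radialScale_ne_zero {k : ℝ} (hk : k ≠ 0) {F : E4 → E4} {x : E4} (hx : x ≠ 0)
    (hF : F x ≠ 0) : radialScale k F x ≠ 0 := by
  intro h
  have h1 := inner_radialScale (k := k) (F := F) hx
  rw [h, inner_zero_left, eq_comm, mul_eq_zero, or_iff_right hk] at h1
  rw [radialScale, h1, mul_zero, zero_div, zero_smul, add_zero] at h
  exact hF h

/-- The radial and the tangential part of a radially scaled field at a multiple of a unit vector. -/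
theorem radialScale_radial {k ρ : ℝ} (hρ : 0 < ρ) {F : E4 → E4} {y : E4} (hy : y ≠ 0) :
    radialScale k F (ρ • unitVec y) = F (ρ • unitVec y) +
      ((k - 1) * ⟪F (ρ • unitVec y), unitVec y⟫) • unitVec y := by
  rw [radialScale, norm_radial hρ hy, real_inner_smul_right, smul_smul]
  congr 2
  field_simp

/-- The form `ds² + A dΩ² + B ℓ² - D (σ₃ / 2)²` on the cylinder, where `ℓ` is the pull-back of
`- d(morseFun) / r` by the radial map of value `r` and derivative `1`. -/
noncomputable def cylForm (A B D r : ℝ) (y : E4) : E4 →L[ℝ] E4 →L[ℝ] ℝ :=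
  let ℓ : E4 →L[ℝ] ℝ := ⟪morseField (unitVec y), unitVec y⟫ • cylDs y +
    r • (innerSL ℝ (morseField (unitVec y))).comp (unitVecDeriv y)
  let η : E4 →L[ℝ] ℝ := (innerSL ℝ (mulI (unitVec y))).comp (unitVecDeriv y)
  (cylDs y).smulRight (cylDs y) + A • pullForm (innerSL ℝ) (unitVecDeriv y) +
    B • ℓ.smulRight ℓ + (-D) • η.smulRight η

/-- The one-form `ℓ` of `cylForm`. -/
noncomputable def cylEll (r : ℝ) (y v : E4) : ℝ :=
  ⟪morseField (unitVec y), unitVec y⟫ * cylDs y v + r * ⟪morseField (unitVec y), unitVecDeriv y v⟫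

theorem cylForm_apply (A B D r : ℝ) (y v w : E4) : cylForm A B D r y v w =
    cylDs y v * cylDs y w + A * ⟪unitVecDeriv y v, unitVecDeriv y w⟫ +
      B * (cylEll r y v * cylEll r y w) -
      D * (⟪mulI (unitVec y), unitVecDeriv y v⟫ * ⟪mulI (unitVec y), unitVecDeriv y w⟫) := by
  have hI : ∀ a b : E4, (innerSL ℝ : E4 →L[ℝ] E4 →L[ℝ] ℝ) a b = ⟪a, b⟫ := fun _ _ => rfl
  simp [cylForm, cylEll, pullForm, hI]
  ring

theorem cylForm_symm (A B D r : ℝ) (y v w : E4) : cylForm A B D r y v w = cylForm A B D r y w v := by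
  rw [cylForm_apply, cylForm_apply, real_inner_comm]
  ring

theorem norm_mulI (x : E4) : ‖mulI x‖ = ‖x‖ := by
  rw [← sq_eq_sq₀ (norm_nonneg _) (norm_nonneg _), norm_sq_eq, norm_sq_eq]
  simp [mulI]
  ring

/-- The vector `mulI u` has length one, so by Cauchy-Schwarz the subtracted square is at most D
times the spherical part. What remains is at least ds² + (A - D) dΩ². -/
theorem cylForm_pos {A B D r : ℝ} (hB : 0 ≤ B) (hD : 0 ≤ D) (hDA : D < A) {y : E4} (hy : y ≠ 0)
    {v : E4} (hv : v ≠ 0) : 0 < cylForm A B D r y v v := by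
  rw [cylForm_apply]
  have h1 : ⟪mulI (unitVec y), unitVecDeriv y v⟫ ^ 2 ≤ ‖unitVecDeriv y v‖ ^ 2 := by
    rw [← sq_abs]
    refine pow_le_pow_left₀ (abs_nonneg _) ?_ 2
    refine (abs_real_inner_le_norm _ _).trans ?_
    rw [norm_mulI, norm_unitVec hy, one_mul]
  rw [real_inner_self_eq_norm_sq]
  have h2 : 0 < cylDs y v ^ 2 + (A - D) * ‖unitVecDeriv y v‖ ^ 2 := by
    have hAD : 0 < A - D := sub_pos.2 hDA
    by_cases h0 : unitVecDeriv y v = 0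
    · have h3 : cylDs y v ≠ 0 := by
        intro h
        have := cyl_decomposition hy v
        rw [h, h0] at this
        simp at this
        exact hv this
      positivity
    · positivity
  nlinarith [mul_nonneg hB (sq_nonneg (cylEll r y v)), mul_le_mul_of_nonneg_left h1 hD]

theorem contDiffAt_cylDs {n : WithTop ℕ∞} {y : E4} (hy : y ≠ 0) (v : E4) :
    ContDiffAt ℝ n (fun z => cylDs z v) y := by
  simp only [cylDs_apply]
  exact (contDiffAt_id.inner ℝ contDiffAt_const).div (contDiffAt_id.norm_sq ℝ) (by positivity)

theorem contDiffAt_unitVecDeriv {n : WithTop ℕ∞} {y : E4} (hy : y ≠ 0) (v : E4) :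
    ContDiffAt ℝ n (fun z => unitVecDeriv z v) y := by
  simp only [unitVecDeriv_apply]
  exact ((contDiffAt_id.norm ℝ hy).inv (norm_ne_zero_iff.2 hy)).smul (contDiffAt_const.sub
    (((contDiffAt_id.inner ℝ contDiffAt_const).div (contDiffAt_id.norm_sq ℝ)
      (by positivity)).smul contDiffAt_id))

theorem contDiffAt_mulI {n : WithTop ℕ∞} {X : E4 → E4} {p : E4} (hX : ContDiffAt ℝ n X p) :
    ContDiffAt ℝ n (fun q => mulI (X q)) p := by
  have h := contDiffAt_coord hX
  refine contDiffAt_euclidean.2 fun i => ?_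
  fin_cases i <;> simp [mulI] <;> fun_prop (disch := assumption)

theorem contDiffAt_clm_of_apply {F : Type*} [NormedAddCommGroup F] [NormedSpace ℝ F]
    {n : WithTop ℕ∞} {f : E4 → E4 →L[ℝ] F} {y : E4} (h : ∀ v, ContDiffAt ℝ n (fun z => f z v) y) :
    ContDiffAt ℝ n f y :=
  (contMDiffAt_clm_of_apply fun v => (h v).contMDiffAt).contDiffAt

theorem contDiffAt_cylForm {n : WithTop ℕ∞} {A B D r : ℝ → ℝ} {y : E4} (hy : y ≠ 0)
    (hA : ContDiffAt ℝ n A (Real.log ‖y‖)) (hB : ContDiffAt ℝ n B (Real.log ‖y‖))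
    (hD : ContDiffAt ℝ n D (Real.log ‖y‖)) (hr : ContDiffAt ℝ n r (Real.log ‖y‖)) :
    ContDiffAt ℝ n (fun z => cylForm (A (Real.log ‖z‖)) (B (Real.log ‖z‖)) (D (Real.log ‖z‖))
      (r (Real.log ‖z‖)) z) y := by
  have hn : ‖y‖ ≠ 0 := norm_ne_zero_iff.2 hy
  have hlog : ContDiffAt ℝ n (fun z : E4 => Real.log ‖z‖) y := (contDiffAt_id.norm ℝ hy).log hn
  have hA := hA.comp y hlog
  have hB := hB.comp y hlog
  have hD := hD.comp y hlog
  have hr := hr.comp y hlog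
  have hu := contDiffAt_unitVec (n := n) (contDiffAt_id (x := y)) hy
  have hm := contDiffAt_morseField hu
  have hi := contDiffAt_mulI hu
  have hℓ : ∀ v, ContDiffAt ℝ n (fun z => cylEll (r (Real.log ‖z‖)) z v) y := fun v =>
    ((hm.inner ℝ hu).mul (contDiffAt_cylDs hy v)).add
      (hr.mul (hm.inner ℝ (contDiffAt_unitVecDeriv hy v)))
  refine contDiffAt_clm_of_apply fun v => contDiffAt_clm_of_apply fun w => ?_
  simp only [cylForm_apply]
  exact ((((contDiffAt_cylDs hy v).mul (contDiffAt_cylDs hy w)).add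
    (hA.mul ((contDiffAt_unitVecDeriv hy v).inner ℝ (contDiffAt_unitVecDeriv hy w)))).add
    (hB.mul ((hℓ v).mul (hℓ w)))).sub
    (hD.mul ((hi.inner ℝ (contDiffAt_unitVecDeriv hy v)).mul
      (hi.inner ℝ (contDiffAt_unitVecDeriv hy w))))

end Cylinder

/-! ### The prescribed forms in terms of the radial decomposition -/

section Decomposition

theorem dRadius_eq {x : E4} (hx : x ≠ 0) (v : E4) : dRadius x v = ‖x‖ * cylDs x v := by
  have hn : ‖x‖ ≠ 0 := norm_ne_zero_iff.2 hx
  rw [dRadius, cylDs_apply]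
  field_simp

theorem roundForm_eq {x : E4} (hx : x ≠ 0) (v w : E4) :
    roundForm x v w = ⟪unitVecDeriv x v, unitVecDeriv x w⟫ := by
  have hn : ‖x‖ ≠ 0 := norm_ne_zero_iff.2 hx
  have h : ⟪v, w⟫ = ‖x‖ ^ 2 * (cylDs x v * cylDs x w + ⟪unitVecDeriv x v, unitVecDeriv x w⟫) := by
    conv_lhs => rw [cyl_decomposition hx v, cyl_decomposition hx w]
    have h1 : ⟪unitVecDeriv x v, unitVec x⟫ = 0 := by
      rw [real_inner_comm]
      exact inner_unitVec_unitVecDeriv hx v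
    simp only [real_inner_smul_left, real_inner_smul_right, inner_add_left, inner_add_right,
      inner_unitVec_self hx, inner_unitVec_unitVecDeriv hx, h1]
    ring
  rw [roundForm, dRadius_eq hx, dRadius_eq hx, h]
  field_simp
  ring

theorem mulI_smul (c : ℝ) (x : E4) : mulI (c • x) = c • mulI x := by
  ext i
  fin_cases i <;> simp [mulI]

theorem inner_mulI_self (x : E4) : ⟪mulI x, x⟫ = 0 := by
  rw [inner_eq]
  simp [mulI]
  ring

theorem hopfForm_eq {x : E4} (hx : x ≠ 0) (v : E4) :
    hopfForm x v = ⟪mulI (unitVec x), unitVecDeriv x v⟫ := by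
  have hn : ‖x‖ ≠ 0 := norm_ne_zero_iff.2 hx
  rw [hopfForm, unitVecDeriv_apply, unitVec, mulI_smul, real_inner_smul_left, real_inner_smul_right,
    inner_sub_right, real_inner_smul_right, inner_mulI_self]
  field_simp
  ring

theorem fderiv_morseFun (x v : E4) : fderiv ℝ morseFun x v = ⟪morseField x, v⟫ := by
  have hk : ∀ k : Fin 4, HasFDerivAt (fun y : E4 => y k) (EuclideanSpace.proj k : E4 →L[ℝ] ℝ) x :=
    fun k => (EuclideanSpace.proj k : E4 →L[ℝ] ℝ).hasFDerivAt
  have h := ((((((hk 0).pow 2).neg).add ((hk 1).pow 2)).add ((hk 2).pow 2)).add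
    ((hk 3).pow 2)).mul_const (2⁻¹ : ℝ)
  have h2 : HasFDerivAt morseFun _ x :=
    h.congr_of_eventuallyEq (Eventually.of_forall fun y => by simp [morseFun, div_eq_mul_inv])
  rw [h2.fderiv, inner_eq]
  simp [morseField]
  ring

theorem fderiv_morseFun_div {x : E4} (hx : x ≠ 0) (v : E4) :
    fderiv ℝ morseFun x v / ‖x‖ = ⟪morseField (unitVec x), unitVec x⟫ * dRadius x v +
      ‖x‖ * ⟪morseField (unitVec x), unitVecDeriv x v⟫ := by
  have hn : ‖x‖ ≠ 0 := norm_ne_zero_iff.2 hx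
  rw [fderiv_morseFun]
  conv_lhs => rw [cyl_decomposition hx v]
  rw [dRadius_eq hx, unitVec, morseField_smul]
  simp only [real_inner_smul_left, real_inner_smul_right, inner_add_right]
  field_simp

theorem dRadius_radialCLM {h' h : ℝ} (hh : 0 < h) {y : E4} (hy : y ≠ 0) (v : E4) :
    dRadius (h • unitVec y) (radialCLM h' h y v) = h' * cylDs y v := by
  rw [dRadius, norm_radial hh hy, radialCLM_apply, real_inner_smul_left, inner_add_right,
    real_inner_smul_right, real_inner_smul_right, inner_unitVec_self hy,
    inner_unitVec_unitVecDeriv hy]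
  field_simp
  ring

theorem radial_ne_zero {h : ℝ} (hh : 0 < h) {y : E4} (hy : y ≠ 0) : h • unitVec y ≠ 0 :=
  smul_ne_zero hh.ne' (unitVec_ne_zero hy)

theorem unitVecDeriv_radialCLM {h' h : ℝ} (hh : 0 < h) {y : E4} (hy : y ≠ 0) (v : E4) :
    unitVecDeriv (h • unitVec y) (radialCLM h' h y v) = unitVecDeriv y v := by
  have hx := radial_ne_zero hh hy
  have h1 : ⟪unitVec (h • unitVec y), unitVecDeriv y v⟫ = 0 := by
    rw [unitVec_radial hh hy]
    exact inner_unitVec_unitVecDeriv hy v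
  have h2 := unitVecDeriv_mk hx (h' * cylDs y v / h) h1
  rw [← h2, norm_radial hh hy, unitVec_radial hh hy, radialCLM_apply]
  congr 1
  rw [smul_add, smul_smul, mul_div_cancel₀ _ hh.ne']

/-- A radial map keeps the direction, so the spherical part of a vector is unchanged, and dr pulls
back to ds because the radius grows at unit rate. -/
theorem morseAnnulusForm_radialCLM {α β : ℝ → ℝ} {r : ℝ} (hr : 0 < r) {y : E4} (hy : y ≠ 0)
    (v w : E4) : morseAnnulusForm α β (r • unitVec y) (radialCLM 1 r y v) (radialCLM 1 r y w) =
      cylForm (α r ^ 2) (β r ^ 2) 0 r y v w := by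
  have hx := radial_ne_zero hr hy
  rw [morseAnnulusForm, cylForm_apply, roundForm_eq hx, fderiv_morseFun_div hx,
    fderiv_morseFun_div hx, dRadius_radialCLM hr hy, dRadius_radialCLM hr hy,
    unitVecDeriv_radialCLM hr hy, unitVecDeriv_radialCLM hr hy, norm_radial hr hy,
    unitVec_radial hr hy, cylEll, cylEll]
  ring

/-- The derivative -κ (1 + ρ²) is that of tan (κ (τ₀ + n₀ - s)); with it dχ pulls back to -ds, and
the sign disappears in the square. The number r is arbitrary, as the term in which it occurs has
coefficient 0. -/
theorem projectiveAnnulusForm_radialCLM {Λ : ℝ} (hΛ : 0 < Λ) {a b : ℝ → ℝ} {ρ : ℝ} (hρ : 0 < ρ)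
    {y : E4} (hy : y ≠ 0) (r : ℝ) (v w : E4) :
    projectiveAnnulusForm Λ a b (ρ • unitVec y)
      (radialCLM (-(kappa Λ * (1 + ρ ^ 2))) ρ y v) (radialCLM (-(kappa Λ * (1 + ρ ^ 2))) ρ y w) =
      cylForm (4 * a (chi Λ (ρ • unitVec y)) ^ 2) 0
        (4 * a (chi Λ (ρ • unitVec y)) ^ 2 * b (chi Λ (ρ • unitVec y)) ^ 2) r y v w := by
  have hx := radial_ne_zero hρ hy
  have hκ : kappa Λ ≠ 0 := (kappa_pos hΛ).ne'
  have hρ1 : 1 + ρ ^ 2 ≠ 0 := by positivity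
  rw [projectiveAnnulusForm, cylForm_apply, dChi, dChi, roundForm_eq hx, hopfForm_eq hx,
    hopfForm_eq hx, dRadius_radialCLM hρ hy, dRadius_radialCLM hρ hy,
    unitVecDeriv_radialCLM hρ hy, unitVecDeriv_radialCLM hρ hy, norm_radial hρ hy,
    unitVec_radial hρ hy]
  field_simp
  ring

theorem neckForm_eq (R : ℝ) {y : E4} (hy : y ≠ 0) (r : ℝ) (v w : E4) :
    cylForm (R ^ 2) 0 0 r y v w = neckForm R y v w := by
  rw [neckForm, cylForm_apply, roundForm_eq hy, cylDs_apply, cylDs_apply]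
  ring

/-- Where both profiles are the identity, the first two terms are the flat metric and the third is
df ⊗ df. This is the agreement of the annulus with the given metric beyond the surgery sphere. -/
theorem morseAnnulusForm_eq {α β : ℝ → ℝ} {x : E4} (hx : x ≠ 0) (hα : α ‖x‖ = ‖x‖)
    (hβ : β ‖x‖ = ‖x‖) (v w : E4) : morseAnnulusForm α β x v w =
      ⟪v, w⟫ + ⟪morseField x, v⟫ * ⟪morseField x, w⟫ := by
  have hn : ‖x‖ ≠ 0 := norm_ne_zero_iff.2 hx
  rw [morseAnnulusForm, hα, hβ, roundForm, fderiv_morseFun, fderiv_morseFun]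
  field_simp
  ring

theorem projectiveAnnulusForm_eq {Λ : ℝ} (hΛ : 0 < Λ) {a b : ℝ → ℝ} {x : E4} (hx : x ≠ 0)
    (ha : a (chi Λ x) = Real.sin (kappa Λ * chi Λ x) / (2 * kappa Λ))
    (hb : b (chi Λ x) = Real.sin (kappa Λ * chi Λ x)) (v w : E4) :
    projectiveAnnulusForm Λ a b x v w = fubiniStudyForm Λ x v w := by
  have hn : ‖x‖ ≠ 0 := norm_ne_zero_iff.2 hx
  have hκ : kappa Λ ≠ 0 := (kappa_pos hΛ).ne'
  have h1 : 1 + ‖x‖ ^ 2 ≠ 0 := by positivity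
  -- The angle is arctan r, so sin² = r² / (1 + r²); with 6 / Λ = 1 / κ² the comparison becomes
  -- rational.
  have hs : Real.sin (kappa Λ * chi Λ x) ^ 2 = ‖x‖ ^ 2 / (1 + ‖x‖ ^ 2) := by
    rw [kappa_mul_chi hΛ, Real.sin_arctan, div_pow, Real.sq_sqrt (by positivity)]
  have hk : 6 / Λ = 1 / kappa Λ ^ 2 := by
    rw [kappa, Real.sq_sqrt (by positivity), one_div_div]
  rw [projectiveAnnulusForm, ha, hb, div_pow, hs, fubiniStudyForm, hk, dChi, dChi, dRadius,
    dRadius, roundForm, dRadius, dRadius, hopfForm, hopfForm]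
  field_simp
  ring

end Decomposition

/-! ### Radial coefficients of the glued metric -/

section Coefficients

theorem deriv_ite_le_of_lt {f g : ℝ → ℝ} {c d : ℝ} (h : c < d) :
    deriv (fun t => if t ≤ d then f t else g t) c = deriv f c := by
  refine Filter.EventuallyEq.deriv_eq ?_
  filter_upwards [Iio_mem_nhds h] with t ht
  exact if_pos (le_of_lt ht)

theorem contDiff_one_ite_le {f g : ℝ → ℝ} {c : ℝ} (hf : ContDiff ℝ 1 f) (hg : ContDiff ℝ 1 g)
    (h0 : f c = g c) (h1 : deriv f c = deriv g c) :
    ContDiff ℝ 1 (fun t => if t ≤ c then f t else g t) :=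
  contDiff_iff_contDiffAt.2 fun _ =>
    contDiffAt_one_ite_le (fun _ => hf.contDiffAt) (fun _ => hg.contDiffAt) h0 h1

theorem hasDerivAt_sin_mul (κ t : ℝ) :
    HasDerivAt (fun t => Real.sin (κ * t)) (κ * Real.cos (κ * t)) t := by
  have h := ((hasDerivAt_id t).const_mul κ).sin
  exact h.congr_deriv (by simp [mul_comm])

/-- The profile `a`, extended by that of the Fubini-Study metric. -/
noncomputable def extA (Λ χ₁ : ℝ) (a : ℝ → ℝ) (t : ℝ) : ℝ :=
  if t ≤ χ₁ then a t else Real.sin (kappa Λ * t) / (2 * kappa Λ)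

/-- The profile `b`, extended by that of the Fubini-Study metric. -/
noncomputable def extB (Λ χ₁ : ℝ) (b : ℝ → ℝ) (t : ℝ) : ℝ :=
  if t ≤ χ₁ then b t else Real.sin (kappa Λ * t)

/-- A profile on the Morse side, extended by the identity. -/
noncomputable def extId (ξ₁ : ℝ) (α : ℝ → ℝ) (t : ℝ) : ℝ := if t ≤ ξ₁ then α t else t

section Projective

variable {Λ τ₀ χ₁ R : ℝ} {a b : ℝ → ℝ}

theorem contDiff_extA (hΛ : 0 < Λ) (h : ProjectiveProfile Λ τ₀ χ₁ R a b) :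
    ContDiff ℝ 1 (extA Λ χ₁ a) := by
  refine contDiff_one_ite_le (h.a_smooth.of_le (by norm_cast)) (by fun_prop) h.a_outer.1 ?_
  have hκ := (kappa_pos hΛ).ne'
  rw [h.a_outer.2, ((hasDerivAt_sin_mul (kappa Λ) χ₁).div_const _).deriv]
  field_simp

theorem contDiff_extB (h : ProjectiveProfile Λ τ₀ χ₁ R a b) : ContDiff ℝ 1 (extB Λ χ₁ b) := by
  refine contDiff_one_ite_le (h.b_smooth.of_le (by norm_cast)) (by fun_prop) h.b_outer.1 ?_
  rw [h.b_outer.2, (hasDerivAt_sin_mul (kappa Λ) χ₁).deriv]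

theorem sin_kappa_mul_pos (hΛ : 0 < Λ) {t : ℝ} (h0 : 0 < t) (h1 : t < Real.pi / (2 * kappa Λ)) :
    0 < Real.sin (kappa Λ * t) ∧ Real.sin (kappa Λ * t) < 1 := by
  have hκ := kappa_pos hΛ
  have h2 : kappa Λ * t < Real.pi / 2 := by
    rw [lt_div_iff₀ (by positivity)] at h1
    linarith
  have h3 : 0 < kappa Λ * t := mul_pos hκ h0
  refine ⟨Real.sin_pos_of_pos_of_lt_pi h3 (by linarith [Real.pi_pos]), ?_⟩
  have hc : 0 < Real.cos (kappa Λ * t) := Real.cos_pos_of_mem_Ioo ⟨by linarith, h2⟩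
  nlinarith [Real.sin_sq_add_cos_sq (kappa Λ * t)]

theorem extA_pos (hΛ : 0 < Λ) (h0 : 0 < τ₀) (h : ProjectiveProfile Λ τ₀ χ₁ R a b)
    {t : ℝ} (ht : τ₀ ≤ t) (ht' : t < Real.pi / (2 * kappa Λ)) : 0 < extA Λ χ₁ a t := by
  unfold extA
  split_ifs with h1
  · exact h.a_pos t ⟨ht, h1⟩
  · exact div_pos (sin_kappa_mul_pos hΛ (h0.trans_le ht) ht').1 (by linarith [kappa_pos hΛ])

/-- Up to χ₁ monotonicity keeps b between 0 and sin κχ₁ < 1; beyond, the function is a sine below 1.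
This is the inequality D < A needed for positivity. -/
theorem extB_sq_lt (hΛ : 0 < Λ) (h0 : 0 < τ₀) (h1 : τ₀ < χ₁) (h2 : χ₁ < Real.pi / (2 * kappa Λ))
    (h : ProjectiveProfile Λ τ₀ χ₁ R a b) {t : ℝ} (ht : τ₀ ≤ t)
    (ht' : t < Real.pi / (2 * kappa Λ)) : extB Λ χ₁ b t ^ 2 < 1 := by
  have key : 0 ≤ extB Λ χ₁ b t ∧ extB Λ χ₁ b t < 1 := by
    unfold extB
    split_ifs with h3
    · have h4 := h.b_mono ⟨le_rfl, h1.le⟩ ⟨ht, h3⟩ ht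
      have h5 := h.b_mono ⟨ht, h3⟩ ⟨h1.le, le_rfl⟩ h3
      rw [h.b_inner.1] at h4
      rw [h.b_outer.1] at h5
      exact ⟨h4, h5.trans_lt (sin_kappa_mul_pos hΛ (h0.trans h1) h2).2⟩
    · have h4 := sin_kappa_mul_pos hΛ (h0.trans_le ht) ht'
      exact ⟨h4.1.le, h4.2⟩
  nlinarith [key.1, key.2]

theorem hasDerivAt_extA (hΛ : 0 < Λ) (h1 : τ₀ < χ₁) (h : ProjectiveProfile Λ τ₀ χ₁ R a b) :
    HasDerivAt (extA Λ χ₁ a) 0 τ₀ := by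
  have h2 := ((contDiff_extA hΛ h).differentiable one_ne_zero).differentiableAt (x := τ₀)
  have h3 : deriv (extA Λ χ₁ a) τ₀ = 0 := (deriv_ite_le_of_lt h1).trans h.a_inner.2
  rw [← h3]
  exact h2.hasDerivAt

theorem hasDerivAt_extB (h1 : τ₀ < χ₁) (h : ProjectiveProfile Λ τ₀ χ₁ R a b) :
    HasDerivAt (extB Λ χ₁ b) 0 τ₀ := by
  have h2 := ((contDiff_extB h).differentiable one_ne_zero).differentiableAt (x := τ₀)
  have h3 : deriv (extB Λ χ₁ b) τ₀ = 0 := (deriv_ite_le_of_lt h1).trans h.b_inner.2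
  rw [← h3]
  exact h2.hasDerivAt

end Projective

section Morse

variable {σ₀ ξ₁ A : ℝ} {α : ℝ → ℝ}

theorem contDiff_extId (h : ContDiff ℝ ∞ α) (h0 : α ξ₁ = ξ₁) (h1 : deriv α ξ₁ = 1) :
    ContDiff ℝ 1 (extId ξ₁ α) :=
  contDiff_one_ite_le (h.of_le (by norm_cast)) contDiff_id h0 (by rw [h1]; exact (deriv_id ξ₁).symm)

theorem hasDerivAt_extId (h : ContDiff ℝ ∞ α) (h0 : α ξ₁ = ξ₁) (h1 : deriv α ξ₁ = 1)
    (hσ : σ₀ < ξ₁) (hα : deriv α σ₀ = 0) : HasDerivAt (extId ξ₁ α) 0 σ₀ := by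
  have h2 := ((contDiff_extId h h0 h1).differentiable one_ne_zero).differentiableAt (x := σ₀)
  have h3 : deriv (extId ξ₁ α) σ₀ = 0 := (deriv_ite_le_of_lt hσ).trans hα
  rw [← h3]
  exact h2.hasDerivAt

theorem extId_pos (hσ : 0 < σ₀) (hα : ∀ t ∈ Icc σ₀ ξ₁, 0 < α t) {t : ℝ} (ht : σ₀ ≤ t) :
    0 < extId ξ₁ α t := by
  unfold extId
  split_ifs with h1
  · exact hα t ⟨ht, h1⟩
  · linarith

end Morse

/-- A function of the cylinder coordinate that is constant on the neck `[n₀, n₁]` and given by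
functions of the radii `χ = τ₀ + n₀ - s` and `r = σ₀ + s - n₁` outside. -/
noncomputable def neckCoef (τ₀ σ₀ n₀ n₁ : ℝ) (f : ℝ → ℝ) (c : ℝ) (g : ℝ → ℝ) (s : ℝ) : ℝ :=
  if s ≤ n₀ then f (τ₀ + n₀ - s) else if s ≤ n₁ then c else g (σ₀ + s - n₁)

section NeckCoef

variable {τ₀ σ₀ n₀ n₁ c : ℝ} {f g : ℝ → ℝ}

theorem neckCoef_mid (hf : f τ₀ = c) {s : ℝ} (hs : s ∈ Icc n₀ n₁) :
    neckCoef τ₀ σ₀ n₀ n₁ f c g s = c := by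
  unfold neckCoef
  split_ifs with h1 h2
  · rw [le_antisymm h1 hs.1, add_sub_cancel_right, hf]
  · rfl
  · exact absurd hs.2 h2

theorem neckCoef_left {s : ℝ} (hs : s ≤ n₀) :
    neckCoef τ₀ σ₀ n₀ n₁ f c g s = f (τ₀ + n₀ - s) := if_pos hs

theorem neckCoef_right (hn : n₀ < n₁) (hg : g σ₀ = c) {s : ℝ} (hs : n₁ ≤ s) :
    neckCoef τ₀ σ₀ n₀ n₁ f c g s = g (σ₀ + s - n₁) := by
  unfold neckCoef
  rw [if_neg (by linarith)]
  split_ifs with h2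
  · rw [le_antisymm h2 hs, add_sub_cancel_right, hg]
  · rfl

/-- Both outer functions are stationary at the inner radii, so they join the constant to first
order; for this reason the reversal of the radius on the left does no harm. -/
theorem contDiff_neckCoef (hn : n₀ < n₁) (hf : ContDiff ℝ 1 f) (hg : ContDiff ℝ 1 g)
    (hf0 : f τ₀ = c) (hg0 : g σ₀ = c) (hf1 : HasDerivAt f 0 τ₀) (hg1 : HasDerivAt g 0 σ₀) :
    ContDiff ℝ 1 (neckCoef τ₀ σ₀ n₀ n₁ f c g) := by
  have hl : deriv (fun s => f (τ₀ + n₀ - s)) n₀ = 0 := by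
    have h1 : HasDerivAt f 0 (τ₀ + n₀ - n₀) := by rwa [add_sub_cancel_right]
    have := (h1.comp n₀ ((hasDerivAt_id n₀).const_sub (τ₀ + n₀))).deriv
    rwa [zero_mul] at this
  have hr : deriv (fun s => g (σ₀ + s - n₁)) n₁ = 0 := by
    have h1 : HasDerivAt g 0 (σ₀ + n₁ - n₁) := by rwa [add_sub_cancel_right]
    have := (h1.comp (h := fun s => σ₀ + s - n₁) n₁
      (((hasDerivAt_id n₁).const_add σ₀).sub_const n₁)).deriv
    rwa [zero_mul] at this
  refine contDiff_one_ite_le (hf.comp (by fun_prop)) (contDiff_one_ite_le contDiff_const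
    (hg.comp (by fun_prop)) (by rw [add_sub_cancel_right, hg0]) (by rw [hr, deriv_const])) ?_ ?_
  · rw [if_pos hn.le, add_sub_cancel_right, hf0]
  · rw [deriv_ite_le_of_lt hn, hl, deriv_const]

end NeckCoef

/-- Functions adapting the radial component and the radius of the fields to the neck. -/
structure NeckScales (Λ τ₀ σ₀ R n₀ n₁ : ℝ) (e : Fin 5 → ℝ) (k ρ μ ν ρ₀ : ℝ → ℝ) : Prop where
  k_smooth : ContDiff ℝ 1 k
  ρ_smooth : ∀ s, n₀ + τ₀ - Real.pi / (2 * kappa Λ) < s → ContDiffAt ℝ 1 ρ s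
  μ_smooth : ContDiff ℝ ∞ μ
  ν_smooth : ContDiff ℝ ∞ ν
  ρ₀_smooth : ContDiff ℝ ∞ ρ₀
  k_pos : ∀ s, n₀ + τ₀ - Real.pi / (2 * kappa Λ) < s → 0 < k s
  ρ_pos : ∀ s, n₀ + τ₀ - Real.pi / (2 * kappa Λ) < s → 0 < ρ s
  μ_pos : ∀ s, 0 < μ s
  ν_pos : ∀ s, 0 < ν s
  ρ₀_pos : ∀ s, 0 < ρ₀ s
  left : ∀ s ≤ n₀, k s = Real.sin (2 * (kappa Λ * (τ₀ + n₀ - s))) / (2 * R * kappa Λ) ∧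
    ρ s = Real.tan (kappa Λ * (τ₀ + n₀ - s))
  collar_left : ∀ s ∈ Icc n₀ (e 0), k s = ν s ∧ ρ s = ρ₀ s
  mid : ∀ s ∈ Icc (e 0) (e 4), k s = 1 ∧ ρ s = R
  collar_right : ∀ s ∈ Icc (e 4) n₁, k s = μ s ∧ ρ s = R
  right : ∀ s, n₁ ≤ s → k s = (σ₀ + s - n₁) / R ∧ ρ s = R

/-- The end values of k are the spherical stretch r / R of the map from the cylinder to the annulus
divided by its radial stretch |dr/ds|. The latter is 1 on the Morse side and κ (1 + r²) with r = tan
θ on the other, which gives sin 2θ / (2Rκ). The radius ρ has to follow tan θ because w_r is not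
homogeneous; v is linear and can be evaluated at the fixed radius R. -/
theorem exists_neckScales {Λ τ₀ σ₀ R n₀ n₁ : ℝ} {e : Fin 5 → ℝ} (hΛ : 0 < Λ) (hτ₀ : 0 < τ₀)
    (hτ : τ₀ < Real.pi / (2 * kappa Λ)) (hσ₀ : 0 < σ₀) (hR : 0 < R) (h0 : n₀ < e 0)
    (he : e 0 < e 4) (h4 : e 4 < n₁) :
    ∃ k ρ μ ν ρ₀, NeckScales Λ τ₀ σ₀ R n₀ n₁ e k ρ μ ν ρ₀ := by
  have hκ := kappa_pos hΛ
  have hangle : ∀ s, n₀ + τ₀ - Real.pi / (2 * kappa Λ) < s → s ≤ n₀ →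
      0 < kappa Λ * (τ₀ + n₀ - s) ∧ kappa Λ * (τ₀ + n₀ - s) < Real.pi / 2 := by
    intro s hs hs'
    have h1 : τ₀ + n₀ - s < Real.pi / (2 * kappa Λ) := by linarith
    rw [lt_div_iff₀ (by positivity)] at h1
    exact ⟨mul_pos hκ (by linarith), by linarith⟩
  have hcos : ∀ s, n₀ + τ₀ - Real.pi / (2 * kappa Λ) < s → s ≤ n₀ →
      0 < Real.cos (kappa Λ * (τ₀ + n₀ - s)) := fun s hs hs' =>
    Real.cos_pos_of_mem_Ioo ⟨by linarith [(hangle s hs hs').1, Real.pi_pos], (hangle s hs hs').2⟩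
  have hsin : ∀ s, n₀ + τ₀ - Real.pi / (2 * kappa Λ) < s → s ≤ n₀ →
      0 < Real.sin (2 * (kappa Λ * (τ₀ + n₀ - s))) / (2 * R * kappa Λ) := fun s hs hs' => by
    have := hangle s hs hs'
    exact div_pos (Real.sin_pos_of_pos_of_lt_pi (by linarith) (by linarith)) (by positivity)
  have htan : ∀ s, n₀ + τ₀ - Real.pi / (2 * kappa Λ) < s → s ≤ n₀ →
      0 < Real.tan (kappa Λ * (τ₀ + n₀ - s)) := fun s hs hs' =>
    Real.tan_pos_of_pos_of_lt_pi_div_two (hangle s hs hs').1 (hangle s hs hs').2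
  have hn : n₀ + τ₀ - Real.pi / (2 * kappa Λ) < n₀ := by linarith
  obtain ⟨ν, hν, hνp, hν1, hν2, hν3, hν4⟩ := exists_pos_smooth_jets (B := 1) (B' := 0)
    (A' := deriv (fun s => Real.sin (2 * (kappa Λ * (τ₀ + n₀ - s))) / (2 * R * kappa Λ)) n₀)
    h0 (hsin n₀ hn le_rfl) one_pos
  obtain ⟨ρ₀, hρ, hρp, hρ1, hρ2, hρ3, hρ4⟩ := exists_pos_smooth_jets (B := R) (B' := 0)
    (A' := deriv (fun s => Real.tan (kappa Λ * (τ₀ + n₀ - s))) n₀) h0 (htan n₀ hn le_rfl) hR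
  obtain ⟨μ, hμ, hμp, hμ1, hμ2, hμ3, hμ4⟩ := exists_pos_smooth_jets (A := 1) (A' := 0)
    (B := (σ₀ + n₁ - n₁) / R) (B' := deriv (fun s => (σ₀ + s - n₁) / R) n₁) h4 one_pos
    (by rw [add_sub_cancel_right]; positivity)
  have hone : (1 : WithTop ℕ∞) ≤ ∞ := by norm_cast
  -- The pieces are nested from the right, so that each junction is a single application of
  -- `contDiff_one_ite_le`.
  let k₃ : ℝ → ℝ := fun s => if s ≤ n₁ then μ s else (σ₀ + s - n₁) / R
  let k₂ : ℝ → ℝ := fun s => if s ≤ e 4 then 1 else k₃ s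
  let k₁ : ℝ → ℝ := fun s => if s ≤ e 0 then ν s else k₂ s
  let k : ℝ → ℝ := fun s => if s ≤ n₀ then
    Real.sin (2 * (kappa Λ * (τ₀ + n₀ - s))) / (2 * R * kappa Λ) else k₁ s
  let ρ₁ : ℝ → ℝ := fun s => if s ≤ e 0 then ρ₀ s else R
  let ρ : ℝ → ℝ := fun s => if s ≤ n₀ then Real.tan (kappa Λ * (τ₀ + n₀ - s)) else ρ₁ s
  have hk₃ : ContDiff ℝ 1 k₃ := contDiff_one_ite_le (hμ.of_le hone) (by fun_prop) hμ3 hμ4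
  have hk₂ : ContDiff ℝ 1 k₂ := contDiff_one_ite_le contDiff_const hk₃
    (by simp only [k₃]; rw [if_pos h4.le, hμ1])
    (by simp only [k₃]; rw [deriv_ite_le_of_lt h4, hμ2, deriv_const])
  have hk₁ : ContDiff ℝ 1 k₁ := contDiff_one_ite_le (hν.of_le hone) hk₂
    (by simp only [k₂]; rw [if_pos he.le, hν3])
    (by simp only [k₂]; rw [deriv_ite_le_of_lt he, hν4, deriv_const])
  have hk : ContDiff ℝ 1 k := contDiff_one_ite_le
    ((Real.contDiff_sin.comp (by fun_prop)).div_const _) hk₁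
    (by simp only [k₁]; rw [if_pos h0.le, hν1])
    (by simp only [k₁]; rw [deriv_ite_le_of_lt h0, hν2])
  have hρ₁ : ContDiff ℝ 1 ρ₁ := contDiff_one_ite_le (hρ.of_le hone) contDiff_const hρ3
    (by rw [hρ4, deriv_const])
  have hl : ∀ s ∈ Icc n₀ (e 0), k s = ν s ∧ ρ s = ρ₀ s := by
    intro s hs
    simp only [k, ρ, k₁, ρ₁, if_pos hs.2]
    split_ifs with h1
    · rw [le_antisymm h1 hs.1]
      exact ⟨hν1.symm, hρ1.symm⟩
    · exact ⟨rfl, rfl⟩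
  have hm : ∀ s ∈ Icc (e 0) (e 4), k s = 1 ∧ ρ s = R := by
    intro s hs
    simp only [k, ρ, k₁, ρ₁, k₂, if_pos hs.2, if_neg (show ¬ s ≤ n₀ by linarith [hs.1])]
    split_ifs with h1
    · rw [le_antisymm h1 hs.1]
      exact ⟨hν3, hρ3⟩
    · exact ⟨rfl, rfl⟩
  have hr₁ : ∀ s, e 4 ≤ s → k s = k₃ s ∧ ρ s = R := by
    intro s hs
    simp only [k, ρ, k₁, ρ₁, k₂, if_neg (show ¬ s ≤ n₀ by linarith),
      if_neg (show ¬ s ≤ e 0 by linarith), and_true]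
    split_ifs with h1
    · rw [le_antisymm h1 hs]
      simp only [k₃]
      rw [if_pos h4.le, hμ1]
    · rfl
  have hr₂ : ∀ s ∈ Icc (e 4) n₁, k s = μ s ∧ ρ s = R := fun s hs => by
    obtain ⟨h1, h2⟩ := hr₁ s hs.1
    exact ⟨h1.trans (if_pos hs.2), h2⟩
  have hr₃ : ∀ s, n₁ ≤ s → k s = (σ₀ + s - n₁) / R ∧ ρ s = R := fun s hs => by
    obtain ⟨h1, h2⟩ := hr₁ s (h4.le.trans hs)
    refine ⟨h1.trans ?_, h2⟩
    simp only [k₃]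
    split_ifs with h3
    · rw [le_antisymm h3 hs, hμ3]
    · rfl
  have hpos : ∀ s, n₀ + τ₀ - Real.pi / (2 * kappa Λ) < s → 0 < k s ∧ 0 < ρ s := by
    intro s hs
    rcases le_total s n₀ with h1 | h1
    · simp only [k, ρ, if_pos h1]
      exact ⟨hsin s hs h1, htan s hs h1⟩
    rcases le_total s (e 0) with h2 | h2
    · rw [(hl s ⟨h1, h2⟩).1, (hl s ⟨h1, h2⟩).2]
      exact ⟨hνp s, hρp s⟩
    rcases le_total s (e 4) with h3 | h3
    · rw [(hm s ⟨h2, h3⟩).1, (hm s ⟨h2, h3⟩).2]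
      exact ⟨one_pos, hR⟩
    rcases le_total s n₁ with h5 | h5
    · rw [(hr₂ s ⟨h3, h5⟩).1, (hr₂ s ⟨h3, h5⟩).2]
      exact ⟨hμp s, hR⟩
    · rw [(hr₃ s h5).1, (hr₃ s h5).2]
      exact ⟨div_pos (by linarith) hR, hR⟩
  refine ⟨k, ρ, μ, ν, ρ₀, hk, fun s hs => ?_, hμ, hν, hρ, fun s hs => (hpos s hs).1,
    fun s hs => (hpos s hs).2, hμp, hνp, hρp, fun s hs => ?_, hl, hm, hr₂, hr₃⟩
  · refine contDiffAt_one_ite_le (fun h => ?_) (fun _ => hρ₁.contDiffAt)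
      (by simp only [ρ₁]; rw [if_pos h0.le, hρ1])
      (by simp only [ρ₁]; rw [deriv_ite_le_of_lt h0, hρ2])
    exact (Real.contDiffAt_tan.2 (hcos s hs h).ne').comp (g := Real.tan)
      (f := fun s => kappa Λ * (τ₀ + n₀ - s)) s (by fun_prop)
  · simp only [k, ρ, if_pos hs, and_self]

end Coefficients

/-! ### The metric and the field on the cylinder -/

section NeckModel

/-- The Riemannian metric of the neck, extended over both annuli and beyond. -/
noncomputable def neckMetric (Λ τ₀ χ₁ σ₀ ξ₁ R n₀ n₁ : ℝ) (a b α β : ℝ → ℝ) (y : E4) :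
    E4 →L[ℝ] E4 →L[ℝ] ℝ :=
  cylForm
    (neckCoef τ₀ σ₀ n₀ n₁ (fun t => 4 * extA Λ χ₁ a t ^ 2) (R ^ 2) (fun t => extId ξ₁ α t ^ 2)
      (Real.log ‖y‖))
    (neckCoef τ₀ σ₀ n₀ n₁ (fun _ => 0) 0 (fun t => extId ξ₁ β t ^ 2) (Real.log ‖y‖))
    (neckCoef τ₀ σ₀ n₀ n₁ (fun t => 4 * extA Λ χ₁ a t ^ 2 * extB Λ χ₁ b t ^ 2) 0 (fun _ => 0)
      (Real.log ‖y‖))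
    (σ₀ + Real.log ‖y‖ - n₁) y

/-- The vector field of the neck, extended over both annuli and beyond. -/
noncomputable def neckVectorField (R : ℝ) (e : Fin 5 → ℝ) (b c d : ℝ → ℝ)
    (P : ℝ → Matrix (Fin 4) (Fin 4) ℝ) (k ρ : ℝ → ℝ) (y : E4) : E4 :=
  neckVector R y (radialScale (k (Real.log ‖y‖)) (clampedDeformation e b c d P (Real.log ‖y‖))
    (ρ (Real.log ‖y‖) • unitVec y))

section Metric

variable {Λ τ₀ χ₁ σ₀ ξ₁ R n₀ n₁ : ℝ} {a b α β : ℝ → ℝ}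

theorem neckMetric_symm (y v w : E4) : neckMetric Λ τ₀ χ₁ σ₀ ξ₁ R n₀ n₁ a b α β y v w =
    neckMetric Λ τ₀ χ₁ σ₀ ξ₁ R n₀ n₁ a b α β y w v := cylForm_symm _ _ _ _ _ _ _

theorem sq_extA_inner (hτ : τ₀ < χ₁) (hA : ProjectiveProfile Λ τ₀ χ₁ R a b) :
    4 * extA Λ χ₁ a τ₀ ^ 2 = R ^ 2 := by
  rw [extA, if_pos hτ.le, ← hA.a_inner.1]
  ring

theorem extB_inner (hτ : τ₀ < χ₁) (hA : ProjectiveProfile Λ τ₀ χ₁ R a b) : extB Λ χ₁ b τ₀ = 0 := by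
  rw [extB, if_pos hτ.le, hA.b_inner.1]

/-- At the inner radii 4a² = R², b = 0, α = R and β = 0, with vanishing derivatives; products and
squares inherit this, so each coefficient meets the constant value on the neck to first order. -/
theorem contDiffAt_neckMetric (hΛ : 0 < Λ) (hτ : τ₀ < χ₁) (hσ : σ₀ < ξ₁) (hn : n₀ < n₁)
    (hA : ProjectiveProfile Λ τ₀ χ₁ R a b) (hB : MorseProfile σ₀ ξ₁ R α β) {y : E4} (hy : y ≠ 0) :
    ContDiffAt ℝ 1 (neckMetric Λ τ₀ χ₁ σ₀ ξ₁ R n₀ n₁ a b α β) y := by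
  have ha := contDiff_extA hΛ hA
  have hb := contDiff_extB hA
  have hα := contDiff_extId hB.α_smooth hB.α_outer.1 hB.α_outer.2
  have hβ := contDiff_extId hB.β_smooth hB.β_outer.1 hB.β_outer.2
  have ha' := hasDerivAt_extA hΛ hτ hA
  have hb' := hasDerivAt_extB hτ hA
  have hα' := hasDerivAt_extId hB.α_smooth hB.α_outer.1 hB.α_outer.2 hσ hB.α_inner.2
  have hβ' := hasDerivAt_extId hB.β_smooth hB.β_outer.1 hB.β_outer.2 hσ hB.β_inner.2
  have hα0 : extId ξ₁ α σ₀ = R := (if_pos hσ.le).trans hB.α_inner.1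
  have hβ0 : extId ξ₁ β σ₀ = 0 := (if_pos hσ.le).trans hB.β_inner.1
  refine contDiffAt_cylForm (r := fun s => σ₀ + s - n₁) hy (ContDiff.contDiffAt ?_)
    (ContDiff.contDiffAt ?_) (ContDiff.contDiffAt ?_) (by fun_prop)
  · exact contDiff_neckCoef hn (contDiff_const.mul (ha.pow 2)) (hα.pow 2) (sq_extA_inner hτ hA)
      (by rw [hα0]) (((ha'.pow 2).const_mul 4).congr_deriv (by simp))
      ((hα'.pow 2).congr_deriv (by simp))
  · exact contDiff_neckCoef hn contDiff_const (hβ.pow 2) rfl (by rw [hβ0]; simp)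
      (hasDerivAt_const _ _) ((hβ'.pow 2).congr_deriv (by simp))
  · exact contDiff_neckCoef hn ((contDiff_const.mul (ha.pow 2)).mul (hb.pow 2)) contDiff_const
      (by rw [extB_inner hτ hA]; simp) rfl
      ((((ha'.pow 2).const_mul 4).mul (hb'.pow 2)).congr_deriv (by simp)) (hasDerivAt_const _ _)

theorem neckMetric_pos (hΛ : 0 < Λ) (hτ₀ : 0 < τ₀) (hτ : τ₀ < χ₁)
    (hχ : χ₁ < Real.pi / (2 * kappa Λ)) (hσ₀ : 0 < σ₀) (hσ : σ₀ < ξ₁) (hR : 0 < R) (hn : n₀ < n₁)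
    (hA : ProjectiveProfile Λ τ₀ χ₁ R a b) (hB : MorseProfile σ₀ ξ₁ R α β) {y : E4} (hy : y ≠ 0)
    (hs : n₀ + τ₀ - Real.pi / (2 * kappa Λ) < Real.log ‖y‖) {v : E4} (hv : v ≠ 0) :
    0 < neckMetric Λ τ₀ χ₁ σ₀ ξ₁ R n₀ n₁ a b α β y v v := by
  have hα0 : extId ξ₁ α σ₀ = R := (if_pos hσ.le).trans hB.α_inner.1
  have hβ0 : extId ξ₁ β σ₀ = 0 := (if_pos hσ.le).trans hB.β_inner.1
  have hA0 := sq_extA_inner hτ hA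
  have hB0 := extB_inner hτ hA
  unfold neckMetric
  rcases le_total (Real.log ‖y‖) n₀ with h1 | h1
  · have h2 : τ₀ ≤ τ₀ + n₀ - Real.log ‖y‖ := by linarith
    have h3 : τ₀ + n₀ - Real.log ‖y‖ < Real.pi / (2 * kappa Λ) := by linarith
    have ha := extA_pos hΛ hτ₀ hA h2 h3
    have hb := extB_sq_lt hΛ hτ₀ hτ hχ hA h2 h3
    rw [neckCoef_left h1, neckCoef_left h1, neckCoef_left h1]
    refine cylForm_pos le_rfl (by positivity) ?_ hy hv
    have : 0 < 4 * extA Λ χ₁ a (τ₀ + n₀ - Real.log ‖y‖) ^ 2 := by positivity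
    exact mul_lt_of_lt_one_right this hb
  rcases le_total (Real.log ‖y‖) n₁ with h2 | h2
  · rw [neckCoef_mid (f := fun t => 4 * extA Λ χ₁ a t ^ 2) hA0 ⟨h1, h2⟩,
      neckCoef_mid (f := fun _ => 0) rfl ⟨h1, h2⟩,
      neckCoef_mid (f := fun t => 4 * extA Λ χ₁ a t ^ 2 * extB Λ χ₁ b t ^ 2) (by rw [hB0]; simp) ⟨h1, h2⟩]
    exact cylForm_pos le_rfl le_rfl (by positivity) hy hv
  · rw [neckCoef_right hn (by rw [hα0]) h2, neckCoef_right hn (by rw [hβ0]; simp) h2,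
      neckCoef_right hn (g := fun _ => 0) rfl h2]
    have := extId_pos hσ₀ hB.α_pos (t := σ₀ + Real.log ‖y‖ - n₁) (by linarith)
    exact cylForm_pos (by positivity) le_rfl (by positivity) hy hv

theorem neckMetric_neck (hτ : τ₀ < χ₁) (hA : ProjectiveProfile Λ τ₀ χ₁ R a b) {y : E4}
    (hy : y ≠ 0) (hs : Real.log ‖y‖ ∈ Icc n₀ n₁) (v w : E4) :
    neckMetric Λ τ₀ χ₁ σ₀ ξ₁ R n₀ n₁ a b α β y v w = neckForm R y v w := by
  rw [neckMetric, neckCoef_mid (f := fun t => 4 * extA Λ χ₁ a t ^ 2) (sq_extA_inner hτ hA) hs,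
    neckCoef_mid (f := fun _ => 0) rfl hs, neckCoef_mid (f := fun t => 4 * extA Λ χ₁ a t ^ 2 * extB Λ χ₁ b t ^ 2)
      (by rw [extB_inner hτ hA]; simp) hs, neckForm_eq R hy]

theorem neckMetric_morse (hσ₀ : 0 < σ₀) (hσ : σ₀ < ξ₁) (hn : n₀ < n₁)
    (hB : MorseProfile σ₀ ξ₁ R α β) {y : E4} (hy : y ≠ 0) (hs : n₁ ≤ Real.log ‖y‖) (v w : E4) :
    morseAnnulusForm (extId ξ₁ α) (extId ξ₁ β) ((σ₀ + Real.log ‖y‖ - n₁) • unitVec y)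
        (radialCLM 1 (σ₀ + Real.log ‖y‖ - n₁) y v) (radialCLM 1 (σ₀ + Real.log ‖y‖ - n₁) y w) =
      neckMetric Λ τ₀ χ₁ σ₀ ξ₁ R n₀ n₁ a b α β y v w := by
  have hα0 : extId ξ₁ α σ₀ = R := (if_pos hσ.le).trans hB.α_inner.1
  have hβ0 : extId ξ₁ β σ₀ = 0 := (if_pos hσ.le).trans hB.β_inner.1
  rw [morseAnnulusForm_radialCLM (by linarith) hy, neckMetric, neckCoef_right hn (by rw [hα0]) hs,
    neckCoef_right hn (by rw [hβ0]; simp) hs, neckCoef_right hn (g := fun _ => 0) rfl hs]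

theorem neckMetric_projective (hΛ : 0 < Λ) (hτ₀ : 0 < τ₀) {y : E4} (hy : y ≠ 0)
    (hs : n₀ + τ₀ - Real.pi / (2 * kappa Λ) < Real.log ‖y‖) (hs' : Real.log ‖y‖ ≤ n₀)
    {h ρ : ℝ} (hρ : ρ = Real.tan (kappa Λ * (τ₀ + n₀ - Real.log ‖y‖)))
    (hh : h = -(kappa Λ * (1 + ρ ^ 2))) (v w : E4) :
    projectiveAnnulusForm Λ (extA Λ χ₁ a) (extB Λ χ₁ b) (ρ • unitVec y)
        (radialCLM h ρ y v) (radialCLM h ρ y w) =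
      neckMetric Λ τ₀ χ₁ σ₀ ξ₁ R n₀ n₁ a b α β y v w := by
  have h1 : 0 < τ₀ + n₀ - Real.log ‖y‖ := by linarith
  have h2 : τ₀ + n₀ - Real.log ‖y‖ < Real.pi / (2 * kappa Λ) := by linarith
  have h3 := norm_tan_smul_unitVec (kappa_pos hΛ) h1 h2 hy
  have h4 := chi_tan_smul_unitVec hΛ h1 h2 hy
  rw [← hρ] at h3 h4
  rw [hh, projectiveAnnulusForm_radialCLM hΛ h3.2.1 hy (σ₀ + Real.log ‖y‖ - n₁), h4, neckMetric,
    neckCoef_left hs', neckCoef_left hs', neckCoef_left hs']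

end Metric

section Field

variable {Λ τ₀ σ₀ R n₀ n₁ : ℝ} {e : Fin 5 → ℝ} {b c d : ℝ → ℝ} {P : ℝ → Matrix (Fin 4) (Fin 4) ℝ}
  {k ρ μ ν ρ₀ : ℝ → ℝ}

theorem radialScale_congr (k : ℝ) {F F' : E4 → E4} {x : E4} (h : F x = F' x) :
    radialScale k F x = radialScale k F' x := by
  rw [radialScale, radialScale, h]

/-- The radial component is multiplied by h' κ and the spherical one by h / R. When the two factors
agree up to sign, a multiple of F or of its radial reflection comes out; this dictates κ. -/
theorem radialCLM_neckVector_radialScale {h' h : ℝ} {κ r : ℝ} (hr : 0 < r) {F : E4 → E4} {y : E4}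
    (hy : y ≠ 0) : radialCLM h' h y (neckVector R y (radialScale κ F (r • unitVec y))) =
      (h' * (κ * ⟪F (r • unitVec y), unitVec y⟫)) • unitVec y + (h * R⁻¹) •
        (F (r • unitVec y) - ⟪F (r • unitVec y), unitVec y⟫ • unitVec y) := by
  rw [radialCLM_neckVector hy, radialScale_radial hr hy, inner_add_left, real_inner_smul_left,
    inner_unitVec_self hy]
  module

theorem clampedDeformation_ne_zero (h : NeckSchedule e b c d P) (s : ℝ) {x : E4} (hx : x ≠ 0) :
    clampedDeformation e b c d P s x ≠ 0 := by
  rcases le_total s (e 0) with h1 | h1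
  · rw [h.clampedDeformation_left h1 hx, reflectedField_eq hx]
    have := reflectedField_stage_ne_zero 1 hx
    rwa [one_smul] at this
  rcases le_total s (e 4) with h2 | h2
  · rw [h.clampedDeformation_eq ⟨h1, h2⟩]
    exact h.neckField_ne_zero ⟨h1, h2⟩ hx
  · rw [h.clampedDeformation_right h2]
    rwa [Ne, morseField_eq_zero_iff]

theorem neckVectorField_ne_zero (hR : 0 < R) (h : NeckSchedule e b c d P)
    (hk : NeckScales Λ τ₀ σ₀ R n₀ n₁ e k ρ μ ν ρ₀) {y : E4} (hy : y ≠ 0)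
    (hs : n₀ + τ₀ - Real.pi / (2 * kappa Λ) < Real.log ‖y‖) :
    neckVectorField R e b c d P k ρ y ≠ 0 := by
  have hx := radial_ne_zero (hk.ρ_pos _ hs) hy
  exact neckVector_ne_zero hR.ne' hy
    (radialScale_ne_zero (hk.k_pos _ hs).ne' hx (clampedDeformation_ne_zero h _ hx))

theorem contDiffAt_neckVectorField (h : NeckSchedule e b c d P)
    (hk : NeckScales Λ τ₀ σ₀ R n₀ n₁ e k ρ μ ν ρ₀) {y : E4} (hy : y ≠ 0)
    (hs : n₀ + τ₀ - Real.pi / (2 * kappa Λ) < Real.log ‖y‖) :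
    ContDiffAt ℝ 1 (neckVectorField R e b c d P k ρ) y := by
  have hn : ‖y‖ ≠ 0 := norm_ne_zero_iff.2 hy
  have hlog : ContDiffAt ℝ 1 (fun z : E4 => Real.log ‖z‖) y := (contDiffAt_id.norm ℝ hy).log hn
  have hu : ContDiffAt ℝ 1 unitVec y := contDiffAt_unitVec contDiffAt_id hy
  have hX : ContDiffAt ℝ 1 (fun z : E4 => ρ (Real.log ‖z‖) • unitVec z) y :=
    ((hk.ρ_smooth _ hs).comp y hlog).smul hu
  have hx := radial_ne_zero (hk.ρ_pos _ hs) hy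
  have hF := h.contDiffAt_clampedDeformation hlog hX hx
  have hK := hk.k_smooth.contDiffAt.comp y hlog
  have hG : ContDiffAt ℝ 1 (fun z : E4 => radialScale (k (Real.log ‖z‖))
      (clampedDeformation e b c d P (Real.log ‖z‖)) (ρ (Real.log ‖z‖) • unitVec z)) y :=
    hF.add ((((hK.sub contDiffAt_const).mul (hF.inner ℝ hX)).div (hX.norm_sq ℝ)
      (by positivity)).smul hX)
  have hin := hG.inner ℝ hu
  exact (contDiffAt_id.norm ℝ hy).smul ((hin.smul hu).add
    ((contDiffAt_const (c := R⁻¹)).smul (hG.sub (hin.smul hu))))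

/-- Here k equals r / R, so the radial and spherical factors agree, and linearity of the Morse field
turns (r / R) v(R u) into v(r u). -/
theorem radialCLM_neckVectorField_morse (hR : 0 < R) (h : NeckSchedule e b c d P) (h4 : e 4 < n₁)
    (hk : NeckScales Λ τ₀ σ₀ R n₀ n₁ e k ρ μ ν ρ₀) {y : E4} (hy : y ≠ 0)
    (hs : n₁ ≤ Real.log ‖y‖) :
    radialCLM 1 (σ₀ + Real.log ‖y‖ - n₁) y (neckVectorField R e b c d P k ρ y) =
      morseField ((σ₀ + Real.log ‖y‖ - n₁) • unitVec y) := by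
  have h1 := hk.right _ hs
  rw [neckVectorField, h1.1, h1.2, radialCLM_neckVector_radialScale hR hy,
    h.clampedDeformation_right (h4.le.trans hs), morseField_smul, morseField_smul,
    real_inner_smul_left, smul_sub, smul_smul, smul_smul]
  have e1 : 1 * ((σ₀ + Real.log ‖y‖ - n₁) / R * (R * ⟪morseField (unitVec y), unitVec y⟫)) =
      (σ₀ + Real.log ‖y‖ - n₁) * R⁻¹ * (R * ⟪morseField (unitVec y), unitVec y⟫) := by
    field_simp
  rw [e1, inv_mul_cancel_right₀ hR.ne']
  module

/-- The radius decreases with s, so the radial factor is -r / R while the spherical one is r / R.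
The sign undoes the radial reflection and w itself reappears. -/
theorem radialCLM_neckVectorField_projective (hΛ : 0 < Λ) (hτ₀ : 0 < τ₀)
    (h : NeckSchedule e b c d P) (h0 : n₀ < e 0)
    (hk : NeckScales Λ τ₀ σ₀ R n₀ n₁ e k ρ μ ν ρ₀) {y : E4} (hy : y ≠ 0)
    (hs : n₀ + τ₀ - Real.pi / (2 * kappa Λ) < Real.log ‖y‖) (hs' : Real.log ‖y‖ ≤ n₀)
    {q r : ℝ} (hr : r = Real.tan (kappa Λ * (τ₀ + n₀ - Real.log ‖y‖)))
    (hq : q = -(kappa Λ * (1 + r ^ 2))) :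
    radialCLM q r y (neckVectorField R e b c d P k ρ y) =
      (r / R) • affineField 0 (r • unitVec y) := by
  have h1 : 0 < τ₀ + n₀ - Real.log ‖y‖ := by linarith
  have h2 : τ₀ + n₀ - Real.log ‖y‖ < Real.pi / (2 * kappa Λ) := by linarith
  obtain ⟨h3, h4, h5⟩ := norm_tan_smul_unitVec (kappa_pos hΛ) h1 h2 hy
  rw [← hr] at h4 h5
  have hx := radial_ne_zero h4 hy
  have hl := hk.left _ hs'
  have hk' : q * k (Real.log ‖y‖) = -(r / R) := by
    have hκ := (kappa_pos hΛ).ne'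
    have hc : 0 < Real.cos (kappa Λ * (τ₀ + n₀ - Real.log ‖y‖)) := by
      rw [← h5]
      exact Real.cos_arctan_pos _
    have hr1 : 1 + r ^ 2 = (Real.cos (kappa Λ * (τ₀ + n₀ - Real.log ‖y‖)) ^ 2)⁻¹ := by
      rw [hr, Real.inv_one_add_tan_sq hc.ne' |>.symm, inv_inv]
    rw [hq, hl.1, hr1, Real.sin_two_mul, hr, Real.tan_eq_sin_div_cos]
    field_simp
  rw [neckVectorField, hl.2, ← hr, radialCLM_neckVector_radialScale h4 hy,
    h.clampedDeformation_left (hs'.trans h0.le) hx, reflectedField, ← mul_assoc, hk',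
    radialScale_radial h4 hy, inner_add_left, real_inner_smul_left, inner_unitVec_self hy,
    div_eq_mul_inv]
  module

theorem neckVectorField_neck (hR : 0 < R) (h : NeckSchedule e b c d P)
    (hk : NeckScales Λ τ₀ σ₀ R n₀ n₁ e k ρ μ ν ρ₀) {y : E4} (hy : y ≠ 0)
    (hs : Real.log ‖y‖ ∈ Icc (e 0) (e 4)) :
    ∃ c' : ℝ, 0 < c' ∧ neckVectorField R e b c d P k ρ y =
      c' • neckVector R y (unitVec (neckField e b c d P (Real.log ‖y‖) (R • unitVec y))) := by
  have hm := hk.mid _ hs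
  have hne := h.neckField_ne_zero hs (radial_ne_zero hR hy)
  refine ⟨_, norm_pos_iff.2 hne, ?_⟩
  rw [← neckVector_smul, norm_smul_unitVec, neckVectorField, hm.1, hm.2, radialScale_one,
    h.clampedDeformation_eq hs]

theorem neckVectorField_collar_right (hR : 0 < R) (h : NeckSchedule e b c d P)
    (hk : NeckScales Λ τ₀ σ₀ R n₀ n₁ e k ρ μ ν ρ₀) {y : E4} (hy : y ≠ 0)
    (hs : Real.log ‖y‖ ∈ Icc (e 4) n₁) :
    ∃ c' : ℝ, 0 < c' ∧ neckVectorField R e b c d P k ρ y =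
      c' • neckVector R y (radialScale (μ (Real.log ‖y‖)) morseField (unitVec y)) := by
  have hm := hk.collar_right _ hs
  refine ⟨R, hR, ?_⟩
  rw [neckVectorField, hm.1, hm.2, ← neckVector_smul, radialScale_radial hR hy,
    h.clampedDeformation_right hs.1, morseField_smul, real_inner_smul_left, radialScale,
    norm_unitVec hy]
  congr 1
  module

theorem neckVectorField_collar_left (h : NeckSchedule e b c d P)
    (hk : NeckScales Λ τ₀ σ₀ R n₀ n₁ e k ρ μ ν ρ₀) {y : E4} (hy : y ≠ 0)
    (hs : Real.log ‖y‖ ∈ Icc n₀ (e 0)) :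
    neckVectorField R e b c d P k ρ y = neckVector R y
      (radialScale (ν (Real.log ‖y‖)) reflectedField (ρ₀ (Real.log ‖y‖) • unitVec y)) := by
  have hm := hk.collar_left _ hs
  rw [neckVectorField, hm.1, hm.2]
  congr 1
  exact radialScale_congr _ (h.clampedDeformation_left hs.2 (radial_ne_zero (hk.ρ₀_pos _) hy))

end Field

end NeckModel

/-! ### Absence of a thin shell -/

section Shell

theorem continuousAt_fderiv_apply {F : Type*} [NormedAddCommGroup F] [NormedSpace ℝ F] {B : E4 → F}
    {y : E4} (hB : ContDiffAt ℝ 1 B y) {c : E4 → E4} (hc : ContinuousAt c y) :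
    ContinuousAt (fun z => fderiv ℝ B z (c z)) y :=
  ((hB.fderiv_right (m := 0) (by norm_num)).continuousAt).clm_apply hc

theorem fderiv_form_apply_self {F : Type*} [NormedAddCommGroup F] [NormedSpace ℝ F]
    {B : E4 → E4 →L[ℝ] F} {z : E4} (hB : DifferentiableAt ℝ B z) (c : E4) :
    fderiv ℝ (fun z' => B z' z') z c = fderiv ℝ B z c z + B z c := by
  have h : HasFDerivAt (fun z' => B z' z') _ z := hB.hasFDerivAt.clm_apply (hasFDerivAt_id z)
  rw [h.fderiv]
  simp [add_comm]

theorem fderiv_form_apply_const {F : Type*} [NormedAddCommGroup F] [NormedSpace ℝ F]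
    {B : E4 → E4 →L[ℝ] F} {z : E4} (hB : DifferentiableAt ℝ B z) (a c : E4) :
    fderiv ℝ (fun z' => B z' a) z c = fderiv ℝ B z c a := by
  have h : HasFDerivAt (fun z' => B z' a) _ z := hB.hasFDerivAt.clm_apply (hasFDerivAt_const a z)
  rw [h.fderiv]
  simp

/-- The tensor 𝓗 is an expression K in the metric and its first derivatives only. For a C¹ metric K
is continuous, so both one-sided limits are its value at y. -/
theorem noThinShell_of_contDiffAt {G : E4 → E4 → E4 → ℝ} {B : E4 → E4 →L[ℝ] E4 →L[ℝ] ℝ} {y : E4}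
    (hy : y ≠ 0) (hB : ContDiffAt ℝ 1 B y) (h : ∀ᶠ z in 𝓝 y, ∀ v w, G z v w = B z v w) :
    NoThinShell G y := by
  intro v w
  let p : E4 → E4 → E4 := fun z v => rigProjection z v
  let K : E4 → ℝ := fun z =>
    (fderiv ℝ B z (p z v) z (p z w) + B z (p z v) (p z w)) -
      ((fderiv ℝ B z (p z v) z (p z w) + fderiv ℝ B z (p z w) z (p z v)) -
        fderiv ℝ B z z (p z v) (p z w)) / 2
  have hp : ∀ v, ContinuousAt (fun z => p z v) y := fun v =>
    (contDiffAt_const.sub (((contDiffAt_id.inner ℝ contDiffAt_const).div (contDiffAt_id.norm_sq ℝ)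
      (by positivity)).smul contDiffAt_id) : ContDiffAt ℝ 1 _ y).continuousAt
  have h1 := ((continuousAt_fderiv_apply hB (hp v)).clm_apply continuousAt_id).clm_apply (hp w)
  have h2 := ((continuousAt_fderiv_apply hB (hp w)).clm_apply continuousAt_id).clm_apply (hp v)
  have h3 := ((continuousAt_fderiv_apply hB continuousAt_id).clm_apply (hp v)).clm_apply (hp w)
  have h4 := (hB.continuousAt.clm_apply (hp v)).clm_apply (hp w)
  have hK : ContinuousAt K y := (h1.add h4).sub (((h1.add h2).sub h3).div_const 2)
  have hd : ∀ᶠ z in 𝓝 y, DifferentiableAt ℝ B z := by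
    filter_upwards [hB.eventually (by simp)] with z hz
    exact hz.differentiableAt one_ne_zero
  have key : (fun z => riggedCurvature G z v w) =ᶠ[𝓝 y] K := by
    filter_upwards [hd, h.eventually_nhds] with z hz hG
    have e1 : ∀ a b c : E4, fderiv ℝ (fun z' => G z' a b) z c = fderiv ℝ B z c a b := by
      intro a b c
      have e : (fun z' => G z' a b) =ᶠ[𝓝 z] fun z' => B z' a b := by
        filter_upwards [hG] with z' h'
        exact h' a b
      rw [e.fderiv_eq, fderiv_form_apply_const (hz.clm_apply (differentiableAt_const a)),
        fderiv_form_apply_const hz]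
    -- The rigging is the position vector, so its own derivative along c adds the term B z c b.
    have e2 : ∀ b c : E4, fderiv ℝ (fun z' => G z' z' b) z c = fderiv ℝ B z c z b + B z c b := by
      intro b c
      have e : (fun z' => G z' z' b) =ᶠ[𝓝 z] fun z' => B z' z' b := by
        filter_upwards [hG] with z' h'
        exact h' z' b
      rw [e.fderiv_eq, fderiv_form_apply_const (B := fun z' => B z' z')
        (hz.clm_apply differentiableAt_id),
        fderiv_form_apply_self hz]
      rfl
    simp only [riggedCurvature, covDerivRigging, e1, e2, K, p]
  have hlim : Tendsto (fun z => riggedCurvature G z v w) (𝓝 y) (𝓝 (K y)) := hK.congr' key.symm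
  exact ⟨K y, hlim.mono_left nhdsWithin_le_nhds, hlim.mono_left nhdsWithin_le_nhds⟩

/-- The Lorentzian form of a Riemannian form and a vector, as a continuous bilinear map. -/
noncomputable def lorentzCLM (B : E4 →L[ℝ] E4 →L[ℝ] ℝ) (Z : E4) : E4 →L[ℝ] E4 →L[ℝ] ℝ :=
  B + (-(2 / B Z Z)) • (B Z).smulRight (B Z)

theorem lorentzCLM_apply (B : E4 →L[ℝ] E4 →L[ℝ] ℝ) (Z v w : E4) :
    lorentzCLM B Z v w = lorentzForm (fun v w => B v w) Z v w := by
  simp [lorentzCLM, lorentzForm]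
  ring

theorem contDiffAt_lorentzCLM {n : WithTop ℕ∞} {B : E4 → E4 →L[ℝ] E4 →L[ℝ] ℝ} {Z : E4 → E4}
    {y : E4} (hB : ContDiffAt ℝ n B y) (hZ : ContDiffAt ℝ n Z y) (h : B y (Z y) (Z y) ≠ 0) :
    ContDiffAt ℝ n (fun z => lorentzCLM (B z) (Z z)) y := by
  have hBZ := hB.clm_apply hZ
  refine contDiffAt_clm_of_apply fun v => contDiffAt_clm_of_apply fun w => ?_
  simp only [lorentzCLM_apply, lorentzForm]
  exact ((hB.clm_apply contDiffAt_const).clm_apply contDiffAt_const).sub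
    ((contDiffAt_const.mul ((hBZ.clm_apply contDiffAt_const).mul
      (hBZ.clm_apply contDiffAt_const))).div (hBZ.clm_apply hZ) h)

end Shell

/-! ### Regularity on `CP2` -/

section FubiniStudy

/-- The Fubini-Study metric of an affine chart, as a continuous bilinear map. -/
noncomputable def fubiniStudyCLM (Λ : ℝ) (x : E4) : E4 →L[ℝ] E4 →L[ℝ] ℝ :=
  ((6 / Λ) / (1 + ‖x‖ ^ 2)) • (pullForm (innerSL ℝ) (ContinuousLinearMap.id ℝ E4) +
    (-(1 + ‖x‖ ^ 2)⁻¹) • ((innerSL ℝ x).smulRight (innerSL ℝ x) +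
      (innerSL ℝ (mulI x)).smulRight (innerSL ℝ (mulI x))))

theorem fubiniStudyCLM_apply (Λ : ℝ) (x v w : E4) :
    fubiniStudyCLM Λ x v w = fubiniStudyForm Λ x v w := by
  have h : fubiniStudyCLM Λ x v w = ((6 / Λ) / (1 + ‖x‖ ^ 2)) * (⟪v, w⟫ + -(1 + ‖x‖ ^ 2)⁻¹ *
    (⟪x, v⟫ * ⟪x, w⟫ + ⟪mulI x, v⟫ * ⟪mulI x, w⟫)) := rfl
  rw [h, fubiniStudyForm, div_eq_inv_mul (⟪x, v⟫ * ⟪x, w⟫ + ⟪mulI x, v⟫ * ⟪mulI x, w⟫)]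
  ring

theorem contDiff_fubiniStudyCLM (Λ : ℝ) (x : E4) : ContDiffAt ℝ 1 (fubiniStudyCLM Λ) x := by
  refine contDiffAt_clm_of_apply fun v => contDiffAt_clm_of_apply fun w => ?_
  simp only [fubiniStudyCLM_apply, fubiniStudyForm]
  have h1 : ContDiffAt ℝ 1 (fun z : E4 => 1 + ‖z‖ ^ 2) x :=
    contDiffAt_const.add (contDiffAt_id.norm_sq ℝ)
  have h2 : 1 + ‖x‖ ^ 2 ≠ 0 := by positivity
  have h3 := contDiffAt_mulI (n := 1) (contDiffAt_id (x := x))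
  have h4 : ∀ v, ContDiffAt ℝ 1 (fun z : E4 => ⟪z, v⟫) x := fun v =>
    contDiffAt_id.inner ℝ contDiffAt_const
  have h5 : ∀ v, ContDiffAt ℝ 1 (fun z : E4 => ⟪mulI z, v⟫) x := fun v =>
    h3.inner ℝ contDiffAt_const
  exact (contDiffAt_const.div h1 h2).mul (contDiffAt_const.sub
    ((((h4 v).mul (h4 w)).add ((h5 v).mul (h5 w))).div h1 h2))

theorem fubiniStudyForm_symm (Λ : ℝ) (x v w : E4) :
    fubiniStudyForm Λ x v w = fubiniStudyForm Λ x w v := by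
  rw [fubiniStudyForm, fubiniStudyForm, real_inner_comm]
  ring

theorem fubiniStudyForm_pos {Λ : ℝ} (hΛ : 0 < Λ) (x : E4) {v : E4} (hv : v ≠ 0) :
    0 < fubiniStudyForm Λ x v v := by
  have h1 : 0 < 1 + ‖x‖ ^ 2 := by positivity
  have h2 : 0 < ‖v‖ ^ 2 := by positivity
  -- Cauchy-Schwarz for the Hermitian form of ℂ²; the defect is |x₁ v₂ - x₂ v₁|² in complex
  -- notation, whose real and imaginary parts are the two squares below.
  have h3 : ⟪x, v⟫ * ⟪x, v⟫ + ⟪mulI x, v⟫ * ⟪mulI x, v⟫ ≤ ‖x‖ ^ 2 * ‖v‖ ^ 2 := by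
    rw [norm_sq_eq, norm_sq_eq, inner_eq, inner_eq]
    simp [mulI]
    linarith [sq_nonneg (x 0 * v 2 - x 1 * v 3 - x 2 * v 0 + x 3 * v 1),
      sq_nonneg (x 0 * v 3 + x 1 * v 2 - x 2 * v 1 - x 3 * v 0)]
  unfold fubiniStudyForm
  refine mul_pos (by positivity) ?_
  rw [real_inner_self_eq_norm_sq, sub_pos, div_lt_iff₀ h1]
  nlinarith

variable {Λ : ℝ}

/-- The Fubini-Study metric of `CP2`, as a field of continuous bilinear maps. -/
noncomputable def CP2.metric (Λ : ℝ) (p : CP2) :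
    TangentSpace 𝓘(ℝ, E4) p →L[ℝ] TangentSpace 𝓘(ℝ, E4) p →L[ℝ] ℝ :=
  fubiniStudyCLM Λ (CP2.coord (CP2.index p) p)

theorem CP2.metric_apply (Λ : ℝ) (p : CP2) (v w : TangentSpace 𝓘(ℝ, E4) p) :
    CP2.metric Λ p v w = CP2.fubiniStudy Λ p v w := fubiniStudyCLM_apply _ _ _ _

theorem CP2.metric_symm (Λ : ℝ) (p : CP2) (v w : TangentSpace 𝓘(ℝ, E4) p) :
    CP2.metric Λ p v w = CP2.metric Λ p w v := by
  rw [CP2.metric_apply, CP2.metric_apply]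
  exact fubiniStudyForm_symm _ _ _ _

theorem CP2.metric_pos (hΛ : 0 < Λ) (p : CP2) {v : TangentSpace 𝓘(ℝ, E4) p} (hv : v ≠ 0) :
    0 < CP2.metric Λ p v v := by
  rw [CP2.metric_apply]
  exact fubiniStudyForm_pos hΛ _ hv

/-- The inverse of an affine chart, as a partial diffeomorphism. -/
noncomputable def CP2.param (i : Fin 3) : PartialDiffeomorph 𝓘(ℝ, E4) 𝓘(ℝ, E4) E4 CP2 ∞ :=
  (isSmoothPH_CP2_chart i).symm.toPartialDiffeomorph

theorem CP2.param_coord (p : CP2) : CP2.param (CP2.index p) (CP2.coord (CP2.index p) p) = p :=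
  (CP2.chart (CP2.index p)).left_inv (CP2.mem_dom_index p)

theorem CP2.formC1At_metric (Λ : ℝ) (p : CP2) : FormC1At 𝓘(ℝ, E4) (CP2.metric Λ) p := by
  have h := formC1At_of_patch (CP2.param (CP2.index p)) (Q := CP2.metric Λ)
    (x₀ := CP2.coord (CP2.index p) p) (mem_univ _)
    (formC1At_of_contDiffAt (contDiff_fubiniStudyCLM Λ _)) (Eventually.of_forall fun x v w => by
      rw [CP2.metric_apply]
      exact (CP2.fubiniStudy_mfderiv_chart_symm Λ _ x v w).trans (fubiniStudyCLM_apply _ _ _ _).symm)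
  rwa [CP2.param_coord] at h

theorem contDiffAt_affineField (i : Fin 3) (x : E4) : ContDiffAt ℝ 1 (affineField i) x := by
  have h := contDiffAt_coord (n := 1) (contDiffAt_id (x := x))
  refine contDiffAt_euclidean.2 fun m => ?_
  fin_cases i <;> fin_cases m <;> simp [affineField] <;> fun_prop

theorem CP2.fieldC1At_field (p : CP2) : FieldC1At 𝓘(ℝ, E4) CP2.field p := by
  have h := fieldC1At_of_patch (CP2.param (CP2.index p)) (V := CP2.field)
    (x₀ := CP2.coord (CP2.index p) p) (mem_univ _)
    (fieldC1At_iff_contDiffAt.2 (contDiffAt_affineField (CP2.index p) _))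
    (Eventually.of_forall fun x => (CP2.mfderiv_chart_symm_affineField _ x).symm)
  rwa [CP2.param_coord] at h

end FubiniStudy

/-! ### Push-forward of a form and a vector field -/

section Push

variable {H : Type*} [TopologicalSpace H] {I : ModelWithCorners ℝ E4 H}
  {W : Type u} [TopologicalSpace W] [ChartedSpace H W]
  {K : Type*} [TopologicalSpace K] {J : ModelWithCorners ℝ E4 K}
  {A : Type*} [TopologicalSpace A] [ChartedSpace K A]
  (j : PartialDiffeomorph J I A W ∞)
  (G : ∀ x : A, TangentSpace J x →L[ℝ] TangentSpace J x →L[ℝ] ℝ) (Z : ∀ x : A, TangentSpace J x)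

theorem pushForm_symm (h : ∀ x v w, G x v w = G x w v) (w : W) (a b : TangentSpace I w) :
    pushForm j G w a b = pushForm j G w b a := h _ _ _

theorem pushForm_pos {w : W} (hw : w ∈ j.target) (h : ∀ v, v ≠ 0 → 0 < G (j.symm w) v v)
    {a : TangentSpace I w} (ha : a ≠ 0) : 0 < pushForm j G w a a := by
  refine h _ fun h0 => ha ?_
  have h1 := PartialDiffeomorph.mfderiv_mfderiv_symm j hw a
  exact (h1.symm.trans (congrArg (mfderiv J I j (j.symm w)) h0)).trans (map_zero _)

theorem pushForm_pushField {w : W} (hw : w ∈ j.target) :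
    pushForm j G w (pushField j Z w) (pushField j Z w) =
      G (j.symm w) (Z (j.symm w)) (Z (j.symm w)) := by
  obtain ⟨x, hx, rfl⟩ : ∃ x ∈ j.source, j x = w := ⟨j.symm w, j.map_target hw, j.right_inv hw⟩
  rw [pushField_apply j Z hx, pushForm_apply j G hx, show j.symm (j x) = x from j.left_inv hx]

theorem normalize_eq {B : E4 →L[ℝ] E4 →L[ℝ] ℝ} {Z : E4} {c : ℝ} (h : B Z Z = c) :
    normalize B Z = (√c)⁻¹ • Z := by
  rw [normalize, h]

theorem patchModel_of_push {Q : ∀ x : W, TangentSpace I x →L[ℝ] TangentSpace I x →L[ℝ] ℝ}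
    {V : ∀ x : W, TangentSpace I x} {x : A} (hx : x ∈ j.source) (hpos : 0 < G x (Z x) (Z x))
    (hQ : Q (j x) = pushForm j G (j x))
    (hV : V (j x) = normalize (Q (j x)) (pushField j Z (j x))) :
    PatchModel Q V (j x) (mfderiv J I j x) (fun v w => G x v w) (Z x) := by
  refine ⟨fun a b => ?_, (√(G x (Z x) (Z x)))⁻¹, inv_pos.2 (Real.sqrt_pos.2 hpos), ?_⟩
  · rw [hQ]
    exact pushForm_apply j G hx a b
  · have h1 : pushForm j G (j x) (pushField j Z (j x)) (pushField j Z (j x)) =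
        G x (Z x) (Z x) := by
      rw [pushField_apply j Z hx]
      exact pushForm_apply j G hx _ _
    rw [← hQ] at h1
    exact hV.trans ((normalize_eq h1).trans
      (congrArg (fun v : E4 => (√(G x (Z x) (Z x)))⁻¹ • v) (pushField_apply j Z hx)))

end Push

/-! ### A form and a vector field glued from three patches -/

section GlueForms

variable {H : Type*} [TopologicalSpace H] {I : ModelWithCorners ℝ E4 H}
  {W : Type u} [TopologicalSpace W] [ChartedSpace H W]
  {K₁ : Type*} [TopologicalSpace K₁] {J₁ : ModelWithCorners ℝ E4 K₁}
  {A₁ : Type*} [TopologicalSpace A₁] [ChartedSpace K₁ A₁]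
  {K₂ : Type*} [TopologicalSpace K₂] {J₂ : ModelWithCorners ℝ E4 K₂}
  {A₂ : Type*} [TopologicalSpace A₂] [ChartedSpace K₂ A₂]
  {K₃ : Type*} [TopologicalSpace K₃] {J₃ : ModelWithCorners ℝ E4 K₃}
  {A₃ : Type*} [TopologicalSpace A₃] [ChartedSpace K₃ A₃]

-- The first patch takes precedence; off its image the other two cannot conflict, being disjoint. No
-- agreement on overlaps is required: positivity and unit length hold pointwise, and agreement near
-- the seams is proved later from the explicit data.
open Classical in
theorem exists_glued_form_field (j₁ : PartialDiffeomorph J₁ I A₁ W ∞)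
    (j₂ : PartialDiffeomorph J₂ I A₂ W ∞) (j₃ : PartialDiffeomorph J₃ I A₃ W ∞)
    (hcov : ∀ w, w ∈ j₁.target ∨ w ∈ j₂.target ∨ w ∈ j₃.target)
    (hdis : Disjoint j₂.target j₃.target)
    {G₁ : ∀ x : A₁, TangentSpace J₁ x →L[ℝ] TangentSpace J₁ x →L[ℝ] ℝ}
    {G₂ : ∀ x : A₂, TangentSpace J₂ x →L[ℝ] TangentSpace J₂ x →L[ℝ] ℝ}
    {G₃ : ∀ x : A₃, TangentSpace J₃ x →L[ℝ] TangentSpace J₃ x →L[ℝ] ℝ}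
    {Z₁ : ∀ x : A₁, TangentSpace J₁ x} {Z₂ : ∀ x : A₂, TangentSpace J₂ x}
    {Z₃ : ∀ x : A₃, TangentSpace J₃ x}
    (hs₁ : ∀ x v w, G₁ x v w = G₁ x w v) (hs₂ : ∀ x v w, G₂ x v w = G₂ x w v)
    (hs₃ : ∀ x v w, G₃ x v w = G₃ x w v)
    (hp₁ : ∀ x ∈ j₁.source, ∀ v, v ≠ 0 → 0 < G₁ x v v) (hp₂ : ∀ x v, v ≠ 0 → 0 < G₂ x v v)
    (hp₃ : ∀ x v, v ≠ 0 → 0 < G₃ x v v) (hz₁ : ∀ x ∈ j₁.source, Z₁ x ≠ 0)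
    (hz₂ : ∀ x ∈ j₂.source, j₂ x ∉ j₁.target → Z₂ x ≠ 0)
    (hz₃ : ∀ x ∈ j₃.source, j₃ x ∉ j₁.target → Z₃ x ≠ 0) :
    ∃ (Q : ∀ w : W, TangentSpace I w →L[ℝ] TangentSpace I w →L[ℝ] ℝ)
      (V : ∀ w : W, TangentSpace I w),
      (∀ w a b, Q w a b = Q w b a) ∧ (∀ w a, a ≠ 0 → 0 < Q w a a) ∧ (∀ w, Q w (V w) (V w) = 1) ∧
      (∀ x ∈ j₁.source, PatchModel Q V (j₁ x) (mfderiv J₁ I j₁ x) (fun v w => G₁ x v w) (Z₁ x)) ∧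
      (∀ x ∈ j₂.source, j₂ x ∉ j₁.target →
        PatchModel Q V (j₂ x) (mfderiv J₂ I j₂ x) (fun v w => G₂ x v w) (Z₂ x)) ∧
      (∀ x ∈ j₃.source, j₃ x ∉ j₁.target →
        PatchModel Q V (j₃ x) (mfderiv J₃ I j₃ x) (fun v w => G₃ x v w) (Z₃ x)) := by
  let Q : ∀ w : W, TangentSpace I w →L[ℝ] TangentSpace I w →L[ℝ] ℝ := fun w =>
    if w ∈ j₁.target then pushForm j₁ G₁ w
    else if w ∈ j₂.target then pushForm j₂ G₂ w else pushForm j₃ G₃ w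
  let Z : ∀ w : W, TangentSpace I w := fun w =>
    if w ∈ j₁.target then pushField j₁ Z₁ w
    else if w ∈ j₂.target then pushField j₂ Z₂ w else pushField j₃ Z₃ w
  have hQ₁ : ∀ w ∈ j₁.target, Q w = pushForm j₁ G₁ w := fun w h => if_pos h
  have hZ₁ : ∀ w ∈ j₁.target, Z w = pushField j₁ Z₁ w := fun w h => if_pos h
  have hQ₂ : ∀ w ∈ j₂.target, w ∉ j₁.target → Q w = pushForm j₂ G₂ w := fun w h h' =>
    (if_neg h').trans (if_pos h)
  have hZ₂ : ∀ w ∈ j₂.target, w ∉ j₁.target → Z w = pushField j₂ Z₂ w := fun w h h' =>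
    (if_neg h').trans (if_pos h)
  have hn : ∀ w ∈ j₃.target, w ∉ j₂.target := fun w h h' => hdis.notMem_of_mem_left h' h
  have hQ₃ : ∀ w ∈ j₃.target, w ∉ j₁.target → Q w = pushForm j₃ G₃ w := fun w h h' =>
    (if_neg h').trans (if_neg (hn w h))
  have hZ₃ : ∀ w ∈ j₃.target, w ∉ j₁.target → Z w = pushField j₃ Z₃ w := fun w h h' =>
    (if_neg h').trans (if_neg (hn w h))
  have hsymm : ∀ w a b, Q w a b = Q w b a := by
    intro w a b
    by_cases h1 : w ∈ j₁.target
    · rw [hQ₁ w h1]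
      exact pushForm_symm j₁ G₁ hs₁ w a b
    rcases (hcov w).resolve_left h1 with h2 | h3
    · rw [hQ₂ w h2 h1]
      exact pushForm_symm j₂ G₂ hs₂ w a b
    · rw [hQ₃ w h3 h1]
      exact pushForm_symm j₃ G₃ hs₃ w a b
  have hpos : ∀ w a, a ≠ 0 → 0 < Q w a a := by
    intro w a ha
    by_cases h1 : w ∈ j₁.target
    · rw [hQ₁ w h1]
      exact pushForm_pos j₁ G₁ h1 (hp₁ _ (j₁.map_target h1)) ha
    rcases (hcov w).resolve_left h1 with h2 | h3
    · rw [hQ₂ w h2 h1]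
      exact pushForm_pos j₂ G₂ h2 (hp₂ _) ha
    · rw [hQ₃ w h3 h1]
      exact pushForm_pos j₃ G₃ h3 (hp₃ _) ha
  have hZpos : ∀ w, 0 < Q w (Z w) (Z w) := by
    intro w
    by_cases h1 : w ∈ j₁.target
    · rw [hQ₁ w h1, hZ₁ w h1, pushForm_pushField j₁ G₁ Z₁ h1]
      exact hp₁ _ (j₁.map_target h1) _ (hz₁ _ (j₁.map_target h1))
    rcases (hcov w).resolve_left h1 with h2 | h3
    · rw [hQ₂ w h2 h1, hZ₂ w h2 h1, pushForm_pushField j₂ G₂ Z₂ h2]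
      refine hp₂ _ _ (hz₂ _ (j₂.map_target h2) ?_)
      rwa [show j₂ (j₂.symm w) = w from j₂.right_inv h2]
    · rw [hQ₃ w h3 h1, hZ₃ w h3 h1, pushForm_pushField j₃ G₃ Z₃ h3]
      refine hp₃ _ _ (hz₃ _ (j₃.map_target h3) ?_)
      rwa [show j₃ (j₃.symm w) = w from j₃.right_inv h3]
  let V : ∀ w : W, TangentSpace I w := fun w => normalize (Q w) (Z w)
  refine ⟨Q, V, hsymm, hpos, fun w => normalize_unit (hZpos w), fun x hx => ?_, fun x hx h => ?_,
    fun x hx h => ?_⟩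
  · have ht := j₁.map_source hx
    exact patchModel_of_push j₁ G₁ Z₁ hx (hp₁ x hx _ (hz₁ x hx)) (hQ₁ _ ht)
      (congrArg (fun z : E4 => normalize (Q (j₁ x)) z) (hZ₁ _ ht))
  · have ht := j₂.map_source hx
    exact patchModel_of_push j₂ G₂ Z₂ hx (hp₂ x _ (hz₂ x hx h)) (hQ₂ _ ht h)
      (congrArg (fun z : E4 => normalize (Q (j₂ x)) z) (hZ₂ _ ht h))
  · have ht := j₃.map_source hx
    exact patchModel_of_push j₃ G₃ Z₃ hx (hp₃ x _ (hz₃ x hx h)) (hQ₃ _ ht h)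
      (congrArg (fun z : E4 => normalize (Q (j₃ x)) z) (hZ₃ _ ht h))

theorem PartialDiffeomorph.mfderiv_surjective (j : PartialDiffeomorph J₁ I A₁ W ∞) {x : A₁}
    (hx : x ∈ j.source) : Function.Surjective (mfderiv J₁ I j x) := by
  intro v
  have h := PartialDiffeomorph.mfderiv_mfderiv_symm j (j.map_source hx) v
  rw [show j.symm (j x) = x from j.left_inv hx] at h
  exact ⟨_, h⟩

/-- When j = j' ∘ Φ near y, the chain rule turns a model seen through j into one seen through j',
provided the derivative of Φ is onto and matches forms and directions. -/
theorem PatchModel.transfer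
    {Q : ∀ w : W, TangentSpace I w →L[ℝ] TangentSpace I w →L[ℝ] ℝ} {V : ∀ w : W, TangentSpace I w}
    {j : A₁ → W} {j' : A₂ → W} {Φ : A₁ → A₂} {y : A₁} {x : A₂} (hy : Φ y = x)
    (hΦ : MDifferentiableAt J₁ J₂ Φ y)
    (hj' : MDifferentiableAt J₂ I j' x) (he : j =ᶠ[𝓝 y] j' ∘ Φ) {G G' : E4 → E4 → ℝ}
    {Z Z' : E4} (h : PatchModel Q V (j y) (mfderiv J₁ I j y) G' Z')
    {S : E4 →L[ℝ] E4} (hS : mfderiv J₁ J₂ Φ y = S)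
    (hsurj : Function.Surjective S) (hG : ∀ a b : E4, G (S a) (S b) = G' a b)
    (hZ : ∃ c : ℝ, 0 < c ∧ S Z' = c • Z) : PatchModel Q V (j' x) (mfderiv J₂ I j' x) G Z := by
  subst hy
  have h1 : mfderiv J₁ I j y = (mfderiv J₂ I j' (Φ y)).comp (mfderiv J₁ J₂ Φ y) := by
    rw [he.mfderiv_eq]
    exact mfderiv_comp y hj' hΦ
  have h2 : j y = j' (Φ y) := he.self_of_nhds
  have key : ∀ (w w' : W) (T : E4 →L[ℝ] E4), w = w' → PatchModel Q V w T G' Z' →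
      PatchModel Q V w' T G' Z' := by
    rintro w _ T rfl h
    exact h
  have hT : (mfderiv J₁ I j y : E4 →L[ℝ] E4) =
      (mfderiv J₂ I j' (Φ y) : E4 →L[ℝ] E4).comp S := by
    rw [← hS]
    exact h1
  have h' := key _ _ _ h2 h
  rw [hT] at h'
  exact PatchModel.of_comp h' hsurj hG hZ

end GlueForms

theorem eq_smul_of_eq_inv_smul {c : ℝ} (hc : c ≠ 0) {u v : E4} (h : u = c⁻¹ • v) : v = c • u := by
  rw [h, smul_inv_smul₀ hc]

/-! ### The Morse chart -/

section MorseChart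

variable {H : Type v} [TopologicalSpace H] {I : ModelWithCorners ℝ E4 H}
variable {M : Type u} [TopologicalSpace M] [ChartedSpace H M] [IsManifold I ∞ M]
variable (C : MorseCobordism I M)

namespace MorseCobordism

theorem mfderiv_f_mfderiv_symm {X : E4} (hX : X ∈ C.chart.target) (a : E4) :
    mfderiv I 𝓘(ℝ, ℝ) C.f (C.chart.symm X) (mfderiv 𝓘(ℝ, E4) I C.chart.symm X a) =
      ⟪morseField X, a⟫ := by
  have h1 : MDifferentiableAt 𝓘(ℝ, E4) I C.chart.symm X :=
    C.chart.symm.mdifferentiableAt (by simp) hX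
  have h2 : MDifferentiableAt I 𝓘(ℝ, ℝ) C.f (C.chart.symm X) :=
    (C.smooth _).mdifferentiableAt (by simp)
  have h3 := mfderiv_comp X h2 h1
  have h4 : C.f ∘ C.chart.symm =ᶠ[𝓝 X] fun Y => C.f C.p + morseFun Y := by
    filter_upwards [C.chart.open_target.mem_nhds hX] with Y hY
    have h5 := C.normal_form _ (C.chart.map_target hY)
    have h6 : C.chart (C.chart.symm Y) = Y := C.chart.right_inv hY
    exact h5.trans (congrArg (fun z => C.f C.p + morseFun z) h6)
  rw [h4.mfderiv_eq, mfderiv_eq_fderiv, fderiv_const_add] at h3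
  exact (DFunLike.congr_fun h3 a).symm.trans (fderiv_morseFun X a)

theorem inner_mfderiv_symm {X : E4} (hX : X ∈ C.chart.target) (a b : E4) :
    C.metric.inner (C.chart.symm X) (mfderiv 𝓘(ℝ, E4) I C.chart.symm X a)
      (mfderiv 𝓘(ℝ, E4) I C.chart.symm X b) = ⟪a, b⟫ + ⟪morseField X, a⟫ * ⟪morseField X, b⟫ := by
  have h := C.metric_eq (C.chart.symm X) (C.chart.map_target hX)
    (mfderiv 𝓘(ℝ, E4) I C.chart.symm X a) (mfderiv 𝓘(ℝ, E4) I C.chart.symm X b)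
  refine h.trans ?_
  have h1 : ∀ a : E4, mfderiv I 𝓘(ℝ, E4) C.chart (C.chart.symm X)
      (mfderiv 𝓘(ℝ, E4) I C.chart.symm X a) = a :=
    PartialDiffeomorph.mfderiv_mfderiv_symm C.chart hX
  have h2 := C.mfderiv_f_mfderiv_symm hX
  exact congrArg₂ (· + ·) (congrArg₂ (fun u v : E4 => ⟪u, v⟫) (h1 a) (h1 b))
    (congrArg₂ (· * ·) (h2 a) (h2 b))

theorem mfderiv_symm_surjective {X : E4} (hX : X ∈ C.chart.target) :
    Function.Surjective (mfderiv 𝓘(ℝ, E4) I C.chart.symm X) :=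
  PartialDiffeomorph.mfderiv_surjective C.chart.symm hX

/-- For the metric δ + df ⊗ df the vector v = grad_δ f pairs with a to (1 + |v|²) df(a). The
gradient is thus v / (1 + |v|²), a positive multiple of the Morse field. -/
theorem mfderiv_symm_morseField {X : E4} (hX : X ∈ C.chart.target) :
    (mfderiv 𝓘(ℝ, E4) I C.chart.symm X (morseField X) : E4) =
      (1 + ‖morseField X‖ ^ 2) • (C.gradient (C.chart.symm X) : E4) := by
  have h0 : 1 + ‖morseField X‖ ^ 2 ≠ 0 := by positivity
  have h1 : C.gradient (C.chart.symm X) = ((1 + ‖morseField X‖ ^ 2)⁻¹ •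
      (mfderiv 𝓘(ℝ, E4) I C.chart.symm X (morseField X) : E4) : E4) := by
    refine C.gradient_eq fun v => ?_
    obtain ⟨a, rfl⟩ := C.mfderiv_symm_surjective hX v
    refine Eq.trans ?_ (C.mfderiv_f_mfderiv_symm hX a).symm
    refine (form_smul_left (C.metric.inner (C.chart.symm X)) _ _ _).trans ?_
    refine (congrArg (fun t => (1 + ‖morseField X‖ ^ 2)⁻¹ * t)
      (C.inner_mfderiv_symm hX (morseField X) a)).trans ?_
    rw [real_inner_self_eq_norm_sq]
    field_simp
  exact eq_smul_of_eq_inv_smul h0 h1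

end MorseCobordism

end MorseChart

/-! ### The glued form and field on the connected sum -/

section NeckSumModel

variable {H : Type v} [TopologicalSpace H] {I : ModelWithCorners ℝ E4 H}
variable {M : Type u} [TopologicalSpace M] [ChartedSpace H M] [IsManifold I ∞ M]
variable {W : Type u} [TopologicalSpace W] [ChartedSpace H W]

/-- A form and a vector field on the connected sum that are the prescribed ones on the extended neck
and on its complement in the two summands. -/
structure NeckSumModel (C : MorseCobordism I M) (Λ τ₀ χ₁ σ₀ ξ₁ ξ₂ R n₀ n₁ : ℝ) (a b α β : ℝ → ℝ)
    (e : Fin 5 → ℝ) (b' c' d' : ℝ → ℝ) (P : ℝ → Matrix (Fin 4) (Fin 4) ℝ) (k ρ μ ν ρ₀ : ℝ → ℝ)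
    (jM : PartialDiffeomorph I I M W ∞) (jN : PartialDiffeomorph 𝓘(ℝ, E4) I E4 W ∞)
    (jC : PartialDiffeomorph 𝓘(ℝ, E4) I CP2 W ∞)
    (Q : ∀ w : W, TangentSpace I w →L[ℝ] TangentSpace I w →L[ℝ] ℝ)
    (V : ∀ w : W, TangentSpace I w) : Prop where
  params : GluingParameters C Λ τ₀ χ₁ σ₀ ξ₁ ξ₂ R n₀ n₁
  sum : IsNeckSum C Λ τ₀ σ₀ ξ₂ n₀ n₁ jM jN jC
  projectiveProfile : ProjectiveProfile Λ τ₀ χ₁ R a b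
  morseProfile : MorseProfile σ₀ ξ₁ R α β
  schedule : NeckSchedule e b' c' d' P
  lt_left : n₀ < e 0
  lt_right : e 4 < n₁
  scales : NeckScales Λ τ₀ σ₀ R n₀ n₁ e k ρ μ ν ρ₀
  symm : ∀ w v v', Q w v v' = Q w v' v
  pos : ∀ w v, v ≠ 0 → 0 < Q w v v
  unit : ∀ w, Q w (V w) (V w) = 1
  neck : ∀ y ∈ jN.source, PatchModel Q V (jN y) (mfderiv 𝓘(ℝ, E4) I jN y)
    (fun v w => neckMetric Λ τ₀ χ₁ σ₀ ξ₁ R n₀ n₁ a b α β y v w)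
    (neckVectorField R e b' c' d' P k ρ y)
  outer_morse : ∀ x ∈ jM.source, jM x ∉ jN.target → PatchModel Q V (jM x) (mfderiv I I jM x)
    (fun v w => C.metric.inner x v w) (C.gradient x)
  outer_projective : ∀ p ∈ jC.source, jC p ∉ jN.target →
    PatchModel Q V (jC p) (mfderiv 𝓘(ℝ, E4) I jC p)
      (fun v w => CP2.metric Λ p v w) (CP2.field p)

theorem IsNeckSum.mem_source_M {C : MorseCobordism I M} {Λ τ₀ χ₁ σ₀ ξ₁ ξ₂ R n₀ n₁ : ℝ}
    {jM : PartialDiffeomorph I I M W ∞} {jN : PartialDiffeomorph 𝓘(ℝ, E4) I E4 W ∞}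
    {jC : PartialDiffeomorph 𝓘(ℝ, E4) I CP2 W ∞}
    (hS : IsNeckSum C Λ τ₀ σ₀ ξ₂ n₀ n₁ jM jN jC)
    (hP : GluingParameters C Λ τ₀ χ₁ σ₀ ξ₁ ξ₂ R n₀ n₁) {x : M} (hx : x ∉ C.chartBall ξ₁) :
    x ∈ jM.source := by
  rw [hS.source_M]
  exact fun h => hx ⟨h.1, h.2.trans_lt hP.σ₀_lt⟩

theorem IsNeckSum.mem_source_C {C : MorseCobordism I M} {Λ τ₀ χ₁ σ₀ ξ₁ ξ₂ R n₀ n₁ : ℝ}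
    {jM : PartialDiffeomorph I I M W ∞} {jN : PartialDiffeomorph 𝓘(ℝ, E4) I E4 W ∞}
    {jC : PartialDiffeomorph 𝓘(ℝ, E4) I CP2 W ∞}
    (hS : IsNeckSum C Λ τ₀ σ₀ ξ₂ n₀ n₁ jM jN jC)
    (hP : GluingParameters C Λ τ₀ χ₁ σ₀ ξ₁ ξ₂ R n₀ n₁) {p : CP2}
    (hp : p ∉ (CP2.chart 0).symm '' {x | chi Λ x < χ₁}) : p ∈ jC.source := by
  rw [hS.source_C]
  rintro ⟨x, hx, rfl⟩
  exact hp ⟨x, lt_of_le_of_lt hx hP.τ₀_lt, rfl⟩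

/-- The neck is the dominant patch: its chart extends over both annuli and past the surgery spheres,
so the seams between pieces lie inside a single chart with C¹ data. -/
theorem exists_neckSumModel {C : MorseCobordism I M} {Λ τ₀ χ₁ σ₀ ξ₁ ξ₂ R n₀ n₁ : ℝ}
    {a b α β : ℝ → ℝ} {e : Fin 5 → ℝ} {b' c' d' : ℝ → ℝ} {P : ℝ → Matrix (Fin 4) (Fin 4) ℝ}
    {jM : PartialDiffeomorph I I M W ∞} {jN : PartialDiffeomorph 𝓘(ℝ, E4) I E4 W ∞}
    {jC : PartialDiffeomorph 𝓘(ℝ, E4) I CP2 W ∞}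
    (hP : GluingParameters C Λ τ₀ χ₁ σ₀ ξ₁ ξ₂ R n₀ n₁)
    (hS : IsNeckSum C Λ τ₀ σ₀ ξ₂ n₀ n₁ jM jN jC)
    (hA : ProjectiveProfile Λ τ₀ χ₁ R a b) (hB : MorseProfile σ₀ ξ₁ R α β)
    (hN : NeckSchedule e b' c' d' P) (h0 : n₀ < e 0) (h4 : e 4 < n₁) :
    ∃ k ρ μ ν ρ₀ Q V, NeckSumModel C Λ τ₀ χ₁ σ₀ ξ₁ ξ₂ R n₀ n₁ a b α β e b' c' d' P k ρ μ ν ρ₀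
      jM jN jC Q V := by
  have hτ' := hP.τ₀_lt.trans hP.χ₁_lt
  obtain ⟨k, ρ, μ, ν, ρ₀, hk⟩ := exists_neckScales hP.Λ_pos hP.τ₀_pos hτ' hP.σ₀_pos hP.R_pos h0
    (hN.strictMono (show (0 : Fin 5) < 4 by decide)) h4
  have hsrc : ∀ y ∈ jN.source, y ≠ 0 ∧ n₀ + τ₀ - Real.pi / (2 * kappa Λ) < Real.log ‖y‖ := by
    intro y hy
    rw [hS.source_N] at hy
    exact ⟨hy.1, hy.2.1⟩
  have hcov : ∀ w, w ∈ jN.target ∨ w ∈ jM.target ∨ w ∈ jC.target := by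
    intro w
    have : w ∈ jM.target ∪ jN.target ∪ jC.target := by
      rw [hS.cover]
      exact mem_univ w
    rcases this with (h | h) | h
    exacts [Or.inr (Or.inl h), Or.inl h, Or.inr (Or.inr h)]
  obtain ⟨Q, V, h1, h2, h3, h5, h6, h7⟩ := exists_glued_form_field jN jM jC hcov hS.disjoint
    (G₁ := neckMetric Λ τ₀ χ₁ σ₀ ξ₁ R n₀ n₁ a b α β) (Z₁ := neckVectorField R e b' c' d' P k ρ)
    (G₂ := C.metric.inner) (Z₂ := C.gradient) (G₃ := CP2.metric Λ) (Z₃ := CP2.field)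
    neckMetric_symm C.metric.symm (CP2.metric_symm Λ)
    (fun y hy v hv => neckMetric_pos hP.Λ_pos hP.τ₀_pos hP.τ₀_lt hP.χ₁_lt hP.σ₀_pos hP.σ₀_lt hP.R_pos
      hP.neck_lt hA hB (hsrc y hy).1 (hsrc y hy).2 hv)
    C.metric.pos (fun p v hv => CP2.metric_pos hP.Λ_pos p hv)
    (fun y hy => neckVectorField_ne_zero hP.R_pos hN hk (hsrc y hy).1 (hsrc y hy).2)
    -- The only zero of the gradient is p, of chart radius 0, and the only zero of w is the centre
    -- of the projective plane; both lie in the removed balls.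
    (fun x hx _ => C.gradient_ne_zero fun h => by
      rw [hS.source_M] at hx
      refine hx ⟨h ▸ C.mem_chart, ?_⟩
      rw [h, C.chart_p, norm_zero]
      exact hP.σ₀_pos.le)
    (fun p hp _ h => by
      rw [hS.source_C] at hp
      refine hp ⟨0, ?_, ((CP2.field_eq_zero_iff p).1 h).symm⟩
      simp [chi, hP.τ₀_pos.le])
  exact ⟨k, ρ, μ, ν, ρ₀, Q, V, hP, hS, hA, hB, hN, h0, h4, hk, h1, h2, h3, h5, h6, h7⟩

variable {C : MorseCobordism I M} {Λ τ₀ χ₁ σ₀ ξ₁ ξ₂ R n₀ n₁ : ℝ}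
    {a b α β : ℝ → ℝ} {e : Fin 5 → ℝ} {b' c' d' : ℝ → ℝ} {P : ℝ → Matrix (Fin 4) (Fin 4) ℝ}
    {k ρ μ ν ρ₀ : ℝ → ℝ}
    {jM : PartialDiffeomorph I I M W ∞} {jN : PartialDiffeomorph 𝓘(ℝ, E4) I E4 W ∞}
    {jC : PartialDiffeomorph 𝓘(ℝ, E4) I CP2 W ∞}
    {Q : ∀ w : W, TangentSpace I w →L[ℝ] TangentSpace I w →L[ℝ] ℝ}
    {V : ∀ w : W, TangentSpace I w}

namespace NeckSumModel

theorem mdifferentiableAt_morse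
    (h : NeckSumModel C Λ τ₀ χ₁ σ₀ ξ₁ ξ₂ R n₀ n₁ a b α β e b' c' d' P k ρ μ ν ρ₀ jM jN jC Q V)
    {x : E4} (h₁ : σ₀ < ‖x‖) (h₂ : ‖x‖ < ξ₂) :
    C.chart.symm x ∈ jM.source ∧ MDifferentiableAt 𝓘(ℝ, E4) I C.chart.symm x ∧
      MDifferentiableAt I I jM (C.chart.symm x) := by
  have hx : x ∈ C.chart.target := h.params.ball_subset (by rwa [mem_ball_zero_iff])
  have hM : C.chart.symm x ∈ jM.source := by
    rw [h.sum.source_M]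
    intro h3
    have h4 : ‖C.chart (C.chart.symm x)‖ ≤ σ₀ := h3.2
    rw [show C.chart (C.chart.symm x) = x from C.chart.right_inv hx] at h4
    linarith
  exact ⟨hM, C.chart.symm.mdifferentiableAt (by simp) hx, jM.mdifferentiableAt (by simp) hM⟩

/-- The neck model is transferred along the radial map of the gluing. It holds up to radius ξ₂, with
the extended profiles; the part beyond ξ₁ serves the comparison with the given metric. -/
theorem morse_annulus
    (h : NeckSumModel C Λ τ₀ χ₁ σ₀ ξ₁ ξ₂ R n₀ n₁ a b α β e b' c' d' P k ρ μ ν ρ₀ jM jN jC Q V)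
    {x : E4} (h₁ : σ₀ < ‖x‖) (h₂ : ‖x‖ < ξ₂) :
    PatchModel Q V (jM (C.chart.symm x)) (mfderiv 𝓘(ℝ, E4) I (fun x => jM (C.chart.symm x)) x)
      (morseAnnulusForm (extId ξ₁ α) (extId ξ₁ β) x) (morseField x) := by
  have hP := h.params
  obtain ⟨hy, hyx⟩ := h.sum.exists_neck_of_chart hP h₁ h₂
  have hx0 : x ≠ 0 := norm_pos_iff.1 (hP.σ₀_pos.trans h₁)
  obtain ⟨y, hyd⟩ : ∃ y, y = Real.exp (‖x‖ - σ₀ + n₁) • unitVec x := ⟨_, rfl⟩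
  have hlog := norm_exp_smul_unitVec (‖x‖ - σ₀ + n₁) hx0
  have hu : unitVec y = unitVec x := by rw [hyd, unitVec_radial (Real.exp_pos _) hx0]
  rw [← hyd] at hy hyx hlog
  have hy' := hy
  rw [h.sum.source_N] at hy'
  have hy0 : y ≠ 0 := hy'.1
  have hs : n₁ < Real.log ‖y‖ := by rw [hlog]; linarith
  obtain ⟨hM, hd1, hd2⟩ := h.mdifferentiableAt_morse h₁ h₂
  have hr : σ₀ + Real.log ‖y‖ - n₁ = ‖x‖ := by rw [hlog]; ring
  have hΦy : (σ₀ + Real.log ‖y‖ - n₁) • unitVec y = x := by rw [hr, hu, norm_smul_unitVec]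
  have hF := hasFDerivAt_radial (h := fun s => σ₀ + s - n₁) hy0
    (((hasDerivAt_id (Real.log ‖y‖)).const_add σ₀).sub_const n₁)
  refine PatchModel.transfer (Φ := fun z => (σ₀ + Real.log ‖z‖ - n₁) • unitVec z) hΦy
    hF.differentiableAt.mdifferentiableAt (hd2.comp x hd1) ?_ (h.neck y hy)
    (S := radialCLM 1 (σ₀ + Real.log ‖y‖ - n₁) y) ?_
    (surjective_radialCLM one_ne_zero (by rw [hr]; exact (hP.σ₀_pos.trans h₁).ne') hy0) ?_ ?_
  · filter_upwards [jN.open_source.mem_nhds hy, (isOpen_lt_log_norm n₁).mem_nhds ⟨hy0, hs⟩]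
      with z hz hz'
    exact h.sum.glue_M z hz hz'.2
  · rw [mfderiv_eq_fderiv]
    exact hF.fderiv
  · intro v w
    have := neckMetric_morse (Λ := Λ) (τ₀ := τ₀) (χ₁ := χ₁) (a := a) (b := b) hP.σ₀_pos hP.σ₀_lt
      hP.neck_lt h.morseProfile hy0 hs.le v w
    rwa [hΦy] at this
  · refine ⟨1, one_pos, ?_⟩
    rw [radialCLM_neckVectorField_morse hP.R_pos h.schedule h.lt_right h.scales hy0 hs.le, hΦy,
      one_smul]

/-- On the overlap with the neck the radius is at least ξ₁, where the extended profiles are the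
identity. The annulus form is then δ + df ⊗ df, and the Morse field has the direction of the
gradient; this is the missing compatibility of patches. -/
theorem morse
    (h : NeckSumModel C Λ τ₀ χ₁ σ₀ ξ₁ ξ₂ R n₀ n₁ a b α β e b' c' d' P k ρ μ ν ρ₀ jM jN jC Q V)
    {x : M} (hx : x ∉ C.chartBall ξ₁) :
    PatchModel Q V (jM x) (mfderiv I I jM x) (fun v w => C.metric.inner x v w) (C.gradient x) := by
  have hP := h.params
  have hM := h.sum.mem_source_M hP hx
  by_cases hN : jM x ∈ jN.target
  · obtain ⟨y, hy, hyx⟩ : ∃ y ∈ jN.source, jN y = jM x :=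
      ⟨jN.symm (jM x), jN.map_target hN, jN.right_inv hN⟩
    obtain ⟨h1, h2, h3, h4⟩ := h.sum.chart_of_glue hP hM hy hyx
    have h5 : ξ₁ ≤ ‖C.chart x‖ := not_lt.1 fun h => hx ⟨h2, h⟩
    have h6 : ‖C.chart x‖ < ξ₂ := by
      rw [h.sum.source_N] at hy
      rw [h4]
      linarith [hy.2.2]
    have hX : C.chart x ∈ C.chart.target := C.chart.map_source h2
    have hσ : σ₀ < ‖C.chart x‖ := hP.σ₀_lt.trans_le h5
    have hX0 : C.chart x ≠ 0 := norm_pos_iff.1 (hP.σ₀_pos.trans hσ)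
    obtain ⟨-, hd1, hd2⟩ := h.mdifferentiableAt_morse hσ h6
    have hxX : C.chart.symm (C.chart x) = x := C.chart.left_inv h2
    have hext : ∀ α : ℝ → ℝ, α ξ₁ = ξ₁ → extId ξ₁ α ‖C.chart x‖ = ‖C.chart x‖ := by
      intro α hα
      unfold extId
      split_ifs with h7
      · rw [le_antisymm h7 h5, hα]
      · rfl
    rw [hxX] at hd2
    refine PatchModel.transfer (Φ := C.chart.symm) hxX hd1 hd2 (Eventually.of_forall fun z => rfl)
      (h.morse_annulus hσ h6) rfl (C.mfderiv_symm_surjective hX) (fun v w => ?_)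
      ⟨1 + ‖morseField (C.chart x)‖ ^ 2, by positivity, ?_⟩
    · rw [morseAnnulusForm_eq hX0 (hext α h.morseProfile.α_outer.1)
        (hext β h.morseProfile.β_outer.1)]
      have := C.inner_mfderiv_symm hX v w
      rw [hxX] at this
      exact this
    · have := C.mfderiv_symm_morseField hX
      rw [hxX] at this
      exact this
  · exact h.outer_morse x hM hN

theorem projective_annulus
    (h : NeckSumModel C Λ τ₀ χ₁ σ₀ ξ₁ ξ₂ R n₀ n₁ a b α β e b' c' d' P k ρ μ ν ρ₀ jM jN jC Q V)
    {x : E4} (h₁ : τ₀ < chi Λ x) :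
    PatchModel Q V (jC ((CP2.chart 0).symm x))
      (mfderiv 𝓘(ℝ, E4) I (fun x => jC ((CP2.chart 0).symm x)) x)
      (projectiveAnnulusForm Λ (extA Λ χ₁ a) (extB Λ χ₁ b) x) (affineField 0 x) := by
  have hP := h.params
  obtain ⟨hy, hyx⟩ := h.sum.exists_neck_of_chi hP h₁
  have hx0 : x ≠ 0 := ne_zero_of_chi_pos (hP.τ₀_pos.trans h₁)
  obtain ⟨y, hyd⟩ : ∃ y, y = Real.exp (τ₀ + n₀ - chi Λ x) • unitVec x := ⟨_, rfl⟩
  have hlog := norm_exp_smul_unitVec (τ₀ + n₀ - chi Λ x) hx0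
  have hu : unitVec y = unitVec x := by rw [hyd, unitVec_radial (Real.exp_pos _) hx0]
  rw [← hyd] at hy hyx hlog
  have hy' := hy
  rw [h.sum.source_N] at hy'
  have hy0 : y ≠ 0 := hy'.1
  have hκ := kappa_pos hP.Λ_pos
  have hs : Real.log ‖y‖ < n₀ := by rw [hlog]; linarith
  have hr : Real.tan (kappa Λ * (τ₀ + n₀ - Real.log ‖y‖)) = ‖x‖ := by
    rw [hlog, show τ₀ + n₀ - (τ₀ + n₀ - chi Λ x) = chi Λ x by ring, kappa_mul_chi hP.Λ_pos,
      Real.tan_arctan]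
  have hcos : Real.cos (kappa Λ * (τ₀ + n₀ - Real.log ‖y‖)) ≠ 0 := by
    rw [hlog, show τ₀ + n₀ - (τ₀ + n₀ - chi Λ x) = chi Λ x by ring, kappa_mul_chi hP.Λ_pos]
    exact (Real.cos_arctan_pos _).ne'
  have hΦy : Real.tan (kappa Λ * (τ₀ + n₀ - Real.log ‖y‖)) • unitVec y = x := by
    rw [hr, hu, norm_smul_unitVec]
  have hder : HasDerivAt (fun s => Real.tan (kappa Λ * (τ₀ + n₀ - s)))
      (-(kappa Λ * (1 + Real.tan (kappa Λ * (τ₀ + n₀ - Real.log ‖y‖)) ^ 2))) (Real.log ‖y‖) := by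
    have h1 := (Real.hasDerivAt_tan hcos).comp (h := fun s => kappa Λ * (τ₀ + n₀ - s))
      (Real.log ‖y‖) (((hasDerivAt_id (Real.log ‖y‖)).const_sub (τ₀ + n₀)).const_mul (kappa Λ))
    refine h1.congr_deriv ?_
    rw [← Real.inv_one_add_tan_sq hcos, one_div, inv_inv]
    ring
  have hF := hasFDerivAt_radial hy0 hder
  have hpC : (CP2.chart 0).symm x ∈ jC.source := by
    rw [h.sum.source_C]
    intro h3
    exact absurd ((CP2.mem_closedBall_iff x).1 h3) (not_le.2 h₁)
  have hd1 : MDifferentiableAt 𝓘(ℝ, E4) 𝓘(ℝ, E4) (CP2.chart 0).symm x :=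
    (CP2.param 0).mdifferentiableAt (by simp) (mem_univ x)
  have hd2 : MDifferentiableAt 𝓘(ℝ, E4) I jC ((CP2.chart 0).symm x) :=
    jC.mdifferentiableAt (by simp) hpC
  have htan : 0 < Real.tan (kappa Λ * (τ₀ + n₀ - Real.log ‖y‖)) := by
    rw [hr]
    exact norm_pos_iff.2 hx0
  refine PatchModel.transfer
    (Φ := fun z => Real.tan (kappa Λ * (τ₀ + n₀ - Real.log ‖z‖)) • unitVec z) hΦy
    hF.differentiableAt.mdifferentiableAt (hd2.comp x hd1) ?_ (h.neck y hy)
    (S := radialCLM (-(kappa Λ * (1 + Real.tan (kappa Λ * (τ₀ + n₀ - Real.log ‖y‖)) ^ 2)))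
      (Real.tan (kappa Λ * (τ₀ + n₀ - Real.log ‖y‖))) y) ?_
    (surjective_radialCLM (by simp only [neg_ne_zero]; positivity) htan.ne' hy0) ?_ ?_
  · filter_upwards [jN.open_source.mem_nhds hy, (isOpen_log_norm_lt n₀).mem_nhds ⟨hy0, hs⟩]
      with z hz hz'
    exact h.sum.glue_C z hz hz'.2
  · rw [mfderiv_eq_fderiv]
    exact hF.fderiv
  · intro v w
    have := neckMetric_projective (χ₁ := χ₁) (σ₀ := σ₀) (ξ₁ := ξ₁) (R := R) (n₁ := n₁) (a := a)
      (b := b) (α := α) (β := β) hP.Λ_pos hP.τ₀_pos hy0 hy'.2.1 hs.le rfl rfl v w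
    rwa [hΦy] at this
  · refine ⟨_, div_pos htan hP.R_pos, ?_⟩
    have := radialCLM_neckVectorField_projective hP.Λ_pos hP.τ₀_pos h.schedule h.lt_left h.scales hy0
      hy'.2.1 hs.le rfl rfl
    rwa [hΦy] at this

/-- Beyond χ₁ the extended profiles are those of the Fubini-Study metric, and w is the same field in
all charts, so the neck model and the original data agree on the overlap. -/
theorem projective
    (h : NeckSumModel C Λ τ₀ χ₁ σ₀ ξ₁ ξ₂ R n₀ n₁ a b α β e b' c' d' P k ρ μ ν ρ₀ jM jN jC Q V)
    {p : CP2} (hp : p ∉ (CP2.chart 0).symm '' {x | chi Λ x < χ₁}) :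
    PatchModel Q V (jC p) (mfderiv 𝓘(ℝ, E4) I jC p)
      (fun v w => CP2.metric Λ p v w) (CP2.field p) := by
  have hP := h.params
  have hC := h.sum.mem_source_C hP hp
  by_cases hN : jC p ∈ jN.target
  · obtain ⟨h1, h2, h3⟩ := h.sum.chi_of_glue hP hC (jN.map_target hN) (jN.right_inv hN)
    obtain ⟨X, hX⟩ : ∃ X, X = Real.tan (kappa Λ * (τ₀ + n₀ - Real.log ‖jN.symm (jC p)‖)) •
      unitVec (jN.symm (jC p)) := ⟨_, rfl⟩
    have hpX : p = (CP2.chart 0).symm X := by rw [hX]; exact h2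
    have h5 : χ₁ ≤ chi Λ X := not_lt.1 fun h => hp ⟨X, h, hpX.symm⟩
    have h6 : τ₀ < chi Λ X := hP.τ₀_lt.trans_le h5
    have hX0 : X ≠ 0 := ne_zero_of_chi_pos (hP.τ₀_pos.trans h6)
    have hd1 : MDifferentiableAt 𝓘(ℝ, E4) 𝓘(ℝ, E4) (CP2.chart 0).symm X :=
      (CP2.param 0).mdifferentiableAt (by simp) (mem_univ X)
    have hd2 : MDifferentiableAt 𝓘(ℝ, E4) I jC p := jC.mdifferentiableAt (by simp) hC
    refine PatchModel.transfer (Φ := (CP2.chart 0).symm) hpX.symm hd1 hd2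
      (Eventually.of_forall fun z => rfl) (h.projective_annulus h6) rfl
      (PartialDiffeomorph.mfderiv_surjective (CP2.param 0) (mem_univ X)) (fun v w => ?_)
      ⟨1, one_pos, ?_⟩
    · subst hpX
      rw [projectiveAnnulusForm_eq hP.Λ_pos hX0]
      · exact (CP2.metric_apply Λ _ _ _).trans (CP2.fubiniStudy_mfderiv_chart_symm Λ 0 X v w)
      · unfold extA
        split_ifs with h7
        · rw [le_antisymm h7 h5, h.projectiveProfile.a_outer.1]
        · rfl
      · unfold extB
        split_ifs with h7
        · rw [le_antisymm h7 h5, h.projectiveProfile.b_outer.1]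
        · rfl
    · subst hpX
      have h8 : ∀ a b : E4, a = b → a = (1 : ℝ) • b := fun a b hab => by rw [one_smul, hab]
      exact h8 _ _ (CP2.mfderiv_chart_symm_affineField 0 X)
  · exact h.outer_projective p hC hN

end NeckSumModel

end NeckSumModel

/-! ### Regularity and the prescribed pieces of the glued metric -/

theorem PatchModel.congr {H : Type*} [TopologicalSpace H] {I : ModelWithCorners ℝ E4 H}
    {W : Type*} [TopologicalSpace W] [ChartedSpace H W]
    {Q : ∀ x : W, TangentSpace I x →L[ℝ] TangentSpace I x →L[ℝ] ℝ} {V : ∀ x : W, TangentSpace I x}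
    {w : W} {T : E4 →L[ℝ] E4} {G G' : E4 → E4 → ℝ} {Z Z' : E4}
    (h : PatchModel Q V w T G Z) (hG : ∀ v v', G v v' = G' v v')
    (hZ : ∃ c : ℝ, 0 < c ∧ Z = c • Z') : PatchModel Q V w T G' Z' := by
  obtain ⟨h1, k, hk, h2⟩ := h
  obtain ⟨c, hc, rfl⟩ := hZ
  refine ⟨fun v v' => (h1 v v').trans (hG v v'), k * c, mul_pos hk hc, ?_⟩
  rw [h2, map_smul, smul_smul]

theorem lorentzForm_of_eq_zero {T : Type*} {g : T → T → ℝ} {Z v : T} (h : g Z v = 0) :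
    lorentzForm g Z v v = g v v := by
  rw [lorentzForm, h]
  simp

section NeckSumModel

variable {H : Type v} [TopologicalSpace H] {I : ModelWithCorners ℝ E4 H}
variable {M : Type u} [TopologicalSpace M] [ChartedSpace H M] [IsManifold I ∞ M]
variable {W : Type u} [TopologicalSpace W] [ChartedSpace H W]
variable {C : MorseCobordism I M} {Λ τ₀ χ₁ σ₀ ξ₁ ξ₂ R n₀ n₁ : ℝ}
    {a b α β : ℝ → ℝ} {e : Fin 5 → ℝ} {b' c' d' : ℝ → ℝ} {P : ℝ → Matrix (Fin 4) (Fin 4) ℝ}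
    {k ρ μ ν ρ₀ : ℝ → ℝ}
    {jM : PartialDiffeomorph I I M W ∞} {jN : PartialDiffeomorph 𝓘(ℝ, E4) I E4 W ∞}
    {jC : PartialDiffeomorph 𝓘(ℝ, E4) I CP2 W ∞}
    {Q : ∀ w : W, TangentSpace I w →L[ℝ] TangentSpace I w →L[ℝ] ℝ}
    {V : ∀ w : W, TangentSpace I w}

namespace NeckSumModel

theorem mem_neck_source
    (h : NeckSumModel C Λ τ₀ χ₁ σ₀ ξ₁ ξ₂ R n₀ n₁ a b α β e b' c' d' P k ρ μ ν ρ₀ jM jN jC Q V)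
    {y : E4} (hy : y ≠ 0) (h₁ : n₀ + τ₀ - χ₁ ≤ Real.log ‖y‖) (h₂ : Real.log ‖y‖ ≤ n₁ + ξ₁ - σ₀) :
    y ∈ jN.source := by
  have hP := h.params
  rw [h.sum.source_N]
  exact ⟨hy, by linarith [hP.χ₁_lt], by linarith [hP.ξ₁_lt]⟩

theorem neck_source
    (h : NeckSumModel C Λ τ₀ χ₁ σ₀ ξ₁ ξ₂ R n₀ n₁ a b α β e b' c' d' P k ρ μ ν ρ₀ jM jN jC Q V)
    {y : E4} (hy : y ∈ jN.source) :
    y ≠ 0 ∧ n₀ + τ₀ - Real.pi / (2 * kappa Λ) < Real.log ‖y‖ := by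
  rw [h.sum.source_N] at hy
  exact ⟨hy.1, hy.2.1⟩

theorem contDiffAt_metric
    (h : NeckSumModel C Λ τ₀ χ₁ σ₀ ξ₁ ξ₂ R n₀ n₁ a b α β e b' c' d' P k ρ μ ν ρ₀ jM jN jC Q V)
    {y : E4} (hy : y ∈ jN.source) :
    ContDiffAt ℝ 1 (neckMetric Λ τ₀ χ₁ σ₀ ξ₁ R n₀ n₁ a b α β) y :=
  contDiffAt_neckMetric h.params.Λ_pos h.params.τ₀_lt h.params.σ₀_lt h.params.neck_lt
    h.projectiveProfile h.morseProfile (h.neck_source hy).1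

theorem contDiffAt_field
    (h : NeckSumModel C Λ τ₀ χ₁ σ₀ ξ₁ ξ₂ R n₀ n₁ a b α β e b' c' d' P k ρ μ ν ρ₀ jM jN jC Q V)
    {y : E4} (hy : y ∈ jN.source) : ContDiffAt ℝ 1 (neckVectorField R e b' c' d' P k ρ) y :=
  contDiffAt_neckVectorField h.schedule h.scales (h.neck_source hy).1 (h.neck_source hy).2

/-- Any point with radius in (σ₀, ξ₁] lies on the neck, so a point off the neck is outside the
closed ball of radius ξ₁. That ball is closed, and the model holds in a whole neighbourhood. -/
theorem eventually_morse [T2Space M]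
    (h : NeckSumModel C Λ τ₀ χ₁ σ₀ ξ₁ ξ₂ R n₀ n₁ a b α β e b' c' d' P k ρ μ ν ρ₀ jM jN jC Q V)
    {x : M} (hx : x ∈ jM.source) (hN : jM x ∉ jN.target) :
    ∀ᶠ z in 𝓝 x, PatchModel Q V (jM z) (mfderiv I I jM z)
      (fun v w => C.metric.inner z v w) (C.gradient z) := by
  have hP := h.params
  have hcl : IsClosed (C.closedChartBall ξ₁) :=
    MorseCobordism.isClosed_closedChartBall (hP.closedBall_subset hP.ξ₁_lt)
  have hx' : x ∉ C.closedChartBall ξ₁ := by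
    rintro ⟨h1, h2⟩
    rw [h.sum.source_M] at hx
    have h3 : σ₀ < ‖C.chart x‖ := not_le.1 fun h4 => hx ⟨h1, h4⟩
    obtain ⟨h5, h6⟩ := h.sum.exists_neck_of_chart hP h3 (h2.trans_lt hP.ξ₁_lt)
    rw [show C.chart.symm (C.chart x) = x from C.chart.left_inv h1] at h6
    exact hN (h6 ▸ jN.map_source h5)
  filter_upwards [hcl.isOpen_compl.mem_nhds hx'] with z hz
  exact h.morse fun hz' => hz ⟨hz'.1, hz'.2.le⟩

theorem eventually_projective
    (h : NeckSumModel C Λ τ₀ χ₁ σ₀ ξ₁ ξ₂ R n₀ n₁ a b α β e b' c' d' P k ρ μ ν ρ₀ jM jN jC Q V)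
    {p : CP2} (hp : p ∈ jC.source) (hN : jC p ∉ jN.target) :
    ∀ᶠ q in 𝓝 p, PatchModel Q V (jC q) (mfderiv 𝓘(ℝ, E4) I jC q)
      (fun v w => CP2.metric Λ q v w) (CP2.field q) := by
  have hP := h.params
  have hcl : IsClosed (CP2.closedBall Λ χ₁) :=
    (CP2.isCompact_closedBall hP.Λ_pos (hP.τ₀_pos.trans hP.τ₀_lt) hP.χ₁_lt).isClosed
  have hp' : p ∉ CP2.closedBall Λ χ₁ := by
    rintro ⟨x, hx, rfl⟩
    rw [h.sum.source_C] at hp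
    have h3 : τ₀ < chi Λ x := not_le.1 fun h4 => hp ⟨x, h4, rfl⟩
    obtain ⟨h5, h6⟩ := h.sum.exists_neck_of_chi hP h3
    exact hN (h6 ▸ jN.map_source h5)
  filter_upwards [hcl.isOpen_compl.mem_nhds hp'] with q hq
  refine h.projective ?_
  rintro ⟨x, hx, rfl⟩
  exact hq ⟨x, le_of_lt (show chi Λ x < χ₁ from hx), rfl⟩

variable [IsManifold I ∞ W]

theorem formC1At_and_fieldC1At [T2Space M]
    (h : NeckSumModel C Λ τ₀ χ₁ σ₀ ξ₁ ξ₂ R n₀ n₁ a b α β e b' c' d' P k ρ μ ν ρ₀ jM jN jC Q V)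
    (w : W) : FormC1At I Q w ∧ FieldC1At I V w := by
  by_cases hN : w ∈ jN.target
  · obtain ⟨y, hy, rfl⟩ : ∃ y ∈ jN.source, jN y = w :=
      ⟨jN.symm w, jN.map_target hN, jN.right_inv hN⟩
    have hev : ∀ᶠ z in 𝓝 y, PatchModel Q V (jN z) (mfderiv 𝓘(ℝ, E4) I jN z)
        (fun v w => neckMetric Λ τ₀ χ₁ σ₀ ξ₁ R n₀ n₁ a b α β z v w)
        (neckVectorField R e b' c' d' P k ρ z) := by
      filter_upwards [jN.open_source.mem_nhds hy] with z hz using h.neck z hz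
    have hG := formC1At_of_contDiffAt (h.contDiffAt_metric hy)
    exact ⟨formC1At_of_patch jN hy hG (hev.mono fun z hz => hz.1),
      fieldC1At_of_patchModel jN hy hG (fieldC1At_iff_contDiffAt.2 (h.contDiffAt_field hy))
        h.unit hev⟩
  have hw : w ∈ jM.target ∪ jN.target ∪ jC.target := by
    rw [h.sum.cover]
    exact mem_univ w
  rcases hw with (hw | hw) | hw
  · obtain ⟨x, hx, rfl⟩ : ∃ x ∈ jM.source, jM x = w :=
      ⟨jM.symm w, jM.map_target hw, jM.right_inv hw⟩
    have hev := h.eventually_morse hx hN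
    exact ⟨formC1At_of_patch jM hx (C.formC1At_metric x) (hev.mono fun z hz => hz.1),
      fieldC1At_of_patchModel jM hx (C.formC1At_metric x) (C.fieldC1At_gradient x) h.unit hev⟩
  · exact absurd hw hN
  · obtain ⟨p, hp, rfl⟩ : ∃ p ∈ jC.source, jC p = w :=
      ⟨jC.symm w, jC.map_target hw, jC.right_inv hw⟩
    have hev := h.eventually_projective hp hN
    exact ⟨formC1At_of_patch jC hp (CP2.formC1At_metric Λ p) (hev.mono fun z hz => hz.1),
      fieldC1At_of_patchModel jC hp (CP2.formC1At_metric Λ p) (CP2.fieldC1At_field p) h.unit hev⟩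

theorem isGluedMetric {g : LorentzMetric I W}
    {gR : Bundle.ContMDiffRiemannianMetric I 1 E4 (fun x : W => TangentSpace I x)}
    (h : NeckSumModel C Λ τ₀ χ₁ σ₀ ξ₁ ξ₂ R n₀ n₁ a b α β e b' c' d' P k ρ μ ν ρ₀ jM jN jC
      gR.inner V)
    (hg : ∀ x v w, g.inner x v w = gR.inner x v w - 2 * (gR.inner x (V x) v * gR.inner x (V x) w)) :
    IsGluedMetric C Λ τ₀ χ₁ σ₀ ξ₁ R n₀ n₁ a b α β e b' c' d' P jM jN jC g gR V := by
  have hP := h.params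
  have he := h.schedule.strictMono (show (0 : Fin 5) < 4 by decide)
  have hl := h.lt_left
  have hr := h.lt_right
  have hin : ∀ y : E4, y ≠ 0 → Real.log ‖y‖ ∈ Icc n₀ n₁ → y ∈ jN.source := fun y hy hs =>
    h.mem_neck_source hy (by linarith [hs.1, hP.τ₀_lt]) (by linarith [hs.2, hP.σ₀_lt])
  have hneck : ∀ y : E4, y ≠ 0 → Real.log ‖y‖ ∈ Icc n₀ n₁ → ∀ Z : E4,
      (∃ c : ℝ, 0 < c ∧ neckVectorField R e b' c' d' P k ρ y = c • Z) →
      ModelledOn 𝓘(ℝ, E4) g gR V jN y (neckForm R y) Z := fun y hy hs Z hZ =>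
    PatchModel.modelledOn h.unit hg ((h.neck y (hin y hy hs)).congr
      (neckMetric_neck hP.τ₀_lt h.projectiveProfile hy hs) hZ)
  refine ⟨fun x hx => PatchModel.modelledOn h.unit hg (h.morse hx), fun x h1 h2 => ?_,
    ⟨μ, h.scales.μ_smooth, h.scales.μ_pos, fun y hy hs => ?_⟩, fun y hy hs => ?_,
    ⟨ν, ρ₀, h.scales.ν_smooth, h.scales.ρ₀_smooth, h.scales.ν_pos, h.scales.ρ₀_pos,
      fun y hy hs => ?_⟩, fun x h1 h2 => ?_, fun p hp => ?_, fun y hy hs => ?_⟩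
  · refine PatchModel.modelledOn h.unit hg ((h.morse_annulus h1 (h2.trans_lt hP.ξ₁_lt)).congr
      (fun v w => ?_) ⟨1, one_pos, (one_smul ℝ (morseField x)).symm⟩)
    simp only [morseAnnulusForm, extId, if_pos h2]
  · exact hneck y hy ⟨by linarith [hs.1], hs.2⟩ _
      (neckVectorField_collar_right hP.R_pos h.schedule h.scales hy hs)
  · exact hneck y hy ⟨by linarith [hs.1], by linarith [hs.2]⟩ _
      (neckVectorField_neck hP.R_pos h.schedule h.scales hy hs)
  · exact hneck y hy ⟨hs.1, by linarith [hs.2]⟩ _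
      ⟨1, one_pos, by rw [one_smul, neckVectorField_collar_left h.schedule h.scales hy hs]⟩
  · refine PatchModel.modelledOn h.unit hg ((h.projective_annulus h1).congr
      (fun v w => ?_) ⟨1, one_pos, (one_smul ℝ (affineField 0 x)).symm⟩)
    simp only [projectiveAnnulusForm, extA, extB, if_pos h2]
  · exact PatchModel.modelledOn h.unit hg ((h.projective hp).congr
      (CP2.metric_apply Λ p) ⟨1, one_pos, (one_smul ℝ (show E4 from CP2.field p)).symm⟩)
  -- All four junctions are interior to the neck chart, where the Lorentzian form comes from one C¹
  -- metric and one C¹ field without zeros.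
  · have hs' : n₀ + τ₀ - χ₁ ≤ Real.log ‖y‖ ∧ Real.log ‖y‖ ≤ n₁ + ξ₁ - σ₀ := by
      have h1 := hP.τ₀_lt
      have h2 := hP.σ₀_lt
      have h3 := hP.neck_lt
      rcases hs with hs | hs | hs | hs <;> constructor <;> linarith [hs.le, hs.ge]
    have hy' := h.mem_neck_source hy hs'.1 hs'.2
    have hns := h.neck_source hy'
    have hpos := neckMetric_pos hP.Λ_pos hP.τ₀_pos hP.τ₀_lt hP.χ₁_lt hP.σ₀_pos hP.σ₀_lt hP.R_pos
      hP.neck_lt h.projectiveProfile h.morseProfile hns.1 hns.2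
      (neckVectorField_ne_zero hP.R_pos h.schedule h.scales hns.1 hns.2)
    refine noThinShell_of_contDiffAt hy (contDiffAt_lorentzCLM (h.contDiffAt_metric hy')
      (h.contDiffAt_field hy') hpos.ne') ?_
    filter_upwards [jN.open_source.mem_nhds hy'] with z hz v w
    rw [lorentzCLM_apply]
    exact (PatchModel.modelledOn h.unit hg (h.neck z hz)).2.2 v w

/-- A vector tangent to a level set is orthogonal to the gradient, so the subtracted term vanishes
and g agrees with the Riemannian metric on it. -/
theorem spacelike {g : LorentzMetric I W}
    {gR : Bundle.ContMDiffRiemannianMetric I 1 E4 (fun x : W => TangentSpace I x)}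
    (h : NeckSumModel C Λ τ₀ χ₁ σ₀ ξ₁ ξ₂ R n₀ n₁ a b α β e b' c' d' P k ρ μ ν ρ₀ jM jN jC
      gR.inner V)
    (hg : ∀ x v w, g.inner x v w = gR.inner x v w - 2 * (gR.inner x (V x) v * gR.inner x (V x) w))
    {x : M} (hx : x ∉ C.chartBall ξ₁) {v : TangentSpace I x} (hv : v ≠ 0)
    (hf : mfderiv I 𝓘(ℝ, ℝ) C.f x v = 0) :
    0 < g.inner (jM x) (mfderiv I I jM x v) (mfderiv I I jM x v) := by
  have h1 : C.metric.inner x (C.gradient x) v = 0 := (C.inner_gradient x v).trans hf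
  have h2 := (PatchModel.modelledOn h.unit hg (h.morse hx)).2.2 v v
  have h3 := lorentzForm_of_eq_zero (g := fun v w => C.metric.inner x v w) h1
  rw [h2]
  exact (C.metric.pos x v hv).trans_eq h3.symm

end NeckSumModel

end NeckSumModel

end WormholeNucleation

/-! ### The main theorem -/

theorem mainTheorem2
    {H : Type v} [TopologicalSpace H] (I : ModelWithCorners ℝ E4 H)
    {M : Type u} [TopologicalSpace M] [T2Space M] [ChartedSpace H M] [IsManifold I ∞ M]
    (C : MorseCobordism I M) (Λ τ₀ χ₁ σ₀ ξ₁ ξ₂ R n₀ n₁ : ℝ)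
    (hP : GluingParameters C Λ τ₀ χ₁ σ₀ ξ₁ ξ₂ R n₀ n₁) :
    -- the vector field and the metric of the projective plane
    (∀ (i : Fin 3) (x : E4),
      mfderiv 𝓘(ℝ, E4) 𝓘(ℝ, E4) (CP2.chart i).symm x (affineField i x) =
        CP2.field ((CP2.chart i).symm x) ∧
      ∀ v w : E4, CP2.fubiniStudy Λ ((CP2.chart i).symm x)
        (mfderiv 𝓘(ℝ, E4) 𝓘(ℝ, E4) (CP2.chart i).symm x v)
        (mfderiv 𝓘(ℝ, E4) 𝓘(ℝ, E4) (CP2.chart i).symm x w) = fubiniStudyForm Λ x v w) ∧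
    (∀ p : CP2, CP2.field p = 0 ↔ p = CP2.center) ∧
    -- the two fields on the three-sphere have degree `-1`
    (∀ x : E4, x ≠ 0 → reflectedField x ≠ 0) ∧
    HasSphereDegree (fun u => unitVec (reflectedField (R • u))) (-1) ∧
    HasSphereDegree (fun u => unitVec (morseField (R • u))) (-1) ∧
    -- the interpolating profiles and the schedule of the deformation exist
    (∃ a b, ProjectiveProfile Λ τ₀ χ₁ R a b) ∧
    (∃ α β, MorseProfile σ₀ ξ₁ R α β) ∧
    (∃ e b c d P, n₀ < e 0 ∧ e 4 < n₁ ∧ NeckSchedule e b c d P) ∧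
    -- the explicit deformation is continuously differentiable and has no zeros
    (∀ e b c d P, NeckSchedule e b c d P →
      (∀ s ∈ Icc (e 0) (e 4), ∀ x : E4, x ≠ 0 → neckField e b c d P s x ≠ 0) ∧
      (∀ x : E4, x ≠ 0 → neckField e b c d P (e 0) x = reflectedField x) ∧
      (∀ x : E4, neckField e b c d P (e 4) x = morseField x) ∧
      ContDiffOn ℝ 1 (fun q : ℝ × E4 => unitVec (neckField e b c d P q.1 q.2))
        (Icc (e 0) (e 4) ×ˢ {0}ᶜ)) ∧
    -- the connected sum carries the glued Lorentzian metric
    (∀ a b α β e b' c' d' P, ProjectiveProfile Λ τ₀ χ₁ R a b → MorseProfile σ₀ ξ₁ R α β →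
      NeckSchedule e b' c' d' P → n₀ < e 0 → e 4 < n₁ →
      ∃ (W : Type u) (_ : TopologicalSpace W) (_ : ChartedSpace H W) (_ : IsManifold I ∞ W)
        (jM : PartialDiffeomorph I I M W ∞) (jN : PartialDiffeomorph 𝓘(ℝ, E4) I E4 W ∞)
        (jC : PartialDiffeomorph 𝓘(ℝ, E4) I CP2 W ∞)
        (g : LorentzMetric I W)
        (gR : Bundle.ContMDiffRiemannianMetric I 1 E4 (fun x : W => TangentSpace I x))
        (V : ∀ x : W, TangentSpace I x),
        T2Space W ∧ (SecondCountableTopology M → SecondCountableTopology W) ∧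
        (CompactSpace M → CompactSpace W) ∧
        IsNeckSum C Λ τ₀ σ₀ ξ₂ n₀ n₁ jM jN jC ∧
        I.boundary W = jM '' I.boundary M ∧
        ContMDiff I I.tangent 1 (fun x => (⟨x, V x⟩ : TangentBundle I W)) ∧
        (∀ x, gR.inner x (V x) (V x) = 1) ∧
        (∀ x v w, g.inner x v w = gR.inner x v w - 2 * (gR.inner x (V x) v * gR.inner x (V x) w)) ∧
        (∀ x, g.inner x (V x) (V x) < 0) ∧
        IsGluedMetric C Λ τ₀ χ₁ σ₀ ξ₁ R n₀ n₁ a b α β e b' c' d' P jM jN jC g gR V ∧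
        -- outside the surgery region the level sets of the Morse function are spacelike
        (∀ x ∉ C.chartBall ξ₁, ∀ v : TangentSpace I x, v ≠ 0 →
          mfderiv I 𝓘(ℝ, ℝ) C.f x v = 0 →
          0 < g.inner (jM x) (mfderiv I I jM x v) (mfderiv I I jM x v))) := by
  have hne : ∀ x : E4, x ≠ 0 → reflectedField x ≠ 0 := fun x hx => by
    have := reflectedField_stage_ne_zero 1 hx
    rwa [one_smul, ← reflectedField_eq hx] at this
  refine ⟨fun i x => ⟨CP2.mfderiv_chart_symm_affineField i x,
      CP2.fubiniStudy_mfderiv_chart_symm Λ i x⟩, CP2.field_eq_zero_iff, hne,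
    hasSphereDegree_reflectedField hP.R_pos, hasSphereDegree_morseField hP.R_pos,
    exists_projectiveProfile hP.Λ_pos hP.τ₀_pos hP.τ₀_lt hP.χ₁_lt hP.R_pos,
    exists_morseProfile hP.σ₀_pos hP.σ₀_lt hP.R_pos, exists_neckSchedule hP.neck_lt,
    fun e b c d P hN => ⟨fun s hs x hx => hN.neckField_ne_zero hs hx,
      fun x hx => hN.neckField_left hx, hN.neckField_right, hN.contDiffOn_unitVec_neckField⟩, ?_⟩
  intro a b α β e b' c' d' P hA hB hN h0 h4
  obtain ⟨W, top, cs, man, jM, jN, jC, hS⟩ := exists_neckSum hP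
  obtain ⟨k, ρ, μ, ν, ρ₀, Q, V, h⟩ := exists_neckSumModel hP hS hA hB hN h0 h4
  have hQ : ∀ w, FormC1At I Q w := fun w => (h.formC1At_and_fieldC1At w).1
  have hV : ∀ w, FieldC1At I V w := fun w => (h.formC1At_and_fieldC1At w).2
  let gR := riemannianMetricOf Q h.symm h.pos hQ
  let g := lorentzMetricOf Q V h.symm h.pos hQ hV h.unit
  have hg : ∀ x v w, g.inner x v w =
      gR.inner x v w - 2 * (gR.inner x (V x) v * gR.inner x (V x) w) := fun x v w =>
    reflectForm_apply (Q x) (V x) v w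
  exact ⟨W, top, cs, man, jM, jN, jC, g, gR, V, hS.t2Space hP,
    fun _ => hS.secondCountableTopology, fun _ => hS.compactSpace hP, hS, hS.boundary_eq, hV,
    h.unit, hg, fun x => (reflectForm_signature (B := Q x) (h.pos x) (h.unit x)).1,
    NeckSumModel.isGluedMetric (gR := gR) h hg,
    fun x hx v hv hf => NeckSumModel.spacelike (gR := gR) h hg hx hv hf⟩
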